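/- **Setting.** Let $s_1,\dots,s_n\in\mathbf R^2$ be distinct points, $s_i=(x_i,y_i)$, $S=\{s_1,\dots,s_n\}$, let $\alpha_1,\dots,\alpha_n\in\mathbf R\setminus\mathbf Z$, and let $R_0$ be such that $S\subset B(0,R_0)$. Put $$\vec A(x,y)=\sum_{i=1}^n-\alpha_i\left(-\frac{y-y_i}{(x-x_i)^2+(y-y_i)^2},\ \frac{x-x_i}{(x-x_i)^2+(y-y_i)^2}\right),$$ and let $P_{\boldsymbol\alpha}$, with domain $\mathcal D_{\boldsymbol\alpha}$, be the Friedrichs extension on $\mathcal H_{\boldsymbol\alpha}=L^2(\mathbf R^2;\mathbf C)$ of $\left(\frac1i\nabla-\vec A\right)^2$ defined on $C_c^\infty(\mathbf R^2\setminus S)$; that is, $P_{\boldsymbol\alpha}$ is the restriction of the adjoint of that operator to those elements of the adjoint's domain which lie in the form domain, the completion of $C_c^\infty(\mathbf R^2\setminus S)$ in the norm $(\|\varphi\|^2+\|(\frac1i\nabla-\vec A)\varphi\|^2)^{1/2}$. The domain $\mathcal D_{\boldsymbol\alpha}$ carries the graph norm. Let $\mathcal H_{\boldsymbol\alpha,\mathrm{comp}}$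 be the space of $f\in L^2(\mathbf R^2)$ which vanish almost everywhere outside a bounded set, and let $\mathcal D_{\boldsymbol\alpha,\mathrm{loc}}$ be the space of (classes of) measurable functions $u$ on $\mathbf R^2$ such that $\chi u\in\mathcal D_{\boldsymbol\alpha}$ for every $\chi\in C_c^\infty(\mathbf R^2)$ with $\chi=1$ on $B(0,R_0)$. Let $\Lambda$ be the logarithmic cover (universal cover) of $\mathbf C\setminus\{0\}$, identified with $\mathbf C$ through $\zeta=\log\lambda$; the part $0<\arg\lambda<\pi$ of $\Lambda$ is identified with the upper half-plane $\{\operatorname{Im}\lambda>0\}$. A family $F(z)$ of bounded operators between normed spaces is *meromorphic at $z_0$* if for $z\ne z_0$ near $z_0$ one has $F(z)=F_0(z)+\sum_{k=1}^J(z-z_0)^{-k}B_k$ with $F_0$ holomorphic near $z_0$ (in operator norm) and $B_k$ of finite rank. A family $R(\lambda):\mathcal H_{\boldsymbol\alpha,\mathrm{comp}}\to\mathcal D_{\boldsymbol\alpha,\mathrm{loc}}$, $\lambda\in\Lambda$, of linear maps is *meromorphic on $\Lambda$ with poles in $Z$*, where $Z\subset\Lambda$ is closed and discrete, if for all $\chi_1,\chi_2\in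 C_c^\infty(\mathbf R^2)$ with $\chi_2=1$ on $B(0,R_0)$ the family $\chi_2R(\lambda)\chi_1:L^2(\mathbf R^2)\to\mathcal D_{\boldsymbol\alpha}$, $\lambda\notin Z$, consists of bounded operators, is holomorphic on $\Lambda\setminus Z$, and is meromorphic at every point of $\Lambda$ (the values $R(\lambda)$ for $\lambda\in Z$ play no role here). **Theorem.** The resolvent $R_{\boldsymbol\alpha}(\lambda)=(P_{\boldsymbol\alpha}-\lambda^2)^{-1}:\mathcal H_{\boldsymbol\alpha}\to\mathcal H_{\boldsymbol\alpha}$ exists and is a meromorphic family of bounded operators for $\operatorname{Im}\lambda>0$. Moreover, it extends meromorphically to $\Lambda$ as a family of operators $\mathcal H_{\boldsymbol\alpha,\mathrm{comp}}\to\mathcal D_{\boldsymbol\alpha,\mathrm{loc}}$: there are a closed discrete set $Z\subset\Lambda$ and a family of linear maps $R(\lambda):\mathcal H_{\boldsymbol\alpha,\mathrm{comp}}\to\mathcal D_{\boldsymbol\alpha,\mathrm{loc}}$, $\lambda\in\Lambda$, which is meromorphic on $\Lambda$ with poles in $Z$, such that $R(\lambda)f=R_{\boldsymbol\alpha}(\lambda)f$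 for all $f\in\mathcal H_{\boldsymbol\alpha,\mathrm{comp}}$ and all $\lambda$ with $0<\arg\lambda<\pi$. -/

import Mathlib

open MeasureTheory Set Filter Topology
open scoped ContDiff LinearPMap

noncomputable section

namespace AharonovBohm

/-- The Euclidean plane. -/
abbrev Plane : Type := EuclideanSpace ℝ (Fin 2)

/-- The Hilbert space of complex square integrable functions on the plane. -/
abbrev L2 : Type := Lp ℂ 2 (volume : Measure Plane)

variable {n : ℕ} (s : Fin n → Plane) (α : Fin n → ℝ)

/-! ### The differential operator on test functions -/

/-- The vector potential with fluxes `α i` at the points `s i`. -/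
def vectorPotential (x : Plane) : Fin 2 → ℝ :=
  ∑ i, (-α i) • ![-(x 1 - s i 1) / ((x 0 - s i 0) ^ 2 + (x 1 - s i 1) ^ 2),
    (x 0 - s i 0) / ((x 0 - s i 0) ^ 2 + (x 1 - s i 1) ^ 2)]

/-- Smooth complex functions with compact support in the plane minus the points `s i`. -/
def testFun : Submodule ℂ (Plane → ℂ) where
  carrier := {φ | ContDiff ℝ ∞ φ ∧ HasCompactSupport φ ∧ tsupport φ ⊆ (range s)ᶜ}
  zero_mem' := ⟨contDiff_const, HasCompactSupport.zero, by simp [tsupport]⟩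
  add_mem' := fun {f g} hf hg => ⟨hf.1.add hg.1, hf.2.1.add hg.2.1,
    (tsupport_add f g).trans (union_subset hf.2.2 hg.2.2)⟩
  smul_mem' := fun c f hf => ⟨contDiff_const.smul hf.1, hf.2.1.smul_left (f := fun _ => c),
    (tsupport_smul_subset_right (fun _ => c) f).trans hf.2.2⟩

/-- The `j`-th component of the magnetic gradient, `-i ∂ⱼ φ - Aⱼ φ`. -/
def magneticDerivFun (j : Fin 2) (φ : Plane → ℂ) (x : Plane) : ℂ :=
  -Complex.I * fderiv ℝ φ x (EuclideanSpace.single j 1) - (vectorPotential s α x j : ℂ) * φ x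

theorem contDiffAt_vectorPotential {x : Plane} (hx : x ∉ range s) (j : Fin 2) :
    ContDiffAt ℝ ∞ (fun y => vectorPotential s α y j) x := by
  have hc : ∀ k : Fin 2, ContDiffAt ℝ ∞ (fun y : Plane => y k) x := fun k =>
    (EuclideanSpace.proj k : Plane →L[ℝ] ℝ).contDiff.contDiffAt
  have hne : ∀ i, (x 0 - s i 0) ^ 2 + (x 1 - s i 1) ^ 2 ≠ 0 := by
    intro i h
    apply hx
    refine ⟨i, ?_⟩
    have h0 : x 0 - s i 0 = 0 := by nlinarith [sq_nonneg (x 0 - s i 0), sq_nonneg (x 1 - s i 1)]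
    have h1 : x 1 - s i 1 = 0 := by nlinarith [sq_nonneg (x 0 - s i 0), sq_nonneg (x 1 - s i 1)]
    ext k
    fin_cases k
    · simpa using (sub_eq_zero.1 h0).symm
    · simpa using (sub_eq_zero.1 h1).symm
  have hden : ∀ i, ContDiffAt ℝ ∞
      (fun y : Plane => (y 0 - s i 0) ^ 2 + (y 1 - s i 1) ^ 2) x := fun i =>
    (((hc 0).sub contDiffAt_const).pow 2).add (((hc 1).sub contDiffAt_const).pow 2)
  simp only [vectorPotential, Finset.sum_apply, Pi.smul_apply, smul_eq_mul]
  refine ContDiffAt.sum fun i _ => contDiffAt_const.mul ?_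
  fin_cases j
  · exact ((hc 1).sub contDiffAt_const).neg.div (hden i) (hne i)
  · exact ((hc 0).sub contDiffAt_const).div (hden i) (hne i)

theorem magneticDerivFun_eq_zero (j : Fin 2) {φ : Plane → ℂ} {x : Plane}
    (hx : x ∉ tsupport φ) : magneticDerivFun s α j φ x = 0 := by
  have h1 : fderiv ℝ φ x = 0 := by
    by_contra h
    exact hx (support_fderiv_subset ℝ h)
  simp [magneticDerivFun, h1, image_eq_zero_of_notMem_tsupport hx]

theorem tsupport_magneticDerivFun (j : Fin 2) (φ : Plane → ℂ) :
    tsupport (magneticDerivFun s α j φ) ⊆ tsupport φ := by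
  refine closure_minimal (fun x hx => ?_) (isClosed_tsupport φ)
  by_contra h
  exact hx (magneticDerivFun_eq_zero s α j h)

theorem magneticDerivFun_mem (j : Fin 2) {φ : Plane → ℂ} (hφ : φ ∈ testFun s) :
    magneticDerivFun s α j φ ∈ testFun s := by
  obtain ⟨h1, h2, h3⟩ := hφ
  have hsub := tsupport_magneticDerivFun s α j φ
  refine ⟨contDiff_iff_contDiffAt.2 fun x => ?_,
    h2.of_isClosed_subset (isClosed_tsupport _) hsub, hsub.trans h3⟩
  by_cases hx : x ∈ tsupport φ
  swap
  · have h0 : magneticDerivFun s α j φ =ᶠ[𝓝 x] fun _ => 0 := by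
      filter_upwards [(isClosed_tsupport φ).isOpen_compl.mem_nhds hx] with y hy
      exact magneticDerivFun_eq_zero s α j hy
    exact contDiffAt_const.congr_of_eventuallyEq h0
  have hA := contDiffAt_vectorPotential s α (h3 hx) j
  have hd : ContDiff ℝ ∞ (fun y => fderiv ℝ φ y (EuclideanSpace.single j 1)) :=
    (h1.fderiv_right (m := ∞) (by simp)).clm_apply contDiff_const
  exact (contDiffAt_const.mul hd.contDiffAt).sub
    ((Complex.ofRealCLM.contDiff.contDiffAt.comp x hA).mul h1.contDiffAt)

/-- `-i ∂ⱼ - Aⱼ` as a linear map on test functions. -/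
def magneticDeriv (j : Fin 2) : testFun s →ₗ[ℂ] testFun s where
  toFun φ := ⟨magneticDerivFun s α j φ, magneticDerivFun_mem s α j φ.2⟩
  map_add' φ ψ := by
    ext x
    have h1 := (φ.2.1.differentiable (by simp)) x
    have h2 := (ψ.2.1.differentiable (by simp)) x
    simp only [magneticDerivFun, Submodule.coe_add, Pi.add_apply, fderiv_add h1 h2,
      add_apply]
    ring
  map_smul' c φ := by
    ext x
    have h1 := (φ.2.1.differentiable (by simp)) x
    simp only [magneticDerivFun, Submodule.coe_smul, Pi.smul_apply, fderiv_const_smul h1 c,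
      smul_apply, smul_eq_mul, RingHom.id_apply]
    ring

theorem memLp_testFun (φ : testFun s) : MemLp (φ : Plane → ℂ) 2 volume :=
  φ.2.1.continuous.memLp_of_hasCompactSupport φ.2.2.1

/-- The class of a test function in `L²`. -/
def testToL2 : testFun s →ₗ[ℂ] L2 where
  toFun φ := (memLp_testFun s φ).toLp
  map_add' φ ψ := (memLp_testFun s φ).toLp_add (memLp_testFun s ψ)
  map_smul' c φ := (memLp_testFun s φ).toLp_const_smul c

theorem testToL2_injective : Function.Injective (testToL2 s) := by
  intro φ ψ h
  have h' : (φ : Plane → ℂ) =ᵐ[volume] ψ :=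
    (MemLp.toLp_eq_toLp_iff (memLp_testFun s φ) (memLp_testFun s ψ)).1 h
  exact Subtype.ext
    ((Continuous.ae_eq_iff_eq volume φ.2.1.continuous ψ.2.1.continuous).1 h')

/-- The differential operator `(-i∇ - A)²`, as an unbounded operator on `L²` whose domain is the
space of smooth functions with compact support in the plane minus the points `s i`. -/
def minimalHamiltonian : L2 →ₗ.[ℂ] L2 where
  domain := LinearMap.range (testToL2 s)
  toFun := (testToL2 s ∘ₗ ∑ j, magneticDeriv s α j ∘ₗ magneticDeriv s α j) ∘ₗ
    (LinearEquiv.ofInjective (testToL2 s) (testToL2_injective s)).symm.toLinearMap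

/-- The domain of `minimalHamiltonian` is dense, so that its adjoint is the usual one. -/
theorem dense_minimalHamiltonian_domain :
    Dense ((minimalHamiltonian s α).domain : Set L2) := by
  rw [Submodule.dense_iff_topologicalClosure_eq_top, Submodule.topologicalClosure_eq_top_iff,
    Submodule.eq_bot_iff]
  intro u hu
  have hU : IsOpen ((range s)ᶜ : Set Plane) := (finite_range s).isClosed.isOpen_compl
  have hloc : LocallyIntegrable (u : Plane → ℂ) volume :=
    (Lp.memLp u).locallyIntegrable (by norm_num)
  have h0 : ∀ᵐ x ∂(volume : Measure Plane), x ∈ ((range s)ᶜ : Set Plane) → u x = 0 := by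
    refine hU.ae_eq_zero_of_integral_contDiff_smul_eq_zero (hloc.locallyIntegrableOn _) ?_
    intro g hg hgc hgs
    have hsup : tsupport (fun x => (g x : ℂ)) ⊆ tsupport g :=
      closure_mono fun x hx => by
        intro h
        exact hx (by simp [h])
    let φ : testFun s := ⟨fun x => (g x : ℂ), Complex.ofRealCLM.contDiff.comp hg,
      hgc.of_isClosed_subset (isClosed_tsupport _) hsup, hsup.trans hgs⟩
    have h := (Submodule.mem_orthogonal _ _).1 hu (testToL2 s φ) ⟨φ, rfl⟩
    rw [L2.inner_def] at h
    rw [← h]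
    refine integral_congr_ae ?_
    filter_upwards [(memLp_testFun s φ).coeFn_toLp] with x hx
    have hx' : (testToL2 s φ : Plane → ℂ) x = (g x : ℂ) := hx
    rw [hx']
    simp [RCLike.inner_apply, mul_comm]
  have h1 : ∀ᵐ x ∂(volume : Measure Plane), x ∈ ((range s)ᶜ : Set Plane) :=
    compl_mem_ae_iff.2 ((finite_range s).measure_zero volume)
  refine Lp.ext ?_
  filter_upwards [h0, h1, Lp.coeFn_zero ℂ 2 (volume : Measure Plane)] with x hx hx1 hx2
  rw [hx hx1, hx2]
  rfl

/-! ### The Friedrichs extension -/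

/-- The form domain: those `u` in `L²` for which there are test functions `φₖ` such that
`φₖ → u` in `L²` and the magnetic gradients of `φₖ` converge in `L²`. -/
def formDomain : Submodule ℂ L2 :=
  (LinearMap.range ((testToL2 s).prod
    (LinearMap.pi fun j : Fin 2 => testToL2 s ∘ₗ magneticDeriv s α j))).topologicalClosure.map
    (LinearMap.fst ℂ L2 (Fin 2 → L2))

/-- The Aharonov–Bohm Hamiltonian: the Friedrichs extension of `(-i∇ - A)²`, that is, the
restriction of the adjoint of `minimalHamiltonian` to the form domain. -/
def hamiltonian : L2 →ₗ.[ℂ] L2 :=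
  (minimalHamiltonian s α)†.domRestrict (formDomain s α)

/-! ### Resolvents and meromorphic families of operators -/

/-- `R` is a bounded everywhere defined two-sided inverse of `P - z`. -/
def IsResolventAt (P : L2 →ₗ.[ℂ] L2) (z : ℂ) (R : L2 →L[ℂ] L2) : Prop :=
  (∀ f, ∃ h : R f ∈ P.domain, P ⟨R f, h⟩ - z • R f = f) ∧
    ∀ u : P.domain, R (P u - z • (u : L2)) = u

open scoped Classical in
/-- The operator `(P - z)⁻¹`, and zero if `z` is in the spectrum of `P`. -/
def resolventAt (P : L2 →ₗ.[ℂ] L2) (z : ℂ) : L2 →L[ℂ] L2 :=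
  if h : ∃ R, IsResolventAt P z R then h.choose else 0

/-- A family of bounded operators is meromorphic at `z₀` if near `z₀` it is the sum of a
holomorphic family and finitely many negative powers of `z - z₀` with coefficients of
finite rank. -/
def MeromorphicFamilyAt {V W : Type*} [NormedAddCommGroup V] [NormedSpace ℂ V]
    [NormedAddCommGroup W] [NormedSpace ℂ W] (F : ℂ → V →L[ℂ] W) (z₀ : ℂ) : Prop :=
  ∃ (F₀ : ℂ → V →L[ℂ] W) (J : ℕ) (B : Fin J → V →L[ℂ] W),
    AnalyticAt ℂ F₀ z₀ ∧
    (∀ k, FiniteDimensional ℂ (LinearMap.range (B k).toLinearMap)) ∧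
    ∀ᶠ z in 𝓝[≠] z₀, F z = F₀ z + ∑ k : Fin J, ((z - z₀) ^ ((k : ℕ) + 1))⁻¹ • B k

/-! ### The spaces with compact supports and the local domain -/

/-- A smooth compactly supported complex function on the plane. -/
def IsCutoff (χ : Plane → ℂ) : Prop := ContDiff ℝ ∞ χ ∧ HasCompactSupport χ

/-- The square integrable functions that vanish almost everywhere outside a bounded set. -/
def Hcomp : Submodule ℂ L2 where
  carrier := {f | ∃ r : ℝ, ∀ᵐ x, r < ‖x‖ → f x = 0}
  zero_mem' := ⟨0, by
    filter_upwards [Lp.coeFn_zero ℂ 2 (volume : Measure Plane)] with x hx _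
    rw [hx]; rfl⟩
  add_mem' := by
    rintro f g ⟨r, hr⟩ ⟨t, ht⟩
    refine ⟨max r t, ?_⟩
    filter_upwards [hr, ht, Lp.coeFn_add f g] with x h1 h2 h3 hx
    rw [h3, Pi.add_apply, h1 ((le_max_left r t).trans_lt hx), h2 ((le_max_right r t).trans_lt hx),
      add_zero]
  smul_mem' := by
    rintro c f ⟨r, hr⟩
    refine ⟨r, ?_⟩
    filter_upwards [hr, Lp.coeFn_smul c f] with x h1 h2 hx
    rw [h2, Pi.smul_apply, h1 hx, smul_zero]

theorem IsCutoff.memLp_mul {χ : Plane → ℂ} (hχ : IsCutoff χ) (f : L2) :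
    MemLp (fun x => χ x * f x) 2 volume :=
  MemLp.mul (p := ⊤) (q := 2) (r := 2) (Lp.memLp f)
    (hχ.1.continuous.memLp_of_hasCompactSupport hχ.2)

/-- Multiplication by a cutoff function, from `L²` to `Hcomp`. -/
def cutoffMul {χ : Plane → ℂ} (hχ : IsCutoff χ) : L2 →ₗ[ℂ] Hcomp where
  toFun f := ⟨(hχ.memLp_mul f).toLp, by
    obtain ⟨r, hr⟩ := hχ.2.isCompact.isBounded.subset_closedBall (0 : Plane)
    refine ⟨r, ?_⟩
    filter_upwards [(hχ.memLp_mul f).coeFn_toLp] with x hx hrx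
    have : x ∉ tsupport χ := fun h => by
      have := hr h
      rw [mem_closedBall_zero_iff] at this
      linarith
    rw [hx, image_eq_zero_of_notMem_tsupport this, zero_mul]⟩
  map_add' f g := by
    refine Subtype.ext (Lp.ext ?_)
    filter_upwards [(hχ.memLp_mul (f + g)).coeFn_toLp, (hχ.memLp_mul f).coeFn_toLp,
      (hχ.memLp_mul g).coeFn_toLp, Lp.coeFn_add f g,
      Lp.coeFn_add (hχ.memLp_mul f).toLp (hχ.memLp_mul g).toLp] with x h1 h2 h3 h4 h5
    rw [h1, h4]
    refine Eq.trans ?_ h5.symm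
    simp only [Pi.add_apply, h2, h3]
    ring
  map_smul' c f := by
    refine Subtype.ext (Lp.ext ?_)
    filter_upwards [(hχ.memLp_mul (c • f)).coeFn_toLp, (hχ.memLp_mul f).coeFn_toLp,
      Lp.coeFn_smul c f, Lp.coeFn_smul c (hχ.memLp_mul f).toLp] with x h1 h2 h3 h4
    rw [h1, h3]
    refine Eq.trans ?_ h4.symm
    simp only [Pi.smul_apply, h2, smul_eq_mul]
    ring

/-- The local domain of `P`: the functions `u` on the plane (modulo equality almost everywhere)
such that `χ u` is in the domain of `P` for every smooth compactly supported `χ` that is `1` on the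
disc of radius `R₀`. -/
def Dloc (P : L2 →ₗ.[ℂ] L2) (R₀ : ℝ) : Submodule ℂ (Plane →ₘ[volume] ℂ) where
  carrier := {u | ∀ χ : Plane → ℂ, IsCutoff χ → (∀ x ∈ Metric.ball (0 : Plane) R₀, χ x = 1) →
    ∃ w ∈ P.domain, ∀ᵐ x, w x = χ x * u x}
  zero_mem' := by
    intro χ _ _
    refine ⟨0, P.domain.zero_mem, ?_⟩
    filter_upwards [Lp.coeFn_zero ℂ 2 (volume : Measure Plane),
      AEEqFun.coeFn_zero (α := Plane) (μ := volume) (β := ℂ)] with x h1 h2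
    rw [h1, h2]
    simp
  add_mem' := by
    intro u v hu hv χ hχ hχ1
    obtain ⟨w, hw, hwu⟩ := hu χ hχ hχ1
    obtain ⟨w', hw', hwv⟩ := hv χ hχ hχ1
    refine ⟨w + w', P.domain.add_mem hw hw', ?_⟩
    filter_upwards [hwu, hwv, Lp.coeFn_add w w', AEEqFun.coeFn_add u v] with x h1 h2 h3 h4
    rw [h3, h4, Pi.add_apply, Pi.add_apply, h1, h2]
    ring
  smul_mem' := by
    intro c u hu χ hχ hχ1
    obtain ⟨w, hw, hwu⟩ := hu χ hχ hχ1
    refine ⟨c • w, P.domain.smul_mem c hw, ?_⟩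
    filter_upwards [hwu, Lp.coeFn_smul c w, AEEqFun.coeFn_smul c u] with x h1 h2 h3
    rw [h2, h3, Pi.smul_apply, Pi.smul_apply, h1]
    simp only [smul_eq_mul]
    ring

/-! ### The logarithmic cover -/

/-- The logarithmic cover of the punctured complex plane, in its global coordinate `ζ = log λ`: the
point `ζ` lies above `λ = exp ζ`, and its imaginary part is the argument of that point. -/
abbrev LogCover : Type := ℂ

/-- The covering map. -/
def LogCover.proj (ζ : LogCover) : ℂ := Complex.exp ζ

/-- The sheet of the logarithmic cover that is identified with the upper half plane. -/
def LogCover.physicalSheet : Set LogCover := {ζ | 0 < ζ.im ∧ ζ.im < Real.pi}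

/-- `R` is a meromorphic family of operators from `Hcomp` to the local domain of `P`, with all its
poles in the closed discrete set `Z` (the values of `R` at the points of `Z` are irrelevant): all
cutoffs `χ₂ R χ₁` are, outside `Z`, bounded operators from `L²` to the domain of `P` with its graph
norm, holomorphic outside `Z` and meromorphic everywhere. -/
def IsMeromorphicLocFamily (P : L2 →ₗ.[ℂ] L2) (R₀ : ℝ) (Z : Set LogCover)
    (R : LogCover → Hcomp →ₗ[ℂ] Dloc P R₀) : Prop :=
  IsClosed Z ∧ IsDiscrete Z ∧
  ∀ (χ₁ χ₂ : Plane → ℂ) (h₁ : IsCutoff χ₁), IsCutoff χ₂ →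
    (∀ x ∈ Metric.ball (0 : Plane) R₀, χ₂ x = 1) →
    ∃ M : LogCover → L2 →L[ℂ] P.graph,
      (∀ ζ ∉ Z, ∀ f : L2, ∀ᵐ x,
        (M ζ f : L2 × L2).1 x = χ₂ x * (R ζ (cutoffMul h₁ f) : Plane →ₘ[volume] ℂ) x) ∧
      AnalyticOnNhd ℂ M Zᶜ ∧
      ∀ ζ, MeromorphicFamilyAt M ζ

end AharonovBohm

end

open scoped ComplexConjugate

noncomputable section

namespace AharonovBohm

section

/-! ### Multiplication operators -/

/-! Write P for `hamiltonian` and λ = e^ζ. The resolvent itself is spectral theory. Closing the jets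
(φ, D₀φ, D₁φ) of the test functions, with D_j = -i∂_j - A_j, in a Hilbert space realises the form
domain, and Riesz representation there turns (P + 1)⁻¹ into a compression T = `invOne` of an
orthogonal projection. By `mem_graph_iff` the graph of P consists of the pairs (u, g) with T(u + g)
= u. Since T is a positive contraction, (P - w)T = 1 - (w + 1)T is invertible for w outside [0, ∞),
and w = z² lies there when Im z > 0.

The continuation is a parametrix argument. Outside a disc of radius ρ containing all s_i the vector
potential differs by a gradient from that of the total flux Φ placed at the origin; the phase is
single valued because |s_i / z| < 1 makes log(1 - s_i / z) well defined. After this change of gauge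
P separates into angular modes, and mode m carries the Bessel equation of order ν = |m + Φ|. In the
variable t = log r its coefficients depend on ζ and t through ζ + t only, and as functions of the
logarithm the Bessel functions are entire: `besI` is a series of exponentials, and `besK` is the
second solution corrected so as to decay along the real axis. The outgoing Hankel function is a
multiple of K_ν(-iλr), which is the translation by -iπ/2 in `shift`. Every mode of the outgoing
Green function is therefore entire in ζ; this is why the logarithmic cover is the natural domain.
For large ν the product of the two solutions is bounded by C ν⁻¹ e^{-ν|t - t'|}, locally uniformly
in ζ (`norm_besI_mul_besK_le_of_large`), so the modes sum in operator norm on bounded annuli to an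
entire family G(ζ).

With cutoffs `inn` and `out` put Q(ζ) = out (P + κ²)⁻¹ 1_{r ≤ ρ+3} + (1 - inn) G(ζ) 1_{r > ρ+3}. On
bounded sets (P - λ²)Q = 1 + K(ζ), where K is made of commutator terms and is entire, compact, and
supported on the left in the disc of radius ρ + 4. At λ = iκ with κ large K is O(1/κ): the inner
commutator by the energy estimate for (P + κ²)⁻¹, the outer one because the source (r > ρ + 3) is
separated from the support of the gradient of `inn`. Thus 1 + K is invertible somewhere, the
analytic Fredholm theorem makes its inverse meromorphic with polar parts of finite rank, and Q(1 +
K)⁻¹ is the continuation. Since the range of K stays in a fixed disc, one singular set serves all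
truncation radii N.

Compactness of K is a local matter. Away from the points s_i the potential is bounded and the usual
Rellich argument applies. Near them |φ|² has gradient at most of size |φ| |Dφ|, with no contribution
of A, so the planar Sobolev inequality for |φ|² bounds φ in L⁴ and the mass near the points is
uniformly small. First-order terms follow from the energy identity `sum_norm_mulJet_sq`.

On the physical sheet the construction must reproduce the resolvent. At λ = iκ the outgoing
solutions decay, so (1 - inn)G f is square integrable when f has a single angular mode, and an
energy argument with slowly varying cutoffs (`eq_zero_of_local_solution`) identifies it with the
resolvent of the appropriate source. Density of single-mode functions and the identity theorem on
the strip 0 < Im ζ < π give the rest.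

Holomorphy in the graph norm comes from never differentiating G: each χQ(ζ) equals T applied to an
entire family of bounded operators (`exists_greenSource`, `invOne_source`), and f ↦ (Tf, f - Tf) is
bounded into the graph of P. -/

/-- Multiplication by an essentially bounded function on `L²` (zero for other functions). -/
def bmul (g : Plane → ℂ) : L2 →L[ℂ] L2 := by
  classical
  exact if h : MemLp g ⊤ (volume : Measure Plane) then
    (ContinuousLinearMap.mul ℂ ℂ).holderL volume ⊤ 2 2 h.toLp else 0

theorem bmul_ae {g : Plane → ℂ} (h : MemLp g ⊤ (volume : Measure Plane)) (f : L2) :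
    bmul g f =ᵐ[volume] fun x => g x * f x := by
  rw [bmul, dif_pos h]
  have h1 := ContinuousLinearMap.coeFn_holder (r := 2) (ContinuousLinearMap.mul ℂ ℂ) h.toLp f
  filter_upwards [h1, h.coeFn_toLp] with x hx hx2
  rw [ContinuousLinearMap.holderL_apply_apply, hx, hx2]
  rfl

theorem bmul_eq_of_ae {g : Plane → ℂ} (h : MemLp g ⊤ (volume : Measure Plane)) {f u : L2}
    (hu : ∀ᵐ x, u x = g x * f x) : bmul g f = u := by
  refine Lp.ext ?_
  filter_upwards [bmul_ae h f, hu] with x h1 h2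
  rw [h1, h2]

theorem bmul_bmul {g h : Plane → ℂ} (hg : MemLp g ⊤ (volume : Measure Plane))
    (hh : MemLp h ⊤ (volume : Measure Plane)) (hgh : MemLp (fun x => g x * h x) ⊤ volume)
    (f : L2) : bmul g (bmul h f) = bmul (fun x => g x * h x) f := by
  refine bmul_eq_of_ae hg ?_
  filter_upwards [bmul_ae hgh f, bmul_ae hh f] with x h1 h2
  rw [h1, h2, mul_assoc]

theorem bmul_comm {g h : Plane → ℂ} (hg : MemLp g ⊤ (volume : Measure Plane))
    (hh : MemLp h ⊤ (volume : Measure Plane)) (f : L2) :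
    bmul g (bmul h f) = bmul h (bmul g f) := by
  refine bmul_eq_of_ae hg ?_
  filter_upwards [bmul_ae hg f, bmul_ae hh f, bmul_ae hh (bmul g f)] with x h1 h2 h3
  rw [h3, h1, h2]; ring

theorem memLp_conj {g : Plane → ℂ} (hg : MemLp g ⊤ (volume : Measure Plane)) :
    MemLp (fun x => conj (g x)) ⊤ volume :=
  hg.star

theorem inner_bmul {g : Plane → ℂ} (hg : MemLp g ⊤ (volume : Measure Plane)) (u v : L2) :
    inner ℂ (bmul g u) v = inner ℂ u (bmul (fun x => conj (g x)) v) := by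
  rw [L2.inner_def, L2.inner_def]
  refine integral_congr_ae ?_
  filter_upwards [bmul_ae hg u, bmul_ae (memLp_conj hg) v] with x h1 h2
  rw [h1, h2]
  simp only [RCLike.inner_apply, map_mul]
  ring

theorem norm_bmul_le {g h : Plane → ℂ} (hg : MemLp g ⊤ (volume : Measure Plane))
    (hh : MemLp h ⊤ (volume : Measure Plane)) {C : ℝ}
    (hC : ∀ᵐ x, ‖g x‖ ≤ C * ‖h x‖) (f : L2) : ‖bmul g f‖ ≤ C * ‖bmul h f‖ := by
  refine Lp.norm_le_mul_norm_of_ae_le_mul ?_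
  filter_upwards [bmul_ae hg f, bmul_ae hh f, hC] with x h1 h2 h3
  rw [h1, h2, norm_mul, norm_mul, ← mul_assoc]
  gcongr

theorem norm_bmul_le_mul {g : Plane → ℂ} (hg : MemLp g ⊤ (volume : Measure Plane)) {C : ℝ}
    (hC : ∀ x, ‖g x‖ ≤ C) (f : L2) : ‖bmul g f‖ ≤ C * ‖f‖ := by
  refine Lp.norm_le_mul_norm_of_ae_le_mul ?_
  filter_upwards [bmul_ae hg f] with x h1
  rw [h1, norm_mul]
  gcongr
  exact hC x

/-! ### Cutoff functions and their derivatives -/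

/-- The partial derivative in the direction of the `j`-th basis vector. -/
def pd (j : Fin 2) (χ : Plane → ℂ) (x : Plane) : ℂ := fderiv ℝ χ x (EuclideanSpace.single j 1)

/-- The Laplacian. -/
def lap (χ : Plane → ℂ) (x : Plane) : ℂ := ∑ j, pd j (pd j χ) x

theorem tsupport_pd (j : Fin 2) (χ : Plane → ℂ) : tsupport (pd j χ) ⊆ tsupport χ := by
  refine closure_minimal (fun x hx => ?_) (isClosed_tsupport χ)
  by_contra h
  have h1 : fderiv ℝ χ x = 0 := by
    by_contra h'
    exact h (support_fderiv_subset ℝ h')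
  exact hx (by simp [pd, h1])

theorem ContDiff.pd {χ : Plane → ℂ} (hχ : ContDiff ℝ ∞ χ) (j : Fin 2) : ContDiff ℝ ∞ (pd j χ) :=
  (hχ.fderiv_right (m := ∞) (by simp)).clm_apply contDiff_const

namespace IsCutoff

variable {χ ψ : Plane → ℂ}

theorem memLp (h : IsCutoff χ) : MemLp χ ⊤ (volume : Measure Plane) :=
  h.1.continuous.memLp_of_hasCompactSupport h.2

theorem pd (h : IsCutoff χ) (j : Fin 2) : IsCutoff (pd j χ) :=
  ⟨ContDiff.pd h.1 j, h.2.of_isClosed_subset (isClosed_tsupport _) (tsupport_pd j χ)⟩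

theorem mul (h : IsCutoff χ) (h' : IsCutoff ψ) : IsCutoff (fun x => χ x * ψ x) :=
  ⟨h.1.mul h'.1, h.2.mul_right⟩

theorem mul_contDiff (h : IsCutoff χ) (h' : ContDiff ℝ ∞ ψ) : IsCutoff (fun x => χ x * ψ x) :=
  ⟨h.1.mul h', h.2.mul_right⟩

theorem add (h : IsCutoff χ) (h' : IsCutoff ψ) : IsCutoff (fun x => χ x + ψ x) :=
  ⟨h.1.add h'.1, h.2.add h'.2⟩

theorem lap (h : IsCutoff χ) : IsCutoff (lap χ) := by
  have : AharonovBohm.lap χ = fun x => AharonovBohm.pd 0 (AharonovBohm.pd 0 χ) x +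
      AharonovBohm.pd 1 (AharonovBohm.pd 1 χ) x := by
    ext x; simp [AharonovBohm.lap, Fin.sum_univ_two]
  rw [this]
  exact ((h.pd 0).pd 0).add ((h.pd 1).pd 1)

theorem conjugate (h : IsCutoff χ) : IsCutoff (fun x => conj (χ x)) :=
  ⟨Complex.conjCLE.contDiff.comp h.1, h.2.comp_left (g := fun z => (starRingEnd ℂ) z) (by simp)⟩

theorem exists_bound (h : IsCutoff χ) : ∃ C : ℝ, 0 ≤ C ∧ ∀ x, ‖χ x‖ ≤ C := by
  obtain ⟨C, hC⟩ := h.1.continuous.bounded_above_of_compact_support h.2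
  exact ⟨C, (norm_nonneg _).trans (hC 0), hC⟩

end IsCutoff

theorem pd_mul {f g : Plane → ℂ} {x : Plane} (hf : DifferentiableAt ℝ f x)
    (hg : DifferentiableAt ℝ g x) (j : Fin 2) :
    pd j (fun y => f y * g y) x = f x * pd j g x + pd j f x * g x := by
  simp only [pd]
  rw [fderiv_fun_mul hf hg]
  simp [mul_comm]

theorem pd_conj {f : Plane → ℂ} {x : Plane} (hf : DifferentiableAt ℝ f x) (j : Fin 2) :
    pd j (fun y => conj (f y)) x = conj (pd j f x) := by
  have h := ((Complex.conjCLE : ℂ ≃L[ℝ] ℂ).toContinuousLinearMap.hasFDerivAt.comp x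
    hf.hasFDerivAt).fderiv
  have h2 : (fun y => conj (f y)) = (Complex.conjCLE : ℂ ≃L[ℝ] ℂ).toContinuousLinearMap ∘ f := rfl
  rw [pd, h2, h]
  rfl

variable {n : ℕ} (s : Fin n → Plane) (α : Fin n → ℝ)

theorem magneticDerivFun_mul {χ φ : Plane → ℂ} {x : Plane} (hχ : DifferentiableAt ℝ χ x)
    (hφ : DifferentiableAt ℝ φ x) (j : Fin 2) :
    magneticDerivFun s α j (fun y => χ y * φ y) x =
      χ x * magneticDerivFun s α j φ x - Complex.I * (pd j χ x * φ x) := by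
  have := pd_mul hχ hφ j
  simp only [pd] at this
  simp only [magneticDerivFun, this, pd]
  ring

/-- The product of a cutoff function and a test function. -/
def testMul {χ : Plane → ℂ} (hχ : ContDiff ℝ ∞ χ) (φ : testFun s) : testFun s :=
  ⟨fun x => χ x * φ.1 x, hχ.mul φ.2.1, φ.2.2.1.mul_left,
    (tsupport_mul_subset_right (f := χ) (g := φ.1)).trans φ.2.2.2⟩

theorem testToL2_ae (φ : testFun s) : testToL2 s φ =ᵐ[volume] φ.1 :=
  (memLp_testFun s φ).coeFn_toLp

theorem bmul_testToL2 {χ : Plane → ℂ} (hχ : IsCutoff χ) (φ : testFun s) :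
    bmul χ (testToL2 s φ) = testToL2 s (testMul s hχ.1 φ) := by
  refine bmul_eq_of_ae hχ.memLp ?_
  filter_upwards [testToL2_ae s φ, testToL2_ae s (testMul s hχ.1 φ)] with x h1 h2
  rw [h2, h1]; rfl

theorem testToL2_magneticDeriv_testMul {χ : Plane → ℂ} (hχ : IsCutoff χ) (φ : testFun s)
    (j : Fin 2) : testToL2 s (magneticDeriv s α j (testMul s hχ.1 φ)) =
      bmul χ (testToL2 s (magneticDeriv s α j φ)) -
        Complex.I • bmul (pd j χ) (testToL2 s φ) := by
  rw [bmul_testToL2 s hχ, bmul_testToL2 s (hχ.pd j), ← map_smul, ← map_sub]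
  congr 1
  ext x
  exact magneticDerivFun_mul s α (hχ.1.differentiable (by simp) x)
    (φ.2.1.differentiable (by simp) x) j

theorem inner_testToL2 (φ ψ : testFun s) :
    inner ℂ (testToL2 s φ) (testToL2 s ψ) = ∫ x, conj (φ.1 x) * ψ.1 x := by
  rw [L2.inner_def]
  refine integral_congr_ae ?_
  filter_upwards [testToL2_ae s φ, testToL2_ae s ψ] with x h1 h2
  rw [h1, h2, RCLike.inner_apply, mul_comm]

/-- The magnetic derivatives are symmetric on test functions. -/
theorem inner_magneticDeriv (φ ψ : testFun s) (j : Fin 2) :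
    inner ℂ (testToL2 s (magneticDeriv s α j φ)) (testToL2 s ψ) =
      inner ℂ (testToL2 s φ) (testToL2 s (magneticDeriv s α j ψ)) := by
  have hint : ∀ f : Plane → ℂ, Continuous f → HasCompactSupport f → Integrable f volume :=
    fun f hf hc => hf.integrable_of_hasCompactSupport hc
  have cφ : ContDiff ℝ ∞ (fun x => conj (φ.1 x)) := Complex.conjCLE.contDiff.comp φ.2.1
  have kφ : HasCompactSupport (fun x => conj (φ.1 x)) :=
    φ.2.2.1.comp_left (g := fun z => (starRingEnd ℂ) z) (by simp)
  have cψ := ψ.2.1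
  have dψ : Continuous (pd j ψ.1) := (ContDiff.pd ψ.2.1 j).continuous
  have dφ : Continuous (pd j fun x => conj (φ.1 x)) := (ContDiff.pd cφ j).continuous
  have key : ∫ x, conj (φ.1 x) * pd j ψ.1 x = - ∫ x, pd j (fun x => conj (φ.1 x)) x * ψ.1 x := by
    refine integral_mul_fderiv_eq_neg_fderiv_mul_of_integrable ?_ ?_ ?_ ?_ ?_
    · exact hint _ (dφ.mul cψ.continuous) ψ.2.2.1.mul_left
    · exact hint _ (cφ.continuous.mul dψ) kφ.mul_right
    · exact hint _ (cφ.continuous.mul cψ.continuous) kφ.mul_right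
    · exact fun x _ => cφ.differentiable (by simp) x
    · exact fun x _ => cψ.differentiable (by simp) x
  have i1 : Integrable (fun x => conj (φ.1 x) * pd j ψ.1 x) volume :=
    hint _ (cφ.continuous.mul dψ) kφ.mul_right
  have i2 : Integrable (fun x => pd j (fun x => conj (φ.1 x)) x * ψ.1 x) volume :=
    hint _ (dφ.mul cψ.continuous) ψ.2.2.1.mul_left
  rw [inner_testToL2, inner_testToL2, ← sub_eq_zero, ← integral_sub]
  · have : ∀ x, conj ((magneticDeriv s α j φ).1 x) * ψ.1 x -
        conj (φ.1 x) * (magneticDeriv s α j ψ).1 x =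
        Complex.I * (pd j (fun x => conj (φ.1 x)) x * ψ.1 x) +
        Complex.I * (conj (φ.1 x) * pd j ψ.1 x) := by
      intro x
      rw [pd_conj (φ.2.1.differentiable (by simp) x)]
      change conj (magneticDerivFun s α j φ.1 x) * _ - _ * magneticDerivFun s α j ψ.1 x = _
      simp only [magneticDerivFun, pd, map_sub, map_mul, map_neg, Complex.conj_I,
        Complex.conj_ofReal]
      ring
    rw [integral_congr_ae (Eventually.of_forall this), integral_add (i2.const_mul _)
      (i1.const_mul _), integral_const_mul, integral_const_mul, key]
    ring
  · exact hint _ ((Complex.continuous_conj.comp (magneticDeriv s α j φ).2.1.continuous).mul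
      cψ.continuous) ψ.2.2.1.mul_left
  · exact hint _ (cφ.continuous.mul (magneticDeriv s α j ψ).2.1.continuous) kφ.mul_right

end

section

/-! ### The form space and the resolvent at `-1` -/

/-- Triples consisting of a function and two further functions in the role of its derivatives. -/
abbrev Jet : Type := PiLp 2 (fun _ : Option (Fin 2) => L2)

/-- The component of a jet with a given index. -/
def comp (o : Option (Fin 2)) : Jet →L[ℂ] L2 := PiLp.proj 2 (fun _ => L2) o

/-- The inclusion of `L²` as one of the components of the space of jets. -/
def inc (o : Option (Fin 2)) : L2 →L[ℂ] Jet := (comp o).adjoint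

theorem inner_inc (o : Option (Fin 2)) (w : Jet) (f : L2) :
    inner ℂ w (inc o f) = inner ℂ (w o) f :=
  ContinuousLinearMap.adjoint_inner_right _ _ _

theorem inner_jets (v w : Jet) :
    inner ℂ v w = inner ℂ (v none) (w none) + ∑ j, inner ℂ (v (some j)) (w (some j)) := by
  rw [PiLp.inner_apply, Fintype.sum_option]

variable {n : ℕ} (s : Fin n → Plane) (α : Fin n → ℝ)

/-- A test function together with its magnetic derivatives. -/
def jet : testFun s →ₗ[ℂ] Jet where
  toFun φ := WithLp.toLp 2 (fun o => o.elim (testToL2 s φ)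
    (fun j => testToL2 s (magneticDeriv s α j φ)))
  map_add' φ ψ := by
    refine PiLp.ext fun o => ?_
    cases o <;> simp
  map_smul' c φ := by
    refine PiLp.ext fun o => ?_
    cases o <;> simp

@[simp] theorem jet_none (φ : testFun s) : jet s α φ none = testToL2 s φ := rfl

@[simp] theorem jet_some (φ : testFun s) (j : Fin 2) :
    jet s α φ (some j) = testToL2 s (magneticDeriv s α j φ) := rfl

/-- The form space, realised as the closure of the jets of the test functions. -/
def formSpace : Submodule ℂ Jet := (LinearMap.range (jet s α)).topologicalClosure

instance : CompleteSpace (formSpace s α) :=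
  (Submodule.isClosed_topologicalClosure _).completeSpace_coe

theorem jet_mem (φ : testFun s) : jet s α φ ∈ formSpace s α :=
  Submodule.le_topologicalClosure _ ⟨φ, rfl⟩

/-- Jets of test functions are dense in the form space, so closed conditions need only be checked on
them. Identities for the form space are reduced in this way to smooth compactly supported functions.
-/
theorem formSpace_induction {p : Jet → Prop} (hp : IsClosed {w | p w})
    (h : ∀ φ, p (jet s α φ)) {w : Jet} (hw : w ∈ formSpace s α) : p w := by
  have : closure (LinearMap.range (jet s α) : Set Jet) ⊆ {w | p w} :=
    closure_minimal (by rintro _ ⟨φ, rfl⟩; exact h φ) hp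
  exact this hw

/-- The orthogonal projection onto the form space. -/
def formProj : Jet →L[ℂ] Jet := (formSpace s α).starProjection

theorem formProj_mem (F : Jet) : formProj s α F ∈ formSpace s α :=
  Submodule.starProjection_apply_mem _ _

theorem inner_formProj {w : Jet} (hw : w ∈ formSpace s α) (F : Jet) :
    inner ℂ w (formProj s α F) = inner ℂ w F := by
  have := Submodule.starProjection_inner_eq_zero (K := formSpace s α) F w hw
  rw [inner_sub_left, sub_eq_zero] at this
  rw [← inner_conj_symm, ← inner_conj_symm w F]
  exact congrArg _ this.symm

/-- Testing against jets suffices because they are dense: the residual F - w is then orthogonal to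
the whole form space. This is the weak formulation of the equation and the way in which values of
the projection are computed. -/
theorem formProj_eq {w F : Jet} (hw : w ∈ formSpace s α)
    (h : ∀ φ, inner ℂ (jet s α φ) w = inner ℂ (jet s α φ) F) : formProj s α F = w := by
  refine Submodule.eq_starProjection_of_mem_of_inner_eq_zero hw fun v hv => ?_
  refine formSpace_induction s α (p := fun v => inner ℂ (F - w) v = 0)
    (isClosed_eq (continuous_const.inner continuous_id) continuous_const) (fun φ => ?_) hv
  rw [← inner_conj_symm, inner_sub_right, h, sub_self, map_zero]

/-- Symmetry of the magnetic derivatives on test functions survives the closure, so the remaining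
components of an element of the form space are weak magnetic derivatives of its first component. -/
theorem inner_some {w : Jet} (hw : w ∈ formSpace s α) (j : Fin 2) (ψ : testFun s) :
    inner ℂ (testToL2 s ψ) (w (some j)) =
      inner ℂ (testToL2 s (magneticDeriv s α j ψ)) (w none) := by
  refine formSpace_induction s α (p := fun w => inner ℂ (testToL2 s ψ) (w (some j)) =
      inner ℂ (testToL2 s (magneticDeriv s α j ψ)) (w none))
    (isClosed_eq (continuous_const.inner (comp (some j)).continuous)
      (continuous_const.inner (comp none).continuous)) (fun φ => ?_) hw
  exact (inner_magneticDeriv s α ψ φ j).symm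

/-- Multiplication of a jet by a function, following the Leibniz rule. -/
def mulJet (χ : Plane → ℂ) : Jet → Jet := fun w => WithLp.toLp 2 (fun o => o.elim
  (bmul χ (w none)) (fun j => bmul χ (w (some j)) - Complex.I • bmul (pd j χ) (w none)))

@[simp] theorem mulJet_none (χ : Plane → ℂ) (w : Jet) : mulJet χ w none = bmul χ (w none) := rfl

@[simp] theorem mulJet_some (χ : Plane → ℂ) (w : Jet) (j : Fin 2) : mulJet χ w (some j) =
    bmul χ (w (some j)) - Complex.I • bmul (pd j χ) (w none) := rfl

theorem continuous_mulJet (χ : Plane → ℂ) : Continuous (mulJet χ) := by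
  refine (PiLp.continuous_toLp 2 _).comp (continuous_pi fun o => ?_)
  cases o with
  | none => exact (bmul χ).continuous.comp (comp none).continuous
  | some j =>
    exact ((bmul χ).continuous.comp (comp (some j)).continuous).sub
      ((continuous_const_smul Complex.I).comp
        ((bmul (pd j χ)).continuous.comp (comp none).continuous))

theorem mulJet_mem {χ : Plane → ℂ} (hχ : IsCutoff χ) {w : Jet} (hw : w ∈ formSpace s α) :
    mulJet χ w ∈ formSpace s α := by
  refine formSpace_induction s α (p := fun w => mulJet χ w ∈ formSpace s α)
    ((Submodule.isClosed_topologicalClosure _).preimage (continuous_mulJet χ)) (fun φ => ?_) hw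
  convert jet_mem s α (testMul s hχ.1 φ) using 1
  refine PiLp.ext fun o => ?_
  cases o with
  | none => exact bmul_testToL2 s hχ φ
  | some j => exact (testToL2_magneticDeriv_testMul s α hχ φ j).symm

/-- The closure in `formDomain` is taken in a product space and the one in `formSpace` in its ℓ²
version. The two topologies agree, and the second space has the inner product needed for
projections. -/
theorem mem_formDomain_iff (u : L2) : u ∈ formDomain s α ↔ ∃ w ∈ formSpace s α, w none = u := by
  constructor
  · rintro ⟨⟨a, b⟩, hab, rfl⟩
    have hc : Continuous (fun p : L2 × (Fin 2 → L2) =>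
        (WithLp.toLp 2 (fun o : Option (Fin 2) => o.elim p.1 p.2) : Jet)) := by
      refine (PiLp.continuous_toLp 2 _).comp (continuous_pi fun o => ?_)
      cases o with
      | none => exact continuous_fst
      | some j => exact (continuous_apply j).comp continuous_snd
    refine ⟨_, map_mem_closure hc hab ?_, rfl⟩
    rintro _ ⟨φ, rfl⟩
    refine ⟨φ, PiLp.ext fun o => ?_⟩
    cases o <;> rfl
  · rintro ⟨w, hw, rfl⟩
    have hc : Continuous (fun w : Jet => (w none, fun j : Fin 2 => w (some j))) :=
      (comp none).continuous.prodMk (continuous_pi fun j => (comp (some j)).continuous)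
    refine ⟨_, map_mem_closure hc hw ?_, rfl⟩
    rintro _ ⟨φ, rfl⟩
    exact ⟨φ, rfl⟩

/-- The inverse of `P + 1`, where `P` is the Friedrichs extension. -/
def invOne : L2 →L[ℂ] L2 := comp none ∘L formProj s α ∘L inc none

/-- The magnetic derivatives of the inverse of `P + 1`. -/
def derivInv (j : Fin 2) : L2 →L[ℂ] L2 := comp (some j) ∘L formProj s α ∘L inc none

theorem minimalHamiltonian_apply (φ : testFun s)
    (h : testToL2 s φ ∈ (minimalHamiltonian s α).domain) :
    minimalHamiltonian s α ⟨testToL2 s φ, h⟩ =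
      ∑ j, testToL2 s (magneticDeriv s α j (magneticDeriv s α j φ)) := by
  have : (LinearEquiv.ofInjective (testToL2 s) (testToL2_injective s)).symm
      ⟨testToL2 s φ, ⟨φ, rfl⟩⟩ = φ :=
    (LinearEquiv.symm_apply_eq _).2 rfl
  change (testToL2 s ∘ₗ ∑ j, magneticDeriv s α j ∘ₗ magneticDeriv s α j)
    ((LinearEquiv.ofInjective (testToL2 s) (testToL2_injective s)).symm
      ⟨testToL2 s φ, ⟨φ, rfl⟩⟩) = _
  rw [this]
  simp

/-- Both derivatives are moved onto the test function, so that the form pairing only sees the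
function component of w. This links the form to the adjoint of `minimalHamiltonian`. -/
theorem inner_jet_of_mem {w : Jet} (hw : w ∈ formSpace s α) (φ : testFun s) :
    inner ℂ (jet s α φ) w = inner ℂ (testToL2 s φ) (w none) +
      inner ℂ (∑ j, testToL2 s (magneticDeriv s α j (magneticDeriv s α j φ))) (w none) := by
  rw [inner_jets, sum_inner]
  congr 1
  exact Finset.sum_congr rfl fun j _ => inner_some s α hw j _

/-- The graph of the Friedrichs extension. -/
theorem mem_graph_iff (u g : L2) :
    (u, g) ∈ (hamiltonian s α).graph ↔ invOne s α (u + g) = u := by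
  have hd := dense_minimalHamiltonian_domain s α
  rw [LinearPMap.mem_graph_iff]
  constructor
  · rintro ⟨⟨v, hv⟩, rfl, hg⟩
    change v ∈ formDomain s α ⊓ _ at hv
    obtain ⟨hv1, hv2⟩ := hv
    obtain ⟨w, hw, hwv⟩ := (mem_formDomain_iff s α v).1 hv1
    have hg' : (minimalHamiltonian s α)† ⟨v, hv2⟩ = g :=
      (LinearPMap.domRestrict_apply rfl).symm.trans hg
    have hadj := LinearPMap.adjoint_isFormalAdjoint hd
    -- The adjoint relation says ⟨Hφ, v⟩ = ⟨φ, g⟩ for all test functions φ; adding ⟨φ, v⟩ on both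
    -- sides gives the variational characterisation of the projection of (v + g, 0, 0).
    have : formProj s α (inc none (v + g)) = w := by
      refine formProj_eq s α hw fun φ => ?_
      rw [inner_jet_of_mem s α hw, inner_inc, jet_none, hwv, inner_add_right]
      congr 1
      have hm : testToL2 s φ ∈ (minimalHamiltonian s α).domain := ⟨φ, rfl⟩
      have h1 := hadj ⟨v, hv2⟩ ⟨testToL2 s φ, hm⟩
      rw [hg', minimalHamiltonian_apply] at h1
      rw [← inner_conj_symm, ← inner_conj_symm _ g]
      exact congrArg _ h1.symm
    change (formProj s α (inc none (v + g))) none = v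
    rw [this, hwv]
  · intro h
    set w := formProj s α (inc none (u + g)) with hwdef
    have hw : w ∈ formSpace s α := formProj_mem s α _
    have hwu : w none = u := h
    -- Conversely, testing the projection against jets and cancelling ⟨φ, u⟩ leaves the relation
    -- that puts u in the domain of the adjoint with value g.
    have key : ∀ x : (minimalHamiltonian s α).domain,
        inner ℂ g (x : L2) = inner ℂ u (minimalHamiltonian s α x) := by
      rintro ⟨v, hv⟩
      obtain ⟨φ, rfl⟩ := id hv
      rw [minimalHamiltonian_apply]
      have h1 := inner_jet_of_mem s α hw φ
      rw [hwdef, inner_formProj s α (jet_mem s α φ), inner_inc, ← hwdef, hwu, jet_none,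
        inner_add_right, add_right_inj] at h1
      rw [← inner_conj_symm, ← inner_conj_symm u]
      exact congrArg _ h1
    have hu2 : u ∈ (minimalHamiltonian s α)†.domain :=
      LinearPMap.mem_adjoint_domain_of_exists _ ⟨g, key⟩
    refine ⟨⟨u, ⟨(mem_formDomain_iff s α u).2 ⟨w, hw, hwu⟩, hu2⟩⟩, rfl, ?_⟩
    exact (LinearPMap.domRestrict_apply (y := ⟨u, hu2⟩) rfl).trans
      (LinearPMap.adjoint_apply_eq hd ⟨u, hu2⟩ key)

theorem mem_graph_invOne (f : L2) :
    (invOne s α f, f - invOne s α f) ∈ (hamiltonian s α).graph := by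
  rw [mem_graph_iff, add_sub_cancel]

theorem mem_domain_iff (u : L2) : u ∈ (hamiltonian s α).domain ↔ ∃ f, invOne s α f = u := by
  rw [LinearPMap.mem_domain_iff]
  constructor
  · rintro ⟨g, hg⟩
    exact ⟨_, (mem_graph_iff s α u g).1 hg⟩
  · rintro ⟨f, rfl⟩
    exact ⟨_, mem_graph_invOne s α f⟩

theorem invOne_injective : Function.Injective (invOne s α) := by
  rw [injective_iff_map_eq_zero]
  intro f hf
  have := mem_graph_invOne s α f
  rw [hf, sub_zero] at this
  exact LinearPMap.graph_fst_eq_zero_snd _ this rfl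

/-- The source of explicit elements of the domain: cut-off angular modes are test functions, and
their images under the operator are computed pointwise. -/
theorem test_mem_graph (φ : testFun s) : (testToL2 s φ,
    ∑ j, testToL2 s (magneticDeriv s α j (magneticDeriv s α j φ))) ∈ (hamiltonian s α).graph := by
  rw [mem_graph_iff]
  change (formProj s α (inc none _)) none = _
  rw [formProj_eq s α (jet_mem s α φ), jet_none]
  intro ψ
  rw [inner_jet_of_mem s α (jet_mem s α φ), inner_inc, jet_none, jet_none, inner_add_right]
  congr 1
  rw [sum_inner, inner_sum]
  refine Finset.sum_congr rfl fun j _ => ?_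
  rw [inner_magneticDeriv, inner_magneticDeriv]

theorem inner_invOne (f g : L2) :
    inner ℂ (invOne s α f) g = inner ℂ f (invOne s α g) := by
  have h1 : inner ℂ (invOne s α f) g = inner ℂ (formProj s α (inc none f)) (inc none g) :=
    (inner_inc none _ g).symm
  have h2 : inner ℂ f (invOne s α g) = inner ℂ (inc none f) (formProj s α (inc none g)) := by
    rw [← inner_conj_symm, ← inner_conj_symm (inc none f), inner_inc]; rfl
  rw [h1, h2]
  exact Submodule.inner_starProjection_left_eq_right _ _ _

/-- The projection of (f, 0, 0) pairs with (f, 0, 0) as with itself, so the quadratic form of T is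
the squared form norm of Tf. Positivity and the bound ‖T‖ ≤ 1 both follow. -/
theorem inner_invOne_self (f : L2) : inner ℂ (invOne s α f) f =
    ((‖invOne s α f‖ ^ 2 + ∑ j, ‖derivInv s α j f‖ ^ 2 : ℝ) : ℂ) := by
  have h1 : inner ℂ (invOne s α f) f = inner ℂ (formProj s α (inc none f)) (inc none f) :=
    (inner_inc none _ f).symm
  rw [h1, ← inner_formProj s α (formProj_mem s α _), inner_jets]
  simp only [inner_self_eq_norm_sq_to_K]
  push_cast
  rfl

theorem norm_invOne_le (f : L2) : ‖invOne s α f‖ ≤ ‖f‖ := by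
  have h1 := congrArg Complex.re (inner_invOne_self s α f)
  rw [Complex.ofReal_re] at h1
  have h2 := (Complex.re_le_norm _).trans (norm_inner_le_norm (𝕜 := ℂ) (invOne s α f) f)
  have h3 : 0 ≤ ∑ j, ‖derivInv s α j f‖ ^ 2 := Finset.sum_nonneg fun _ _ => sq_nonneg _
  by_contra! h
  nlinarith [norm_nonneg (invOne s α f), norm_nonneg f]

/-! ### The Leibniz rule -/

/-- The commutator of `P` with multiplication by `χ`, composed with the inverse of `P + 1`. -/
def comm (χ : Plane → ℂ) : L2 →L[ℂ] L2 :=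
  -(bmul (lap χ) ∘L invOne s α) -
    (2 * Complex.I) • ∑ j, bmul (pd j χ) ∘L derivInv s α j

theorem comm_apply (χ : Plane → ℂ) (f : L2) : comm s α χ f = -bmul (lap χ) (invOne s α f) -
    (2 * Complex.I) • ∑ j, bmul (pd j χ) (derivInv s α j f) := by
  simp [comm]

theorem bmul_lap {χ : Plane → ℂ} (hχ : IsCutoff χ) (f : L2) :
    bmul (lap χ) f = ∑ j, bmul (pd j (pd j χ)) f := by
  refine bmul_eq_of_ae hχ.lap.memLp ?_
  rw [Fin.sum_univ_two]
  filter_upwards [bmul_ae ((hχ.pd 0).pd 0).memLp f, bmul_ae ((hχ.pd 1).pd 1).memLp f,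
    Lp.coeFn_add (bmul (pd 0 (pd 0 χ)) f) (bmul (pd 1 (pd 1 χ)) f)] with x h1 h2 h3
  rw [h3, Pi.add_apply, h1, h2, lap, Fin.sum_univ_two]
  ring

/-- The multiplier is moved to the test function as its conjugate, where the defining property of
the projection applies; the terms left over come from the gradient of χ. Both forms of the Leibniz
rule below are read off from this identity. -/
theorem inner_jet_mulJet {χ : Plane → ℂ} (hχ : IsCutoff χ) (f : L2) (φ : testFun s) :
    inner ℂ (jet s α φ) (mulJet χ (formProj s α (inc none f))) =
      inner ℂ (testToL2 s φ) (bmul χ f)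
      - Complex.I * ∑ j, inner ℂ (testToL2 s φ) (bmul (pd j χ) (derivInv s α j f))
      - Complex.I * ∑ j, inner ℂ (testToL2 s (magneticDeriv s α j φ))
          (bmul (pd j χ) (invOne s α f)) := by
  set w := formProj s α (inc none f) with hw
  have hwm : w ∈ formSpace s α := formProj_mem s α _
  have e0 : invOne s α f = w none := rfl
  have ej : ∀ j, derivInv s α j f = w (some j) := fun j => rfl
  have hmove : ∀ (g : Plane → ℂ), IsCutoff g → ∀ u v : L2,
      inner ℂ u (bmul g v) = inner ℂ (bmul (fun x => conj (g x)) u) v := by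
    intro g hg u v
    rw [inner_bmul hg.conjugate.memLp]
    simp
  have h1 : inner ℂ (jet s α (testMul s hχ.conjugate.1 φ)) w =
      inner ℂ (testToL2 s φ) (bmul χ f) := by
    rw [hw, inner_formProj s α (jet_mem s α _), inner_inc, jet_none, hmove χ hχ,
      bmul_testToL2 s hχ.conjugate]
  have hpd : ∀ j, pd j (fun x => conj (χ x)) = fun x => conj (pd j χ x) := fun j =>
    funext fun x => pd_conj (hχ.1.differentiable (by simp) x) j
  rw [inner_jets] at h1 ⊢
  simp only [mulJet_none, mulJet_some, jet_none, jet_some, inner_sub_right, inner_smul_right,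
    Finset.sum_sub_distrib, ← Finset.mul_sum, e0, ej]
  rw [← h1]
  simp only [jet_none, jet_some, testToL2_magneticDeriv_testMul s α hχ.conjugate, hpd,
    inner_sub_left, inner_smul_left, Complex.conj_I, Finset.sum_sub_distrib, ← Finset.mul_sum]
  rw [hmove χ hχ, bmul_testToL2 s hχ.conjugate]
  simp only [hmove χ hχ, hmove _ (hχ.pd _)]
  ring

theorem inner_magneticDeriv_bmul {χ : Plane → ℂ} (hχ : IsCutoff χ) (f : L2) (φ : testFun s)
    (j : Fin 2) : inner ℂ (testToL2 s (magneticDeriv s α j φ)) (bmul χ (invOne s α f)) =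
      inner ℂ (testToL2 s φ) (bmul χ (derivInv s α j f)) -
        Complex.I * inner ℂ (testToL2 s φ) (bmul (pd j χ) (invOne s α f)) := by
  have := inner_some s α (mulJet_mem s α hχ (formProj_mem s α (inc none f))) j φ
  rw [mulJet_some, mulJet_none, inner_sub_right, inner_smul_right] at this
  exact this.symm

/-- A version of the Leibniz rule for whole jets, so that derivatives of χTf are identified too. One
more integration by parts turns the remaining weak divergence into the first-order terms and the
Laplacian term of `comm`. -/
theorem mulJet_formProj {χ : Plane → ℂ} (hχ : IsCutoff χ) (f : L2) :
    formProj s α (inc none (bmul χ f + comm s α χ f)) =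
      mulJet χ (formProj s α (inc none f)) := by
  refine formProj_eq s α (mulJet_mem s α hχ (formProj_mem s α _)) fun φ => ?_
  rw [inner_jet_mulJet s α hχ, inner_inc, jet_none]
  simp only [inner_magneticDeriv_bmul s α (hχ.pd _), comm_apply, inner_add_right, inner_sub_right,
    inner_neg_right, inner_smul_right, bmul_lap hχ, inner_sum, Finset.sum_sub_distrib,
    ← Finset.mul_sum]
  linear_combination (∑ j, inner ℂ (testToL2 s φ) (bmul (pd j (pd j χ)) (invOne s α f))) *
    Complex.I_sq

/-- The Leibniz rule for the Friedrichs extension. -/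
theorem bmul_invOne {χ : Plane → ℂ} (hχ : IsCutoff χ) (f : L2) :
    bmul χ (invOne s α f) = invOne s α (bmul χ f + comm s α χ f) :=
  (congrArg (fun w : Jet => w none) (mulJet_formProj s α hχ f)).symm

/-- Here the gradient terms are kept in divergence form, as sources in the derivative slots. The
input then involves f and Tf but no derivative of Tf, so derivatives can be recovered from L² data
by bounded operators. -/
theorem mulJet_formProj' {χ : Plane → ℂ} (hχ : IsCutoff χ) (f : L2) :
    formProj s α (inc none (bmul χ f + bmul (lap χ) (invOne s α f)) -
      (2 * Complex.I) • ∑ j, inc (some j) (bmul (pd j χ) (invOne s α f))) =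
      mulJet χ (formProj s α (inc none f)) := by
  refine formProj_eq s α (mulJet_mem s α hχ (formProj_mem s α _)) fun φ => ?_
  rw [inner_jet_mulJet s α hχ, inner_sub_right, inner_inc, jet_none, inner_smul_right, inner_sum]
  simp only [inner_inc, jet_some, inner_magneticDeriv_bmul s α (hχ.pd _), inner_add_right,
    bmul_lap hχ, inner_sum, Finset.sum_sub_distrib, ← Finset.mul_sum]
  linear_combination (-∑ j, inner ℂ (testToL2 s φ) (bmul (pd j (pd j χ)) (invOne s α f))) *
    Complex.I_sq

/-- The localised energy identity. -/
theorem sum_norm_mulJet_sq {θ : Plane → ℂ} (hθ : IsCutoff θ) (hr : ∀ x, conj (θ x) = θ x)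
    (f : L2) : ∑ j, ‖mulJet θ (formProj s α (inc none f)) (some j)‖ ^ 2 =
      (inner ℂ (bmul θ (invOne s α f)) (bmul θ (f - invOne s α f)) : ℂ).re +
        ∑ j, ‖bmul (pd j θ) (invOne s α f)‖ ^ 2 := by
  set w := formProj s α (inc none f) with hw
  have hwm : w ∈ formSpace s α := formProj_mem s α _
  have e0 : invOne s α f = w none := rfl
  have hθ2 := hθ.mul hθ
  have hsym : ∀ u v : L2, inner ℂ (bmul θ u) v = inner ℂ u (bmul θ v) := by
    intro u v
    rw [inner_bmul hθ.memLp]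
    simp only [hr]
  -- The test element is θ² times the solution, as in the Caccioppoli inequality.
  have h1 := inner_formProj s α (mulJet_mem s α hθ2 hwm) (inc none f)
  rw [← hw, inner_inc, inner_jets, mulJet_none, ← bmul_bmul hθ.memLp hθ.memLp hθ2.memLp, hsym,
    hsym _ f] at h1
  have hpd : ∀ j (u : L2), bmul (pd j fun x => θ x * θ x) u =
      (2 : ℂ) • bmul θ (bmul (pd j θ) u) := by
    intro j u
    refine bmul_eq_of_ae (hθ2.pd j).memLp ?_
    filter_upwards [bmul_ae hθ.memLp (bmul (pd j θ) u), bmul_ae (hθ.pd j).memLp u,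
      Lp.coeFn_smul (2 : ℂ) (bmul θ (bmul (pd j θ) u))] with x a1 a2 a3
    rw [a3, Pi.smul_apply, a1, a2, smul_eq_mul, pd_mul (hθ.1.differentiable (by simp) x)
      (hθ.1.differentiable (by simp) x)]
    ring
  -- With a the j-th derivative of θu and b = i(∂_jθ)u the left side is Re ⟨a - b, a + b⟩. The cross
  -- terms have opposite signs and equal real parts, which leaves ‖a‖² - ‖b‖².
  have h2 : ∀ j, (inner ℂ (mulJet (fun x => θ x * θ x) w (some j)) (w (some j)) : ℂ).re =
      ‖mulJet θ w (some j)‖ ^ 2 - ‖bmul (pd j θ) (w none)‖ ^ 2 := by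
    intro j
    set a := mulJet θ w (some j) with ha
    set b := Complex.I • bmul (pd j θ) (w none) with hb
    have hab : bmul θ (w (some j)) = a + b := by
      rw [ha, hb, mulJet_some, sub_add_cancel]
    have hlhs : inner ℂ (mulJet (fun x => θ x * θ x) w (some j)) (w (some j)) =
        inner ℂ (a - b) (a + b) := by
      rw [mulJet_some, hpd, ← bmul_bmul hθ.memLp hθ.memLp hθ2.memLp, hab,
        smul_comm Complex.I (2 : ℂ), ← map_smul (bmul θ) Complex.I, ← hb, ← map_smul, ← map_sub,
        hsym, hab, two_smul]
      congr 1
      abel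
    have hnb : ‖bmul (pd j θ) (w none)‖ = ‖b‖ := by rw [hb, norm_smul]; simp
    have hs : (inner ℂ a b : ℂ).re = (inner ℂ b a : ℂ).re := inner_re_symm (𝕜 := ℂ) a b
    have hna : (inner ℂ a a : ℂ).re = ‖a‖ ^ 2 := inner_self_eq_norm_sq (𝕜 := ℂ) a
    have hnb' : (inner ℂ b b : ℂ).re = ‖b‖ ^ 2 := inner_self_eq_norm_sq (𝕜 := ℂ) b
    rw [hlhs, hnb, inner_sub_left, inner_add_right, inner_add_right, Complex.sub_re,
      Complex.add_re, Complex.add_re, hs, hna, hnb']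
    ring
  have h3 := congrArg Complex.re h1
  rw [Complex.add_re, Complex.re_sum, Finset.sum_congr rfl fun j _ => h2 j,
    Finset.sum_sub_distrib] at h3
  rw [e0, map_sub, inner_sub_right, Complex.sub_re]
  linarith

end

section

/-! ### Resolvents of the Friedrichs extension -/

variable {n : ℕ} (s : Fin n → Plane) (α : Fin n → ℝ)

theorem isPositive_invOne : (invOne s α).IsPositive := by
  refine ⟨fun f g => inner_invOne s α f g, fun f => ?_⟩
  rw [ContinuousLinearMap.reApplyInnerSelf_apply, inner_invOne_self]
  simp only [RCLike.re_to_complex, Complex.ofReal_re]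
  exact add_nonneg (sq_nonneg _) (Finset.sum_nonneg fun _ _ => sq_nonneg _)

/-- The spectrum of the positive contraction T lies in [0, 1]. If 1 - (w + 1)T were singular, 1/(w +
1) would lie in (0, 1], which forces w into [0, ∞). The case w = -1 is trivial and has to be
separated. -/
theorem isUnit_one_sub_invOne {w : ℂ} (hw : ¬ (w.im = 0 ∧ 0 ≤ w.re)) :
    IsUnit (1 - (w + 1) • invOne s α) := by
  by_cases h0 : w + 1 = 0
  · simp [h0]
  by_contra h
  have hsp : (w + 1)⁻¹ ∈ spectrum ℂ (invOne s α) := by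
    rw [spectrum.mem_iff]
    intro h'
    apply h
    have : (1 : L2 →L[ℂ] L2) - (w + 1) • invOne s α =
        (w + 1) • (algebraMap ℂ (L2 →L[ℂ] L2) (w + 1)⁻¹ - invOne s α) := by
      rw [smul_sub, Algebra.algebraMap_eq_smul_one, smul_smul, mul_inv_cancel₀ h0, one_smul]
    rw [this]
    exact h'.smul (Units.mk0 (w + 1) h0)
  have hpos := isPositive_invOne s α
  have hre : (w + 1)⁻¹ = (((w + 1)⁻¹).re : ℂ) := hpos.isSelfAdjoint.mem_spectrum_eq_re hsp
  have hnn : 0 ≤ ((w + 1)⁻¹).re := by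
    have h1 : 0 ≤ invOne s α := by rwa [ContinuousLinearMap.nonneg_iff_isPositive]
    have h2 := spectrum_nonneg_of_nonneg h1 (x := ((w + 1)⁻¹).re) (by
      rw [← spectrum.algebraMap_mem_iff ℂ]
      have h3 := hsp
      rw [hre] at h3
      exact h3)
    exact h2
  have hle : ‖(w + 1)⁻¹‖ ≤ 1 := by
    have h1 : ‖invOne s α‖ ≤ 1 :=
      ContinuousLinearMap.opNorm_le_bound _ zero_le_one fun f => by
        rw [one_mul]; exact norm_invOne_le s α f
    have := spectrum.norm_le_norm_mul_of_mem hsp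
    exact this.trans (by
      have h2 : ‖(1 : L2 →L[ℂ] L2)‖ ≤ 1 := ContinuousLinearMap.norm_id_le
      nlinarith [norm_nonneg (invOne s α), norm_nonneg (1 : L2 →L[ℂ] L2)])
  set r := ((w + 1)⁻¹).re with hr
  rw [hre, Complex.norm_real, Real.norm_of_nonneg hnn] at hle
  have hr0 : r ≠ 0 := by
    intro h
    rw [h] at hre
    exact inv_ne_zero h0 (by simpa using hre)
  have hw1 : w = ((r⁻¹ - 1 : ℝ) : ℂ) := by
    have : w + 1 = ((r⁻¹ : ℝ) : ℂ) := by
      rw [← inv_inv (w + 1), hre]; push_cast; rfl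
    push_cast at this ⊢
    linear_combination this
  apply hw
  rw [hw1]
  refine ⟨Complex.ofReal_im _, ?_⟩
  rw [Complex.ofReal_re, sub_nonneg]
  exact (one_le_inv₀ (lt_of_le_of_ne hnn hr0.symm)).2 hle

/-- The operator `(P + 1) (P - w)⁻¹`. -/
def resFactor (w : ℂ) : L2 →L[ℂ] L2 := Ring.inverse (1 - (w + 1) • invOne s α)

theorem resFactor_mul {w : ℂ} (hw : ¬ (w.im = 0 ∧ 0 ≤ w.re)) (f : L2) :
    resFactor s α w (f - (w + 1) • invOne s α f) = f := by
  have := Ring.inverse_mul_cancel _ (isUnit_one_sub_invOne s α hw)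
  have h2 := congrArg (fun A : L2 →L[ℂ] L2 => A f) this
  simpa [resFactor] using h2

theorem mul_resFactor {w : ℂ} (hw : ¬ (w.im = 0 ∧ 0 ≤ w.re)) (f : L2) :
    resFactor s α w f - (w + 1) • invOne s α (resFactor s α w f) = f := by
  have := Ring.mul_inverse_cancel _ (isUnit_one_sub_invOne s α hw)
  have h2 := congrArg (fun A : L2 →L[ℂ] L2 => A f) this
  simpa [resFactor] using h2

theorem analyticAt_resFactor {w : ℂ} (hw : ¬ (w.im = 0 ∧ 0 ≤ w.re)) :
    AnalyticAt ℂ (resFactor s α) w := by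
  obtain ⟨u, hu⟩ := isUnit_one_sub_invOne s α hw
  have h1 := analyticAt_inverse (𝕜 := ℂ) u
  rw [hu] at h1
  exact h1.comp (f := fun w : ℂ => 1 - (w + 1) • invOne s α) (by fun_prop)

/-- Everything rests on (P - w)T = 1 - (w + 1)T: the right inverse uses the inverse of this factor
after T, the left inverse writes a domain element as u = T(u + Pu). -/
theorem isResolventAt_invOne_resFactor {w : ℂ} (hw : ¬ (w.im = 0 ∧ 0 ≤ w.re)) :
    IsResolventAt (hamiltonian s α) w (invOne s α ∘L resFactor s α w) := by
  constructor
  · intro f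
    have h := mem_graph_invOne s α (resFactor s α w f)
    obtain ⟨⟨v, hv⟩, h1, h2⟩ := (LinearPMap.mem_graph_iff _).1 h
    simp only at h1
    subst h1
    refine ⟨hv, ?_⟩
    change hamiltonian s α ⟨invOne s α (resFactor s α w f), hv⟩ -
      w • invOne s α (resFactor s α w f) = f
    have h3 : hamiltonian s α ⟨invOne s α (resFactor s α w f), hv⟩ =
      resFactor s α w f - invOne s α (resFactor s α w f) := h2
    rw [h3]
    conv_rhs => rw [← mul_resFactor s α hw f, add_smul, one_smul]
    abel
  · rintro ⟨u, hu⟩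
    have h1 := LinearPMap.mem_graph (hamiltonian s α) ⟨u, hu⟩
    have h2 := (mem_graph_iff s α _ _).1 h1
    set g := hamiltonian s α ⟨u, hu⟩ with hg
    simp only at h2 ⊢
    have h3 : g - w • u = (u + g) - (w + 1) • invOne s α (u + g) := by
      rw [h2, add_smul, one_smul]; abel
    rw [h3, ContinuousLinearMap.comp_apply, resFactor_mul s α hw, h2]

theorem IsResolventAt.unique {P : L2 →ₗ.[ℂ] L2} {z : ℂ} {R R' : L2 →L[ℂ] L2}
    (h : IsResolventAt P z R) (h' : IsResolventAt P z R') : R = R' := by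
  ext1 f
  obtain ⟨hf, hf2⟩ := h.1 f
  have := h'.2 ⟨R f, hf⟩
  rw [hf2] at this
  exact this.symm

theorem resolventAt_eq {w : ℂ} (hw : ¬ (w.im = 0 ∧ 0 ≤ w.re)) :
    resolventAt (hamiltonian s α) w = invOne s α ∘L resFactor s α w := by
  have h : ∃ R, IsResolventAt (hamiltonian s α) w R :=
    ⟨_, isResolventAt_invOne_resFactor s α hw⟩
  rw [resolventAt, dif_pos h]
  exact h.choose_spec.unique (isResolventAt_invOne_resFactor s α hw)

theorem sq_notMem_of_im_pos {z : ℂ} (hz : 0 < z.im) : ¬ ((z ^ 2).im = 0 ∧ 0 ≤ (z ^ 2).re) := by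
  rintro ⟨h1, h2⟩
  rw [sq, Complex.mul_im] at h1
  rw [sq, Complex.mul_re] at h2
  have h3 : z.re = 0 := by
    have : z.re * z.im = 0 := by linarith
    exact (mul_eq_zero.1 this).resolve_right hz.ne'
  rw [h3] at h2
  nlinarith

theorem isResolventAt_resolventAt {z : ℂ} (hz : 0 < z.im) :
    IsResolventAt (hamiltonian s α) (z ^ 2) (resolventAt (hamiltonian s α) (z ^ 2)) := by
  rw [resolventAt_eq s α (sq_notMem_of_im_pos hz)]
  exact isResolventAt_invOne_resFactor s α (sq_notMem_of_im_pos hz)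

theorem MeromorphicFamilyAt.of_analyticAt {V W : Type*} [NormedAddCommGroup V] [NormedSpace ℂ V]
    [NormedAddCommGroup W] [NormedSpace ℂ W] {F : ℂ → V →L[ℂ] W} {z : ℂ}
    (h : AnalyticAt ℂ F z) : MeromorphicFamilyAt F z :=
  ⟨F, 0, fun k => k.elim0, h, fun k => k.elim0, Eventually.of_forall fun w => by simp⟩

theorem meromorphicFamilyAt_resolventAt {z : ℂ} (hz : 0 < z.im) :
    MeromorphicFamilyAt (fun w : ℂ => resolventAt (hamiltonian s α) (w ^ 2)) z := by
  refine MeromorphicFamilyAt.of_analyticAt ?_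
  have h1 : AnalyticAt ℂ (fun w : ℂ => invOne s α ∘L resFactor s α (w ^ 2)) z := by
    have h2 : AnalyticAt ℂ (fun w : ℂ => resFactor s α (w ^ 2)) z :=
      (analyticAt_resFactor s α (sq_notMem_of_im_pos hz)).comp (f := fun w : ℂ => w ^ 2)
        (by fun_prop)
    exact (ContinuousLinearMap.analyticAt
      (ContinuousLinearMap.compL ℂ L2 L2 L2 (invOne s α)) _).comp h2
  refine h1.congr ?_
  filter_upwards [(isOpen_lt continuous_const Complex.continuous_im).mem_nhds hz] with w hw
  exact (resolventAt_eq s α (sq_notMem_of_im_pos hw)).symm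

end

section

/-! ### Compactness of bounded sets of `H¹` -/

theorem lintegral_enorm_sq (f : L2) :
    ∫⁻ x, ‖f x‖ₑ ^ 2 = ENNReal.ofReal (‖f‖ ^ 2) := by
  have h := eLpNorm_nnreal_pow_eq_lintegral (μ := (volume : Measure Plane)) (f := (f : Plane → ℂ))
    (p := 2) two_ne_zero
  have h2 : eLpNorm (f : Plane → ℂ) 2 volume = ENNReal.ofReal ‖f‖ := by
    rw [Lp.norm_def, ENNReal.ofReal_toReal (Lp.eLpNorm_ne_top f)]
  simp only [NNReal.coe_ofNat, ENNReal.coe_ofNat, ENNReal.rpow_ofNat] at h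
  rw [← h, h2, ENNReal.ofReal_pow (norm_nonneg _)]

theorem norm_le_of_lintegral {f : L2} {c : ℝ} (hc : 0 ≤ c)
    (h : ∫⁻ x, ‖f x‖ₑ ^ 2 ≤ ENNReal.ofReal (c ^ 2)) : ‖f‖ ≤ c := by
  rw [lintegral_enorm_sq, ENNReal.ofReal_le_ofReal_iff (sq_nonneg c)] at h
  exact (sq_le_sq₀ (norm_nonneg _) hc).1 h

theorem sq_lintegral_le {X : Type*} [MeasurableSpace X] (μ : Measure X) {f : X → ENNReal}
    (hf : AEMeasurable f μ) : (∫⁻ x, f x ∂μ) ^ 2 ≤ μ univ * ∫⁻ x, f x ^ 2 ∂μ := by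
  have h := ENNReal.lintegral_mul_le_Lp_mul_Lq μ Real.HolderConjugate.two_two hf
    (g := fun _ => 1) aemeasurable_const
  simp only [Pi.mul_apply, mul_one, ENNReal.rpow_ofNat, one_pow, lintegral_const, one_mul] at h
  calc (∫⁻ x, f x ∂μ) ^ 2 ≤ ((∫⁻ x, f x ^ 2 ∂μ) ^ (1 / 2 : ℝ) * μ univ ^ (1 / 2 : ℝ)) ^ 2 := by
        gcongr
    _ = μ univ * ∫⁻ x, f x ^ 2 ∂μ := by
        rw [mul_pow, ← ENNReal.rpow_natCast, ← ENNReal.rpow_natCast, ← ENNReal.rpow_mul,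
          ← ENNReal.rpow_mul, mul_comm]
        norm_num

/-- The increment is the integral of the derivative along the segment; Cauchy–Schwarz in the segment
parameter, Tonelli and translation invariance then give the bound. -/
theorem lintegral_translate_le {ψ : Plane → ℂ} (hψ : ContDiff ℝ 1 ψ) (v : Plane) :
    ∫⁻ x, ‖ψ (x + v) - ψ x‖ₑ ^ 2 ≤ ‖v‖ₑ ^ 2 * ∫⁻ x, ‖fderiv ℝ ψ x‖ₑ ^ 2 := by
  have hd : Continuous (fderiv ℝ ψ) := hψ.continuous_fderiv one_ne_zero
  have hpt : ∀ x, ‖ψ (x + v) - ψ x‖ₑ ^ 2 ≤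
      ‖v‖ₑ ^ 2 * ∫⁻ t in Ioc (0 : ℝ) 1, ‖fderiv ℝ ψ (x + t • v)‖ₑ ^ 2 := by
    intro x
    have hder : ∀ t : ℝ, HasDerivAt (fun t : ℝ => ψ (x + t • v)) (fderiv ℝ ψ (x + t • v) v) t := by
      intro t
      have h1 : HasDerivAt (fun t : ℝ => x + t • v) v t := by
        simpa using ((hasDerivAt_id t).smul_const v).const_add x
      exact ((hψ.differentiable one_ne_zero _).hasFDerivAt).comp_hasDerivAt t h1
    have hc : Continuous fun t : ℝ => fderiv ℝ ψ (x + t • v) := hd.comp (by fun_prop)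
    have hftc := intervalIntegral.integral_eq_sub_of_hasDerivAt (a := 0) (b := 1)
      (fun t _ => hder t) ((hc.clm_apply continuous_const).intervalIntegrable _ _)
    simp only [one_smul, zero_smul, add_zero] at hftc
    rw [← hftc, intervalIntegral.integral_of_le zero_le_one]
    calc _ ≤ (∫⁻ t in Ioc (0 : ℝ) 1, ‖fderiv ℝ ψ (x + t • v) v‖ₑ) ^ 2 := by
          gcongr; exact enorm_integral_le_lintegral_enorm _
      _ ≤ (∫⁻ t in Ioc (0 : ℝ) 1, ‖v‖ₑ * ‖fderiv ℝ ψ (x + t • v)‖ₑ) ^ 2 := by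
          gcongr with t
          rw [mul_comm]
          exact ContinuousLinearMap.le_opENorm _ _
      _ = ‖v‖ₑ ^ 2 * (∫⁻ t in Ioc (0 : ℝ) 1, ‖fderiv ℝ ψ (x + t • v)‖ₑ) ^ 2 := by
          rw [lintegral_const_mul _ hc.enorm.measurable, mul_pow]
      _ ≤ _ := by
          gcongr
          refine (sq_lintegral_le _ hc.enorm.aemeasurable).trans ?_
          simp
  have hjoint : Measurable fun p : Plane × ℝ => ‖fderiv ℝ ψ (p.1 + p.2 • v)‖ₑ ^ 2 := by
    have : Continuous fun p : Plane × ℝ => fderiv ℝ ψ (p.1 + p.2 • v) := hd.comp (by fun_prop)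
    exact this.enorm.measurable.pow_const 2
  calc _ ≤ ∫⁻ x, ‖v‖ₑ ^ 2 * ∫⁻ t in Ioc (0 : ℝ) 1, ‖fderiv ℝ ψ (x + t • v)‖ₑ ^ 2 :=
        lintegral_mono hpt
    _ = ‖v‖ₑ ^ 2 * ∫⁻ t in Ioc (0 : ℝ) 1, ∫⁻ x, ‖fderiv ℝ ψ (x + t • v)‖ₑ ^ 2 := by
        rw [lintegral_const_mul _ hjoint.lintegral_prod_right, lintegral_lintegral_swap]
        exact hjoint.aemeasurable
    _ = _ := by
        congr 1
        simp only [lintegral_add_right_eq_self (fun x => ‖fderiv ℝ ψ x‖ₑ ^ 2)]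
        simp

/-- The half open square with a given index in the grid of mesh size `h`. -/
def gridCell (h : ℝ) (c : Fin 2 → ℤ) : Set Plane := {x | ∀ j, x j ∈ Ico (c j * h) ((c j + 1) * h)}

theorem gridCell_eq (h : ℝ) (c : Fin 2 → ℤ) : gridCell h c =
    WithLp.ofLp ⁻¹' (univ.pi fun j => Ico (c j * h) ((c j + 1) * h)) := by
  ext x; simp [gridCell]

theorem measurableSet_gridCell (h : ℝ) (c : Fin 2 → ℤ) : MeasurableSet (gridCell h c) := by
  rw [gridCell_eq]
  exact (PiLp.volume_preserving_ofLp (Fin 2)).measurable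
    (MeasurableSet.univ_pi fun _ => measurableSet_Ico)

theorem volume_gridCell (h : ℝ) (c : Fin 2 → ℤ) :
    volume (gridCell h c) = ENNReal.ofReal h ^ 2 := by
  rw [gridCell_eq, (PiLp.volume_preserving_ofLp (Fin 2)).measure_preimage
    (MeasurableSet.univ_pi fun _ => measurableSet_Ico).nullMeasurableSet, volume_pi_pi]
  simp [add_mul]

theorem dist_le_of_mem_gridCell {h : ℝ} (hh : 0 < h) {c : Fin 2 → ℤ} {x y : Plane}
    (hx : x ∈ gridCell h c) (hy : y ∈ gridCell h c) : dist x y ≤ 2 * h := by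
  rw [EuclideanSpace.dist_eq, Real.sqrt_le_left (by positivity), Fin.sum_univ_two]
  have key : ∀ j, dist (x j) (y j) ^ 2 ≤ h ^ 2 := by
    intro j
    rw [Real.dist_eq, sq_abs]
    have h1 := hx j
    have h2 := hy j
    simp only [mem_Ico] at h1 h2
    apply sq_le_sq' <;> nlinarith
  nlinarith [key 0, key 1]

theorem gridCell_unique {h : ℝ} (hh : 0 < h) {c : Fin 2 → ℤ} {x : Plane}
    (hx : x ∈ gridCell h c) : c = fun j => ⌊x j / h⌋ := by
  ext j
  have h1 := hx j
  simp only [mem_Ico] at h1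
  symm
  rw [Int.floor_eq_iff, le_div_iff₀ hh, div_lt_iff₀ hh]
  exact h1

theorem mem_gridCell_floor {h : ℝ} (hh : 0 < h) (x : Plane) :
    x ∈ gridCell h fun j => ⌊x j / h⌋ := by
  intro j
  rw [mem_Ico, ← le_div_iff₀ hh, ← div_lt_iff₀ hh]
  exact ⟨Int.floor_le _, Int.lt_floor_add_one _⟩

/-- The indicator function of a grid cell. -/
def cellInd (h : ℝ) (c : Fin 2 → ℤ) : L2 :=
  indicatorConstLp 2 (measurableSet_gridCell h c)
    (by rw [volume_gridCell]; exact ENNReal.pow_ne_top ENNReal.ofReal_ne_top) 1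

/-- Replacing a function by its averages over finitely many grid cells. -/
def gridAvg (h : ℝ) (I : Finset (Fin 2 → ℤ)) : L2 →L[ℂ] L2 :=
  ∑ c ∈ I, (((h ^ 2)⁻¹ : ℝ) : ℂ) • (innerSL ℂ (cellInd h c)).smulRight (cellInd h c)

theorem isCompactOperator_smulRight (l : L2 →L[ℂ] ℂ) (v : L2) :
    IsCompactOperator (l.smulRight v) := by
  have h1 : IsCompactOperator (l : L2 → ℂ) :=
    isCompactOperator_of_locallyCompactSpace_dom l
  exact h1.clm_comp (ContinuousLinearMap.toSpanSingleton ℂ v)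

theorem isCompactOperator_gridAvg (h : ℝ) (I : Finset (Fin 2 → ℤ)) :
    IsCompactOperator (gridAvg h I) := by
  have : gridAvg h I ∈ compactOperator (RingHom.id ℂ) L2 L2 :=
    Submodule.sum_mem _ fun c _ => Submodule.smul_mem _ _ (isCompactOperator_smulRight _ _)
  exact this

theorem gridAvg_ae (h : ℝ) (I : Finset (Fin 2 → ℤ)) (f : L2) :
    ∀ᵐ x, gridAvg h I f x =
      ∑ c ∈ I, (gridCell h c).indicator (fun _ => ((h ^ 2)⁻¹ : ℝ) * ∫ y in gridCell h c, f y) x := by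
  have h1 : gridAvg h I f = ∑ c ∈ I, ((((h ^ 2)⁻¹ : ℝ) : ℂ) * ∫ y in gridCell h c, f y) •
      cellInd h c := by
    rw [gridAvg, sum_apply]
    refine Finset.sum_congr rfl fun c _ => ?_
    rw [smul_apply, ContinuousLinearMap.smulRight_apply, smul_smul]
    congr 2
    rw [innerSL_apply_apply]
    exact L2.inner_indicatorConstLp_one (𝕜 := ℂ) _ _ f
  rw [h1]
  have h2 : ∀ᵐ x, ∀ c ∈ I, (((((h ^ 2)⁻¹ : ℝ) : ℂ) * ∫ y in gridCell h c, f y) •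
      cellInd h c : L2) x =
      (gridCell h c).indicator (fun _ => ((h ^ 2)⁻¹ : ℝ) * ∫ y in gridCell h c, f y) x := by
    rw [Filter.eventually_all_finset]
    intro c _
    filter_upwards [Lp.coeFn_smul ((((h ^ 2)⁻¹ : ℝ) : ℂ) * ∫ y in gridCell h c, f y)
      (cellInd h c), indicatorConstLp_coeFn (p := 2) (hs := measurableSet_gridCell h c)
      (hμs := by rw [volume_gridCell]; exact ENNReal.pow_ne_top ENNReal.ofReal_ne_top)
      (c := (1 : ℂ))] with x h3 h4
    rw [h3, Pi.smul_apply]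
    change _ • (indicatorConstLp 2 _ _ 1 : L2) x = _
    rw [h4]
    by_cases hx : x ∈ gridCell h c <;> simp [hx]
  filter_upwards [h2, Lp.coeFn_finsetSum I fun c => ((((h ^ 2)⁻¹ : ℝ) : ℂ) *
    ∫ y in gridCell h c, f y) • cellInd h c] with x h3 h4
  rw [h4, Finset.sum_apply]
  exact Finset.sum_congr rfl fun c hc => h3 c hc

/-- By Cauchy–Schwarz the deviation from the cell mean is at most the quadratic mean of ψ(y) - ψ(x)
over the cell. The cell lies in the disc of radius 2h about x, and enlarging it to that disc makes
the bound depend on translations only. -/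
theorem enorm_sub_gridAvg_le {h : ℝ} (hh : 0 < h) {I : Finset (Fin 2 → ℤ)} {ψ : Plane → ℂ}
    (hψ : Continuous ψ) {x : Plane}
    (hI' : (fun j => ⌊x j / h⌋) ∉ I → ψ x = 0) :
    ‖ψ x - ∑ c ∈ I, (gridCell h c).indicator
      (fun _ => ((h ^ 2)⁻¹ : ℝ) * ∫ y in gridCell h c, ψ y) x‖ₑ ^ 2 ≤
      (ENNReal.ofReal h ^ 2)⁻¹ * ∫⁻ v in Metric.closedBall (0 : Plane) (2 * h),
        ‖ψ (x + v) - ψ x‖ₑ ^ 2 := by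
  set c₀ : Fin 2 → ℤ := fun j => ⌊x j / h⌋ with hc₀
  have hsum : ∑ c ∈ I, (gridCell h c).indicator
      (fun _ => ((h ^ 2)⁻¹ : ℝ) * ∫ y in gridCell h c, ψ y) x =
      if c₀ ∈ I then ((h ^ 2)⁻¹ : ℝ) * ∫ y in gridCell h c₀, ψ y else 0 := by
    rw [← Finset.sum_ite_eq' I c₀ fun c => (((h ^ 2)⁻¹ : ℝ) : ℂ) * ∫ y in gridCell h c, ψ y]
    refine Finset.sum_congr rfl fun c _ => ?_
    by_cases hx : x ∈ gridCell h c
    · rw [if_pos (gridCell_unique hh hx), indicator_of_mem hx]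
    · rw [indicator_of_notMem hx, if_neg]
      rintro rfl
      exact hx (mem_gridCell_floor hh x)
  rw [hsum]
  by_cases hm : c₀ ∈ I
  swap
  · rw [if_neg hm, hI' hm]; simp
  rw [if_pos hm]
  have hvol : volume (gridCell h c₀) = ENNReal.ofReal h ^ 2 := volume_gridCell h c₀
  have hreal : (volume : Measure Plane).real (gridCell h c₀) = h ^ 2 := by
    rw [Measure.real, hvol, ENNReal.toReal_pow, ENNReal.toReal_ofReal hh.le]
  have hfin : volume (gridCell h c₀) ≠ ⊤ := by
    rw [hvol]; exact ENNReal.pow_ne_top ENNReal.ofReal_ne_top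
  have hx := mem_gridCell_floor hh x
  have hsub : gridCell h c₀ ⊆ Metric.closedBall x (2 * h) := fun y hy => by
    rw [Metric.mem_closedBall]
    exact dist_le_of_mem_gridCell hh hy hx
  have hint : IntegrableOn ψ (gridCell h c₀) volume :=
    (hψ.continuousOn.integrableOn_compact (isCompact_closedBall x (2 * h))).mono_set hsub
  have hintc : IntegrableOn (fun _ => ψ x) (gridCell h c₀) volume :=
    integrableOn_const hfin (by simp)
  have e1 : ψ x - ((h ^ 2)⁻¹ : ℝ) * ∫ y in gridCell h c₀, ψ y =
      ((h ^ 2)⁻¹ : ℝ) * ∫ y in gridCell h c₀, (ψ x - ψ y) := by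
    rw [integral_sub hintc hint, setIntegral_const, hreal, mul_sub,
      Complex.real_smul, ← mul_assoc, ← Complex.ofReal_mul, inv_mul_cancel₀ (by positivity)]
    simp
  have hmeas : Measurable fun y => ‖ψ y - ψ x‖ₑ := (hψ.sub continuous_const).enorm.measurable
  have hinv : ‖(((h ^ 2)⁻¹ : ℝ) : ℂ)‖ₑ = (ENNReal.ofReal h ^ 2)⁻¹ := by
    rw [← ofReal_norm, Complex.norm_real, Real.norm_of_nonneg (by positivity),
      ENNReal.ofReal_inv_of_pos (by positivity), ENNReal.ofReal_pow hh.le]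
  have h0 : ENNReal.ofReal h ^ 2 ≠ 0 := by simp [hh]
  have ht : ENNReal.ofReal h ^ 2 ≠ ⊤ := ENNReal.pow_ne_top ENNReal.ofReal_ne_top
  rw [e1, enorm_mul, hinv, mul_pow]
  calc _ ≤ (ENNReal.ofReal h ^ 2)⁻¹ ^ 2 * (∫⁻ y in gridCell h c₀, ‖ψ y - ψ x‖ₑ) ^ 2 := by
        gcongr
        refine (enorm_integral_le_lintegral_enorm _).trans (le_of_eq ?_)
        simp_rw [← enorm_neg (ψ x - ψ _), neg_sub]
    _ ≤ (ENNReal.ofReal h ^ 2)⁻¹ ^ 2 *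
        (ENNReal.ofReal h ^ 2 * ∫⁻ y in gridCell h c₀, ‖ψ y - ψ x‖ₑ ^ 2) := by
        gcongr
        refine (sq_lintegral_le _ hmeas.aemeasurable).trans ?_
        rw [Measure.restrict_apply_univ, hvol]
    _ = (ENNReal.ofReal h ^ 2)⁻¹ * ∫⁻ y in gridCell h c₀, ‖ψ y - ψ x‖ₑ ^ 2 := by
        rw [sq, mul_assoc, ← mul_assoc _ (ENNReal.ofReal h ^ 2), ENNReal.inv_mul_cancel h0 ht,
          one_mul]
    _ ≤ (ENNReal.ofReal h ^ 2)⁻¹ * ∫⁻ y in Metric.closedBall x (2 * h), ‖ψ y - ψ x‖ₑ ^ 2 := by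
        gcongr
    _ = _ := by
        congr 1
        rw [← lintegral_indicator measurableSet_closedBall,
          ← lintegral_indicator measurableSet_closedBall,
          ← lintegral_add_left_eq_self _ x]
        refine lintegral_congr fun v => ?_
        simp only [indicator, Metric.mem_closedBall, dist_self_add_left, dist_zero_right]

/-- Functions with bounded gradient and support in a fixed disc are approximated uniformly by
operators of finite rank. -/
theorem exists_compact_approx (r : ℝ) {ε : ℝ} (hε : 0 < ε) : ∃ A : L2 →L[ℂ] L2,
    IsCompactOperator A ∧ ∀ (ψ : Plane → ℂ) (f : L2) (G : ℝ), ContDiff ℝ 1 ψ →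
      (∀ x, r < ‖x‖ → ψ x = 0) → f =ᵐ[volume] ψ → 0 ≤ G →
      ∫⁻ x, ‖fderiv ℝ ψ x‖ₑ ^ 2 ≤ ENNReal.ofReal (G ^ 2) → ‖f - A f‖ ≤ ε * G := by
  set V : ENNReal := volume (Metric.ball (0 : Plane) 1) with hV
  have hVt : V ≠ ⊤ := measure_ball_lt_top.ne
  -- The constant is the product of h⁻² from the cell average, the area 4h²V of the disc of
  -- translations, and (2h)² from the translation estimate.
  obtain ⟨h, hh, hhε⟩ : ∃ h : ℝ, 0 < h ∧ 16 * h ^ 2 * V.toReal ≤ ε ^ 2 := by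
    refine ⟨ε / (4 * (V.toReal + 1)), by positivity, ?_⟩
    have hp : 0 ≤ V.toReal := ENNReal.toReal_nonneg
    have : 16 * (ε / (4 * (V.toReal + 1))) ^ 2 * V.toReal =
      ε ^ 2 * (V.toReal / (V.toReal + 1) ^ 2) := by field_simp; norm_num
    rw [this]
    refine mul_le_of_le_one_right (sq_nonneg _) ?_
    rw [div_le_one (by positivity)]
    nlinarith
  set N : ℤ := ⌈r / h⌉ + 1 with hN
  set I : Finset (Fin 2 → ℤ) := Fintype.piFinset fun _ => Finset.Icc (-N) N with hI
  refine ⟨gridAvg h I, isCompactOperator_gridAvg h I, ?_⟩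
  intro ψ f G hψ hsupp hf hG hgrad
  have hmem : ∀ x : Plane, (fun j => ⌊x j / h⌋) ∉ I → ψ x = 0 := by
    intro x hx
    by_contra h0
    have hxr : ‖x‖ ≤ r := by
      by_contra! h1
      exact h0 (hsupp x h1)
    apply hx
    rw [hI, Fintype.mem_piFinset]
    intro j
    have h1 : |x j| ≤ r := by
      have := PiLp.norm_apply_le x j
      rw [Real.norm_eq_abs] at this
      exact this.trans hxr
    rw [abs_le] at h1
    have h2 : r / h ≤ ⌈r / h⌉ := Int.le_ceil _
    have h3 : x j / h ≤ r / h := by gcongr; exact h1.2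
    have h4 : -(r / h) ≤ x j / h := by rw [← neg_div]; gcongr; exact h1.1
    rw [Finset.mem_Icc, hN]
    constructor
    · rw [Int.le_floor]; push_cast; linarith
    · have h5 : ((⌊x j / h⌋ : ℤ) : ℝ) ≤ x j / h := Int.floor_le _
      have : ((⌊x j / h⌋ : ℤ) : ℝ) ≤ ((⌈r / h⌉ + 1 : ℤ) : ℝ) := by push_cast; linarith
      exact_mod_cast this
  refine norm_le_of_lintegral (by positivity) ?_
  have hinteq : ∀ c, ∫ y in gridCell h c, f y = ∫ y in gridCell h c, ψ y := fun c =>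
    integral_congr_ae (ae_restrict_of_ae hf)
  have hjoint : Measurable fun p : Plane × Plane => ‖ψ (p.1 + p.2) - ψ p.1‖ₑ ^ 2 := by
    have : Continuous fun p : Plane × Plane => ψ (p.1 + p.2) - ψ p.1 :=
      (hψ.continuous.comp (by fun_prop)).sub (hψ.continuous.comp (by fun_prop))
    exact this.enorm.measurable.pow_const 2
  calc ∫⁻ x, ‖(f - gridAvg h I f) x‖ₑ ^ 2
      ≤ ∫⁻ x, (ENNReal.ofReal h ^ 2)⁻¹ * ∫⁻ v in Metric.closedBall (0 : Plane) (2 * h),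
          ‖ψ (x + v) - ψ x‖ₑ ^ 2 := by
        refine lintegral_mono_ae ?_
        filter_upwards [Lp.coeFn_sub f (gridAvg h I f), gridAvg_ae h I f, hf] with x h1 h2 h3
        rw [h1, Pi.sub_apply, h2, h3]
        simp only [hinteq]
        exact enorm_sub_gridAvg_le hh hψ.continuous (hmem x)
    _ = (ENNReal.ofReal h ^ 2)⁻¹ * ∫⁻ v in Metric.closedBall (0 : Plane) (2 * h),
          ∫⁻ x, ‖ψ (x + v) - ψ x‖ₑ ^ 2 := by
        rw [lintegral_const_mul _ hjoint.lintegral_prod_right, lintegral_lintegral_swap]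
        exact hjoint.aemeasurable
    _ ≤ (ENNReal.ofReal h ^ 2)⁻¹ * ∫⁻ v in Metric.closedBall (0 : Plane) (2 * h),
          ENNReal.ofReal (2 * h) ^ 2 * ENNReal.ofReal (G ^ 2) := by
        refine mul_le_mul' le_rfl ?_
        refine setLIntegral_mono measurable_const fun v hv => ?_
        refine (lintegral_translate_le hψ v).trans ?_
        gcongr
        rw [← ofReal_norm]
        exact ENNReal.ofReal_le_ofReal (by simpa using hv)
    _ = ENNReal.ofReal (16 * h ^ 2 * V.toReal * G ^ 2) := by
        rw [setLIntegral_const, Measure.addHaar_closedBall _ _ (by positivity),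
          ← hV, ← ENNReal.ofReal_toReal hVt, ← ENNReal.ofReal_pow hh.le,
          ← ENNReal.ofReal_inv_of_pos (by positivity), ← ENNReal.ofReal_pow (by positivity),
          ← ENNReal.ofReal_mul (by positivity), ← ENNReal.ofReal_mul (by positivity),
          ← ENNReal.ofReal_mul (by positivity), ← ENNReal.ofReal_mul (by positivity)]
        congr 1
        rw [finrank_euclideanSpace_fin, ENNReal.toReal_ofReal ENNReal.toReal_nonneg]
        field_simp
        ring
    _ ≤ ENNReal.ofReal ((ε * G) ^ 2) := by
        refine ENNReal.ofReal_le_ofReal ?_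
        rw [mul_pow]
        gcongr

end

section

/-! ### Compactness of the localised form space -/

variable {n : ℕ} (s : Fin n → Plane) (α : Fin n → ℝ)

theorem opNorm_fderiv_le (u : Plane → ℂ) (x : Plane) :
    ‖fderiv ℝ u x‖ ≤ ∑ j, ‖pd j u x‖ := by
  refine ContinuousLinearMap.opNorm_le_bound _ (Finset.sum_nonneg fun _ _ => norm_nonneg _) ?_
  intro v
  have hv : v = ∑ j, v j • EuclideanSpace.single j (1 : ℝ) := by
    ext i
    fin_cases i <;> simp [Fin.sum_univ_two]
  conv_lhs => rw [hv]
  rw [map_sum, Finset.sum_mul]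
  refine (norm_sum_le _ _).trans (Finset.sum_le_sum fun j _ => ?_)
  rw [map_smul, norm_smul, mul_comm]
  exact mul_le_mul_of_nonneg_left (PiLp.norm_apply_le v j) (norm_nonneg _)

theorem norm_le_jet (w : Jet) (o : Option (Fin 2)) : ‖w o‖ ≤ ‖w‖ := PiLp.norm_apply_le w o

theorem pd_eq_magneticDerivFun (φ : Plane → ℂ) (x : Plane) (j : Fin 2) :
    pd j φ x = Complex.I * (magneticDerivFun s α j φ x + (vectorPotential s α x j : ℂ) * φ x) := by
  simp only [magneticDerivFun, pd]
  linear_combination (fderiv ℝ φ x (EuclideanSpace.single j 1)) * Complex.I_sq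

/-- Since A is real it drops out of the derivative of |φ|². This is the diamagnetic mechanism:
control of |φ|² needs no bound on the singular potential. -/
theorem norm_pd_normSq_le (φ : testFun s) (x : Plane) (j : Fin 2) :
    ‖pd j (fun y => conj (φ.1 y) * φ.1 y) x‖ ≤
      2 * ‖φ.1 x‖ * ‖magneticDerivFun s α j φ.1 x‖ := by
  have hd := φ.2.1.differentiable (by simp) x
  have hdc : DifferentiableAt ℝ (fun y => conj (φ.1 y)) x :=
    (Complex.conjCLE.contDiff.comp φ.2.1).differentiable (n := ∞) (by simp) x
  rw [pd_mul hdc hd, pd_conj hd, pd_eq_magneticDerivFun s α]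
  set a := φ.1 x
  set d := magneticDerivFun s α j φ.1 x
  have : conj a * (Complex.I * (d + (vectorPotential s α x j : ℂ) * a)) +
      conj (Complex.I * (d + (vectorPotential s α x j : ℂ) * a)) * a =
      Complex.I * (conj a * d) - Complex.I * (conj d * a) := by
    simp only [map_mul, map_add, Complex.conj_I, Complex.conj_ofReal]
    ring
  rw [this]
  refine (norm_sub_le _ _).trans (le_of_eq ?_)
  simp only [norm_mul, Complex.norm_I, RCLike.norm_conj]
  ring

theorem lintegral_mul_le_norm (f g : L2) :
    ∫⁻ x, ‖f x‖ₑ * ‖g x‖ₑ ≤ ENNReal.ofReal (‖f‖ * ‖g‖) := by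
  have h := ENNReal.lintegral_mul_le_Lp_mul_Lq volume Real.HolderConjugate.two_two
    (f := fun x => ‖f x‖ₑ) (g := fun x => ‖g x‖ₑ)
    (Lp.aestronglyMeasurable f).enorm (Lp.aestronglyMeasurable g).enorm
  simp only [Pi.mul_apply, ENNReal.rpow_ofNat, lintegral_enorm_sq] at h
  refine h.trans (le_of_eq ?_)
  rw [ENNReal.ofReal_rpow_of_nonneg (sq_nonneg _) (by norm_num),
    ENNReal.ofReal_rpow_of_nonneg (sq_nonneg _) (by norm_num), ← ENNReal.ofReal_mul (by positivity),
    ← Real.sqrt_eq_rpow, ← Real.sqrt_eq_rpow, Real.sqrt_sq (norm_nonneg _),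
    Real.sqrt_sq (norm_nonneg _)]

/-- The `L²` norm of an element of the form space over a small set is small. -/
theorem exists_norm_indicator_le : ∃ C : ℝ, 0 ≤ C ∧ ∀ E : Set Plane, MeasurableSet E →
    volume E ≠ ⊤ → ∀ w ∈ formSpace s α, ‖bmul (E.indicator fun _ => 1) (w none)‖ ^ 2 ≤
      C * √((volume : Measure Plane).real E) * ‖w‖ ^ 2 := by
  have hfin : Module.finrank ℝ Plane = 2 := finrank_euclideanSpace_fin
  have hp : Real.HolderConjugate (Module.finrank ℝ Plane) 2 := by
    rw [hfin]; exact Real.HolderConjugate.two_two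
  set K := lintegralPowLePowLIntegralFDerivConst (volume : Measure Plane) 2 with hK
  refine ⟨√K * 4, by positivity, fun E hE hEt w hw => ?_⟩
  have hEm : MemLp (E.indicator fun _ => (1 : ℂ)) ⊤ (volume : Measure Plane) :=
    memLp_top_of_bound (measurable_const.indicator hE).aestronglyMeasurable 1
      (Eventually.of_forall fun x => by by_cases hx : x ∈ E <;> simp [hx])
  refine formSpace_induction s α (p := fun w => ‖bmul (E.indicator fun _ => 1) (w none)‖ ^ 2 ≤
      √K * 4 * √((volume : Measure Plane).real E) * ‖w‖ ^ 2) (isClosed_le ?_ ?_)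
    (fun φ => ?_) hw
  · exact (((bmul _).continuous.comp (comp none).continuous).norm).pow 2
  · exact continuous_const.mul (continuous_norm.pow 2)
  set u : Plane → ℂ := fun y => conj (φ.1 y) * φ.1 y with hu
  have huc : ContDiff ℝ 1 u := ((Complex.conjCLE.contDiff.comp φ.2.1).mul φ.2.1).of_le (by simp)
  have hucs : HasCompactSupport u := φ.2.2.1.mul_left
  -- In dimension two the Gagliardo–Nirenberg–Sobolev inequality bounds the L² norm by the L¹ norm
  -- of the gradient. Applied to |φ|² it bounds φ in L⁴, and Cauchy–Schwarz on E then yields the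
  -- factor √|E|.
  have hgns := lintegral_pow_le_pow_lintegral_fderiv (volume : Measure Plane) huc hucs hp
  rw [← hK] at hgns
  simp only [ENNReal.rpow_ofNat] at hgns
  have hgrad : ∫⁻ x, ‖fderiv ℝ u x‖ₑ ≤ ENNReal.ofReal (4 * ‖jet s α φ‖ ^ 2) := by
    calc ∫⁻ x, ‖fderiv ℝ u x‖ₑ ≤ ∫⁻ x, ∑ j, 2 * (‖testToL2 s φ x‖ₑ *
          ‖testToL2 s (magneticDeriv s α j φ) x‖ₑ) := by
          refine lintegral_mono_ae ?_
          filter_upwards [testToL2_ae s φ, testToL2_ae s (magneticDeriv s α 0 φ),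
            testToL2_ae s (magneticDeriv s α 1 φ)] with x h1 h2 h3
          have h4 : ‖fderiv ℝ u x‖ ≤ ∑ j, 2 * (‖testToL2 s φ x‖ *
              ‖testToL2 s (magneticDeriv s α j φ) x‖) := by
            refine (opNorm_fderiv_le u x).trans (Finset.sum_le_sum fun j _ => ?_)
            refine (norm_pd_normSq_le s α φ x j).trans (le_of_eq ?_)
            rw [h1, mul_assoc]
            fin_cases j
            · exact congrArg (fun t => 2 * (_ * ‖t‖)) h2.symm
            · exact congrArg (fun t => 2 * (_ * ‖t‖)) h3.symm
          rw [← ofReal_norm]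
          refine (ENNReal.ofReal_le_ofReal h4).trans (le_of_eq ?_)
          rw [ENNReal.ofReal_sum_of_nonneg fun _ _ => by positivity]
          refine Finset.sum_congr rfl fun j _ => ?_
          rw [ENNReal.ofReal_mul (by norm_num), ENNReal.ofReal_mul (norm_nonneg _), ofReal_norm,
            ofReal_norm]
          simp
      _ = ∑ j, 2 * ∫⁻ x, ‖testToL2 s φ x‖ₑ * ‖testToL2 s (magneticDeriv s α j φ) x‖ₑ := by
          have hm : ∀ j, AEMeasurable (fun x => 2 * (‖testToL2 s φ x‖ₑ *
              ‖testToL2 s (magneticDeriv s α j φ) x‖ₑ)) volume := fun j =>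
            ((Lp.aestronglyMeasurable _).enorm.mul (Lp.aestronglyMeasurable _).enorm).const_mul _
          rw [lintegral_finsetSum' _ fun j _ => hm j]
          refine Finset.sum_congr rfl fun j _ => lintegral_const_mul'' _ ?_
          exact (Lp.aestronglyMeasurable _).enorm.mul (Lp.aestronglyMeasurable _).enorm
      _ ≤ ∑ _j : Fin 2, 2 * ENNReal.ofReal (‖jet s α φ‖ ^ 2) := by
          refine Finset.sum_le_sum fun j _ => ?_
          gcongr
          refine (lintegral_mul_le_norm _ _).trans (ENNReal.ofReal_le_ofReal ?_)
          rw [sq]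
          exact mul_le_mul (norm_le_jet (jet s α φ) none) (norm_le_jet (jet s α φ) (some j))
            (norm_nonneg _) (norm_nonneg _)
      _ = _ := by
          rw [Fin.sum_univ_two, ← two_mul, ← mul_assoc, ENNReal.ofReal_mul (by norm_num)]
          norm_num
  have hsq : ENNReal.ofReal (‖bmul (E.indicator fun _ => 1) (testToL2 s φ)‖ ^ 2) ≤
      ∫⁻ x in E, ‖u x‖ₑ := by
    rw [← lintegral_enorm_sq, ← lintegral_indicator hE]
    refine lintegral_mono_ae ?_
    filter_upwards [bmul_ae hEm (testToL2 s φ), testToL2_ae s φ] with x h1 h2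
    rw [h1, h2]
    by_cases hx : x ∈ E
    · simp [hx, hu, enorm_mul, sq]
    · simp [hx]
  have hfinal : ENNReal.ofReal (‖bmul (E.indicator fun _ => 1) (testToL2 s φ)‖ ^ 2) ^ 2 ≤
      ENNReal.ofReal ((√K * 4 * √((volume : Measure Plane).real E) * ‖jet s α φ‖ ^ 2) ^ 2) := by
    calc _ ≤ (∫⁻ x in E, ‖u x‖ₑ) ^ 2 := by gcongr
      _ ≤ volume E * ∫⁻ x in E, ‖u x‖ₑ ^ 2 := by
          refine (sq_lintegral_le _ huc.continuous.enorm.aemeasurable).trans ?_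
          rw [Measure.restrict_apply_univ]
      _ ≤ volume E * (K * ENNReal.ofReal (4 * ‖jet s α φ‖ ^ 2) ^ 2) := by
          gcongr
          exact (setLIntegral_le_lintegral _ _).trans (hgns.trans (by gcongr))
      _ = _ := by
          rw [← ofReal_measureReal hEt, ← ENNReal.ofReal_coe_nnreal, ← ENNReal.ofReal_pow
            (by positivity), ← ENNReal.ofReal_mul (by positivity), ← ENNReal.ofReal_mul
            (by positivity)]
          congr 1
          rw [mul_pow, mul_pow, mul_pow, mul_pow,
            Real.sq_sqrt (NNReal.coe_nonneg K), Real.sq_sqrt measureReal_nonneg]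
          ring
  rw [← ENNReal.ofReal_pow (by positivity), ENNReal.ofReal_le_ofReal_iff (by positivity)] at hfinal
  exact (sq_le_sq₀ (by positivity) (by positivity)).1 hfinal

theorem isCompactOperator_of_approx {V : Type*} [NormedAddCommGroup V] [NormedSpace ℂ V]
    (B : V →L[ℂ] L2) (h : ∀ ε > 0, ∃ A : V →L[ℂ] L2, IsCompactOperator A ∧
      ∀ v, ‖B v - A v‖ ≤ ε * ‖v‖) : IsCompactOperator B := by
  have hcl : B ∈ closure {A : V →L[ℂ] L2 | IsCompactOperator A} := by
    rw [Metric.mem_closure_iff]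
    intro ε hε
    obtain ⟨A, hA, hAB⟩ := h (ε / 2) (half_pos hε)
    refine ⟨A, hA, ?_⟩
    rw [dist_eq_norm]
    refine lt_of_le_of_lt (ContinuousLinearMap.opNorm_le_bound _ (half_pos hε).le fun v => ?_)
      (half_lt_self hε)
    simpa using hAB v
  have hc : IsClosed {A : V →L[ℂ] L2 | IsCompactOperator A} :=
    isClosed_setOfPred_isCompactOperator
  rw [hc.closure_eq] at hcl
  exact hcl

/-- The form space, cut off away from the points `s i`, embeds compactly into `L²`. -/
theorem isCompactOperator_cutoff_of_disjoint {χ : Plane → ℂ} (hχ : IsCutoff χ)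
    (hs : tsupport χ ⊆ (range s)ᶜ) :
    IsCompactOperator (bmul χ ∘L comp none ∘L formProj s α) := by
  obtain ⟨M, hM0, hM⟩ : ∃ M : ℝ, 0 ≤ M ∧ ∀ x ∈ tsupport χ, ∀ j, |vectorPotential s α x j| ≤ M := by
    have hcont : ∀ j, ContinuousOn (fun x => vectorPotential s α x j) (tsupport χ) := fun j x hx =>
      (contDiffAt_vectorPotential s α (hs hx) j).continuousAt.continuousWithinAt
    obtain ⟨M0, h0⟩ := hχ.2.isCompact.exists_bound_of_continuousOn (hcont 0)
    obtain ⟨M1, h1⟩ := hχ.2.isCompact.exists_bound_of_continuousOn (hcont 1)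
    refine ⟨max 0 (max M0 M1), le_max_left _ _, fun x hx j => ?_⟩
    fin_cases j
    · exact (h0 x hx).trans ((le_max_left _ _).trans (le_max_right _ _))
    · exact (h1 x hx).trans ((le_max_right _ _).trans (le_max_right _ _))
  obtain ⟨C0, hC00, hC0⟩ := hχ.exists_bound
  obtain ⟨C1, hC10, hC1⟩ := (hχ.pd 0).exists_bound
  obtain ⟨C2, hC20, hC2⟩ := (hχ.pd 1).exists_bound
  obtain ⟨r, hr⟩ := hχ.2.isCompact.isBounded.subset_closedBall (0 : Plane)
  -- With S the sum in parentheses, both magnetic derivatives of χφ and M times χφ are bounded by S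
  -- times the jet norm. The pointwise bound by 4(a² + b² + 2c²) then integrates to 16 S² times its
  -- square, whence the factor 4.
  set G : ℝ := 4 * (C0 + C1 + C2 + M * C0) with hG
  refine isCompactOperator_of_approx _ fun ε hε => ?_
  obtain ⟨A, hA, hAb⟩ := exists_compact_approx r (ε := ε / (G + 1)) (by positivity)
  refine ⟨A ∘L (bmul χ ∘L comp none ∘L formProj s α), hA.comp_clm _, fun v => ?_⟩
  have key : ∀ w ∈ formSpace s α, ‖bmul χ (w none) - A (bmul χ (w none))‖ ≤ ε * ‖w‖ := by
    intro w hw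
    refine formSpace_induction s α (p := fun w => ‖bmul χ (w none) - A (bmul χ (w none))‖ ≤ ε * ‖w‖)
      (isClosed_le ?_ (continuous_const.mul continuous_norm)) (fun φ => ?_) hw
    · have hc := (bmul χ).continuous.comp (comp none).continuous
      exact (hc.sub (A.continuous.comp hc)).norm
    rw [jet_none, bmul_testToL2 s hχ]
    set ψ := testMul s hχ.1 φ with hψ
    have hψs : tsupport ψ.1 ⊆ tsupport χ := tsupport_mul_subset_left
    have hptw : ∀ᵐ x, ‖fderiv ℝ ψ.1 x‖ₑ ^ 2 ≤ ENNReal.ofReal 4 *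
        (‖testToL2 s (magneticDeriv s α 0 ψ) x‖ₑ ^ 2 + ‖testToL2 s (magneticDeriv s α 1 ψ) x‖ₑ ^ 2 +
        ENNReal.ofReal (2 * M ^ 2) * ‖testToL2 s ψ x‖ₑ ^ 2) := by
      filter_upwards [testToL2_ae s ψ, testToL2_ae s (magneticDeriv s α 0 ψ),
        testToL2_ae s (magneticDeriv s α 1 ψ)] with x h1 h2 h3
      have h5 : ∀ j, ‖pd j ψ.1 x‖ ≤ ‖magneticDerivFun s α j ψ.1 x‖ + M * ‖ψ.1 x‖ := by
        intro j
        rw [pd_eq_magneticDerivFun s α, norm_mul, Complex.norm_I, one_mul]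
        refine (norm_add_le _ _).trans ?_
        gcongr
        rw [norm_mul, Complex.norm_real, Real.norm_eq_abs]
        by_cases hx : x ∈ tsupport χ
        · gcongr; exact hM x hx j
        · have : ψ.1 x = 0 := image_eq_zero_of_notMem_tsupport fun h => hx (hψs h)
          rw [this]; simp
      have h4 : ‖fderiv ℝ ψ.1 x‖ ^ 2 ≤ 4 * (‖testToL2 s (magneticDeriv s α 0 ψ) x‖ ^ 2 +
          ‖testToL2 s (magneticDeriv s α 1 ψ) x‖ ^ 2 + 2 * M ^ 2 * ‖testToL2 s ψ x‖ ^ 2) := by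
        have h6 := opNorm_fderiv_le ψ.1 x
        rw [Fin.sum_univ_two] at h6
        have h2' : testToL2 s (magneticDeriv s α 0 ψ) x = magneticDerivFun s α 0 ψ.1 x := h2
        have h3' : testToL2 s (magneticDeriv s α 1 ψ) x = magneticDerivFun s α 1 ψ.1 x := h3
        rw [h2', h3', h1]
        set a := ‖magneticDerivFun s α 0 ψ.1 x‖
        set b := ‖magneticDerivFun s α 1 ψ.1 x‖
        set c := M * ‖ψ.1 x‖ with hc
        have h7 : ‖fderiv ℝ ψ.1 x‖ ≤ a + b + 2 * c := by linarith [h5 0, h5 1]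
        have h8 : ‖fderiv ℝ ψ.1 x‖ ^ 2 ≤ (a + b + 2 * c) ^ 2 := by gcongr
        have h9 : 2 * M ^ 2 * ‖ψ.1 x‖ ^ 2 = 2 * c ^ 2 := by rw [hc]; ring
        rw [h9]
        nlinarith [sq_nonneg (a - b), sq_nonneg (a - c), sq_nonneg (b - c)]
      rw [← ofReal_norm, ← ofReal_norm, ← ofReal_norm, ← ofReal_norm,
        ← ENNReal.ofReal_pow (norm_nonneg _), ← ENNReal.ofReal_pow (norm_nonneg _),
        ← ENNReal.ofReal_pow (norm_nonneg _), ← ENNReal.ofReal_pow (norm_nonneg _),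
        ← ENNReal.ofReal_mul (by positivity), ← ENNReal.ofReal_add (by positivity) (by positivity),
        ← ENNReal.ofReal_add (by positivity) (by positivity), ← ENNReal.ofReal_mul (by positivity)]
      exact ENNReal.ofReal_le_ofReal h4
    have hmeas : ∀ f : L2, AEMeasurable (fun x => ‖f x‖ₑ ^ 2) volume := fun f =>
      (Lp.aestronglyMeasurable f).enorm.pow_const 2
    have hJ : ∀ o, ‖jet s α φ o‖ ≤ ‖jet s α φ‖ := norm_le_jet _
    have hb : ‖testToL2 s ψ‖ ≤ C0 * ‖jet s α φ‖ := by
      rw [hψ, ← bmul_testToL2 s hχ]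
      exact (norm_bmul_le_mul hχ.memLp hC0 _).trans (by gcongr; exact hJ none)
    have ha : ∀ j (C : ℝ), 0 ≤ C → (∀ x, ‖pd j χ x‖ ≤ C) →
        ‖testToL2 s (magneticDeriv s α j ψ)‖ ≤ (C0 + C) * ‖jet s α φ‖ := by
      intro j C hC hCb
      rw [hψ, testToL2_magneticDeriv_testMul s α hχ, add_mul]
      refine (norm_sub_le _ _).trans (add_le_add ?_ ?_)
      · exact (norm_bmul_le_mul hχ.memLp hC0 _).trans (by gcongr; exact hJ (some j))
      · rw [norm_smul, Complex.norm_I, one_mul]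
        exact (norm_bmul_le_mul (hχ.pd j).memLp hCb _).trans (by gcongr; exact hJ none)
    have hgrad : ∫⁻ x, ‖fderiv ℝ ψ.1 x‖ₑ ^ 2 ≤ ENNReal.ofReal ((G * ‖jet s α φ‖) ^ 2) := by
      refine (lintegral_mono_ae hptw).trans ?_
      have hm2 : AEMeasurable (fun x => ‖testToL2 s (magneticDeriv s α 0 ψ) x‖ₑ ^ 2 +
          ‖testToL2 s (magneticDeriv s α 1 ψ) x‖ₑ ^ 2) volume := (hmeas _).add (hmeas _)
      have hm3 : AEMeasurable (fun x => ‖testToL2 s (magneticDeriv s α 0 ψ) x‖ₑ ^ 2 +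
          ‖testToL2 s (magneticDeriv s α 1 ψ) x‖ₑ ^ 2 +
          ENNReal.ofReal (2 * M ^ 2) * ‖testToL2 s ψ x‖ₑ ^ 2) volume :=
        hm2.add ((hmeas _).const_mul _)
      rw [lintegral_const_mul'' _ hm3, lintegral_add_left' hm2, lintegral_add_left' (hmeas _),
        lintegral_const_mul'' _ (hmeas _), lintegral_enorm_sq, lintegral_enorm_sq,
        lintegral_enorm_sq,
        ← ENNReal.ofReal_mul (by positivity), ← ENNReal.ofReal_add (by positivity) (by positivity),
        ← ENNReal.ofReal_add (by positivity) (by positivity), ← ENNReal.ofReal_mul (by positivity)]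
      refine ENNReal.ofReal_le_ofReal ?_
      set J := ‖jet s α φ‖
      set S := C0 + C1 + C2 + M * C0 with hS
      have hMC : 0 ≤ M * C0 := by positivity
      have hJ0 : 0 ≤ J := norm_nonneg _
      have b0 : ‖testToL2 s (magneticDeriv s α 0 ψ)‖ ≤ S * J :=
        (ha 0 C1 hC10 hC1).trans (by gcongr; linarith)
      have b1 : ‖testToL2 s (magneticDeriv s α 1 ψ)‖ ≤ S * J :=
        (ha 1 C2 hC20 hC2).trans (by gcongr; linarith)
      have b2 : M * ‖testToL2 s ψ‖ ≤ S * J := by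
        calc M * ‖testToL2 s ψ‖ ≤ M * (C0 * J) := by gcongr
          _ = (M * C0) * J := by ring
          _ ≤ S * J := by gcongr; linarith
      have b3 : 2 * M ^ 2 * ‖testToL2 s ψ‖ ^ 2 ≤ 2 * (S * J) ^ 2 := by
        rw [mul_assoc, ← mul_pow]; gcongr
      have b0' : ‖testToL2 s (magneticDeriv s α 0 ψ)‖ ^ 2 ≤ (S * J) ^ 2 := by gcongr
      have b1' : ‖testToL2 s (magneticDeriv s α 1 ψ)‖ ^ 2 ≤ (S * J) ^ 2 := by gcongr
      have : (G * J) ^ 2 = 4 * ((S * J) ^ 2 + (S * J) ^ 2 + 2 * (S * J) ^ 2) := by rw [hG]; ring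
      rw [this]
      gcongr
    have hout : ∀ x, r < ‖x‖ → ψ.1 x = 0 := fun x hx =>
      image_eq_zero_of_notMem_tsupport fun h => by
        have := hr (hψs h)
        rw [mem_closedBall_zero_iff] at this
        linarith
    refine (hAb ψ.1 (testToL2 s ψ) (G * ‖jet s α φ‖) (ψ.2.1.of_le (by simp)) hout
      (testToL2_ae s ψ) (by positivity) hgrad).trans ?_
    rw [← mul_assoc]
    gcongr
    rw [div_mul_eq_mul_div, div_le_iff₀ (by positivity)]
    nlinarith
  have h1 := key _ (formProj_mem s α v)
  refine h1.trans ?_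
  gcongr
  exact Submodule.norm_starProjection_apply_le _ _

/-- A smooth function that is one near the points `s i` and vanishes off a small set. -/
theorem exists_cutoff_near {ε : ℝ} (hε : 0 < ε) : ∃ (η : Plane → ℝ) (U : Set Plane),
    ContDiff ℝ ∞ η ∧ IsOpen U ∧ volume U < ENNReal.ofReal ε ∧ (∀ x, 0 ≤ η x ∧ η x ≤ 1) ∧
    (∀ x ∉ U, η x = 0) ∧ ∀ᶠ x in 𝓝ˢ (range s), η x = 1 := by
  have h0 : volume (range s) = 0 := (finite_range s).measure_zero volume
  obtain ⟨U, hU, hUo, hUε⟩ := (range s).exists_isOpen_lt_of_lt (μ := volume) (ENNReal.ofReal ε)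
    (by rw [h0]; simpa using hε)
  obtain ⟨f, h1, h2, h3⟩ := exists_contMDiffMap_zero_one_nhds_of_isClosed (n := ⊤)
    (modelWithCornersSelf ℝ Plane) hUo.isClosed_compl (finite_range s).isClosed
    (disjoint_compl_left_iff_subset.2 hU)
  refine ⟨f, U, f.contMDiff.contDiff, hUo, hUε, fun x => ?_, fun x hx => h1.self_of_nhdsSet x hx,
    h2⟩
  exact h3 x

/-- The localised form space embeds compactly into `L²`. -/
theorem isCompactOperator_cutoff {χ : Plane → ℂ} (hχ : IsCutoff χ) :
    IsCompactOperator (bmul χ ∘L comp none ∘L formProj s α) := by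
  obtain ⟨C, hC0, hC⟩ := exists_norm_indicator_le s α
  obtain ⟨D, hD0, hD⟩ := hχ.exists_bound
  refine isCompactOperator_of_approx _ fun ε hε => ?_
  obtain ⟨δ, hδ, hδε⟩ : ∃ δ : ℝ, 0 < δ ∧ D ^ 2 * (C * √δ) ≤ ε ^ 2 := by
    refine ⟨(ε ^ 2 / (D ^ 2 * C + 1)) ^ 2, by positivity, ?_⟩
    rw [Real.sqrt_sq (by positivity), ← mul_assoc, ← mul_div_assoc, div_le_iff₀ (by positivity)]
    nlinarith [sq_nonneg ε, mul_nonneg (sq_nonneg D) hC0]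
  obtain ⟨η, U, hη, hU, hUδ, hη01, hηU, hη1⟩ := exists_cutoff_near s hδ
  have hηc : ContDiff ℝ ∞ (fun x => (1 - η x : ℂ)) :=
    contDiff_const.sub (Complex.ofRealCLM.contDiff.comp hη)
  set χ' : Plane → ℂ := fun x => χ x * (1 - η x) with hχ'
  have hcut : IsCutoff χ' := hχ.mul_contDiff hηc
  have hsupp : tsupport χ' ⊆ (range s)ᶜ := by
    intro x hx hxs
    have h1 : ∀ᶠ y in 𝓝 x, η y = 1 := eventually_nhdsSet_iff_forall.1 hη1 x hxs
    refine (notMem_tsupport_iff_eventuallyEq.2 ?_) hx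
    filter_upwards [h1] with y hy
    simp [hχ', hy]
  -- The approximating operator uses the part of χ vanishing near the singular points. The discarded
  -- part χη lives on U, whose measure is below δ, and is controlled by the bound over small sets.
  refine ⟨_, isCompactOperator_cutoff_of_disjoint s α hcut hsupp, fun v => ?_⟩
  set w := formProj s α v with hw
  have hUm : MemLp (U.indicator fun _ => (1 : ℂ)) ⊤ (volume : Measure Plane) :=
    memLp_top_of_bound (measurable_const.indicator hU.measurableSet).aestronglyMeasurable 1
      (Eventually.of_forall fun x => by by_cases hx : x ∈ U <;> simp [hx])
  have h1 : ‖bmul χ (w none) - bmul χ' (w none)‖ ≤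
      D * ‖bmul (U.indicator fun _ => 1) (w none)‖ := by
    refine Lp.norm_le_mul_norm_of_ae_le_mul ?_
    filter_upwards [Lp.coeFn_sub (bmul χ (w none)) (bmul χ' (w none)), bmul_ae hχ.memLp (w none),
      bmul_ae hcut.memLp (w none), bmul_ae hUm (w none)] with x h1 h2 h3 h4
    rw [h1, Pi.sub_apply, h2, h3, h4, ← sub_mul, norm_mul, norm_mul, ← mul_assoc]
    gcongr
    have : χ x - χ' x = χ x * η x := by rw [hχ']; ring
    rw [this, norm_mul, Complex.norm_real, Real.norm_of_nonneg (hη01 x).1]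
    by_cases hx : x ∈ U
    · rw [indicator_of_mem hx, norm_one]
      exact mul_le_mul (hD x) (hη01 x).2 (hη01 x).1 hD0
    · rw [hηU x hx, indicator_of_notMem hx]; simp
  have h2 := hC U hU.measurableSet (hUδ.trans ENNReal.ofReal_lt_top).ne w (formProj_mem s α v)
  have h3 : (volume : Measure Plane).real U ≤ δ :=
    ENNReal.toReal_le_of_le_ofReal hδ.le hUδ.le
  have h4 : ‖w‖ ≤ ‖v‖ := Submodule.norm_starProjection_apply_le _ _
  change ‖bmul χ (w none) - bmul χ' (w none)‖ ≤ ε * ‖v‖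
  refine h1.trans ((sq_le_sq₀ (by positivity) (by positivity)).1 ?_)
  calc (D * ‖bmul (U.indicator fun _ => 1) (w none)‖) ^ 2
      = D ^ 2 * ‖bmul (U.indicator fun _ => 1) (w none)‖ ^ 2 := by ring
    _ ≤ D ^ 2 * (C * √δ * ‖v‖ ^ 2) := by
        gcongr
        exact h2.trans (by gcongr)
    _ = (D ^ 2 * (C * √δ)) * ‖v‖ ^ 2 := by ring
    _ ≤ ε ^ 2 * ‖v‖ ^ 2 := by gcongr
    _ = (ε * ‖v‖) ^ 2 := by ring

theorem isCompactOperator_bmul_invOne {χ : Plane → ℂ} (hχ : IsCutoff χ) :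
    IsCompactOperator (bmul χ ∘L invOne s α) :=
  (isCompactOperator_cutoff s α hχ).comp_clm (inc none)

/-- A finite net for the image of the unit ball under A, of mesh comparable to ε², pulls back to an
ε-net for its image under B. A quadratic bound therefore transfers compactness even though B is not
dominated by A linearly. -/
theorem isCompactOperator_of_norm_sq_le {A B : L2 →L[ℂ] L2} (hA : IsCompactOperator A) {C : ℝ}
    (hAB : ∀ f, ‖B f‖ ^ 2 ≤ C * ‖f‖ * ‖A f‖) : IsCompactOperator B := by
  have hC : ∀ f, ‖B f‖ ^ 2 ≤ |C| * ‖f‖ * ‖A f‖ := fun f =>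
    (hAB f).trans (by gcongr; exact le_abs_self C)
  refine (isCompactOperator_iff_isCompact_closure_image_closedBall B.toLinearMap zero_lt_one).2 ?_
  have hA' := hA.isCompact_closure_image_closedBall (f := A.toLinearMap) 1
  have htb : TotallyBounded (A '' Metric.closedBall 0 1) :=
    hA'.totallyBounded.subset subset_closure
  refine (TotallyBounded.closure ?_).isCompact_of_isClosed isClosed_closure
  rw [Metric.totallyBounded_iff]
  intro ε hε
  -- Two points of the unit ball are at distance at most 2, which explains 2|C|; the additional 1
  -- only prevents division by zero.
  have hδ : 0 < ε ^ 2 / (2 * |C| + 1) := by positivity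
  obtain ⟨t, hts, htf, htc⟩ := htb.exists_subset (Metric.dist_mem_uniformity hδ)
  choose! g hg1 hg2 using fun y (hy : y ∈ t) => hts hy
  refine ⟨(fun y => B (g y)) '' t, htf.image _, ?_⟩
  rintro _ ⟨f, hf, rfl⟩
  obtain ⟨y, hy, hfy⟩ := mem_iUnion₂.1 (htc ⟨f, hf, rfl⟩)
  refine mem_iUnion₂.2 ⟨_, ⟨y, hy, rfl⟩, ?_⟩
  have h1 : ‖A (f - g y)‖ < ε ^ 2 / (2 * |C| + 1) := by
    rw [map_sub, hg2 y hy, ← dist_eq_norm]; exact hfy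
  have h2 : ‖f - g y‖ ≤ 2 := by
    refine (norm_sub_le _ _).trans ?_
    have := mem_closedBall_zero_iff.1 hf
    have := mem_closedBall_zero_iff.1 (hg1 y hy)
    linarith
  rw [Metric.mem_ball, dist_eq_norm]
  change ‖B f - B (g y)‖ < ε
  rw [← map_sub]
  refine lt_of_pow_lt_pow_left₀ 2 hε.le ((hC _).trans_lt ?_)
  calc |C| * ‖f - g y‖ * ‖A (f - g y)‖ ≤ |C| * 2 * (ε ^ 2 / (2 * |C| + 1)) := by gcongr
    _ < ε ^ 2 := by
      rw [← mul_div_assoc, div_lt_iff₀ (by positivity)]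
      nlinarith [pow_pos hε 2]

/-- Cutoffs equal to one near a compact set and supported in a given neighbourhood of it. -/
theorem exists_cutoff {K V : Set Plane} (hK : IsCompact K) (hV : IsOpen V) (hKV : K ⊆ V) :
    ∃ θ : Plane → ℂ, IsCutoff θ ∧ (∀ x, conj (θ x) = θ x) ∧ (∀ x, ‖θ x‖ ≤ 1) ∧ tsupport θ ⊆ V ∧
      ∀ᶠ x in 𝓝ˢ K, θ x = 1 := by
  obtain ⟨K', hK', hKK', hK'V⟩ := exists_compact_between hK hV hKV
  obtain ⟨f, h1, h2, h3⟩ := exists_contMDiffMap_zero_one_nhds_of_isClosed (n := ⊤)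
    (modelWithCornersSelf ℝ Plane) isOpen_interior.isClosed_compl hK.isClosed
    (disjoint_compl_left_iff_subset.2 hKK')
  have hsub : tsupport (fun x => (f x : ℂ)) ⊆ K' := by
    refine closure_minimal (fun x hx => ?_) hK'.isClosed
    by_contra h
    exact hx (by simp [h1.self_of_nhdsSet x fun h' => h (interior_subset h')])
  refine ⟨fun x => (f x : ℂ), ⟨Complex.ofRealCLM.contDiff.comp f.contMDiff.contDiff,
    hK'.of_isClosed_subset (isClosed_tsupport _) hsub⟩, fun x => Complex.conj_ofReal _,
    fun x => ?_, hsub.trans hK'V, ?_⟩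
  · rw [Complex.norm_real, Real.norm_of_nonneg (h3 x).1]
    exact (h3 x).2
  · filter_upwards [h2] with x hx
    simp [hx]

theorem pd_eq_zero_of_eventually {θ : Plane → ℂ} {c : ℂ} {x : Plane} (h : ∀ᶠ y in 𝓝 x, θ y = c)
    (j : Fin 2) : pd j θ x = 0 := by
  have : θ =ᶠ[𝓝 x] fun _ => c := h
  rw [pd, this.fderiv_eq]
  simp

/-- Where χ lives, θ is locally constant equal to 1, so the derivative components of w and of θw
agree there. Derivatives near the support of χ can thus be estimated on a compactly supported jet.
-/
theorem bmul_pd_derivInv {χ θ : Plane → ℂ} (hχ : IsCutoff χ) (hθ : IsCutoff θ)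
    (h1 : ∀ᶠ x in 𝓝ˢ (tsupport χ), θ x = 1) (j : Fin 2) (w : Jet) :
    bmul χ (w (some j)) = bmul χ (mulJet θ w (some j)) := by
  refine bmul_eq_of_ae hχ.memLp ?_
  rw [mulJet_some]
  filter_upwards [bmul_ae hχ.memLp (bmul θ (w (some j)) - Complex.I • bmul (pd j θ) (w none)),
    Lp.coeFn_sub (bmul θ (w (some j))) (Complex.I • bmul (pd j θ) (w none)),
    Lp.coeFn_smul Complex.I (bmul (pd j θ) (w none)), bmul_ae hθ.memLp (w (some j)),
    bmul_ae (hθ.pd j).memLp (w none)] with x e1 e2 e3 e4 e5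
  rw [e1, e2, Pi.sub_apply, e3, Pi.smul_apply, e4, e5]
  by_cases hx : x ∈ tsupport χ
  · have h2 := eventually_nhdsSet_iff_forall.1 h1 x hx
    rw [h2.self_of_nhds, pd_eq_zero_of_eventually h2]
    simp
  · rw [image_eq_zero_of_notMem_tsupport hx]; simp

theorem norm_bmul_le_of_support {g h : Plane → ℂ} (hg : IsCutoff g) (hh : IsCutoff h)
    (h1 : ∀ᶠ x in 𝓝ˢ (tsupport g), h x = 1) {C : ℝ} (hC : ∀ x, ‖g x‖ ≤ C) (f : L2) :
    ‖bmul g f‖ ≤ C * ‖bmul h f‖ := by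
  refine norm_bmul_le hg.memLp hh.memLp (Eventually.of_forall fun x => ?_) f
  by_cases hx : x ∈ tsupport g
  · rw [h1.self_of_nhdsSet x hx, norm_one, mul_one]; exact hC x
  · rw [image_eq_zero_of_notMem_tsupport hx, norm_zero]
    exact mul_nonneg ((norm_nonneg _).trans (hC x)) (norm_nonneg _)

/-- The localised energy identity bounds ‖χ D_j T f‖² by ‖f‖ times ‖θ'Tf‖ for a wider cutoff θ'. The
operator θ'T is already known to be compact, and the quadratic criterion applies. -/
theorem isCompactOperator_bmul_derivInv {χ : Plane → ℂ} (hχ : IsCutoff χ) (j : Fin 2) :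
    IsCompactOperator (bmul χ ∘L derivInv s α j) := by
  obtain ⟨θ, hθ, hθr, hθ1, -, hθχ⟩ := exists_cutoff hχ.2.isCompact isOpen_univ (subset_univ _)
  obtain ⟨θ', hθ', -, hθ'1, -, hθ'θ⟩ := exists_cutoff hθ.2.isCompact isOpen_univ (subset_univ _)
  obtain ⟨D, hD0, hD⟩ := hχ.exists_bound
  obtain ⟨C0, hC00, hC0⟩ := (hθ.pd 0).exists_bound
  obtain ⟨C1, hC10, hC1⟩ := (hθ.pd 1).exists_bound
  have hpd : ∀ j, ∀ᶠ x in 𝓝ˢ (tsupport (pd j θ)), θ' x = 1 := fun j =>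
    hθ'θ.filter_mono (nhdsSet_mono (tsupport_pd j θ))
  refine isCompactOperator_of_norm_sq_le (A := bmul θ' ∘L invOne s α)
    (C := D ^ 2 * (2 + C0 ^ 2 + C1 ^ 2)) (isCompactOperator_bmul_invOne s α hθ') fun f => ?_
  change ‖bmul χ (derivInv s α j f)‖ ^ 2 ≤ _ * ‖f‖ * ‖bmul θ' (invOne s α f)‖
  set w := formProj s α (inc none f) with hw
  set N := ‖bmul θ' (invOne s α f)‖ with hN
  have hTf := norm_invOne_le s α f
  have hNf : N ≤ ‖f‖ := by
    simpa using (norm_bmul_le_mul hθ'.memLp hθ'1 (invOne s α f)).trans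
      (by rw [one_mul]; exact hTf)
  have hN0 : 0 ≤ N := norm_nonneg _
  have e0 : ‖bmul χ (derivInv s α j f)‖ ≤ D * ‖mulJet θ w (some j)‖ := by
    have : derivInv s α j f = w (some j) := rfl
    rw [this, bmul_pd_derivInv hχ hθ hθχ]
    exact norm_bmul_le_mul hχ.memLp hD _
  have e1 : ‖mulJet θ w (some j)‖ ^ 2 ≤ ∑ j, ‖mulJet θ w (some j)‖ ^ 2 :=
    Finset.single_le_sum (f := fun j => ‖mulJet θ w (some j)‖ ^ 2) (fun _ _ => sq_nonneg _)
      (Finset.mem_univ j)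
  rw [sum_norm_mulJet_sq s α hθ hθr, Fin.sum_univ_two] at e1
  have e2 : (inner ℂ (bmul θ (invOne s α f)) (bmul θ (f - invOne s α f)) : ℂ).re ≤
      N * (2 * ‖f‖) := by
    refine (Complex.re_le_norm _).trans ((norm_inner_le_norm _ _).trans ?_)
    have a1 := norm_bmul_le_of_support hθ hθ' hθ'θ hθ1 (invOne s α f)
    have a2 := norm_bmul_le_mul hθ.memLp hθ1 (f - invOne s α f)
    have a3 := norm_sub_le f (invOne s α f)
    exact mul_le_mul (by linarith) (by linarith) (norm_nonneg _) hN0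
  have e3 : ‖bmul (pd 0 θ) (invOne s α f)‖ ^ 2 ≤ C0 ^ 2 * (N * ‖f‖) := by
    have := norm_bmul_le_of_support (hθ.pd 0) hθ' (hpd 0) hC0 (invOne s α f)
    calc _ ≤ (C0 * N) ^ 2 := by gcongr
      _ = C0 ^ 2 * (N * N) := by ring
      _ ≤ _ := by gcongr
  have e4 : ‖bmul (pd 1 θ) (invOne s α f)‖ ^ 2 ≤ C1 ^ 2 * (N * ‖f‖) := by
    have := norm_bmul_le_of_support (hθ.pd 1) hθ' (hpd 1) hC1 (invOne s α f)
    calc _ ≤ (C1 * N) ^ 2 := by gcongr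
      _ = C1 ^ 2 * (N * N) := by ring
      _ ≤ _ := by gcongr
  calc ‖bmul χ (derivInv s α j f)‖ ^ 2 ≤ (D * ‖mulJet θ w (some j)‖) ^ 2 := by gcongr
    _ = D ^ 2 * ‖mulJet θ w (some j)‖ ^ 2 := by ring
    _ ≤ D ^ 2 * (N * (2 * ‖f‖) + (C0 ^ 2 * (N * ‖f‖) + C1 ^ 2 * (N * ‖f‖))) := by
        gcongr; linarith
    _ = _ := by ring

/-- The commutator term `[χ, P] (P + 1)⁻¹` is compact. -/
theorem isCompactOperator_comm {χ : Plane → ℂ} (hχ : IsCutoff χ) :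
    IsCompactOperator (comm s α χ) := by
  have h1 := (isCompactOperator_bmul_invOne s α hχ.lap).neg
  have h2 : IsCompactOperator (bmul (pd 0 χ) ∘L derivInv s α 0 + bmul (pd 1 χ) ∘L derivInv s α 1) :=
    (isCompactOperator_bmul_derivInv s α (hχ.pd 0) 0).add
      (isCompactOperator_bmul_derivInv s α (hχ.pd 1) 1)
  have h3 : comm s α χ = -(bmul (lap χ) ∘L invOne s α) - (2 * Complex.I) •
      (bmul (pd 0 χ) ∘L derivInv s α 0 + bmul (pd 1 χ) ∘L derivInv s α 1) := by
    ext1 f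
    rw [comm_apply, Fin.sum_univ_two]
    rfl
  rw [h3]
  exact h1.sub (h2.smul (2 * Complex.I))

end

section

/-! ### Meromorphic families of operators and the analytic Fredholm theorem -/

/-! ### Operator families with polar parts of finite rank. -/

section Meromorphic

variable {U V W X : Type*} [NormedAddCommGroup U] [NormedSpace ℂ U]
  [NormedAddCommGroup V] [NormedSpace ℂ V] [NormedAddCommGroup W] [NormedSpace ℂ W]
  [NormedAddCommGroup X] [NormedSpace ℂ X]

theorem analyticAt_comp {A : ℂ → V →L[ℂ] W} {B : ℂ → U →L[ℂ] V} {z : ℂ} (hA : AnalyticAt ℂ A z)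
    (hB : AnalyticAt ℂ B z) : AnalyticAt ℂ (fun w => A w ∘L B w) z :=
  ((ContinuousLinearMap.compL ℂ U V W).analyticAt_bilinear (A z, B z)).comp
    (f := fun w => (A w, B w)) (hA.prod hB)

theorem analyticAt_dslope {F : ℂ → V} {z : ℂ} (h : AnalyticAt ℂ F z) :
    AnalyticAt ℂ (dslope F z) z :=
  let ⟨_, hp⟩ := h
  ⟨_, hp.has_fpower_series_dslope_fslope⟩

/-- A bounded operator of finite rank. -/
def IsFiniteRank (B : V →L[ℂ] W) : Prop := FiniteDimensional ℂ (LinearMap.range B.toLinearMap)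

theorem isFiniteRank_zero : IsFiniteRank (0 : V →L[ℂ] W) := by
  have : LinearMap.range (0 : V →L[ℂ] W).toLinearMap = ⊥ := LinearMap.range_zero
  rw [IsFiniteRank, this]
  infer_instance

theorem IsFiniteRank.add {A B : V →L[ℂ] W} (hA : IsFiniteRank A) (hB : IsFiniteRank B) :
    IsFiniteRank (A + B) := by
  unfold IsFiniteRank at *
  exact Submodule.finiteDimensional_of_le (LinearMap.range_add_le A.toLinearMap B.toLinearMap)

theorem isFiniteRank_comp [FiniteDimensional ℂ V] (A : V →L[ℂ] W) (B : U →L[ℂ] V) :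
    IsFiniteRank (A ∘L B) := by
  unfold IsFiniteRank
  exact Submodule.finiteDimensional_of_le
    (LinearMap.range_comp_le_range B.toLinearMap A.toLinearMap)

/-- Coefficients indexed by all natural numbers and padded by zeros allow polar parts of different
lengths to be added. -/
theorem meromorphicFamilyAt_iff {F : ℂ → V →L[ℂ] W} {z₀ : ℂ} : MeromorphicFamilyAt F z₀ ↔
    ∃ (F₀ : ℂ → V →L[ℂ] W) (J : ℕ) (B : ℕ → V →L[ℂ] W), AnalyticAt ℂ F₀ z₀ ∧
    (∀ k, IsFiniteRank (B k)) ∧ (∀ k, J ≤ k → B k = 0) ∧ ∀ᶠ z in 𝓝[≠] z₀,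
      F z = F₀ z + ∑ k ∈ Finset.range J, ((z - z₀) ^ (k + 1))⁻¹ • B k := by
  constructor
  · rintro ⟨F₀, J, B, h1, h2, h3⟩
    refine ⟨F₀, J, fun k => if h : k < J then B ⟨k, h⟩ else 0, h1, fun k => ?_, fun k hk => ?_, ?_⟩
    · by_cases h : k < J
      · simp only [dif_pos h]; exact h2 _
      · simp only [dif_neg h]; exact isFiniteRank_zero
    · exact dif_neg hk.not_gt
    · filter_upwards [h3] with z hz
      rw [hz, Finset.sum_range]
      simp
  · rintro ⟨F₀, J, B, h1, h2, -, h3⟩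
    refine ⟨F₀, J, fun k => B k, h1, fun k => h2 k, ?_⟩
    filter_upwards [h3] with z hz
    rw [hz, Finset.sum_range]

theorem MeromorphicFamilyAt.congr {F G : ℂ → V →L[ℂ] W} {z : ℂ} (hF : MeromorphicFamilyAt F z)
    (h : F =ᶠ[𝓝[≠] z] G) : MeromorphicFamilyAt G z := by
  obtain ⟨F₀, J, B, h1, h2, h3⟩ := hF
  exact ⟨F₀, J, B, h1, h2, by filter_upwards [h3, h] with w e1 e2; rw [← e2, e1]⟩

theorem sum_range_eq_of_le {B : ℕ → V →L[ℂ] W} {J J' : ℕ} (hJ : J ≤ J') (hB : ∀ k, J ≤ k → B k = 0)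
    (c : ℕ → ℂ) : ∑ k ∈ Finset.range J, c k • B k = ∑ k ∈ Finset.range J', c k • B k := by
  refine Finset.sum_subset (Finset.range_mono hJ) fun k _ hk => ?_
  rw [hB k (not_lt.1 fun h => hk (Finset.mem_range.2 h)), smul_zero]

theorem MeromorphicFamilyAt.add {F G : ℂ → V →L[ℂ] W} {z : ℂ} (hF : MeromorphicFamilyAt F z)
    (hG : MeromorphicFamilyAt G z) : MeromorphicFamilyAt (fun w => F w + G w) z := by
  obtain ⟨F₀, J, B, h1, h2, h3, h4⟩ := meromorphicFamilyAt_iff.1 hF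
  obtain ⟨G₀, J', B', h1', h2', h3', h4'⟩ := meromorphicFamilyAt_iff.1 hG
  refine meromorphicFamilyAt_iff.2 ⟨fun w => F₀ w + G₀ w, max J J', fun k => B k + B' k,
    h1.add h1', fun k => (h2 k).add (h2' k), fun k hk => ?_, ?_⟩
  · change B k + B' k = 0
    rw [h3 k ((le_max_left _ _).trans hk), h3' k ((le_max_right _ _).trans hk), add_zero]
  · filter_upwards [h4, h4'] with w e e'
    rw [e, e', sum_range_eq_of_le (le_max_left J J') h3, sum_range_eq_of_le (le_max_right J J') h3']
    simp only [smul_add, Finset.sum_add_distrib]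
    abel

theorem MeromorphicFamilyAt.sum {ι : Type*} (t : Finset ι) {F : ι → ℂ → V →L[ℂ] W} {z : ℂ}
    (h : ∀ i ∈ t, MeromorphicFamilyAt (F i) z) :
    MeromorphicFamilyAt (fun w => ∑ i ∈ t, F i w) z := by
  classical
  induction t using Finset.induction_on with
  | empty => simpa using MeromorphicFamilyAt.of_analyticAt (analyticAt_const (v := (0 : V →L[ℂ] W)))
  | insert i t hi ih =>
    simp only [Finset.sum_insert hi]
    exact (h i (Finset.mem_insert_self i t)).add
      (ih fun j hj => h j (Finset.mem_insert_of_mem hj))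

theorem meromorphicFamilyAt_inv_pow_smul {B : V →L[ℂ] W} (hB : IsFiniteRank B) (k : ℕ) (z : ℂ) :
    MeromorphicFamilyAt (fun w => ((w - z) ^ (k + 1))⁻¹ • B) z := by
  refine meromorphicFamilyAt_iff.2 ⟨0, k + 1, fun i => if i = k then B else 0, analyticAt_const,
    fun i => ?_, fun i hi => if_neg (by omega), Eventually.of_forall fun w => ?_⟩
  · dsimp only
    split_ifs
    exacts [hB, isFiniteRank_zero]
  · simp

/-- All Taylor coefficients of A(w)B(w) factor through the finite-dimensional space V and so have
finite rank. The induction splits off A(z)B(z) and divides the rest by w - z, using the slopes of A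
and of B. -/
theorem meromorphicFamilyAt_of_factor [FiniteDimensional ℂ V] {z : ℂ} (k : ℕ) :
    ∀ {A : ℂ → V →L[ℂ] W} {B : ℂ → U →L[ℂ] V}, AnalyticAt ℂ A z → AnalyticAt ℂ B z →
    MeromorphicFamilyAt (fun w => ((w - z) ^ k)⁻¹ • (A w ∘L B w)) z := by
  induction k with
  | zero =>
    intro A B hA hB
    refine MeromorphicFamilyAt.of_analyticAt ?_
    simpa using analyticAt_comp hA hB
  | succ k ih =>
    intro A B hA hB
    refine MeromorphicFamilyAt.congr ((meromorphicFamilyAt_inv_pow_smul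
      (isFiniteRank_comp (A z) (B z)) k z).add ((ih (analyticAt_dslope hA) hB).add
      (ih (A := fun _ => A z) analyticAt_const (analyticAt_dslope hB)))) ?_
    filter_upwards [self_mem_nhdsWithin] with w hw
    have hw' : w - z ≠ 0 := sub_ne_zero.2 hw
    have e1 : A w = A z + (w - z) • dslope A z w := by rw [sub_smul_dslope]; abel
    have e2 : B w = B z + (w - z) • dslope B z w := by rw [sub_smul_dslope]; abel
    have e3 : A w ∘L B w = A z ∘L B z + (w - z) • (dslope A z w ∘L B w + A z ∘L dslope B z w) := by
      conv_lhs => rw [e1]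
      rw [ContinuousLinearMap.add_comp]
      conv_lhs => enter [1]; rw [e2]
      ext x
      simp only [ContinuousLinearMap.comp_add, add_apply,
        ContinuousLinearMap.comp_apply, smul_apply, map_smul, smul_add]
      abel
    have e4 : ((w - z) ^ (k + 1))⁻¹ * (w - z) = ((w - z) ^ k)⁻¹ := by
      rw [pow_succ]; field_simp
    simp only [e3, smul_add, smul_smul, e4]

/-- Each polar coefficient factors through its own finite-dimensional range, so after composition
with A and B it still gives a product through a finite-dimensional space. -/
theorem MeromorphicFamilyAt.comp_analyticAt {A : ℂ → W →L[ℂ] X} {F : ℂ → V →L[ℂ] W}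
    {B : ℂ → U →L[ℂ] V} {z : ℂ} (hA : AnalyticAt ℂ A z) (hF : MeromorphicFamilyAt F z)
    (hB : AnalyticAt ℂ B z) : MeromorphicFamilyAt (fun w => A w ∘L F w ∘L B w) z := by
  obtain ⟨F₀, J, C, h1, h2, -, h4⟩ := meromorphicFamilyAt_iff.1 hF
  refine MeromorphicFamilyAt.congr (F := fun w => A w ∘L F₀ w ∘L B w + ∑ k ∈ Finset.range J,
    ((w - z) ^ (k + 1))⁻¹ • (A w ∘L C k ∘L B w)) (MeromorphicFamilyAt.add
      (.of_analyticAt (analyticAt_comp hA (analyticAt_comp h1 hB)))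
      (MeromorphicFamilyAt.sum _ fun k _ => ?_)) ?_
  · set E := LinearMap.range (C k).toLinearMap with hE
    have : FiniteDimensional ℂ E := h2 k
    let c : V →L[ℂ] E := (C k).codRestrict E fun x => ⟨x, rfl⟩
    have := meromorphicFamilyAt_of_factor (k + 1) (analyticAt_comp hA
      (analyticAt_const (v := E.subtypeL))) (analyticAt_comp (analyticAt_const (v := c)) hB)
    exact this
  · filter_upwards [h4] with w hw
    rw [hw]
    ext x
    simp

end Meromorphic

/-! ### The analytic Fredholm theorem on a Hilbert space. -/

section Fredholm

variable {H : Type*} [NormedAddCommGroup H] [InnerProductSpace ℂ H] [CompleteSpace H]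

/-- Orthogonal projection onto the span of an ε-net of the image of the unit ball approximates K
within ε. The rank is recorded as a factorisation through ℂ^d, in preparation for determinants. -/
theorem exists_finiteRank_approx {K : H →L[ℂ] H} (hK : IsCompactOperator K) {ε : ℝ} (hε : 0 < ε) :
    ∃ (d : ℕ) (i : (Fin d → ℂ) →L[ℂ] H) (p : H →L[ℂ] (Fin d → ℂ)), ‖K - i ∘L p‖ ≤ ε := by
  have htb : TotallyBounded (K '' Metric.closedBall 0 1) :=
    (hK.isCompact_closure_image_closedBall (f := K.toLinearMap) 1).totallyBounded.subset
      subset_closure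
  obtain ⟨t, -, htf, htc⟩ := htb.exists_subset (Metric.dist_mem_uniformity hε)
  set E := Submodule.span ℂ t with hE
  have : FiniteDimensional ℂ E := FiniteDimensional.span_of_finite ℂ htf
  let b := (Module.finBasis ℂ E).equivFunL
  refine ⟨_, E.subtypeL ∘L (b.symm : (Fin (Module.finrank ℂ E) → ℂ) →L[ℂ] E), (b : E →L[ℂ] (Fin (Module.finrank ℂ E) → ℂ)) ∘L E.orthogonalProjectionOnto ∘L K,
    ContinuousLinearMap.opNorm_le_of_unit_norm hε.le fun x hx => ?_⟩
  obtain ⟨y, hy, hxy⟩ := mem_iUnion₂.1 (htc ⟨x, by simp [hx], rfl⟩)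
  have h1 : (K - (E.subtypeL ∘L (b.symm : (Fin (Module.finrank ℂ E) → ℂ) →L[ℂ] E)) ∘L (b : E →L[ℂ] (Fin (Module.finrank ℂ E) → ℂ)) ∘L
      E.orthogonalProjectionOnto ∘L K) x = K x - E.starProjection (K x) := by
    simp
  rw [h1, Submodule.starProjection_minimal]
  refine (ciInf_le ⟨0, by rintro _ ⟨_, rfl⟩; exact norm_nonneg _⟩
    (⟨y, Submodule.subset_span hy⟩ : E)).trans ?_
  rw [← dist_eq_norm]
  exact (show dist (K x) y < ε from hxy).le

theorem analyticAt_det {d : ℕ} {M : ℂ → Matrix (Fin d) (Fin d) ℂ} {z : ℂ}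
    (h : ∀ i j, AnalyticAt ℂ (fun w => M w i j) z) : AnalyticAt ℂ (fun w => (M w).det) z := by
  simp only [Matrix.det_apply']
  refine Finset.analyticAt_fun_sum _ fun σ _ => analyticAt_const.mul ?_
  exact Finset.analyticAt_fun_prod _ fun i _ => h _ _

/-- Near each point an analytic family `1 + K` is invertible exactly off the zeros of an analytic
function `D`, and its inverse is the sum of an analytic family and a finite rank family over
`D`. -/
theorem exists_local_inverse {K : ℂ → H →L[ℂ] H} {z : ℂ} (hK : AnalyticAt ℂ K z)
    (hc : IsCompactOperator (K z)) : ∃ (d : ℕ) (D : ℂ → ℂ) (b : ℂ → H →L[ℂ] H)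
      (A : ℂ → (Fin d → ℂ) →L[ℂ] H) (B : ℂ → H →L[ℂ] (Fin d → ℂ)), AnalyticAt ℂ D z ∧
      AnalyticAt ℂ b z ∧ AnalyticAt ℂ A z ∧ AnalyticAt ℂ B z ∧ ∀ᶠ w in 𝓝 z,
      (IsUnit (1 + K w) ↔ D w ≠ 0) ∧
      (D w ≠ 0 → Ring.inverse (1 + K w) = b w - (D w)⁻¹ • (A w ∘L B w)) := by
  -- Accuracy 1/2 leaves room for K(w) to vary near z while the remainder K(w) - F stays of norm
  -- less than one.
  obtain ⟨d, i, p, hip⟩ := exists_finiteRank_approx hc (ε := 1 / 2) (by norm_num)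
  set F : H →L[ℂ] H := i ∘L p with hF
  have hnear : ∀ᶠ w in 𝓝 z, ‖K w - F‖ < 1 :=
    ((hK.continuousAt.sub continuousAt_const).norm).eventually_lt continuousAt_const
      (lt_of_le_of_lt hip (by norm_num))
  have hunit : ∀ w, ‖K w - F‖ < 1 → IsUnit (1 + (K w - F)) := fun w hw => by
    have := isUnit_one_sub_of_norm_lt_one (x := -(K w - F)) (by rwa [norm_neg])
    rwa [sub_neg_eq_add] at this
  set b : ℂ → H →L[ℂ] H := fun w => Ring.inverse (1 + (K w - F)) with hb
  have hban : AnalyticAt ℂ b z := by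
    obtain ⟨u, hu⟩ := hunit z hnear.self_of_nhds
    have h1 := analyticAt_inverse (𝕜 := ℂ) u
    rw [hu] at h1
    exact h1.comp (f := fun w => 1 + (K w - F)) (analyticAt_const.add (hK.sub analyticAt_const))
  -- With F = ip and b = (1 + K - F)⁻¹, the operator 1 + K = b⁻¹ + ip is invertible exactly when the
  -- d × d matrix 1 + pbi is, and its inverse is b - b i (1 + pbi)⁻¹ p b.
  set T : ℂ → (Fin d → ℂ) →L[ℂ] (Fin d → ℂ) := fun w => 1 + p ∘L b w ∘L i with hT
  have hTan : AnalyticAt ℂ T z := analyticAt_const.add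
    (analyticAt_comp analyticAt_const (analyticAt_comp hban analyticAt_const))
  set M : ℂ → Matrix (Fin d) (Fin d) ℂ := fun w => LinearMap.toMatrix' (T w).toLinearMap with hM
  have hMan : ∀ k l, AnalyticAt ℂ (fun w => M w k l) z := fun k l => by
    have e : ∀ w, M w k l = (ContinuousLinearMap.proj (R := ℂ) (φ := fun _ : Fin d => ℂ) k)
        (ContinuousLinearMap.apply ℂ (Fin d → ℂ) (Pi.single l (1 : ℂ)) (T w)) := fun w => by
      simp [hM, LinearMap.toMatrix'_apply]
    simp only [e]
    exact (ContinuousLinearMap.analyticAt _ _).comp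
      ((ContinuousLinearMap.analyticAt _ _).comp hTan)
  set D : ℂ → ℂ := fun w => (M w).det with hD
  have hadj : ∀ k l, AnalyticAt ℂ (fun w => (M w).adjugate k l) z := fun k l => by
    simp only [Matrix.adjugate_apply]
    refine analyticAt_det fun a c => ?_
    by_cases ha : a = l
    · subst ha
      simp only [Matrix.updateRow_self]
      exact analyticAt_const
    · simp only [Matrix.updateRow_ne ha]
      exact hMan a c
  -- The adjugate replaces the inverse matrix: it stays analytic where the determinant vanishes, so
  -- the whole singularity sits in the scalar factor 1/D.
  set N : ℂ → (Fin d → ℂ) →L[ℂ] (Fin d → ℂ) := fun w =>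
    LinearMap.toContinuousLinearMap (Matrix.toLin' (M w).adjugate) with hN
  have hNan : AnalyticAt ℂ N z := by
    have e : N = fun w => ∑ k, ∑ l, (M w).adjugate k l •
        LinearMap.toContinuousLinearMap (Matrix.toLin' (Matrix.single k l (1 : ℂ))) := by
      funext w
      simp only [hN]
      conv_lhs => rw [Matrix.matrix_eq_sum_single (M w).adjugate]
      simp only [map_sum]
      refine Finset.sum_congr rfl fun k _ => Finset.sum_congr rfl fun l _ => ?_
      rw [← map_smul, ← map_smul, Matrix.smul_single, smul_eq_mul, mul_one]
    rw [e]
    exact Finset.analyticAt_fun_sum _ fun k _ => Finset.analyticAt_fun_sum _ fun l _ =>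
      (hadj k l).smul analyticAt_const
  have hTM : ∀ w v, T w v = Matrix.mulVec (M w) v := fun w v => by
    simp only [hM]
    rw [← Matrix.toLin'_apply, Matrix.toLin'_toMatrix']
    rfl
  have hTN : ∀ w v, T w (N w v) = D w • v := fun w v => by
    rw [hTM]
    simp only [hN, LinearMap.coe_toContinuousLinearMap', Matrix.toLin'_apply,
      Matrix.mulVec_mulVec, Matrix.mul_adjugate, Matrix.smul_mulVec, Matrix.one_mulVec, hD]
  have hNT : ∀ w v, N w (T w v) = D w • v := fun w v => by
    rw [hTM]
    simp only [hN, LinearMap.coe_toContinuousLinearMap', Matrix.toLin'_apply,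
      Matrix.mulVec_mulVec, Matrix.adjugate_mul, Matrix.smul_mulVec, Matrix.one_mulVec, hD]
  refine ⟨d, D, b, fun w => b w ∘L i ∘L N w, fun w => p ∘L b w, analyticAt_det hMan, hban,
    analyticAt_comp hban (analyticAt_comp analyticAt_const hNan),
    analyticAt_comp analyticAt_const hban, ?_⟩
  filter_upwards [hnear] with w hw
  have hbl : ∀ x, b w (x + (K w x - F x)) = x := fun x => by
    have := congrArg (fun A : H →L[ℂ] H => A x) (Ring.inverse_mul_cancel _ (hunit w hw))
    simpa using this
  have hbr : ∀ x, b w x + (K w (b w x) - F (b w x)) = x := fun x => by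
    have := congrArg (fun A : H →L[ℂ] H => A x) (Ring.mul_inverse_cancel _ (hunit w hw))
    simpa using this
  have hTa : ∀ v, T w v = v + p (b w (i v)) := fun v => rfl
  set Y : H →L[ℂ] H := b w - (D w)⁻¹ • ((b w ∘L i ∘L N w) ∘L (p ∘L b w)) with hY
  have hYa : ∀ x, Y x = b w x - (D w)⁻¹ • b w (i (N w (p (b w x)))) := fun x => rfl
  have hright : D w ≠ 0 → (1 + K w) * Y = 1 := fun hD0 => by
    ext x
    have e1 : ∀ y, (1 + K w) (b w y) = y + i (p (b w y)) := fun y => by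
      have := hbr y
      simp only [add_apply, one_apply_eq_self]
      have hFy : F (b w y) = i (p (b w y)) := rfl
      rw [hFy] at this
      rw [← add_sub_assoc, sub_eq_iff_eq_add] at this
      exact this
    change (1 + K w) (Y x) = x
    rw [hYa, map_sub, map_smul, e1, e1, ← map_add i, ← hTa, hTN, map_smul, smul_smul,
      inv_mul_cancel₀ hD0, one_smul]
    abel
  have hleft : D w ≠ 0 → Y * (1 + K w) = 1 := fun hD0 => by
    ext x
    have e1 : b w ((1 + K w) x) = x + b w (i (p x)) := by
      have h1 := hbl x
      have hFy : F x = i (p x) := rfl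
      have h2 : (1 + K w) x = (x + (K w x - F x)) + i (p x) := by
        rw [hFy]
        simp only [add_apply, one_apply_eq_self]
        abel
      rw [h2, map_add, h1]
    change Y ((1 + K w) x) = x
    rw [hYa, e1, map_add p, ← hTa, hNT, map_smul, map_smul, smul_smul, inv_mul_cancel₀ hD0,
      one_smul]
    abel
  refine ⟨⟨fun hu hD0 => ?_, fun hD0 => ⟨⟨_, Y, hright hD0, hleft hD0⟩, rfl⟩⟩, fun hD0 => ?_⟩
  · obtain ⟨v, hv, hMv⟩ := Matrix.exists_mulVec_eq_zero_iff.2 hD0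
    rw [← hTM, hTa] at hMv
    have h1 : (1 + K w) (b w (i v)) = 0 := by
      have := hbr (i v)
      have hFy : F (b w (i v)) = i (p (b w (i v))) := rfl
      simp only [add_apply, one_apply_eq_self]
      rw [hFy, ← add_sub_assoc, sub_eq_iff_eq_add] at this
      rw [this, ← map_add, hMv, map_zero]
    have h2 : b w (i v) = 0 := by
      have := congrArg (fun A : H →L[ℂ] H => A (b w (i v))) (Ring.inverse_mul_cancel _ hu)
      simp only [mul_apply_eq_comp, h1, map_zero, one_apply_eq_self] at this
      exact this.symm
    rw [h2, map_zero, add_zero] at hMv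
    exact hv hMv
  · exact Ring.inverse_unit (⟨_, Y, hright hD0, hleft hD0⟩ : (H →L[ℂ] H)ˣ)

/-- Locally the singular points are the zeros of an analytic function, hence either fill a
neighbourhood or are isolated. The set of points with invertibility on a punctured neighbourhood is
then open and closed, and it contains z₀; connectedness of ℂ finishes the proof. -/
theorem eventually_isUnit_one_add {K : ℂ → H →L[ℂ] H} (hK : ∀ z, AnalyticAt ℂ K z)
    (hc : ∀ z, IsCompactOperator (K z)) {z₀ : ℂ} (h0 : IsUnit (1 + K z₀)) (z : ℂ) :
    ∀ᶠ w in 𝓝[≠] z, IsUnit (1 + K w) := by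
  set S : Set ℂ := {z | ∀ᶠ w in 𝓝[≠] z, IsUnit (1 + K w)} with hS
  have hopen : IsOpen {w | IsUnit (1 + K w)} := Units.isOpen.preimage
    (continuous_const.add (continuous_iff_continuousAt.2 fun z => (hK z).continuousAt))
  have hdich : ∀ z, (∀ᶠ w in 𝓝 z, ¬ IsUnit (1 + K w)) ∨ z ∈ S := by
    intro z
    obtain ⟨d, D, b, A, B, hD, -, -, -, h⟩ := exists_local_inverse (hK z) (hc z)
    rcases hD.eventually_eq_zero_or_eventually_ne_zero with h1 | h1
    · left
      filter_upwards [h, h1] with w e1 e2 e3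
      exact e1.1.1 e3 e2
    · right
      change ∀ᶠ w in 𝓝[≠] z, _
      filter_upwards [h.filter_mono nhdsWithin_le_nhds, h1] with w e1 e2
      exact e1.1.2 e2
  have hclopen : IsClopen S := by
    constructor
    · refine isOpen_compl_iff.1 (isOpen_iff_mem_nhds.2 fun z hz => ?_)
      have h1 := (hdich z).resolve_right hz
      filter_upwards [eventually_eventually_nhds.2 h1] with w hw hwS
      have : ∀ᶠ u in 𝓝[≠] w, False := by
        filter_upwards [hw.filter_mono nhdsWithin_le_nhds, hwS] with u e1 e2
        exact e1 e2
      exact (NeBot.ne inferInstance) (by simpa using this)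
    · refine isOpen_iff_mem_nhds.2 fun z hz => ?_
      have h1 := eventually_nhdsWithin_iff.1 (eventually_eventually_nhdsWithin.2 hz)
      filter_upwards [h1] with w hw
      by_cases hwz : w = z
      · rw [hwz]; exact hz
      · have h2 := hw hwz
        rw [(isOpen_compl_singleton (x := z)).nhdsWithin_eq hwz] at h2
        exact h2.filter_mono nhdsWithin_le_nhds
  have hne : S.Nonempty := ⟨z₀, mem_nhdsWithin_of_mem_nhds (hopen.mem_nhds h0)⟩
  have := hclopen.eq_univ hne
  exact (this ▸ mem_univ z : z ∈ S)

/-- The set of singular points in the analytic Fredholm theorem. -/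
def singularSet (K : ℂ → H →L[ℂ] H) : Set ℂ := {z | ¬ IsUnit (1 + K z)}

theorem isClosed_singularSet {K : ℂ → H →L[ℂ] H} (hK : ∀ z, AnalyticAt ℂ K z) :
    IsClosed (singularSet K) :=
  isOpen_compl_iff.1 (by
    have : (singularSet K)ᶜ = {w | IsUnit (1 + K w)} := by ext; simp [singularSet]
    rw [this]
    exact Units.isOpen.preimage
      (continuous_const.add (continuous_iff_continuousAt.2 fun z => (hK z).continuousAt)))

theorem isDiscrete_singularSet {K : ℂ → H →L[ℂ] H} (hK : ∀ z, AnalyticAt ℂ K z)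
    (hc : ∀ z, IsCompactOperator (K z)) {z₀ : ℂ} (h0 : IsUnit (1 + K z₀)) :
    IsDiscrete (singularSet K) := by
  refine isDiscrete_iff_nhdsNE.2 fun z _ => ?_
  rw [← disjoint_iff, disjoint_principal_right]
  filter_upwards [eventually_isUnit_one_add hK hc h0 z] with w hw hw'
  exact hw' hw

theorem analyticAt_inverse_one_add {K : ℂ → H →L[ℂ] H} (hK : ∀ z, AnalyticAt ℂ K z) {z : ℂ}
    (hz : z ∉ singularSet K) : AnalyticAt ℂ (fun w => Ring.inverse (1 + K w)) z := by
  obtain ⟨u, hu⟩ := not_not.1 hz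
  have h1 := analyticAt_inverse (𝕜 := ℂ) u
  rw [hu] at h1
  exact h1.comp (f := fun w => 1 + K w) (analyticAt_const.add (hK z))

/-- Writing D = (w - z)^k g with g(z) ≠ 0 reduces the local formula to an analytic family plus (w -
z)^{-k} times a product through ℂ^d, whose polar part has finite rank. -/
theorem meromorphicFamilyAt_inverse_one_add {K : ℂ → H →L[ℂ] H} (hK : ∀ z, AnalyticAt ℂ K z)
    (hc : ∀ z, IsCompactOperator (K z)) {z₀ : ℂ} (h0 : IsUnit (1 + K z₀)) (z : ℂ) :
    MeromorphicFamilyAt (fun w => Ring.inverse (1 + K w)) z := by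
  obtain ⟨d, D, b, A, B, hD, hb, hA, hB, h⟩ := exists_local_inverse (hK z) (hc z)
  have hunit := eventually_isUnit_one_add hK hc h0 z
  have hD0 : ¬ ∀ᶠ w in 𝓝 z, D w = 0 := fun h1 => by
    have : ∀ᶠ u in 𝓝[≠] z, False := by
      filter_upwards [(h.and h1).filter_mono nhdsWithin_le_nhds, hunit] with u e1 e2
      exact e1.1.1.1 e2 e1.2
    exact (NeBot.ne inferInstance) (by simpa using this)
  obtain ⟨k, g, hg, hg0, hgD⟩ := hD.exists_eventuallyEq_pow_smul_nonzero_iff.2 hD0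
  have hA' : AnalyticAt ℂ (fun w => -(g w)⁻¹ • A w) z := (hg.inv hg0).neg.smul hA
  refine ((MeromorphicFamilyAt.of_analyticAt hb).add
    (meromorphicFamilyAt_of_factor k hA' hB)).congr ?_
  filter_upwards [h.filter_mono nhdsWithin_le_nhds, hgD.filter_mono nhdsWithin_le_nhds, hunit]
    with w e1 e2 e3
  rw [e1.2 (e1.1.1 e3), e2, smul_eq_mul, mul_inv, ContinuousLinearMap.smul_comp, smul_smul,
    mul_neg, neg_smul]
  exact (sub_eq_add_neg _ _).symm

end Fredholm

end

section

/-! ### Power series solutions of linear differential equations -/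

section PowerSeries

/-- The Taylor coefficients of the solution of `u'' = q u` with `u 0 = a` and `u' 0 = b`. -/
def odeCoeff (q : ℕ → ℂ) (a b : ℂ) : ℕ → ℂ
  | 0 => a
  | 1 => b
  | n + 2 => (∑ j : Fin (n + 1), q j * odeCoeff q a b (n - j)) / ((n + 1) * (n + 2))
  termination_by k => k
  decreasing_by omega

/-- Coefficients of an entire function. -/
def IsEntireCoeff (c : ℕ → ℂ) : Prop := ∀ R : ℝ, 0 < R → ∃ M, ∀ n, ‖c n‖ * R ^ n ≤ M

theorem IsEntireCoeff.deriv {c : ℕ → ℂ} (hc : IsEntireCoeff c) :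
    IsEntireCoeff fun n : ℕ => ((n : ℂ) + 1) * c (n + 1) := by
  intro R hR
  obtain ⟨M, hM⟩ := hc (2 * R) (by positivity)
  refine ⟨M / R, fun n => ?_⟩
  rw [le_div_iff₀ hR]
  refine le_trans ?_ (hM (n + 1))
  have h1 : ‖((n : ℂ) + 1)‖ ≤ 2 ^ (n + 1) := by
    have : ‖((n : ℂ) + 1)‖ = ((n + 1 : ℕ) : ℝ) := by
      rw [← Complex.norm_natCast]; push_cast; rfl
    rw [this]
    exact_mod_cast (Nat.lt_two_pow_self (n := n + 1)).le
  rw [norm_mul, mul_pow]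
  calc ‖((n : ℂ) + 1)‖ * ‖c (n + 1)‖ * R ^ n * R ≤ 2 ^ (n + 1) * ‖c (n + 1)‖ * R ^ n * R := by
        gcongr
    _ = _ := by ring

theorem IsEntireCoeff.norm_le {c : ℕ → ℂ} (hc : IsEntireCoeff c) {ρ : ℝ} (hρ : 0 < ρ) :
    ∃ M, ∀ n x, ‖x‖ ≤ ρ → ‖c n * x ^ n‖ ≤ M * (1 / 2) ^ n := by
  obtain ⟨M, hM⟩ := hc (2 * ρ) (by positivity)
  refine ⟨M, fun n x hx => ?_⟩
  have h1 := hM n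
  rw [mul_pow] at h1
  rw [norm_mul, norm_pow]
  calc ‖c n‖ * ‖x‖ ^ n ≤ ‖c n‖ * ρ ^ n := by gcongr
    _ = (‖c n‖ * (2 ^ n * ρ ^ n)) * (1 / 2) ^ n := by
      rw [one_div, inv_pow]; field_simp
    _ ≤ _ := by gcongr

theorem IsEntireCoeff.summable {c : ℕ → ℂ} (hc : IsEntireCoeff c) (x : ℂ) :
    Summable fun n => ‖c n * x ^ n‖ := by
  obtain ⟨M, hM⟩ := hc.norm_le (ρ := ‖x‖ + 1) (by positivity)
  exact Summable.of_nonneg_of_le (fun _ => norm_nonneg _) (fun n => hM n x (by linarith))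
    ((summable_geometric_of_lt_one (by norm_num) (by norm_num)).mul_left M)

theorem IsEntireCoeff.hasDerivAt {c : ℕ → ℂ} (hc : IsEntireCoeff c) (x : ℂ) :
    HasDerivAt (fun x => ∑' n, c n * x ^ n) (∑' n : ℕ, (((n : ℂ) + 1) * c (n + 1)) * x ^ n) x := by
  have hρ : 0 < ‖x‖ + 1 := by positivity
  obtain ⟨M, hM⟩ := hc.norm_le hρ
  have hu : Summable fun n => M * (1 / 2 : ℝ) ^ n :=
    (summable_geometric_of_lt_one (by norm_num) (by norm_num)).mul_left M
  have hx : x ∈ Metric.ball (0 : ℂ) (‖x‖ + 1) := by simp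
  have hle : ∀ (n : ℕ) (w : ℂ), w ∈ Metric.ball (0 : ℂ) (‖x‖ + 1) →
      ‖c n * w ^ n‖ ≤ M * (1 / 2) ^ n := fun n w hw => hM n w (by
      have : ‖w‖ < ‖x‖ + 1 := by simpa using hw
      exact this.le)
  have hd : ∀ n : ℕ, DifferentiableOn ℂ (fun w : ℂ => c n * w ^ n) (Metric.ball 0 (‖x‖ + 1)) :=
    fun n => by fun_prop
  have h1 := Complex.hasSum_deriv_of_summable_norm hu hd Metric.isOpen_ball hle hx
  have h2 := (Complex.differentiableOn_tsum_of_summable_norm hu hd Metric.isOpen_ball hle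
    ).differentiableAt (Metric.isOpen_ball.mem_nhds hx)
  have h3 : ∑' n : ℕ, (((n : ℂ) + 1) * c (n + 1)) * x ^ n =
      _root_.deriv (fun x => ∑' n, c n * x ^ n) x := by
    rw [← h1.tsum_eq, h1.summable.tsum_eq_zero_add]
    have : _root_.deriv (fun w : ℂ => c 0 * w ^ 0) x = 0 := by simp
    rw [this, zero_add]
    refine tsum_congr fun n => ?_
    have := ((hasDerivAt_pow (n + 1) x).const_mul (c (n + 1))).deriv
    rw [this]
    push_cast
    ring
  rw [h3]
  exact h2.hasDerivAt

/-- For fixed R put Q = Σ |q_j| R^j. The recursion multiplies the weighted bound by at most R²Q /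
((m + 1)(m + 2)), which is at most 1 once m ≥ R²Q; from there on the weighted coefficients cannot
exceed the sum of the first ones. -/
theorem isEntireCoeff_odeCoeff {q : ℕ → ℂ} (hq : IsEntireCoeff q) (a b : ℂ) :
    IsEntireCoeff (odeCoeff q a b) := by
  intro R hR
  set c := odeCoeff q a b with hc
  set Q := ∑' j, ‖q j * (R : ℂ) ^ j‖ with hQ
  have hQ0 : 0 ≤ Q := tsum_nonneg fun _ => norm_nonneg _
  obtain ⟨n₀, hn₀⟩ := exists_nat_ge (R ^ 2 * Q)
  set M := ∑ k ∈ Finset.range (n₀ + 2), ‖c k‖ * R ^ k with hM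
  have hM0 : 0 ≤ M := Finset.sum_nonneg fun _ _ => by positivity
  refine ⟨M, fun n => ?_⟩
  induction n using Nat.strong_induction_on with
  | _ n ih =>
  by_cases hn : n < n₀ + 2
  · exact Finset.single_le_sum (f := fun k => ‖c k‖ * R ^ k) (fun _ _ => by positivity)
      (Finset.mem_range.2 hn)
  obtain ⟨m, rfl⟩ : ∃ m, n = m + 2 := ⟨n - 2, by omega⟩
  have hm : n₀ ≤ m := by omega
  have e1 : c (m + 2) = (∑ j : Fin (m + 1), q j * c (m - j)) / ((m + 1) * (m + 2)) := by
    rw [hc, odeCoeff]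
  have e2 : ‖((m : ℂ) + 1) * (m + 2)‖ = (m + 1) * (m + 2) := by
    have : ((m : ℂ) + 1) * (m + 2) = ((((m : ℝ) + 1) * (m + 2) : ℝ) : ℂ) := by push_cast; ring
    rw [this, Complex.norm_real, Real.norm_of_nonneg (by positivity)]
  rw [e1, norm_div, e2, div_mul_eq_mul_div, div_le_iff₀ (by positivity)]
  have e3 : ‖∑ j : Fin (m + 1), q j * c (m - j)‖ * R ^ (m + 2) ≤ R ^ 2 * (Q * M) := by
    have : ‖∑ j : Fin (m + 1), q j * c (m - j)‖ * R ^ m ≤ Q * M := by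
      calc _ ≤ (∑ j : Fin (m + 1), ‖q j * c (m - j)‖) * R ^ m := by
            gcongr; exact norm_sum_le _ _
        _ = ∑ j : Fin (m + 1), ‖q j * (R : ℂ) ^ (j : ℕ)‖ * (‖c (m - j)‖ * R ^ (m - j)) := by
            rw [Finset.sum_mul]
            refine Finset.sum_congr rfl fun j _ => ?_
            have hj : (j : ℕ) + (m - j) = m := by omega
            rw [norm_mul, norm_mul, norm_pow, Complex.norm_real, Real.norm_of_nonneg hR.le]
            have hp : R ^ m = R ^ (j : ℕ) * R ^ (m - (j : ℕ)) := by rw [← pow_add, hj]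
            rw [hp]; ring
        _ ≤ ∑ j : Fin (m + 1), ‖q j * (R : ℂ) ^ (j : ℕ)‖ * M := by
            refine Finset.sum_le_sum fun j _ => ?_
            gcongr
            exact ih _ (by omega)
        _ = (∑ j ∈ Finset.range (m + 1), ‖q j * (R : ℂ) ^ j‖) * M := by
            rw [← Finset.sum_mul, Finset.sum_range]
        _ ≤ Q * M := by
            gcongr
            exact (hq.summable R).sum_le_tsum _ fun _ _ => norm_nonneg _
    calc _ = (‖∑ j : Fin (m + 1), q j * c (m - j)‖ * R ^ m) * R ^ 2 := by ring
      _ ≤ (Q * M) * R ^ 2 := by gcongr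
      _ = _ := by ring
  refine e3.trans ?_
  have hmn : (n₀ : ℝ) ≤ m := by exact_mod_cast hm
  have : R ^ 2 * Q ≤ (m + 1) * (m + 2) := by nlinarith
  nlinarith

/-- The recursion for the coefficients is the equation u'' = qu with the right side expanded as a
Cauchy product. It provides entire solutions with prescribed initial data. -/
theorem exists_entire_solution {q : ℕ → ℂ} (hq : IsEntireCoeff q) (a b : ℂ) : ∃ u : ℂ → ℂ,
    Differentiable ℂ u ∧ (∀ x, deriv (deriv u) x = (∑' n, q n * x ^ n) * u x) ∧ u 0 = a ∧
    deriv u 0 = b := by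
  set c := odeCoeff q a b with hc
  have h0 := isEntireCoeff_odeCoeff hq a b
  rw [← hc] at h0
  have h1 := h0.deriv
  have hz : ∀ c : ℕ → ℂ, ∑' n, c n * (0 : ℂ) ^ n = c 0 := fun c => by
    rw [tsum_eq_single 0 fun n hn => by simp [hn]]; simp
  have hd : deriv (fun x => ∑' n, c n * x ^ n) =
      fun x => ∑' n : ℕ, (((n : ℂ) + 1) * c (n + 1)) * x ^ n :=
    funext fun x => (h0.hasDerivAt x).deriv
  refine ⟨fun x => ∑' n, c n * x ^ n, fun x => (h0.hasDerivAt x).differentiableAt, fun x => ?_,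
    ?_, ?_⟩
  · rw [hd, (h1.hasDerivAt x).deriv,
      tsum_mul_tsum_eq_tsum_sum_range_of_summable_norm (hq.summable x) (h0.summable x)]
    refine tsum_congr fun n => ?_
    have e1 : c (n + 1 + 1) = (∑ j : Fin (n + 1), q j * c (n - j)) / ((n + 1) * (n + 2)) := by
      rw [hc, odeCoeff]
    have e2 : ((n : ℂ) + 1) ≠ 0 := by exact_mod_cast n.succ_ne_zero
    have e3 : ((n : ℂ) + 2) ≠ 0 := by exact_mod_cast (n + 1).succ_ne_zero
    rw [e1, Finset.sum_range]
    have e4 : ∑ i : Fin (n + 1), q i * x ^ (i : ℕ) * (c (n - i) * x ^ (n - (i : ℕ))) =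
        (∑ j : Fin (n + 1), q j * c (n - j)) * x ^ n := by
      rw [Finset.sum_mul]
      refine Finset.sum_congr rfl fun j _ => ?_
      have hj : (j : ℕ) + (n - j) = n := by omega
      have hp : x ^ n = x ^ (j : ℕ) * x ^ (n - (j : ℕ)) := by rw [← pow_add, hj]
      rw [hp]; ring
    rw [e4]
    push_cast
    field_simp
    ring
  · exact (hz c).trans (by rw [hc, odeCoeff])
  · rw [hd]
    change ∑' n, (fun n : ℕ => ((n : ℂ) + 1) * c (n + 1)) n * (0 : ℂ) ^ n = b
    rw [hz, hc]
    simp [odeCoeff]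

end PowerSeries

/-! ### Modified Bessel functions in the logarithmic variable -/

/-- The coefficients of the modified Bessel function of order `ν`. -/
def besCoeff (ν : ℝ) : ℕ → ℝ
  | 0 => 1
  | k + 1 => besCoeff ν k / (4 * (k + 1) * (ν + k + 1))

theorem besCoeff_pos {ν : ℝ} (hν : 0 ≤ ν) (k : ℕ) : 0 < besCoeff ν k := by
  induction k with
  | zero => simp [besCoeff]
  | succ k ih => rw [besCoeff]; positivity

theorem besCoeff_le {ν : ℝ} (hν : 0 ≤ ν) (k : ℕ) :
    besCoeff ν k ≤ (1 / (4 * (ν + 1))) ^ k / k.factorial := by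
  induction k with
  | zero => simp [besCoeff]
  | succ k ih =>
    rw [besCoeff, pow_succ, Nat.factorial_succ]
    push_cast
    calc besCoeff ν k / (4 * (k + 1) * (ν + k + 1))
        ≤ ((1 / (4 * (ν + 1))) ^ k / k.factorial) / (4 * (k + 1) * (ν + 1)) := by
          have : (0 : ℝ) ≤ k := k.cast_nonneg
          gcongr
          linarith
      _ = _ := by field_simp

/-- The summands of the modified Bessel function. -/
def besTerm (ν : ℝ) (k : ℕ) (x : ℂ) : ℂ := besCoeff ν k * Complex.exp ((ν + 2 * k) * x)

/-- A multiple of the modified Bessel function `I_ν` at `exp x`. -/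
def besI (ν : ℝ) (x : ℂ) : ℂ := ∑' k, besTerm ν k x

theorem norm_besTerm {ν : ℝ} (hν : 0 ≤ ν) (k : ℕ) (x : ℂ) :
    ‖besTerm ν k x‖ = besCoeff ν k * Real.exp ((ν + 2 * k) * x.re) := by
  rw [besTerm, norm_mul, Complex.norm_real, Real.norm_of_nonneg (besCoeff_pos hν k).le,
    Complex.norm_exp]
  congr 2
  have : ((ν : ℂ) + 2 * k) = ((ν + 2 * k : ℝ) : ℂ) := by push_cast; ring
  rw [this, Complex.re_ofReal_mul]

theorem norm_besTerm_le {ν : ℝ} (hν : 0 ≤ ν) (k : ℕ) (x : ℂ) : ‖besTerm ν k x‖ ≤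
    Real.exp (ν * x.re) * ((Real.exp (2 * x.re) / (4 * (ν + 1))) ^ k / k.factorial) := by
  rw [norm_besTerm hν]
  have e : Real.exp ((ν + 2 * k) * x.re) = Real.exp (ν * x.re) * Real.exp (2 * x.re) ^ k := by
    rw [← Real.exp_nat_mul, ← Real.exp_add]; ring_nf
  rw [e]
  calc _ ≤ (1 / (4 * (ν + 1))) ^ k / k.factorial * (Real.exp (ν * x.re) * Real.exp (2 * x.re) ^ k) :=
        by gcongr; exact besCoeff_le hν k
    _ = _ := by rw [div_pow, div_pow]; ring

/-- The series of `j`-th derivatives, for `j ≤ 2`. -/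
theorem exists_summable_besTerm {ν : ℝ} (hν : 0 ≤ ν) (j : ℕ) (R : ℝ) : ∃ u : ℕ → ℝ, Summable u ∧
    ∀ k x, x.re < R → ‖((ν : ℂ) + 2 * k) ^ j * besTerm ν k x‖ ≤ u k := by
  set A := Real.exp (2 * R) / (4 * (ν + 1)) with hA
  refine ⟨fun k => (ν + 2) ^ j * Real.exp (ν * R) * ((2 ^ j * A) ^ k / k.factorial),
    (Real.summable_pow_div_factorial _).mul_left _, fun k x hx => ?_⟩
  have e : ((ν : ℂ) + 2 * k) = ((ν + 2 * k : ℝ) : ℂ) := by push_cast; ring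
  have h2 : ν + 2 * k ≤ (ν + 2) * 2 ^ k := by
    have h3 : (k : ℝ) ≤ 2 ^ k := by exact_mod_cast (Nat.lt_two_pow_self (n := k)).le
    have h4 : (1 : ℝ) ≤ 2 ^ k := one_le_pow₀ (by norm_num)
    nlinarith
  rw [norm_mul, norm_pow, e, Complex.norm_real, Real.norm_of_nonneg (by positivity)]
  calc (ν + 2 * k) ^ j * ‖besTerm ν k x‖
      ≤ ((ν + 2) * 2 ^ k) ^ j * (Real.exp (ν * R) * (A ^ k / k.factorial)) := by
        gcongr
        refine (norm_besTerm_le hν k x).trans ?_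
        rw [hA]
        gcongr
    _ = _ := by
        simp only [mul_pow, ← pow_mul, mul_comm k j]; ring

theorem hasDerivAt_tsum_besTerm {ν : ℝ} (hν : 0 ≤ ν) (j : ℕ) (x : ℂ) :
    HasDerivAt (fun x => ∑' k : ℕ, ((ν : ℂ) + 2 * k) ^ j * besTerm ν k x)
      (∑' k : ℕ, ((ν : ℂ) + 2 * k) ^ (j + 1) * besTerm ν k x) x := by
  obtain ⟨u, hu, hb⟩ := exists_summable_besTerm hν j (x.re + 1)
  have ho : IsOpen {w : ℂ | w.re < x.re + 1} := isOpen_lt Complex.continuous_re continuous_const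
  have hx : x ∈ {w : ℂ | w.re < x.re + 1} := by simp
  have hd1 : ∀ (k : ℕ) (w : ℂ), HasDerivAt (fun w => ((ν : ℂ) + 2 * k) ^ j * besTerm ν k w)
      (((ν : ℂ) + 2 * k) ^ (j + 1) * besTerm ν k w) w := fun k w => by
    have h := ((((hasDerivAt_id w).const_mul ((ν : ℂ) + 2 * k)).cexp).const_mul
      (besCoeff ν k : ℂ)).const_mul (((ν : ℂ) + 2 * k) ^ j)
    refine h.congr_deriv ?_
    simp only [besTerm, id, mul_one, pow_succ]
    ring
  have hd : ∀ k : ℕ, DifferentiableOn ℂ (fun w => ((ν : ℂ) + 2 * k) ^ j * besTerm ν k w)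
      {w : ℂ | w.re < x.re + 1} := fun k w _ => (hd1 k w).differentiableAt.differentiableWithinAt
  have h1 := Complex.hasSum_deriv_of_summable_norm hu hd ho hb hx
  have h2 := (Complex.differentiableOn_tsum_of_summable_norm hu hd ho hb
    ).differentiableAt (ho.mem_nhds hx)
  have h3 : ∑' k : ℕ, ((ν : ℂ) + 2 * k) ^ (j + 1) * besTerm ν k x =
      deriv (fun x => ∑' k : ℕ, ((ν : ℂ) + 2 * k) ^ j * besTerm ν k x) x := by
    rw [← h1.tsum_eq]
    exact tsum_congr fun k => ((hd1 k x).deriv).symm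
  rw [h3]
  exact h2.hasDerivAt

theorem summable_besTerm {ν : ℝ} (hν : 0 ≤ ν) (j : ℕ) (x : ℂ) :
    Summable fun k : ℕ => ((ν : ℂ) + 2 * k) ^ j * besTerm ν k x := by
  obtain ⟨u, hu, hb⟩ := exists_summable_besTerm hν j (x.re + 1)
  exact Summable.of_norm_bounded hu fun k => hb k x (by linarith)

theorem hasDerivAt_besI {ν : ℝ} (hν : 0 ≤ ν) (x : ℂ) :
    HasDerivAt (besI ν) (∑' k : ℕ, ((ν : ℂ) + 2 * k) * besTerm ν k x) x := by
  have := hasDerivAt_tsum_besTerm hν 0 x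
  simp only [pow_zero, one_mul, zero_add, pow_one] at this
  exact this

theorem deriv_besI {ν : ℝ} (hν : 0 ≤ ν) :
    deriv (besI ν) = fun x => ∑' k : ℕ, ((ν : ℂ) + 2 * k) * besTerm ν k x :=
  funext fun x => (hasDerivAt_besI hν x).deriv

/-- Termwise differentiation multiplies by (ν + 2k)². The coefficient recursion says that (ν + 2k +
2)² - ν² times the (k+1)-st term is e^{2x} times the k-th. -/
theorem besI_ode {ν : ℝ} (hν : 0 ≤ ν) (x : ℂ) : HasDerivAt (deriv (besI ν))
    (((ν : ℂ) ^ 2 + Complex.exp (2 * x)) * besI ν x) x := by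
  rw [deriv_besI hν]
  have h := hasDerivAt_tsum_besTerm hν 1 x
  simp only [pow_one, one_add_one_eq_two] at h
  refine h.congr_deriv ?_
  have h0 : Summable fun k => besTerm ν k x := by simpa using summable_besTerm hν 0 x
  have h2 := summable_besTerm hν 2 x
  have key : ∀ k : ℕ, ((ν : ℂ) + 2 * (k + 1 : ℕ)) ^ 2 * besTerm ν (k + 1) x =
      (ν : ℂ) ^ 2 * besTerm ν (k + 1) x + Complex.exp (2 * x) * besTerm ν k x := fun k => by
    have e1 : (besCoeff ν k : ℂ) = (4 * (k + 1) * (ν + k + 1)) * besCoeff ν (k + 1) := by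
      have : besCoeff ν k = (4 * (k + 1) * (ν + k + 1)) * besCoeff ν (k + 1) := by
        rw [besCoeff]; field_simp
      rw [this]; push_cast; ring
    simp only [besTerm]
    rw [e1]
    have e2 : Complex.exp (2 * x) * ((4 * (k + 1) * (ν + k + 1)) * besCoeff ν (k + 1) *
        Complex.exp ((ν + 2 * k) * x)) = (4 * (k + 1) * (ν + k + 1)) * besCoeff ν (k + 1) *
        Complex.exp ((ν + 2 * (k + 1 : ℕ)) * x) := by
      have : Complex.exp ((ν + 2 * (k + 1 : ℕ)) * x) =
          Complex.exp (2 * x) * Complex.exp ((ν + 2 * k) * x) := by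
        rw [← Complex.exp_add]; push_cast; ring_nf
      rw [this]; ring
    rw [e2]
    push_cast
    ring
  rw [h2.tsum_eq_zero_add, tsum_congr key, Summable.tsum_add
    (((summable_nat_add_iff 1).2 h0).mul_left _) (h0.mul_left _), tsum_mul_left, tsum_mul_left,
    besI, add_mul, ← add_assoc]
  congr 1
  rw [h0.tsum_eq_zero_add, mul_add]
  simp

/-- All terms beyond e^{νx} are dominated by an exponential series in e^{2 Re x} / (4(ν + 1)), which
is small for large order. Hence the leading exponential controls the function uniformly. -/
theorem norm_besI_sub_le {ν : ℝ} (hν : 0 ≤ ν) (x : ℂ) : ‖besI ν x - Complex.exp (ν * x)‖ ≤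
    Real.exp (ν * x.re) * (Real.exp (Real.exp (2 * x.re) / (4 * (ν + 1))) - 1) := by
  have h0 : Summable fun k => besTerm ν k x := by simpa using summable_besTerm hν 0 x
  set A := Real.exp (2 * x.re) / (4 * (ν + 1)) with hA
  have hs := Real.summable_pow_div_factorial A
  have e1 : besI ν x - Complex.exp (ν * x) = ∑' k, besTerm ν (k + 1) x := by
    rw [besI, h0.tsum_eq_zero_add]
    simp [besTerm, besCoeff]
  have e2 : Real.exp A - 1 = ∑' k : ℕ, A ^ (k + 1) / (k + 1).factorial := by
    rw [Real.exp_eq_exp_ℝ, NormedSpace.exp_eq_tsum_div]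
    change ∑' n : ℕ, A ^ n / (n.factorial : ℝ) - 1 = _
    rw [hs.tsum_eq_zero_add]
    simp
  rw [e1, e2, ← tsum_mul_left]
  exact tsum_of_norm_bounded (((summable_nat_add_iff 1).2 hs).mul_left _).hasSum
    fun k => norm_besTerm_le hν _ x

/-! #### Behaviour on the real axis -/

section RealAxis

variable {ν : ℝ}

theorem besI_ofReal_im (hν : 0 ≤ ν) (x : ℝ) : (besI ν x).im = 0 := by
  have h0 : Summable fun k => besTerm ν k x := by simpa using summable_besTerm hν 0 x
  rw [besI, Complex.im_tsum h0]
  refine (tsum_congr fun k => ?_).trans tsum_zero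
  have : besTerm ν k x = ((besCoeff ν k * Real.exp ((ν + 2 * k) * x) : ℝ) : ℂ) := by
    simp [besTerm]
  rw [this, Complex.ofReal_im]

theorem besTerm_re (ν : ℝ) (k : ℕ) (x : ℝ) :
    (besTerm ν k x).re = besCoeff ν k * Real.exp ((ν + 2 * k) * x) := by
  have : besTerm ν k x = ((besCoeff ν k * Real.exp ((ν + 2 * k) * x) : ℝ) : ℂ) := by
    simp [besTerm]
  rw [this, Complex.ofReal_re]

/-- The restriction of `besI` to the real axis. -/
def besIR (ν x : ℝ) : ℝ := (besI ν x).re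

theorem besI_ofReal (hν : 0 ≤ ν) (x : ℝ) : besI ν x = besIR ν x :=
  Complex.ext (by simp [besIR]) (by simp [besI_ofReal_im hν])

theorem hasSum_besIR (hν : 0 ≤ ν) (x : ℝ) :
    HasSum (fun k : ℕ => besCoeff ν k * Real.exp ((ν + 2 * k) * x)) (besIR ν x) := by
  have h0 : Summable fun k => besTerm ν k x := by simpa using summable_besTerm hν 0 x
  have := Complex.hasSum_re h0.hasSum
  simp only [besTerm_re] at this
  exact this

theorem le_besIR (hν : 0 ≤ ν) (k : ℕ) (x : ℝ) :
    besCoeff ν k * Real.exp ((ν + 2 * k) * x) ≤ besIR ν x :=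
  le_hasSum (hasSum_besIR hν x) k fun j _ => mul_nonneg (besCoeff_pos hν j).le (Real.exp_pos _).le

theorem besIR_pos (hν : 0 ≤ ν) (x : ℝ) : 0 < besIR ν x :=
  lt_of_lt_of_le (mul_pos (besCoeff_pos hν 0) (Real.exp_pos _)) (le_besIR hν 0 x)

theorem besIR_le (hν : 0 ≤ ν) {x y : ℝ} (hxy : x ≤ y) :
    besIR ν x ≤ Real.exp (ν * (x - y)) * besIR ν y := by
  refine hasSum_le (fun k => ?_) (hasSum_besIR hν x) ((hasSum_besIR hν y).mul_left _)
  rw [mul_left_comm, ← Real.exp_add]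
  refine mul_le_mul_of_nonneg_left (Real.exp_le_exp.2 ?_) (besCoeff_pos hν k).le
  have : (0 : ℝ) ≤ k := k.cast_nonneg
  nlinarith

/-- The derivative of `besI` on the real axis. -/
def besIR' (ν x : ℝ) : ℝ := (deriv (besI ν) x).re

theorem hasDerivAt_besIR (hν : 0 ≤ ν) (x : ℝ) : HasDerivAt (besIR ν) (besIR' ν x) x :=
  (hasDerivAt_besI hν x).differentiableAt.hasDerivAt.real_of_complex

theorem hasDerivAt_besIR' (hν : 0 ≤ ν) (x : ℝ) : HasDerivAt (besIR' ν)
    ((ν ^ 2 + Real.exp (2 * x)) * besIR ν x) x := by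
  refine (besI_ode hν x).real_of_complex.congr_deriv ?_
  rw [besI_ofReal hν]
  have : ((ν : ℂ) ^ 2 + Complex.exp (2 * x)) * besIR ν x =
      (((ν ^ 2 + Real.exp (2 * x)) * besIR ν x : ℝ) : ℂ) := by push_cast; ring
  rw [this, Complex.ofReal_re]

theorem besIR'_nonneg (hν : 0 ≤ ν) (x : ℝ) : 0 ≤ besIR' ν x := by
  have h1 : Summable fun k : ℕ => ((ν : ℂ) + 2 * k) * besTerm ν k x := by
    simpa using summable_besTerm hν 1 x
  have h2 : besIR' ν x = (∑' k : ℕ, ((ν : ℂ) + 2 * k) * besTerm ν k x).re := by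
    rw [besIR', deriv_besI hν]
  rw [h2, Complex.re_tsum h1]
  refine tsum_nonneg fun k => ?_
  have : ((ν : ℂ) + 2 * k) = ((ν + 2 * k : ℝ) : ℂ) := by push_cast; ring
  rw [this, Complex.re_ofReal_mul, besTerm_re]
  have := (besCoeff_pos hν k).le
  positivity

/-- A Sturm comparison: to the right of x the potential is at least its value k² at x, and the
derivative at x is nonnegative. The Wronskian with cosh(k(t - x)) therefore stays nonnegative and
the quotient is increasing. -/
theorem besIR_ge_cosh (hν : 0 ≤ ν) {x y : ℝ} (hxy : x ≤ y) :
    besIR ν x * Real.cosh (√(ν ^ 2 + Real.exp (2 * x)) * (y - x)) ≤ besIR ν y := by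
  set k := √(ν ^ 2 + Real.exp (2 * x)) with hk
  have hk2 : k ^ 2 = ν ^ 2 + Real.exp (2 * x) := Real.sq_sqrt (by positivity)
  have hk0 : 0 ≤ k := Real.sqrt_nonneg _
  have hlin : ∀ t, HasDerivAt (fun t => k * (t - x)) k t := fun t => by
    simpa using ((hasDerivAt_id t).sub_const x).const_mul k
  have hcosh : ∀ t, HasDerivAt (fun t => Real.cosh (k * (t - x))) (Real.sinh (k * (t - x)) * k) t :=
    fun t => (hlin t).cosh
  have hsinh : ∀ t, HasDerivAt (fun t => Real.sinh (k * (t - x))) (Real.cosh (k * (t - x)) * k) t :=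
    fun t => (hlin t).sinh
  set W : ℝ → ℝ := fun t => besIR' ν t * Real.cosh (k * (t - x)) -
    besIR ν t * (k * Real.sinh (k * (t - x))) with hW
  have hWd : ∀ t, HasDerivAt W ((ν ^ 2 + Real.exp (2 * t) - k ^ 2) * besIR ν t *
      Real.cosh (k * (t - x))) t := fun t => by
    refine (((hasDerivAt_besIR' hν t).mul (hcosh t)).sub
      ((hasDerivAt_besIR hν t).mul ((hsinh t).const_mul k))).congr_deriv ?_
    ring
  have hWmono : MonotoneOn W (Ici x) := by
    refine monotoneOn_of_hasDerivWithinAt_nonneg (convex_Ici x)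
      (fun t _ => (hWd t).continuousAt.continuousWithinAt)
      (fun t _ => (hWd t).hasDerivWithinAt) fun t ht => ?_
    rw [interior_Ici] at ht
    have h1 : Real.exp (2 * x) ≤ Real.exp (2 * t) := Real.exp_le_exp.2 (by
      have : x < t := ht
      linarith)
    have h2 := (besIR_pos hν t).le
    have h3 := (Real.cosh_pos (k * (t - x))).le
    have h4 : 0 ≤ ν ^ 2 + Real.exp (2 * t) - k ^ 2 := by rw [hk2]; linarith
    positivity
  have hW0 : ∀ t, x ≤ t → 0 ≤ W t := fun t ht => by
    have h1 := hWmono (mem_Ici.2 le_rfl) ht ht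
    refine le_trans ?_ h1
    simp only [hW, sub_self, mul_zero, Real.cosh_zero, Real.sinh_zero, mul_one, sub_zero]
    exact besIR'_nonneg hν x
  have hq : MonotoneOn (fun t => besIR ν t / Real.cosh (k * (t - x))) (Ici x) := by
    have hd : ∀ t, HasDerivAt (fun t => besIR ν t / Real.cosh (k * (t - x)))
        (W t / Real.cosh (k * (t - x)) ^ 2) t := fun t => by
      refine ((hasDerivAt_besIR hν t).div (hcosh t) (Real.cosh_pos _).ne').congr_deriv ?_
      simp only [hW]
      ring
    refine monotoneOn_of_hasDerivWithinAt_nonneg (convex_Ici x)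
      (fun t _ => (hd t).continuousAt.continuousWithinAt)
      (fun t _ => (hd t).hasDerivWithinAt) fun t ht => ?_
    rw [interior_Ici] at ht
    exact div_nonneg (hW0 t (le_of_lt ht)) (sq_nonneg _)
  have h1 := hq (mem_Ici.2 le_rfl) hxy hxy
  simp only [sub_self, mul_zero, Real.cosh_zero, div_one] at h1
  rwa [le_div_iff₀ (Real.cosh_pos _)] at h1

theorem isEntireCoeff_potential (ν : ℝ) :
    IsEntireCoeff fun j => (if j = 0 then (ν : ℂ) ^ 2 else 0) + 2 ^ j / (j.factorial : ℂ) := by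
  intro R hR
  refine ⟨ν ^ 2 + Real.exp (2 * R), fun j => ?_⟩
  have h1 : ‖(2 : ℂ) ^ j / (j.factorial : ℂ)‖ * R ^ j ≤ Real.exp (2 * R) := by
    rw [norm_div, norm_pow, Complex.norm_natCast, Complex.norm_ofNat, div_mul_eq_mul_div, ← mul_pow]
    exact Real.pow_div_factorial_le_exp _ (by positivity) j
  have h2 : ‖(if j = 0 then (ν : ℂ) ^ 2 else 0)‖ * R ^ j ≤ ν ^ 2 := by
    split_ifs with h
    · subst h; simp
    · simp [sq_nonneg]
  calc _ ≤ (‖(if j = 0 then (ν : ℂ) ^ 2 else 0)‖ + ‖(2 : ℂ) ^ j / (j.factorial : ℂ)‖) * R ^ j := by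
        gcongr; exact norm_add_le _ _
    _ ≤ _ := by rw [add_mul]; exact add_le_add h2 h1

theorem tsum_potential (ν : ℝ) (x : ℂ) :
    ∑' j : ℕ, ((if j = 0 then (ν : ℂ) ^ 2 else 0) + 2 ^ j / (j.factorial : ℂ)) * x ^ j =
      (ν : ℂ) ^ 2 + Complex.exp (2 * x) := by
  have h1 : HasSum (fun j : ℕ => (if j = 0 then (ν : ℂ) ^ 2 else 0)) ((ν : ℂ) ^ 2) :=
    hasSum_ite_eq 0 _
  have h2 : HasSum (fun j : ℕ => (2 * x) ^ j / (j.factorial : ℂ)) (Complex.exp (2 * x)) := by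
    rw [Complex.exp_eq_exp_ℂ]
    exact NormedSpace.expSeries_div_hasSum_exp _
  rw [← (h1.add h2).tsum_eq]
  refine tsum_congr fun j => ?_
  rw [mul_pow]
  split_ifs with h
  · subst h; simp
  · ring

theorem wronskian_const {u v Q : ℂ → ℂ} (hu : Differentiable ℂ u) (hv : Differentiable ℂ v)
    (hu2 : ∀ x, HasDerivAt (deriv u) (Q x * u x) x) (hv2 : ∀ x, HasDerivAt (deriv v) (Q x * v x) x)
    (x y : ℂ) : u x * deriv v x - deriv u x * v x = u y * deriv v y - deriv u y * v y := by
  have hd : ∀ x, HasDerivAt (fun x => u x * deriv v x - deriv u x * v x) 0 x := fun x => by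
    refine (((hu x).hasDerivAt.mul (hv2 x)).sub ((hu2 x).mul (hv x).hasDerivAt)).congr_deriv ?_
    ring
  exact is_const_of_deriv_eq_zero (fun x => (hd x).differentiableAt) (fun x => (hd x).deriv) x y

/-- For a second solution K₀ the quotient K₀/I has derivative -1/I², so on the real axis it
decreases to a limit ℓ and K₀ - ℓI is the recessive solution. Integrating 1/I² with the lower bound
by cosh gives the estimate of IK. Starting from an entire K₀ keeps the result entire. -/
theorem exists_besK (hν : 0 ≤ ν) : ∃ K : ℂ → ℂ, Differentiable ℂ K ∧
    (∀ x, HasDerivAt (deriv K) (((ν : ℂ) ^ 2 + Complex.exp (2 * x)) * K x) x) ∧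
    (∀ x, besI ν x * deriv K x - deriv (besI ν) x * K x = -1) ∧
    ∀ x : ℝ, ‖besI ν x‖ * ‖K x‖ ≤ 1 / √(ν ^ 2 + Real.exp (2 * x)) := by
  have hI : Differentiable ℂ (besI ν) := fun x => (hasDerivAt_besI hν x).differentiableAt
  have hIne : ∀ x : ℝ, besI ν x ≠ 0 := fun x => by
    rw [besI_ofReal hν]; exact_mod_cast (besIR_pos hν x).ne'
  -- These initial values normalise the Wronskian I K₀' - I' K₀ to -1 at 0, hence everywhere.
  obtain ⟨K₀, hK, hK2', hK0, hK1⟩ := exists_entire_solution (isEntireCoeff_potential ν) 0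
    (-1 / besI ν (0 : ℝ))
  have hK2 : ∀ x, HasDerivAt (deriv K₀) (((ν : ℂ) ^ 2 + Complex.exp (2 * x)) * K₀ x) x := fun x => by
    rw [← tsum_potential, ← hK2']
    exact (hK.deriv x).hasDerivAt
  have hW : ∀ x, besI ν x * deriv K₀ x - deriv (besI ν) x * K₀ x = -1 := fun x => by
    rw [wronskian_const hI hK (besI_ode hν) hK2 x 0, hK0, hK1]
    have := hIne 0
    rw [Complex.ofReal_zero] at this ⊢
    field_simp
    simp
  set r : ℝ → ℝ := fun t => (K₀ t / besI ν t).re with hr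
  have hquot : ∀ t : ℝ, HasDerivAt (fun z => K₀ z / besI ν z)
      (((-(1 / besIR ν t ^ 2) : ℝ) : ℂ)) (t : ℂ) := fun t => by
    refine ((hK t).hasDerivAt.div (hI t).hasDerivAt (hIne t)).congr_deriv ?_
    have : deriv K₀ t * besI ν t - K₀ t * deriv (besI ν) t = -1 := by rw [← hW t]; ring
    rw [this, besI_ofReal hν]
    push_cast
    ring
  have hrd : ∀ t, HasDerivAt r (-(1 / besIR ν t ^ 2)) t := fun t => by
    have := (hquot t).real_of_complex
    rwa [Complex.ofReal_re] at this
  have him : ∀ t : ℝ, (K₀ t / besI ν t).im = 0 := by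
    have hd : ∀ t : ℝ, HasDerivAt (fun t : ℝ => (K₀ t / besI ν t).im) 0 t := fun t => by
      have h1 := (hquot t).comp_ofReal
      have h2 := Complex.imCLM.hasFDerivAt.comp_hasDerivAt t h1
      refine h2.congr_deriv ?_
      rw [Complex.imCLM_apply, Complex.ofReal_im]
    intro t
    have h3 := is_const_of_deriv_eq_zero (fun x => (hd x).differentiableAt) (fun x => (hd x).deriv)
      t 0
    rw [h3, Complex.ofReal_zero, hK0]
    simp
  have hanti : Antitone r := antitone_of_hasDerivAt_nonpos hrd fun t => by
    exact neg_nonpos.2 (one_div_nonneg.2 (sq_nonneg _))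
  -- On [x, ∞) the integrand 1/I² is at most 1/(I(x) cosh(k(t - x)))², with primitive tanh(k(t - x))
  -- / (k I(x)²), and tanh ≤ 1.
  have hbound : ∀ x y, x ≤ y → r x - r y ≤ 1 / (√(ν ^ 2 + Real.exp (2 * x)) * besIR ν x ^ 2) := by
    intro x y hxy
    set k := √(ν ^ 2 + Real.exp (2 * x)) with hk
    have hk0 : 0 < k := Real.sqrt_pos.2 (by positivity)
    have hp := besIR_pos hν x
    have hlin : ∀ t, HasDerivAt (fun t => k * (t - x)) k t := fun t => by
      simpa using ((hasDerivAt_id t).sub_const x).const_mul k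
    set F : ℝ → ℝ := fun t => 1 / (k * besIR ν x ^ 2) *
      (Real.sinh (k * (t - x)) / Real.cosh (k * (t - x))) + r t with hF
    have hFd : ∀ t, HasDerivAt F (1 / (besIR ν x * Real.cosh (k * (t - x))) ^ 2 -
        1 / besIR ν t ^ 2) t := fun t => by
      have hc := (Real.cosh_pos (k * (t - x))).ne'
      refine ((((hlin t).sinh.div (hlin t).cosh hc).const_mul _).add (hrd t)).congr_deriv ?_
      have h1 : Real.cosh (k * (t - x)) * k * Real.cosh (k * (t - x)) -
          Real.sinh (k * (t - x)) * (Real.sinh (k * (t - x)) * k) = k := by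
        have := Real.cosh_sq_sub_sinh_sq (k * (t - x))
        linear_combination k * this
      rw [h1, ← sub_eq_add_neg]
      congr 1
      field_simp
    have hmono : MonotoneOn F (Ici x) := by
      refine monotoneOn_of_hasDerivWithinAt_nonneg (convex_Ici x)
        (fun t _ => (hFd t).continuousAt.continuousWithinAt)
        (fun t _ => (hFd t).hasDerivWithinAt) fun t ht => ?_
      rw [interior_Ici] at ht
      have h1 := besIR_ge_cosh hν (le_of_lt ht : x ≤ t)
      rw [← hk] at h1
      have h2 := mul_pos hp (Real.cosh_pos (k * (t - x)))
      rw [sub_nonneg]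
      gcongr
    have h1 := hmono (mem_Ici.2 le_rfl) hxy hxy
    simp only [hF, sub_self, mul_zero, Real.sinh_zero, zero_div, zero_add] at h1
    have h2 : Real.sinh (k * (y - x)) / Real.cosh (k * (y - x)) ≤ 1 :=
      (div_le_one (Real.cosh_pos _)).2 (Real.sinh_lt_cosh _).le
    have h3 : 1 / (k * besIR ν x ^ 2) * (Real.sinh (k * (y - x)) / Real.cosh (k * (y - x))) ≤
        1 / (k * besIR ν x ^ 2) := mul_le_of_le_one_right (by positivity) h2
    linarith
  have hbdd : BddBelow (range r) := by
    refine ⟨r 0 - 1 / (√(ν ^ 2 + Real.exp (2 * 0)) * besIR ν 0 ^ 2), ?_⟩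
    rintro _ ⟨y, rfl⟩
    rcases le_total 0 y with h | h
    · have := hbound 0 y h; linarith
    · have h1 := hanti h
      have h2 : 0 ≤ 1 / (√(ν ^ 2 + Real.exp (2 * 0)) * besIR ν 0 ^ 2) := by positivity
      linarith
  set ℓ := ⨅ t, r t with hℓ
  have hlim := tendsto_atTop_ciInf hanti hbdd
  refine ⟨fun x => K₀ x - ℓ * besI ν x, hK.sub (hI.const_mul _), ?_, ?_, fun x => ?_⟩
  · have hd : deriv (fun x => K₀ x - ℓ * besI ν x) =
        fun x => deriv K₀ x - ℓ * deriv (besI ν) x := funext fun x =>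
      ((hK x).hasDerivAt.sub ((hI x).hasDerivAt.const_mul _)).deriv
    intro x
    rw [hd]
    refine ((hK2 x).sub ((besI_ode hν x).const_mul _)).congr_deriv ?_
    ring
  · intro x
    have hd : deriv (fun x => K₀ x - ℓ * besI ν x) x = deriv K₀ x - ℓ * deriv (besI ν) x :=
      ((hK x).hasDerivAt.sub ((hI x).hasDerivAt.const_mul _)).deriv
    rw [hd, ← hW x]
    ring
  · have hp := besIR_pos hν x
    have e1 : K₀ x - ℓ * besI ν x = ((besIR ν x * (r x - ℓ) : ℝ) : ℂ) := by
      have : K₀ x / besI ν x = (r x : ℂ) := Complex.ext (by simp [hr]) (by simp [him])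
      rw [div_eq_iff (hIne x)] at this
      rw [this, besI_ofReal hν]
      push_cast
      ring
    have h1 : ℓ ≤ r x := ciInf_le hbdd x
    have h2 : r x - ℓ ≤ 1 / (√(ν ^ 2 + Real.exp (2 * x)) * besIR ν x ^ 2) := by
      have : Tendsto (fun y => r x - r y) atTop (𝓝 (r x - ℓ)) := tendsto_const_nhds.sub hlim
      exact le_of_tendsto this (eventually_atTop.2 ⟨x, fun y hy => hbound x y hy⟩)
    have hk0 : 0 < √(ν ^ 2 + Real.exp (2 * x)) := Real.sqrt_pos.2 (by positivity)
    change ‖besI ν x‖ * ‖K₀ x - ℓ * besI ν x‖ ≤ _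
    rw [e1, besI_ofReal hν, Complex.norm_real, Complex.norm_real, Real.norm_of_nonneg hp.le,
      Real.norm_of_nonneg (mul_nonneg hp.le (by linarith))]
    calc besIR ν x * (besIR ν x * (r x - ℓ))
        ≤ besIR ν x * (besIR ν x * (1 / (√(ν ^ 2 + Real.exp (2 * x)) * besIR ν x ^ 2))) := by
          gcongr
      _ = _ := by field_simp

open scoped Classical in
/-- A multiple of the Macdonald function `K_ν` at `exp x`. -/
def besK (ν : ℝ) : ℂ → ℂ := if h : 0 ≤ ν then (exists_besK h).choose else 0

theorem besK_spec (hν : 0 ≤ ν) : Differentiable ℂ (besK ν) ∧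
    (∀ x, HasDerivAt (deriv (besK ν)) (((ν : ℂ) ^ 2 + Complex.exp (2 * x)) * besK ν x) x) ∧
    (∀ x, besI ν x * deriv (besK ν) x - deriv (besI ν) x * besK ν x = -1) ∧
    ∀ x : ℝ, ‖besI ν x‖ * ‖besK ν x‖ ≤ 1 / √(ν ^ 2 + Real.exp (2 * x)) := by
  rw [besK, dif_pos hν]
  exact (exists_besK hν).choose_spec

theorem norm_besI_ofReal (hν : 0 ≤ ν) (x : ℝ) : ‖besI ν x‖ = besIR ν x := by
  rw [besI_ofReal hν, Complex.norm_real, Real.norm_of_nonneg (besIR_pos hν x).le]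

/-- The product of the two solutions on the real axis. -/
theorem norm_besI_mul_besK_le (hν : 0 ≤ ν) {x y : ℝ} (hxy : x ≤ y) :
    ‖besI ν x‖ * ‖besK ν y‖ ≤ Real.exp (ν * (x - y)) / √(ν ^ 2 + Real.exp (2 * y)) := by
  have h1 := (besK_spec hν).2.2.2 y
  rw [norm_besI_ofReal hν] at h1 ⊢
  calc besIR ν x * ‖besK ν y‖ ≤ (Real.exp (ν * (x - y)) * besIR ν y) * ‖besK ν y‖ := by
        gcongr; exact besIR_le hν hxy
    _ = Real.exp (ν * (x - y)) * (besIR ν y * ‖besK ν y‖) := by ring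
    _ ≤ Real.exp (ν * (x - y)) * (1 / √(ν ^ 2 + Real.exp (2 * y))) := by gcongr
    _ = _ := by ring

/-- The decaying solution decays on the real axis. -/
theorem exists_norm_besK_le (hν : 0 ≤ ν) : ∃ C, 0 ≤ C ∧ ∀ x : ℝ, 0 ≤ x →
    ‖besK ν x‖ ≤ C * Real.exp (-4 * x) := by
  -- The term of index 2 makes I grow at least like e^{4x} for x ≥ 0, so K decays like e^{-4x}. As x
  -- is a logarithm of the radius this is decay r⁻⁴, enough for square integrability in the plane.
  have hc := besCoeff_pos hν 2
  refine ⟨1 / besCoeff ν 2, by positivity, fun x hx => ?_⟩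
  have h1 := (besK_spec hν).2.2.2 x
  rw [norm_besI_ofReal hν] at h1
  have h2 : besCoeff ν 2 * Real.exp (4 * x) ≤ besIR ν x := by
    refine le_trans ?_ (le_besIR hν 2 x)
    refine mul_le_mul_of_nonneg_left (Real.exp_le_exp.2 ?_) hc.le
    push_cast
    nlinarith [mul_nonneg hν hx]
  have h3 : 1 / √(ν ^ 2 + Real.exp (2 * x)) ≤ 1 := by
    rw [div_le_one (Real.sqrt_pos.2 (by positivity))]
    refine Real.le_sqrt_of_sq_le ?_
    have : 1 ≤ Real.exp (2 * x) := Real.one_le_exp (by positivity)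
    nlinarith [sq_nonneg ν]
  have h4 : besCoeff ν 2 * Real.exp (4 * x) * ‖besK ν x‖ ≤ 1 :=
    (mul_le_mul_of_nonneg_right h2 (norm_nonneg _)).trans (h1.trans h3)
  have h5 : Real.exp (-4 * x) = (Real.exp (4 * x))⁻¹ := by rw [← Real.exp_neg]; ring_nf
  have h6 : 1 / besCoeff ν 2 * (Real.exp (4 * x))⁻¹ = 1 / (besCoeff ν 2 * Real.exp (4 * x)) := by
    field_simp
  rw [h5, h6, le_div_iff₀ (by positivity)]
  linarith

end RealAxis

/-! #### Uniform bounds for large orders -/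

/-- In this range the exponent of the correction is at most 1/4 and e^{1/4} ≤ 3/2, so the correction
is at most half the leading exponential. In particular I has no zeros there. -/
theorem norm_besI_bounds {ν : ℝ} (hν : 0 ≤ ν) {x : ℂ} (hx : Real.exp (2 * x.re) ≤ ν + 1) :
    Real.exp (ν * x.re) / 2 ≤ ‖besI ν x‖ ∧ ‖besI ν x‖ ≤ 2 * Real.exp (ν * x.re) := by
  have h1 := norm_besI_sub_le hν x
  have h2 : Real.exp (Real.exp (2 * x.re) / (4 * (ν + 1))) - 1 ≤ 1 / 2 := by
    have h3 : Real.exp (2 * x.re) / (4 * (ν + 1)) ≤ 1 / 4 := by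
      rw [div_le_iff₀ (by positivity)]; linarith
    have h4 : Real.exp (1 / 4) ≤ 3 / 2 := by
      refine le_of_pow_le_pow_left₀ (n := 4) (by norm_num) (by norm_num) ?_
      rw [← Real.exp_nat_mul]
      have := Real.exp_one_lt_d9
      norm_num
      linarith
    have := Real.exp_le_exp.2 h3
    linarith
  have h3 : ‖Complex.exp (ν * x)‖ = Real.exp (ν * x.re) := by
    rw [Complex.norm_exp, Complex.re_ofReal_mul]
  have h0 := Real.exp_pos (ν * x.re)
  have h4 : ‖besI ν x - Complex.exp (ν * x)‖ ≤ Real.exp (ν * x.re) / 2 := by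
    refine h1.trans ?_
    nlinarith
  have h5 := norm_sub_norm_le (Complex.exp (ν * x)) (besI ν x)
  have h6 := norm_sub_norm_le (besI ν x) (Complex.exp (ν * x))
  rw [norm_sub_rev] at h5
  rw [h3] at h5 h6
  constructor <;> linarith

/-- Write K = Iq with q' = -1/I². On the real axis q is known from the estimate of IK, and
integrating q' along a path to y carries the bound to complex arguments. The order is required to
dominate e^{2(R + 1)} so that I is comparable to its leading exponential on the whole path. -/
theorem norm_besI_mul_besK_le_of_large {R ν : ℝ} (hR : 0 ≤ R) (hν1 : 1 ≤ ν)
    (hνR : Real.exp (2 * (R + 1)) ≤ ν) {x y : ℂ} (hx : x.re ≤ R) (hy : y.re ≤ R)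
    (hyi : |y.im| ≤ R) : ‖besI ν x‖ * ‖besK ν y‖ ≤
      (8 * (6 + 4 * R)) / ν * Real.exp (ν * (x.re - y.re)) := by
  have hν : 0 ≤ ν := by linarith
  obtain ⟨hK, -, hW, hreal⟩ := besK_spec hν
  have hI : Differentiable ℂ (besI ν) := fun x => (hasDerivAt_besI hν x).differentiableAt
  have hlow : ∀ z : ℂ, z.re ≤ R + 1 → Real.exp (2 * z.re) ≤ ν + 1 := fun z hz => by
    have : Real.exp (2 * z.re) ≤ Real.exp (2 * (R + 1)) := Real.exp_le_exp.2 (by linarith)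
    linarith
  have hne : ∀ z : ℂ, z.re ≤ R + 1 → besI ν z ≠ 0 := fun z hz h => by
    have := (norm_besI_bounds hν (hlow z hz)).1
    rw [h, norm_zero] at this
    have h0 := Real.exp_pos (ν * z.re)
    linarith
  set q : ℂ → ℂ := fun z => besK ν z / besI ν z with hq
  have hqd : ∀ z : ℂ, z.re ≤ R + 1 → HasDerivAt q (-(1 / besI ν z ^ 2)) z := fun z hz => by
    refine ((hK z).hasDerivAt.div (hI z).hasDerivAt (hne z hz)).congr_deriv ?_
    have : deriv (besK ν) z * besI ν z - besK ν z * deriv (besI ν) z = -1 := by rw [← hW z]; ring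
    rw [this]
    ring
  have hqn : ∀ z : ℂ, z.re ≤ R + 1 → ‖(1 / besI ν z ^ 2 : ℂ)‖ ≤ 4 * Real.exp (-(2 * ν * z.re)) :=
    fun z hz => by
    have h1 := (norm_besI_bounds hν (hlow z hz)).1
    have h0 := Real.exp_pos (ν * z.re)
    rw [norm_div, norm_one, norm_pow]
    have e : 4 * Real.exp (-(2 * ν * z.re)) = 1 / (Real.exp (ν * z.re) / 2) ^ 2 := by
      rw [div_pow, ← Real.exp_nat_mul, Real.exp_neg]
      push_cast
      rw [← mul_assoc]
      field_simp
      norm_num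
    rw [e]
    gcongr
  set E := Real.exp (-(2 * ν * y.re)) with hE
  have hE0 : 0 < E := Real.exp_pos _
  have hE1 : Real.exp (-(2 * ν * (y.re + 1))) ≤ E / ν := by
    have h1 : Real.exp (-(2 * ν * (y.re + 1))) = E * Real.exp (-(2 * ν)) := by
      rw [hE, ← Real.exp_add]; ring_nf
    have h2 : Real.exp (-(2 * ν)) ≤ 1 / ν := by
      rw [Real.exp_neg, ← one_div]
      have := Real.add_one_le_exp (2 * ν)
      gcongr
      linarith
    rw [h1]
    calc E * Real.exp (-(2 * ν)) ≤ E * (1 / ν) := by gcongr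
      _ = _ := by ring
  have hE2 : E / ν ≤ E := div_le_self hE0.le hν1
  -- The path goes one unit to the right of y and then vertically to the real axis. On the vertical
  -- leg and at its end e^{-2ν} ≤ 1/ν supplies the needed factor 1/ν; on the horizontal leg it comes
  -- from integrating e^{-2νt}.
  set y₁ : ℂ := ⟨y.re + 1, y.im⟩ with hy₁
  set y₂ : ℂ := ((y.re + 1 : ℝ) : ℂ) with hy₂
  have s1 : ‖q y₁ - q y‖ ≤ 2 / ν * E := by
    have hg : ∀ t : ℝ, HasDerivAt (fun t : ℝ => (t : ℂ) + y.im * Complex.I) 1 t := fun t => by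
      simpa using (Complex.ofRealCLM.hasDerivAt (x := t)).add_const (y.im * Complex.I)
    have hB : ∀ t : ℝ, HasDerivAt (fun t => 2 / ν * (E - Real.exp (-(2 * ν * t))))
        (4 * Real.exp (-(2 * ν * t))) t := fun t => by
      have h1 : HasDerivAt (fun t : ℝ => -(2 * ν * t)) (-(2 * ν)) t := by
        exact (((hasDerivAt_id t).const_mul (2 * ν)).neg).congr_deriv (by ring)
      refine ((h1.exp.const_sub E).const_mul (2 / ν)).congr_deriv ?_
      field_simp
      ring
    have hre : ∀ t : ℝ, ((t : ℂ) + y.im * Complex.I).re = t := fun t => by simp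
    have hf : ∀ t : ℝ, t ≤ R + 1 → HasDerivAt (fun t : ℝ => q ((t : ℂ) + y.im * Complex.I) - q y)
        (-(1 / besI ν ((t : ℂ) + y.im * Complex.I) ^ 2)) t := fun t ht => by
      have h1 := hqd ((t : ℂ) + y.im * Complex.I) (by rw [hre]; exact ht)
      have h2 := h1.scomp t (hg t)
      simpa using h2.sub_const (q y)
    have hyy : (y.re : ℂ) + y.im * Complex.I = y := Complex.re_add_im y
    have := image_norm_le_of_norm_deriv_right_le_deriv_boundary
      (f := fun t : ℝ => q ((t : ℂ) + y.im * Complex.I) - q y) (a := y.re) (b := y.re + 1)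
      (B := fun t => 2 / ν * (E - Real.exp (-(2 * ν * t))))
      (fun t ht => (hf t (by linarith [ht.2])).continuousAt.continuousWithinAt)
      (fun t ht => (hf t (by linarith [ht.2])).hasDerivWithinAt)
      (by simp only [hyy, sub_self, norm_zero]; simp [hE]) hB
      (fun t ht => by
        rw [norm_neg]
        have := hqn ((t : ℂ) + y.im * Complex.I) (by rw [hre]; linarith [ht.2])
        rwa [hre] at this) (right_mem_Icc.2 (by linarith))
    have e : ((y.re + 1 : ℝ) : ℂ) + y.im * Complex.I = y₁ := by
      apply Complex.ext <;> simp [hy₁]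
    simp only [e] at this
    refine this.trans ?_
    gcongr
    have := Real.exp_pos (-(2 * ν * (y.re + 1)))
    linarith
  have s2 : ‖q y₁ - q y₂‖ ≤ 4 * (E / ν) * R := by
    have hconv : Convex ℝ {z : ℂ | z.re = y.re + 1} := by
      intro a ha b hb u v _ _ huv
      simp only [mem_ofPred_eq] at ha hb ⊢
      simp [ha, hb]
      rw [← add_mul, huv, one_mul]
    have h := hconv.norm_image_sub_le_of_norm_hasDerivWithin_le (f := q)
      (f' := fun z => -(1 / besI ν z ^ 2)) (C := 4 * (E / ν))
      (fun z hz => by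
        have hz' : z.re = y.re + 1 := hz
        exact (hqd z (by linarith)).hasDerivWithinAt)
      (fun z hz => by
        have hz' : z.re = y.re + 1 := hz
        rw [norm_neg]
        refine (hqn z (by linarith)).trans ?_
        rw [hz']
        linarith)
      (show y₂ ∈ _ by simp [hy₂]) (show y₁ ∈ _ by simp [hy₁])
    refine h.trans ?_
    have e : y₁ - y₂ = y.im * Complex.I := by apply Complex.ext <;> simp [hy₁, hy₂]
    rw [e, norm_mul, Complex.norm_I, mul_one, Complex.norm_real, Real.norm_eq_abs]
    gcongr
  have s3 : ‖q y₂‖ ≤ 4 * (E / ν) := by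
    have hre2 : y₂.re = y.re + 1 := by simp [hy₂]
    have hy2 : y₂.re ≤ R + 1 := by rw [hre2]; linarith
    have h1 : ‖besI ν y₂‖ * ‖besK ν y₂‖ ≤ 1 := by
      refine (hreal (y.re + 1)).trans ?_
      rw [div_le_one (Real.sqrt_pos.2 (by positivity))]
      refine Real.le_sqrt_of_sq_le ?_
      have := Real.exp_pos (2 * (y.re + 1))
      nlinarith
    have h2 : q y₂ = (besI ν y₂ * besK ν y₂) * (1 / besI ν y₂ ^ 2) := by
      have := hne y₂ hy2
      simp only [hq]
      field_simp
    rw [h2, norm_mul, norm_mul]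
    calc _ ≤ 1 * (4 * Real.exp (-(2 * ν * y₂.re))) := by
          gcongr; exact hqn _ hy2
      _ ≤ _ := by rw [hre2, one_mul]; gcongr
  have hqy : ‖q y‖ ≤ (6 + 4 * R) / ν * E := by
    have : q y = -(q y₁ - q y) + (q y₁ - q y₂) + q y₂ := by ring
    rw [this]
    refine (norm_add₃_le).trans ?_
    rw [norm_neg]
    calc _ ≤ 2 / ν * E + 4 * (E / ν) * R + 4 * (E / ν) := by gcongr
      _ = _ := by field_simp; ring
  have hKq : besK ν y = besI ν y * q y := by
    have := hne y (by linarith)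
    simp only [hq]
    field_simp
  rw [hKq, norm_mul]
  have b1 := (norm_besI_bounds hν (hlow x (by linarith))).2
  have b2 := (norm_besI_bounds hν (hlow y (by linarith))).2
  calc ‖besI ν x‖ * (‖besI ν y‖ * ‖q y‖)
      ≤ (2 * Real.exp (ν * x.re)) * ((2 * Real.exp (ν * y.re)) * ((6 + 4 * R) / ν * E)) := by
        gcongr
    _ = 4 * (6 + 4 * R) / ν * (Real.exp (ν * x.re) * Real.exp (ν * y.re) * E) := by ring
    _ = 4 * (6 + 4 * R) / ν * Real.exp (ν * (x.re - y.re)) := by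
        rw [hE, ← Real.exp_add, ← Real.exp_add]; ring_nf
    _ ≤ _ := by
        gcongr
        linarith

end

section

/-! ### Integral operators with bounded kernels of bounded support -/

/-- A measurable kernel bounded by `B` and supported in the square of the disc of radius `N`. -/
structure IsKernel (N B : ℝ) (k : Plane → Plane → ℂ) : Prop where
  measurable : Measurable (Function.uncurry k)
  norm_le : ∀ x y, ‖k x y‖ ≤ B
  left : ∀ x y, N < ‖x‖ → k x y = 0
  right : ∀ x y, N < ‖y‖ → k x y = 0

/-- The area of a disc. -/
def discArea (N : ℝ) : ℝ := (volume : Measure Plane).real (Metric.closedBall 0 N)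

theorem discArea_nonneg (N : ℝ) : 0 ≤ discArea N := measureReal_nonneg

theorem volume_closedBall_eq (N : ℝ) :
    (volume : Measure Plane) (Metric.closedBall 0 N) = ENNReal.ofReal (discArea N) :=
  (ofReal_measureReal (measure_closedBall_lt_top).ne).symm

/-! ### Row estimates for bounded kernels. -/

namespace IsKernel

variable {N B : ℝ} {k : Plane → Plane → ℂ}

theorem measurable_right (h : IsKernel N B k) (x : Plane) : Measurable (k x) :=
  h.measurable.comp measurable_prodMk_left

theorem nonneg (h : IsKernel N B k) : 0 ≤ B := (norm_nonneg _).trans (h.norm_le 0 0)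

theorem lintegral_row (h : IsKernel N B k) (x : Plane) :
    ∫⁻ y, ‖k x y‖ₑ ^ 2 ≤ ENNReal.ofReal (B ^ 2 * discArea N) := by
  calc ∫⁻ y, ‖k x y‖ₑ ^ 2 ≤ ∫⁻ y, (Metric.closedBall (0 : Plane) N).indicator
        (fun _ => ENNReal.ofReal (B ^ 2)) y := by
        refine lintegral_mono fun y => ?_
        by_cases hy : y ∈ Metric.closedBall (0 : Plane) N
        · rw [indicator_of_mem hy, ← ofReal_norm, ← ENNReal.ofReal_pow (norm_nonneg _)]
          have := h.norm_le x y
          exact ENNReal.ofReal_le_ofReal (by gcongr)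
        · rw [h.right x y (by simpa using hy)]; simp
    _ = _ := by
        rw [lintegral_indicator measurableSet_closedBall, setLIntegral_const, volume_closedBall_eq,
          ← ENNReal.ofReal_mul (sq_nonneg _)]

theorem lintegral_mul_le (h : IsKernel N B k) {x : Plane} {b : ℝ} (hb : 0 ≤ b)
    (hx : ∫⁻ y, ‖k x y‖ₑ ^ 2 ≤ ENNReal.ofReal (b ^ 2)) (f : L2) :
    ∫⁻ y, ‖k x y * f y‖ₑ ≤ ENNReal.ofReal (b * ‖f‖) := by
  have h1 := ENNReal.lintegral_mul_le_Lp_mul_Lq volume Real.HolderConjugate.two_two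
    (f := fun y => ‖k x y‖ₑ) (g := fun y => ‖f y‖ₑ)
    (h.measurable_right x).enorm.aemeasurable (Lp.aestronglyMeasurable f).enorm
  simp only [Pi.mul_apply, ENNReal.rpow_ofNat, lintegral_enorm_sq] at h1
  simp only [enorm_mul]
  refine h1.trans ?_
  rw [ENNReal.ofReal_mul hb]
  gcongr
  · calc (∫⁻ y, ‖k x y‖ₑ ^ 2) ^ (1 / 2 : ℝ) ≤ ENNReal.ofReal (b ^ 2) ^ (1 / 2 : ℝ) := by gcongr
      _ = ENNReal.ofReal b := by
        rw [ENNReal.ofReal_rpow_of_nonneg (sq_nonneg _) (by norm_num), ← Real.sqrt_eq_rpow,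
          Real.sqrt_sq hb]
  · rw [ENNReal.ofReal_rpow_of_nonneg (sq_nonneg _) (by norm_num), ← Real.sqrt_eq_rpow,
      Real.sqrt_sq (norm_nonneg _)]

theorem lintegral_row' (h : IsKernel N B k) (x : Plane) :
    ∫⁻ y, ‖k x y‖ₑ ^ 2 ≤ ENNReal.ofReal ((B * √(discArea N)) ^ 2) := by
  rw [mul_pow, Real.sq_sqrt (discArea_nonneg N)]
  exact h.lintegral_row x

theorem integrable (h : IsKernel N B k) (f : L2) (x : Plane) : Integrable fun y => k x y * f y := by
  refine ⟨(h.measurable_right x).aestronglyMeasurable.mul (Lp.aestronglyMeasurable f), ?_⟩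
  exact (h.lintegral_mul_le (mul_nonneg h.nonneg (Real.sqrt_nonneg _)) (h.lintegral_row' x)
    f).trans_lt ENNReal.ofReal_lt_top

theorem norm_integral_le (h : IsKernel N B k) {x : Plane} {b : ℝ} (hb : 0 ≤ b)
    (hx : ∫⁻ y, ‖k x y‖ₑ ^ 2 ≤ ENNReal.ofReal (b ^ 2)) (f : L2) :
    ‖∫ y, k x y * f y‖ ≤ b * ‖f‖ := by
  refine (norm_integral_le_lintegral_norm _).trans ?_
  refine ENNReal.toReal_le_of_le_ofReal (by positivity) ?_
  simp only [ofReal_norm]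
  exact h.lintegral_mul_le hb hx f

theorem integral_eq_zero (h : IsKernel N B k) {x : Plane} (hx : N < ‖x‖) (f : L2) :
    ∫ y, k x y * f y = 0 := by
  simp [h.left x _ hx]

theorem aestronglyMeasurable (h : IsKernel N B k) (f : L2) :
    AEStronglyMeasurable (fun x => ∫ y, k x y * f y) volume := by
  have h1 : StronglyMeasurable (fun p : Plane × Plane => k p.1 p.2 * f p.2) :=
    h.measurable.stronglyMeasurable.mul ((Lp.stronglyMeasurable f).comp_measurable measurable_snd)
  exact h1.integral_prod_right.aestronglyMeasurable

/-- Each value of the integral is at most the row norm b times ‖f‖, and the output lives in the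
disc, whose area gives the remaining factor. -/
theorem lintegral_sq_le (h : IsKernel N B k) {b : ℝ} (hb : 0 ≤ b)
    (hx : ∀ x, ∫⁻ y, ‖k x y‖ₑ ^ 2 ≤ ENNReal.ofReal (b ^ 2)) (f : L2) :
    ∫⁻ x, ‖∫ y, k x y * f y‖ₑ ^ 2 ≤ ENNReal.ofReal ((b * √(discArea N) * ‖f‖) ^ 2) := by
  calc _ ≤ ∫⁻ x, (Metric.closedBall (0 : Plane) N).indicator
        (fun _ => ENNReal.ofReal ((b * ‖f‖) ^ 2)) x := by
        refine lintegral_mono fun x => ?_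
        by_cases hxN : x ∈ Metric.closedBall (0 : Plane) N
        · rw [indicator_of_mem hxN, ← ofReal_norm, ← ENNReal.ofReal_pow (norm_nonneg _)]
          have := h.norm_integral_le hb (hx x) f
          exact ENNReal.ofReal_le_ofReal (by gcongr)
        · rw [h.integral_eq_zero (by simpa using hxN)]; simp
    _ = _ := by
        rw [lintegral_indicator measurableSet_closedBall, setLIntegral_const, volume_closedBall_eq,
          ← ENNReal.ofReal_mul (sq_nonneg _)]
        congr 1
        have := Real.sq_sqrt (discArea_nonneg N)
        rw [mul_pow, mul_pow, mul_pow, this]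
        ring

theorem memLp (h : IsKernel N B k) (f : L2) : MemLp (fun x => ∫ y, k x y * f y) 2 volume := by
  refine ⟨h.aestronglyMeasurable f, ?_⟩
  rw [eLpNorm_lt_top_iff_lintegral_rpow_enorm_lt_top (by norm_num) (by norm_num)]
  simp only [ENNReal.toReal_ofNat, ENNReal.rpow_ofNat]
  exact (h.lintegral_sq_le (mul_nonneg h.nonneg (Real.sqrt_nonneg _)) h.lintegral_row'
    f).trans_lt ENNReal.ofReal_lt_top

end IsKernel

open scoped Classical in
/-- The integral operator with kernel `k`. -/
def kernelOp (k : Plane → Plane → ℂ) : L2 →L[ℂ] L2 :=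
  if h : ∃ N B, IsKernel N B k then
    LinearMap.mkContinuous
      { toFun := fun f => (h.choose_spec.choose_spec.memLp f).toLp
        map_add' := fun f g => by
          refine Lp.ext ?_
          filter_upwards [(h.choose_spec.choose_spec.memLp (f + g)).coeFn_toLp,
            (h.choose_spec.choose_spec.memLp f).coeFn_toLp,
            (h.choose_spec.choose_spec.memLp g).coeFn_toLp,
            Lp.coeFn_add (h.choose_spec.choose_spec.memLp f).toLp
              (h.choose_spec.choose_spec.memLp g).toLp] with x h1 h2 h3 h4
          rw [h1]
          refine Eq.trans ?_ h4.symm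
          rw [Pi.add_apply, h2, h3, ← integral_add (h.choose_spec.choose_spec.integrable f x)
            (h.choose_spec.choose_spec.integrable g x)]
          refine integral_congr_ae ?_
          filter_upwards [Lp.coeFn_add f g] with y hy
          rw [hy, Pi.add_apply, mul_add]
        map_smul' := fun c f => by
          refine Lp.ext ?_
          filter_upwards [(h.choose_spec.choose_spec.memLp (c • f)).coeFn_toLp,
            (h.choose_spec.choose_spec.memLp f).coeFn_toLp,
            Lp.coeFn_smul c (h.choose_spec.choose_spec.memLp f).toLp] with x h1 h2 h3
          rw [h1]
          refine Eq.trans ?_ h3.symm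
          rw [Pi.smul_apply, h2, smul_eq_mul, ← integral_const_mul]
          refine integral_congr_ae ?_
          filter_upwards [Lp.coeFn_smul c f] with y hy
          rw [hy, Pi.smul_apply, smul_eq_mul]
          ring }
      (h.choose_spec.choose * √(discArea h.choose) * √(discArea h.choose)) fun f => by
        have hk := h.choose_spec.choose_spec
        refine norm_le_of_lintegral (mul_nonneg (mul_nonneg (mul_nonneg hk.nonneg
          (Real.sqrt_nonneg _)) (Real.sqrt_nonneg _)) (norm_nonneg _)) ?_
        refine le_trans (le_of_eq ?_) (hk.lintegral_sq_le (mul_nonneg hk.nonneg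
          (Real.sqrt_nonneg _)) hk.lintegral_row' f)
        refine lintegral_congr_ae ?_
        filter_upwards [(hk.memLp f).coeFn_toLp] with x hx
        rw [← hx]
        rfl
  else 0

/-! ### Norms of integral operators and their holomorphic dependence on the kernel. -/

section KernelOp

variable {N B : ℝ} {k : Plane → Plane → ℂ}

theorem kernelOp_ae (h : IsKernel N B k) (f : L2) :
    kernelOp k f =ᵐ[volume] fun x => ∫ y, k x y * f y := by
  have h' : ∃ N B, IsKernel N B k := ⟨N, B, h⟩
  rw [kernelOp, dif_pos h']
  exact (h'.choose_spec.choose_spec.memLp f).coeFn_toLp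

/-- The L² norm of the rows can be much smaller than the sup norm of the kernel. For angular modes
this gains the half power of the order that makes the sum over modes converge. -/
theorem norm_kernelOp_le (h : IsKernel N B k) {b : ℝ} (hb : 0 ≤ b)
    (hx : ∀ x, ∫⁻ y, ‖k x y‖ₑ ^ 2 ≤ ENNReal.ofReal (b ^ 2)) :
    ‖kernelOp k‖ ≤ b * √(discArea N) := by
  refine ContinuousLinearMap.opNorm_le_bound _ (by positivity) fun f => ?_
  refine norm_le_of_lintegral (by positivity) ?_
  refine le_trans (le_of_eq ?_) (h.lintegral_sq_le hb hx f)
  refine lintegral_congr_ae ?_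
  filter_upwards [kernelOp_ae h f] with x hx
  rw [hx]

theorem norm_kernelOp_le' (h : IsKernel N B k) : ‖kernelOp k‖ ≤ B * discArea N := by
  refine (norm_kernelOp_le h (mul_nonneg h.nonneg (Real.sqrt_nonneg _)) h.lintegral_row').trans ?_
  rw [mul_assoc, Real.mul_self_sqrt (discArea_nonneg N)]

/-- Cutting off a kernel on both sides. -/
theorem bmul_kernelOp_bmul (h : IsKernel N B k) {g₁ g₂ : Plane → ℂ} (h1 : MemLp g₁ ⊤ volume)
    (h2 : MemLp g₂ ⊤ volume) {B' : ℝ} (h' : IsKernel N B' fun x y => g₁ x * k x y * g₂ y) (f : L2) :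
    bmul g₁ (kernelOp k (bmul g₂ f)) = kernelOp (fun x y => g₁ x * k x y * g₂ y) f := by
  refine bmul_eq_of_ae h1 ?_
  filter_upwards [kernelOp_ae h' f, kernelOp_ae h (bmul g₂ f)] with x e1 e2
  rw [e1, e2, ← integral_const_mul]
  refine integral_congr_ae ?_
  filter_upwards [bmul_ae h2 f] with y hy
  rw [hy]
  ring

/-- A holomorphic function bounded on a disc of radius `3` differs from its linear approximation
by at most the bound times the square of the distance. -/
theorem norm_sub_linear_le {f : ℂ → ℂ} (hf : Differentiable ℂ f) {z₀ : ℂ} {B : ℝ}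
    (hB : ∀ z ∈ Metric.closedBall z₀ 3, ‖f z‖ ≤ B) {z : ℂ} (hz : ‖z - z₀‖ ≤ 1) :
    ‖f z - f z₀ - (z - z₀) * deriv f z₀‖ ≤ B * ‖z - z₀‖ ^ 2 := by
  have hd1 : ∀ w ∈ Metric.closedBall z₀ 2, ‖deriv f w‖ ≤ B := fun w hw => by
    have := Complex.norm_deriv_le_of_forall_mem_sphere_norm_le (c := w) (R := 1) (C := B) (f := f)
      zero_lt_one hf.diffContOnCl fun u hu => hB u (by
        rw [mem_closedBall_iff_norm] at hw ⊢
        rw [mem_sphere_iff_norm] at hu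
        have := norm_add_le (u - w) (w - z₀)
        rw [sub_add_sub_cancel] at this
        linarith)
    simpa using this
  have hd2 : ∀ w ∈ Metric.closedBall z₀ 1, ‖deriv (deriv f) w‖ ≤ B := fun w hw => by
    have := Complex.norm_deriv_le_of_forall_mem_sphere_norm_le (c := w) (R := 1) (C := B)
      (f := deriv f) zero_lt_one hf.deriv.diffContOnCl fun u hu => hd1 u (by
        rw [mem_closedBall_iff_norm] at hw ⊢
        rw [mem_sphere_iff_norm] at hu
        have := norm_add_le (u - w) (w - z₀)
        rw [sub_add_sub_cancel] at this
        linarith)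
    simpa using this
  have hB0 : 0 ≤ B := (norm_nonneg _).trans (hB z₀ (by simp))
  have hlip : ∀ w ∈ Metric.closedBall z₀ ‖z - z₀‖, ‖deriv f w - deriv f z₀‖ ≤ B * ‖z - z₀‖ :=
    fun w hw => by
    have := (convex_closedBall z₀ (1 : ℝ)).norm_image_sub_le_of_norm_deriv_le (f := deriv f)
      (C := B) (fun u _ => hf.deriv u) hd2 (Metric.mem_closedBall_self zero_le_one)
      (Metric.closedBall_subset_closedBall hz hw)
    refine this.trans ?_
    gcongr
    exact mem_closedBall_iff_norm.1 hw
  have hg : ∀ w, HasDerivAt (fun w => f w - w * deriv f z₀) (deriv f w - deriv f z₀) w := fun w =>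
    ((hf w).hasDerivAt.sub ((hasDerivAt_id w).mul_const _)).congr_deriv (by ring)
  have := (convex_closedBall z₀ ‖z - z₀‖).norm_image_sub_le_of_norm_hasDerivWithin_le
    (f := fun w => f w - w * deriv f z₀) (fun w _ => (hg w).hasDerivWithinAt) hlip
    (Metric.mem_closedBall_self (norm_nonneg _)) (mem_closedBall_iff_norm.2 le_rfl : z ∈ Metric.closedBall z₀ ‖z - z₀‖)
  calc _ = ‖(f z - z * deriv f z₀) - (f z₀ - z₀ * deriv f z₀)‖ := by congr 1; ring
    _ ≤ _ := this.trans (le_of_eq (by ring))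

/-- Integral operators depend holomorphically on holomorphic kernels. -/
theorem differentiable_kernelOp {k : ℂ → Plane → Plane → ℂ}
    (hk : ∀ z₀, ∃ B, ∀ z ∈ Metric.closedBall z₀ 3, IsKernel N B (k z))
    (hd : ∀ x y, Differentiable ℂ fun z => k z x y) : Differentiable ℂ fun z => kernelOp (k z) := by
  intro z₀
  obtain ⟨B, hB⟩ := hk z₀
  have hself : ∀ r : ℝ, 0 ≤ r → z₀ ∈ Metric.closedBall z₀ r := fun r hr => by simpa
  set k' : Plane → Plane → ℂ := fun x y => deriv (fun z => k z x y) z₀ with hk'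
  have hkd : IsKernel N B k' := by
    refine ⟨?_, fun x y => ?_, fun x y hx => ?_, fun x y hy => ?_⟩
    -- Joint measurability of the derivative kernel is obtained as that of a pointwise limit of
    -- difference quotients along z₀ + 1/(n + 1).
    · have hlim : Tendsto (fun (n : ℕ) (p : Plane × Plane) => ((1 / ((n : ℂ) + 1))⁻¹) *
          (k (z₀ + 1 / ((n : ℂ) + 1)) p.1 p.2 - k z₀ p.1 p.2)) atTop
          (𝓝 (Function.uncurry k')) := by
        refine tendsto_pi_nhds.2 fun p => ?_
        have h1 := (hd p.1 p.2 z₀).hasDerivAt.tendsto_slope_zero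
        have h2 : Tendsto (fun n : ℕ => (1 / ((n : ℂ) + 1))) atTop (𝓝[≠] 0) := by
          refine tendsto_nhdsWithin_of_tendsto_nhds_of_eventually_within _
            tendsto_one_div_add_atTop_nhds_zero_nat (Eventually.of_forall fun n => ?_)
          have : (n : ℂ) + 1 ≠ 0 := by exact_mod_cast n.succ_ne_zero
          simpa using this
        exact h1.comp h2
      refine measurable_of_tendsto_metrizable' (f := fun (n : ℕ) (p : Plane × Plane) =>
        ((1 / ((n : ℂ) + 1))⁻¹) * (k (z₀ + 1 / ((n : ℂ) + 1)) p.1 p.2 - k z₀ p.1 p.2)) atTop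
        (fun n => ?_) hlim
      refine measurable_const.mul (Measurable.sub (hB _ ?_).measurable
        (hB _ (hself 3 (by norm_num))).measurable)
      rw [mem_closedBall_iff_norm, add_sub_cancel_left, norm_div, norm_one]
      have : ‖(n : ℂ) + 1‖ = n + 1 := by
        have : (n : ℂ) + 1 = ((n + 1 : ℕ) : ℂ) := by push_cast; ring
        rw [this, Complex.norm_natCast]; push_cast; ring
      rw [this, div_le_iff₀ (by positivity)]
      have : (0 : ℝ) ≤ n := n.cast_nonneg
      linarith
    · have := Complex.norm_deriv_le_of_forall_mem_sphere_norm_le (c := z₀) (R := 1) (C := B)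
        (f := fun z => k z x y) zero_lt_one (hd x y).diffContOnCl fun u hu =>
          (hB u (Metric.closedBall_subset_closedBall (by norm_num)
            (Metric.sphere_subset_closedBall hu))).norm_le x y
      simpa using this
    · have h1 : (fun z => k z x y) =ᶠ[𝓝 z₀] fun _ => 0 := by
        filter_upwards [Metric.closedBall_mem_nhds z₀ (by norm_num : (0 : ℝ) < 3)] with z hz
        exact (hB z hz).left x y hx
      simp only [hk', h1.deriv_eq, deriv_const]
    · have h1 : (fun z => k z x y) =ᶠ[𝓝 z₀] fun _ => 0 := by
        filter_upwards [Metric.closedBall_mem_nhds z₀ (by norm_num : (0 : ℝ) < 3)] with z hz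
        exact (hB z hz).right x y hy
      simp only [hk', h1.deriv_eq, deriv_const]
  have hB0 := hkd.nonneg
  suffices h : HasDerivAt (fun z => kernelOp (k z)) (kernelOp k') z₀ from h.differentiableAt
  rw [hasDerivAt_iff_isLittleO]
  refine (Asymptotics.IsBigO.of_bound (B * discArea N) ?_).trans_isLittleO
    (Asymptotics.isLittleO_pow_sub_sub z₀ one_lt_two)
  filter_upwards [Metric.closedBall_mem_nhds z₀ zero_lt_one] with z hz
  have hz1 : ‖z - z₀‖ ≤ 1 := mem_closedBall_iff_norm.1 hz
  have hz3 : z ∈ Metric.closedBall z₀ 3 := Metric.closedBall_subset_closedBall (by norm_num) hz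
  have hk0 := hB z₀ (hself 3 (by norm_num))
  have hkz := hB z hz3
  have hrem : IsKernel N (B * ‖z - z₀‖ ^ 2)
      fun x y => k z x y - k z₀ x y - (z - z₀) * k' x y := by
    refine ⟨(hkz.measurable.sub hk0.measurable).sub (hkd.measurable.const_mul _), fun x y => ?_,
      fun x y hx => ?_, fun x y hy => ?_⟩
    · exact norm_sub_linear_le (hd x y) (fun w hw => (hB w hw).norm_le x y) hz1
    · rw [hkz.left x y hx, hk0.left x y hx, hkd.left x y hx]; simp
    · rw [hkz.right x y hy, hk0.right x y hy, hkd.right x y hy]; simp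
  have heq : kernelOp (k z) - kernelOp (k z₀) - (z - z₀) • kernelOp k' =
      kernelOp fun x y => k z x y - k z₀ x y - (z - z₀) * k' x y := by
    ext1 f
    refine Lp.ext ?_
    change ((kernelOp (k z) f - kernelOp (k z₀) f - (z - z₀) • kernelOp k' f : L2) : Plane → ℂ)
      =ᵐ[volume] _
    filter_upwards [kernelOp_ae hkz f, kernelOp_ae hk0 f, kernelOp_ae hkd f, kernelOp_ae hrem f,
      Lp.coeFn_sub (kernelOp (k z) f - kernelOp (k z₀) f) ((z - z₀) • kernelOp k' f),
      Lp.coeFn_sub (kernelOp (k z) f) (kernelOp (k z₀) f),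
      Lp.coeFn_smul (z - z₀) (kernelOp k' f)] with x e1 e2 e3 e4 e5 e6 e7
    rw [e5, Pi.sub_apply, e6, e7, Pi.sub_apply, Pi.smul_apply, e1, e2, e3, e4, smul_eq_mul,
      ← integral_const_mul, ← integral_sub (hkz.integrable f x) (hk0.integrable f x)]
    have hi : Integrable fun y => k z x y * f y - k z₀ x y * f y :=
      (hkz.integrable f x).sub (hk0.integrable f x)
    rw [← integral_sub hi ((hkd.integrable f x).const_mul _)]
    refine integral_congr_ae (Eventually.of_forall fun y => ?_)
    ring
  rw [heq]
  refine (norm_kernelOp_le' hrem).trans (le_of_eq ?_)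
  rw [norm_pow, norm_norm]
  ring

end KernelOp

end

section

/-! ### The angular modes -/

variable {n : ℕ} (s : Fin n → Plane) (α : Fin n → ℝ)

/-- The identification of the plane with the complex numbers. -/
def zc : Plane ≃ₗᵢ[ℝ] ℂ := Complex.orthonormalBasisOneI.repr.symm

theorem zc_apply (x : Plane) : zc x = x 0 + x 1 * Complex.I :=
  Complex.orthonormalBasisOneI_repr_symm_apply x

theorem zc_re (x : Plane) : (zc x).re = x 0 := by simp [zc_apply]

theorem zc_im (x : Plane) : (zc x).im = x 1 := by simp [zc_apply]

theorem norm_zc (x : Plane) : ‖zc x‖ = ‖x‖ := zc.norm_map x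

theorem norm_sq_eq (x : Plane) : ‖x‖ ^ 2 = x 0 ^ 2 + x 1 ^ 2 := by
  rw [← norm_zc, ← Complex.normSq_eq_norm_sq, Complex.normSq_apply, zc_re, zc_im]
  ring

/-- The unit vectors as complex numbers. -/
def dir (j : Fin 2) : ℂ := zc (EuclideanSpace.single j 1)

theorem dir_zero : dir 0 = 1 := by simp [dir, zc_apply]

theorem dir_one : dir 1 = Complex.I := by simp [dir, zc_apply]

/-- The total flux. -/
def flux : ℝ := ∑ i, α i

/-- The phase by which the vector potential differs from that of a single flux at the origin. -/
def gaugePhase (x : Plane) : ℝ := ∑ i, α i * (Complex.log (1 - zc (s i) / zc x)).im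

/-- The angular part of a point. -/
def angular (x : Plane) : ℂ := zc x / ‖x‖

/-- The angular mode with index `m`. -/
def mode (m : ℤ) (x : Plane) : ℂ := Complex.exp (-Complex.I * gaugePhase s α x) * angular x ^ m

/-- The gradient of the angle. -/
def angGrad (j : Fin 2) (x : Plane) : ℝ := (dir j / zc x).im

theorem angGrad_zero (x : Plane) : angGrad 0 x = -x 1 / ‖x‖ ^ 2 := by
  rw [angGrad, dir_zero, Complex.div_im, zc_re, zc_im, Complex.normSq_eq_norm_sq, norm_zc]
  simp; ring

theorem angGrad_one (x : Plane) : angGrad 1 x = x 0 / ‖x‖ ^ 2 := by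
  rw [angGrad, dir_one, Complex.div_im, zc_re, zc_im, Complex.normSq_eq_norm_sq, norm_zc]
  simp

theorem norm_angular {x : Plane} (hx : x ≠ 0) : ‖angular x‖ = 1 := by
  rw [angular, norm_div, norm_zc, Complex.norm_real, norm_norm, div_self (norm_ne_zero_iff.2 hx)]

theorem norm_mode {x : Plane} (hx : x ≠ 0) (m : ℤ) : ‖mode s α m x‖ = 1 := by
  rw [mode, norm_mul, norm_zpow, norm_angular hx, one_zpow, mul_one, Complex.norm_exp]
  simp

theorem vectorPotential_eq (x : Plane) (j : Fin 2) :
    vectorPotential s α x j = -∑ i, α i * (dir j / (zc x - zc (s i))).im := by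
  have key : ∀ i, (dir 0 / (zc x - zc (s i))).im =
      -(x 1 - s i 1) / ((x 0 - s i 0) ^ 2 + (x 1 - s i 1) ^ 2) ∧
      (dir 1 / (zc x - zc (s i))).im =
      (x 0 - s i 0) / ((x 0 - s i 0) ^ 2 + (x 1 - s i 1) ^ 2) := fun i => by
    rw [← map_sub]
    have h1 := angGrad_zero (x - s i)
    have h2 := angGrad_one (x - s i)
    rw [norm_sq_eq] at h1 h2
    exact ⟨h1, h2⟩
  simp only [vectorPotential, Finset.sum_apply, Pi.smul_apply, smul_eq_mul, neg_mul,
    Finset.sum_neg_distrib]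
  congr 1
  refine Finset.sum_congr rfl fun i _ => ?_
  fin_cases j
  · simp only [Fin.zero_eta, Fin.isValue]
    rw [(key i).1]; rfl
  · simp only [Fin.mk_one, Fin.isValue]
    rw [(key i).2]; rfl

/-- The coordinate line through `x` in direction `j`. -/
def cline (j : Fin 2) (x : Plane) (t : ℝ) : Plane := x + t • EuclideanSpace.single j 1

theorem cline_zero (j : Fin 2) (x : Plane) : cline j x 0 = x := by simp [cline]

theorem pd_eq_of_hasDerivAt {f : Plane → ℂ} {x : Plane} (hf : DifferentiableAt ℝ f x) {j : Fin 2}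
    {d : ℂ} (h : HasDerivAt (fun t => f (cline j x t)) d 0) : pd j f x = d := by
  rw [pd, ← hf.lineDeriv_eq_fderiv]
  exact h.deriv

theorem hasDerivAt_cline {f : Plane → ℂ} {x : Plane} (hf : DifferentiableAt ℝ f x) (j : Fin 2) :
    HasDerivAt (fun t => f (cline j x t)) (pd j f x) 0 :=
  hf.hasFDerivAt.hasLineDerivAt (EuclideanSpace.single j 1)

theorem hasDerivAt_coord (j k : Fin 2) (x : Plane) :
    HasDerivAt (fun t => cline j x t k) (if k = j then 1 else 0) 0 := by
  have : ∀ t, cline j x t k = x k + t * (if k = j then 1 else 0) := fun t => by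
    simp [cline]
  simp only [this]
  simpa using ((hasDerivAt_id (0 : ℝ)).mul_const (if k = j then (1 : ℝ) else 0)).const_add (x k)

theorem hasDerivAt_zc (j : Fin 2) (x : Plane) : HasDerivAt (fun t => zc (cline j x t)) (dir j) 0 := by
  have h : ∀ t : ℝ, zc (cline j x t) = zc x + (t : ℂ) * dir j := fun t => by
    rw [cline, map_add, map_smul, Complex.real_smul, dir]
  simp only [h]
  have := (Complex.ofRealCLM.hasDerivAt (x := (0 : ℝ))).mul_const (dir j)
  simpa using this.const_add (zc x)

theorem hasDerivAt_norm (j : Fin 2) {x : Plane} (hx : x ≠ 0) :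
    HasDerivAt (fun t => ‖cline j x t‖) (x j / ‖x‖) 0 := by
  have e : ∀ y : Plane, ‖y‖ = √(y 0 ^ 2 + y 1 ^ 2) := fun y => by
    rw [← norm_sq_eq, Real.sqrt_sq (norm_nonneg _)]
  have hne : (cline j x 0) 0 ^ 2 + (cline j x 0) 1 ^ 2 ≠ 0 := by
    rw [cline_zero, ← norm_sq_eq]; exact pow_ne_zero 2 (norm_ne_zero_iff.2 hx)
  have h := (((hasDerivAt_coord j 0 x).pow 2).add ((hasDerivAt_coord j 1 x).pow 2)).sqrt hne
  have e2 : (fun t => ‖cline j x t‖) = fun t => √((cline j x t) 0 ^ 2 + (cline j x t) 1 ^ 2) :=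
    funext fun t => e _
  rw [e2]
  refine h.congr_deriv ?_
  simp only [Pi.add_apply, Pi.pow_apply, cline_zero]
  rw [← e]
  have := norm_ne_zero_iff.2 hx
  fin_cases j <;> simp <;> field_simp

variable {s} {ρ : ℝ}

/-! ### Gauge transformation and modes outside a disc containing all the points. -/

section Outside

theorem ne_zero_of_lt {x : Plane} (hρ0 : 0 < ρ) (hx : ρ < ‖x‖) : x ≠ 0 := by
  rintro rfl
  rw [norm_zero] at hx
  linarith

/-- Outside the disc |s_i / z| < 1, so the principal logarithm of 1 - s_i / z is smooth. This is why
the phase is single valued for arbitrary fluxes. -/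
theorem one_sub_mem_slitPlane (hρ : ∀ i, ‖s i‖ < ρ) (hρ0 : 0 < ρ) {x : Plane}
    (hx : ρ < ‖x‖) (i : Fin n) :
    1 - zc (s i) / zc x ∈ Complex.slitPlane := by
  have h1 : ‖-(zc (s i) / zc x)‖ < 1 := by
    rw [norm_neg, norm_div, norm_zc, norm_zc, div_lt_one (hρ0.trans hx)]
    exact (hρ i).trans hx
  have := Complex.mem_slitPlane_of_norm_lt_one h1
  rwa [← sub_eq_add_neg] at this

/-- The logarithmic derivative of 1 - s_i / z is that of z - s_i minus that of z. The phase
therefore has as gradient the difference between the angle gradients about the points s_i and the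
one about the origin, weighted by the fluxes. -/
theorem hasDerivAt_gaugePhase (hρ : ∀ i, ‖s i‖ < ρ) (hρ0 : 0 < ρ) {x : Plane}
    (hx : ρ < ‖x‖) (j : Fin 2) :
    HasDerivAt (fun t => gaugePhase s α (cline j x t))
      (-(vectorPotential s α x j + flux α * angGrad j x)) 0 := by
  have hz : zc x ≠ 0 := by
    rw [← norm_ne_zero_iff, norm_zc]; exact (hρ0.trans hx).ne'
  have hd : ∀ i, HasDerivAt (fun t => α i * (Complex.log (1 - zc (s i) / zc (cline j x t))).im)
      (α i * (dir j / (zc x - zc (s i)) - dir j / zc x).im) 0 := fun i => by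
    have hzi : zc x - zc (s i) ≠ 0 := by
      rw [sub_ne_zero]
      intro h
      have := congrArg norm h
      rw [norm_zc, norm_zc] at this
      linarith [hρ i]
    have h0 := hasDerivAt_zc j x
    have h1 := (((hasDerivAt_const (0 : ℝ) (zc (s i))).div h0 (by rwa [cline_zero])).const_sub
      1).clog_real (by
        have := one_sub_mem_slitPlane hρ hρ0 hx i
        simpa [cline_zero] using this)
    have h2 := (Complex.imCLM.hasFDerivAt.comp_hasDerivAt (0 : ℝ) h1).const_mul (α i)
    refine h2.congr_deriv ?_
    rw [Complex.imCLM_apply]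
    congr 2
    simp only [Pi.div_apply, cline_zero]
    have h3 : 1 - zc (s i) / zc x ≠ 0 := by
      rw [← div_self hz, ← sub_div]
      exact div_ne_zero hzi hz
    have h4 : 1 - zc (s i) / zc x = (zc x - zc (s i)) / zc x := by field_simp
    rw [h4]
    field_simp
    ring
  have hsum := HasDerivAt.fun_sum fun i (_ : i ∈ Finset.univ) => hd i
  refine hsum.congr_deriv ?_
  rw [vectorPotential_eq, flux, angGrad, Finset.sum_mul, neg_add, neg_neg, ← sub_eq_add_neg,
    ← Finset.sum_sub_distrib]
  refine Finset.sum_congr rfl fun i _ => ?_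
  rw [Complex.sub_im]
  ring

theorem hasDerivAt_angular (hρ0 : 0 < ρ) {x : Plane} (hx : ρ < ‖x‖) (j : Fin 2) :
    HasDerivAt (fun t => angular (cline j x t)) (Complex.I * angGrad j x * angular x) 0 := by
  have hx0 : x ≠ 0 := ne_zero_of_lt hρ0 hx
  have hn : (‖x‖ : ℂ) ≠ 0 := by exact_mod_cast norm_ne_zero_iff.2 hx0
  have h1 := (hasDerivAt_norm j hx0).ofReal_comp
  have h2 := (hasDerivAt_zc j x).div h1 (by rwa [cline_zero])
  refine h2.congr_deriv ?_
  simp only [cline_zero, angular]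
  have hsq : (‖x‖ : ℂ) ^ 2 = (x 0 : ℂ) ^ 2 + (x 1 : ℂ) ^ 2 := by exact_mod_cast norm_sq_eq x
  fin_cases j
  · simp only [Fin.zero_eta, Fin.isValue, angGrad_zero, dir_zero]
    push_cast
    rw [zc_apply]
    field_simp
    linear_combination hsq + (x 1 : ℂ) ^ 2 * Complex.I_sq
  · simp only [Fin.mk_one, Fin.isValue, angGrad_one, dir_one]
    push_cast
    rw [zc_apply]
    field_simp
    linear_combination Complex.I * hsq - (x 1 : ℂ) * (x 0 : ℂ) * Complex.I_sq

theorem hasDerivAt_mode (hρ : ∀ i, ‖s i‖ < ρ) (hρ0 : 0 < ρ) (m : ℤ) {x : Plane}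
    (hx : ρ < ‖x‖) (j : Fin 2) :
    HasDerivAt (fun t => mode s α m (cline j x t))
      (Complex.I * (vectorPotential s α x j + (m + flux α) * angGrad j x) * mode s α m x) 0 := by
  have hx0 : x ≠ 0 := ne_zero_of_lt hρ0 hx
  have ha0 : angular x ≠ 0 := by rw [← norm_ne_zero_iff, norm_angular hx0]; exact one_ne_zero
  have h1 := ((hasDerivAt_gaugePhase α hρ hρ0 hx j).ofReal_comp.const_mul (-Complex.I)).cexp
  have h2 := (hasDerivAt_zpow m (angular (cline j x 0)) (by rw [cline_zero]; exact Or.inl ha0)).comp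
    (0 : ℝ) (hasDerivAt_angular hρ0 hx j)
  refine (h1.mul h2).congr_deriv ?_
  simp only [Function.comp_apply, cline_zero, mode]
  have e : angular x ^ m = angular x ^ (m - 1) * angular x := by
    rw [← zpow_add_one₀ ha0, sub_add_cancel]
  rw [e]
  push_cast
  ring

theorem contDiffAt_mode (hρ : ∀ i, ‖s i‖ < ρ) (hρ0 : 0 < ρ) (m : ℤ) {x : Plane} (hx : ρ < ‖x‖) :
    ContDiffAt ℝ ∞ (mode s α m) x := by
  have hx0 : x ≠ 0 := ne_zero_of_lt hρ0 hx
  have hz : zc x ≠ 0 := by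
    rw [← norm_ne_zero_iff, norm_zc]; exact (hρ0.trans hx).ne'
  have hzc : ContDiffAt ℝ ∞ (fun x => zc x) x := zc.contDiff.contDiffAt
  have hg : ContDiffAt ℝ ∞ (gaugePhase s α) x := by
    refine ContDiffAt.sum fun i _ => contDiffAt_const.mul ?_
    have h1 : ContDiffAt ℝ ∞ (fun x => 1 - zc (s i) / zc x) x :=
      by
      simp only [div_eq_mul_inv]
      exact contDiffAt_const.sub (contDiffAt_const.mul (hzc.inv hz))
    have h2 := ((Complex.contDiffAt_log (one_sub_mem_slitPlane hρ hρ0 hx i)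
      (n := ∞)).restrict_scalars ℝ).comp x h1
    exact Complex.imCLM.contDiff.contDiffAt.comp x h2
  have hn : ContDiffAt ℝ ∞ (fun x : Plane => (‖x‖ : ℂ)) x :=
    Complex.ofRealCLM.contDiff.contDiffAt.comp x (contDiffAt_norm ℝ hx0)
  have hn0 : (‖x‖ : ℂ) ≠ 0 := by exact_mod_cast norm_ne_zero_iff.2 hx0
  have ha : ContDiffAt ℝ ∞ angular x := hzc.mul (hn.inv hn0)
  have ha0 : angular x ≠ 0 := by rw [← norm_ne_zero_iff, norm_angular hx0]; exact one_ne_zero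
  have hp : ContDiffAt ℝ ∞ (fun x => angular x ^ m) x := by
    cases m with
    | ofNat k => simpa using ha.pow k
    | negSucc k =>
      simp only [zpow_negSucc]
      exact (ha.pow (k + 1)).inv (pow_ne_zero _ ha0)
  exact ((contDiffAt_const.mul (Complex.ofRealCLM.contDiff.contDiffAt.comp x hg)).cexp).mul hp

/-- The logarithmic derivative of the mode contains the full vector potential, which cancels; only
the angular momentum shifted by the total flux remains in front of the angle gradient. -/
theorem magneticDerivFun_mode_mul (hρ : ∀ i, ‖s i‖ < ρ) (hρ0 : 0 < ρ) (m : ℤ)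
    {x : Plane} (hx : ρ < ‖x‖) {w : Plane → ℂ}
    (hw : DifferentiableAt ℝ w x) (j : Fin 2) :
    magneticDerivFun s α j (fun y => mode s α m y * w y) x =
      mode s α m x * (-Complex.I * pd j w x + (m + flux α) * angGrad j x * w x) := by
  have hE := (contDiffAt_mode α hρ hρ0 m hx).differentiableAt (by simp)
  have h1 : pd j (mode s α m) x = _ :=
    pd_eq_of_hasDerivAt hE (hasDerivAt_mode α hρ hρ0 m hx j)
  have h2 := pd_mul hE hw j
  rw [h1] at h2
  rw [magneticDerivFun]
  change -Complex.I * pd j (fun y => mode s α m y * w y) x - _ = _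
  rw [h2]
  linear_combination (-(vectorPotential s α x j + (m + flux α) * angGrad j x) * mode s α m x * w x) *
    Complex.I_sq

end Outside

/-- A function of the logarithm of the radius. -/
def radial (V : ℝ → ℂ) (x : Plane) : ℂ := V (Real.log ‖x‖)

theorem contDiffAt_radial {V : ℝ → ℂ} (hV : ContDiff ℝ ∞ V) {x : Plane} (hx : x ≠ 0) :
    ContDiffAt ℝ ∞ (radial V) x :=
  hV.contDiffAt.comp x ((contDiffAt_norm ℝ hx).log (norm_ne_zero_iff.2 hx))

theorem pd_radial {V : ℝ → ℂ} (hV : ContDiff ℝ ∞ V) {x : Plane} (hx : x ≠ 0) (j : Fin 2) :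
    pd j (radial V) x = (x j / ‖x‖ ^ 2 : ℝ) * radial (deriv V) x := by
  refine pd_eq_of_hasDerivAt ((contDiffAt_radial hV hx).differentiableAt (by simp)) ?_
  have h1 := (hasDerivAt_norm j hx).log (by rw [cline_zero]; exact norm_ne_zero_iff.2 hx)
  have h2 := (hV.differentiable (by simp) (Real.log ‖cline j x 0‖)).hasDerivAt.scomp (0 : ℝ) h1
  refine h2.congr_deriv ?_
  rw [cline_zero, Complex.real_smul, radial]
  congr 2
  have := norm_ne_zero_iff.2 hx
  field_simp

theorem differentiableAt_coord_div (k : Fin 2) {x : Plane} (hx : x ≠ 0) :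
    DifferentiableAt ℝ (fun y : Plane => ((y k / ‖y‖ ^ 2 : ℝ) : ℂ)) x := by
  have h1 : DifferentiableAt ℝ (fun y : Plane => y k) x :=
    (EuclideanSpace.proj k : Plane →L[ℝ] ℝ).differentiableAt
  have h2 : DifferentiableAt ℝ (fun y : Plane => ‖y‖ ^ 2) x :=
    ((contDiffAt_norm ℝ hx (n := ∞)).differentiableAt (by simp)).pow 2
  simp only [div_eq_mul_inv]
  exact Complex.ofRealCLM.differentiableAt.comp x
    (h1.mul (h2.fun_inv (pow_ne_zero 2 (norm_ne_zero_iff.2 hx))))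

theorem pd_coord_div (j k : Fin 2) {x : Plane} (hx : x ≠ 0) :
    pd j (fun y : Plane => ((y k / ‖y‖ ^ 2 : ℝ) : ℂ)) x =
      (((if k = j then 1 else 0) / ‖x‖ ^ 2 - 2 * x j * x k / ‖x‖ ^ 4 : ℝ) : ℂ) := by
  refine pd_eq_of_hasDerivAt (differentiableAt_coord_div k hx) ?_
  have hn := norm_ne_zero_iff.2 hx
  have h1 := ((hasDerivAt_coord j k x).div ((hasDerivAt_norm j hx).pow 2)
    (by simp only [Pi.pow_apply, cline_zero]; exact pow_ne_zero 2 hn)).ofReal_comp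
  refine h1.congr_deriv ?_
  congr 1
  simp only [Pi.pow_apply, cline_zero]
  split_ifs <;> field_simp <;> norm_num <;> ring

theorem angGrad_eq (j : Fin 2) : angGrad j = fun x => if j = 0 then -(x 1 / ‖x‖ ^ 2) else
    x 0 / ‖x‖ ^ 2 := by
  funext x
  fin_cases j
  · simp [angGrad_zero, neg_div]
  · simp [angGrad_one]

theorem pd_neg (j : Fin 2) (f : Plane → ℂ) (x : Plane) : pd j (fun y => -f y) x = -pd j f x := by
  simp [pd]

theorem differentiableAt_angGrad (k : Fin 2) {x : Plane} (hx : x ≠ 0) :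
    DifferentiableAt ℝ (fun y : Plane => (angGrad k y : ℂ)) x := by
  rw [angGrad_eq]
  fin_cases k
  · have := (differentiableAt_coord_div 1 hx).neg
    refine this.congr_of_eventuallyEq (Eventually.of_forall fun y => ?_)
    simp
  · exact (differentiableAt_coord_div 0 hx).congr_of_eventuallyEq
      (Eventually.of_forall fun y => by simp)

/-- The angle is harmonic away from the origin. With the harmonicity of the logarithm of the radius,
proved next, this removes the divergence terms from the squared operator. -/
theorem sum_pd_angGrad {x : Plane} (hx : x ≠ 0) :
    ∑ j, pd j (fun y => (angGrad j y : ℂ)) x = 0 := by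
  have e0 : (fun y => (angGrad 0 y : ℂ)) = fun y : Plane => -((y 1 / ‖y‖ ^ 2 : ℝ) : ℂ) := by
    funext y; rw [angGrad_eq]; simp
  have e1 : (fun y => (angGrad 1 y : ℂ)) = fun y : Plane => ((y 0 / ‖y‖ ^ 2 : ℝ) : ℂ) := by
    funext y; rw [angGrad_eq]; simp
  rw [Fin.sum_univ_two, e0, e1, pd_neg, pd_coord_div 0 1 hx, pd_coord_div 1 0 hx]
  simp only [Fin.isValue, one_ne_zero, if_false, zero_ne_one]
  push_cast
  ring

theorem sum_pd_coord_div {x : Plane} (hx : x ≠ 0) :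
    ∑ j, pd j (fun y : Plane => ((y j / ‖y‖ ^ 2 : ℝ) : ℂ)) x = 0 := by
  have hn := norm_ne_zero_iff.2 hx
  rw [Fin.sum_univ_two, pd_coord_div 0 0 hx, pd_coord_div 1 1 hx, ← Complex.ofReal_add,
    ← Complex.ofReal_zero]
  congr 1
  simp only [if_true]
  have := norm_sq_eq x
  field_simp
  linear_combination 2 * this

/-- The action of the magnetic operator on a mode with a radial factor. -/
theorem sum_magneticDerivFun_mode (hρ : ∀ i, ‖s i‖ < ρ) (hρ0 : 0 < ρ) (m : ℤ) {V : ℝ → ℂ}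
    (hV : ContDiff ℝ ∞ V) {x : Plane} (hx : ρ < ‖x‖) :
    ∑ j, magneticDerivFun s α j (magneticDerivFun s α j
      fun y => mode s α m y * radial V y) x = mode s α m x * ((‖x‖ : ℂ) ^ 2)⁻¹ *
        (((m : ℂ) + flux α) ^ 2 * radial V x - radial (deriv (deriv V)) x) := by
  have hx0 : x ≠ 0 := ne_zero_of_lt hρ0 hx
  have hV1 : ContDiff ℝ ∞ (deriv V) := ContDiff.iterate_deriv 1 hV
  set μ : ℂ := (m : ℂ) + flux α with hμ
  set w : Fin 2 → Plane → ℂ := fun j y => -Complex.I * (((y j / ‖y‖ ^ 2 : ℝ) : ℂ) *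
    radial (deriv V) y) + μ * ((angGrad j y : ℂ) * radial V y) with hw
  have hloc : ∀ j, magneticDerivFun s α j (magneticDerivFun s α j
      fun y => mode s α m y * radial V y) x =
      magneticDerivFun s α j (fun y => mode s α m y * w j y) x := fun j => by
    have h1 : (magneticDerivFun s α j fun y => mode s α m y * radial V y) =ᶠ[𝓝 x]
        fun y => mode s α m y * w j y := by
      filter_upwards [(isOpen_lt continuous_const continuous_norm).mem_nhds hx] with y hy
      have hy0 : y ≠ 0 := ne_zero_of_lt hρ0 hy
      rw [magneticDerivFun_mode_mul α hρ hρ0 m hy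
        ((contDiffAt_radial hV hy0).differentiableAt (by simp)), pd_radial hV hy0]
      simp only [hw]
      ring
    have h2 := h1.self_of_nhds
    simp only at h2
    rw [magneticDerivFun, h1.fderiv_eq, h2, magneticDerivFun]
  have dr := (contDiffAt_radial hV hx0).differentiableAt (n := ∞) (by simp)
  have dr1 := (contDiffAt_radial hV1 hx0).differentiableAt (n := ∞) (by simp)
  have dc : ∀ j : Fin 2, DifferentiableAt ℝ (fun y : Plane => ((y j / ‖y‖ ^ 2 : ℝ) : ℂ) *
    radial (deriv V) y) x := fun j => (differentiableAt_coord_div j hx0).mul dr1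
  have da : ∀ j : Fin 2, DifferentiableAt ℝ (fun y : Plane => (angGrad j y : ℂ) * radial V y) x :=
    fun j => (differentiableAt_angGrad j hx0).mul dr
  have dw : ∀ j, DifferentiableAt ℝ (w j) x := fun j =>
    ((dc j).const_mul (-Complex.I)).add ((da j).const_mul μ)
  have pw : ∀ j, pd j (w j) x = -Complex.I * (((x j / ‖x‖ ^ 2 : ℝ) : ℂ) *
      (((x j / ‖x‖ ^ 2 : ℝ) : ℂ) * radial (deriv (deriv V)) x) +
      pd j (fun y : Plane => ((y j / ‖y‖ ^ 2 : ℝ) : ℂ)) x * radial (deriv V) x) +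
      μ * ((angGrad j x : ℂ) * (((x j / ‖x‖ ^ 2 : ℝ) : ℂ) * radial (deriv V) x) +
      pd j (fun y => (angGrad j y : ℂ)) x * radial V x) := fun j => by
    have e1 : HasDerivAt (fun t => w j (cline j x t)) _ 0 :=
      ((hasDerivAt_cline (dc j) j).const_mul (-Complex.I)).add
        ((hasDerivAt_cline (da j) j).const_mul μ)
    rw [pd_eq_of_hasDerivAt (dw j) e1, pd_mul (differentiableAt_coord_div j hx0) dr1,
      pd_mul (differentiableAt_angGrad j hx0) dr, pd_radial hV hx0, pd_radial hV1 hx0]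
  have hsum : ∀ j, magneticDerivFun s α j (fun y => mode s α m y * w j y) x = _ := fun j =>
    magneticDerivFun_mode_mul α hρ hρ0 m hx (dw j) j
  simp only [hloc, hsum, ← hμ, pw]
  simp only [hw]
  have s1 := sum_pd_angGrad hx0
  have s2 := sum_pd_coord_div hx0
  have hn : (‖x‖ : ℂ) ≠ 0 := by exact_mod_cast norm_ne_zero_iff.2 hx0
  have hsq : (‖x‖ : ℂ) ^ 2 = (x 0 : ℂ) ^ 2 + (x 1 : ℂ) ^ 2 := by exact_mod_cast norm_sq_eq x
  rw [Fin.sum_univ_two] at s1 s2 ⊢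
  have s1' := eq_neg_of_add_eq_zero_right s1
  have s2' := eq_neg_of_add_eq_zero_right s2
  rw [s1', s2', angGrad_zero, angGrad_one]
  push_cast
  generalize pd 0 (fun y => (angGrad 0 y : ℂ)) x = p
  generalize pd 0 (fun y : Plane => ((y 0 / ‖y‖ ^ 2 : ℝ) : ℂ)) x = q
  generalize radial (deriv (deriv V)) x = V2
  generalize radial (deriv V) x = V1
  generalize radial V x = V0
  generalize mode s α m x = E
  have hr4 : (‖x‖ : ℂ) ^ 4 = ((x 0 : ℂ) ^ 2 + (x 1 : ℂ) ^ 2) * (‖x‖ : ℂ) ^ 2 := by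
    rw [← hsq]; ring
  field_simp
  rw [hr4, hsq]
  ring_nf
  simp only [Complex.I_sq]
  ring

end

section

/-! ### Integrals of radial functions -/

variable {n : ℕ} (s : Fin n → Plane) (α : Fin n → ℝ)

theorem volume_unitBall : (volume : Measure Plane).real (Metric.ball 0 1) = Real.pi := by
  rw [Measure.real, EuclideanSpace.volume_ball_fin_two]
  simp [Real.pi_pos.le]

/-- In polar coordinates with r = e^t the measure |x|⁻² dx is dt dθ. The weight |x|⁻² carried by
single-mode functions is chosen to match this. -/
theorem integral_log_norm (h : ℝ → ℂ) :
    ∫ x : Plane, ((‖x‖ ^ 2)⁻¹ : ℝ) * h (Real.log ‖x‖) = 2 * Real.pi * ∫ t, h t := by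
  have h1 := integral_fun_norm_addHaar (volume : Measure Plane)
    (fun r : ℝ => (((r ^ 2)⁻¹ : ℝ) : ℂ) * h (Real.log r))
  have h2 := integral_image_eq_integral_abs_deriv_smul (s := univ) MeasurableSet.univ
    (fun x _ => (Real.hasDerivAt_exp x).hasDerivWithinAt) Real.exp_injective.injOn
    (fun r : ℝ => r ^ (Module.finrank ℝ Plane - 1) • ((((r ^ 2)⁻¹ : ℝ) : ℂ) * h (Real.log r)))
  rw [image_univ, Real.range_exp] at h2
  rw [h1, h2, setIntegral_univ, volume_unitBall]
  have e : ∀ x : ℝ, |Real.exp x| • (Real.exp x ^ (Module.finrank ℝ Plane - 1) •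
      ((((Real.exp x ^ 2)⁻¹ : ℝ) : ℂ) * h (Real.log (Real.exp x)))) = h x := fun x => by
    rw [Real.log_exp, abs_of_pos (Real.exp_pos x), smul_smul, Complex.real_smul, ← mul_assoc,
      ← Complex.ofReal_mul]
    have : Real.exp x * Real.exp x ^ (Module.finrank ℝ Plane - 1) * (Real.exp x ^ 2)⁻¹ = 1 := by
      simp only [finrank_euclideanSpace, Fintype.card_fin, Nat.add_one_sub_one, pow_one]
      have := Real.exp_pos x
      field_simp
    rw [this, Complex.ofReal_one, one_mul]
  simp only [e]
  simp only [finrank_euclideanSpace, Fintype.card_fin, nsmul_eq_mul, Complex.real_smul]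
  push_cast
  ring

theorem integrable_log_norm {h : ℝ → ℂ} (hh : Integrable h) :
    Integrable fun x : Plane => ((‖x‖ ^ 2)⁻¹ : ℝ) * h (Real.log ‖x‖) := by
  refine (integrable_fun_norm_addHaar (volume : Measure Plane)
    (f := fun r : ℝ => (((r ^ 2)⁻¹ : ℝ) : ℂ) * h (Real.log r))).2 ?_
  have h2 := integrableOn_image_iff_integrableOn_abs_deriv_smul (s := univ) MeasurableSet.univ
    (fun x _ => (Real.hasDerivAt_exp x).hasDerivWithinAt) Real.exp_injective.injOn
    (fun r : ℝ => r ^ (Module.finrank ℝ Plane - 1) • ((((r ^ 2)⁻¹ : ℝ) : ℂ) * h (Real.log r)))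
  rw [image_univ, Real.range_exp] at h2
  rw [h2, integrableOn_univ]
  refine hh.congr (Eventually.of_forall fun x => ?_)
  simp only
  rw [Real.log_exp, abs_of_pos (Real.exp_pos x), smul_smul, Complex.real_smul, ← mul_assoc,
    ← Complex.ofReal_mul]
  have : Real.exp x * Real.exp x ^ (Module.finrank ℝ Plane - 1) * (Real.exp x ^ 2)⁻¹ = 1 := by
    simp only [finrank_euclideanSpace, Fintype.card_fin, Nat.add_one_sub_one, pow_one]
    have := Real.exp_pos x
    field_simp
  rw [this, Complex.ofReal_one, one_mul]

theorem integral_exp_neg_mul_abs {c : ℝ} (hc : 0 < c) (t₀ : ℝ) :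
    Integrable (fun t : ℝ => Real.exp (-c * |t₀ - t|)) ∧
      ∫ t : ℝ, Real.exp (-c * |t₀ - t|) = 2 / c := by
  have h0 : Integrable (fun t : ℝ => Real.exp (-c * |t|)) := by
    rw [← integrableOn_univ, ← Iic_union_Ioi (a := (0 : ℝ))]
    refine IntegrableOn.union ?_ ?_
    · refine (integrableOn_exp_mul_Iic hc 0).congr_fun (fun x hx => ?_) measurableSet_Iic
      simp [abs_of_nonpos (mem_Iic.1 hx)]
    · refine (integrableOn_exp_mul_Ioi (neg_lt_zero.2 hc) 0).congr_fun (fun x hx => ?_)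
        measurableSet_Ioi
      simp [abs_of_pos (mem_Ioi.1 hx)]
  refine ⟨(h0.comp_sub_left t₀), ?_⟩
  rw [integral_sub_left_eq_self (fun t : ℝ => Real.exp (-c * |t|)) volume t₀,
    integral_comp_abs (f := fun x => Real.exp (-c * x))]
  have := integral_exp_mul_Ioi (a := -c) (by linarith) 0
  rw [this]
  simp
  field_simp

/-- The integral of an angular mode with nonzero index against a radial function vanishes. -/
theorem integral_angular_zpow {k : ℤ} (hk : k ≠ 0) (h : ℝ → ℂ) :
    ∫ x : Plane, angular x ^ k * h ‖x‖ = 0 := by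
  -- Rotation by the angle π/k multiplies the k-th angular power by -1 and leaves the radial factor
  -- and the measure unchanged.
  obtain ⟨c, hc⟩ : ∃ c : Circle, (c : ℂ) ^ k ≠ 1 := by
    refine ⟨Circle.exp (Real.pi / k), ?_⟩
    rw [Circle.coe_exp, ← Complex.exp_int_mul]
    have hk' : (k : ℂ) ≠ 0 := by exact_mod_cast hk
    have : (k : ℂ) * (((Real.pi / k : ℝ) : ℂ) * Complex.I) = Real.pi * Complex.I := by
      push_cast
      field_simp
    rw [this, Complex.exp_pi_mul_I]
    norm_num
  let e : Plane ≃ₗᵢ[ℝ] Plane := (zc.trans (rotation c)).trans zc.symm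
  have he : ∀ x, zc (e x) = c * zc x := fun x => by
    simp [e, rotation_apply]
  have h1 := (e.measurePreserving).integral_comp e.toHomeomorph.measurableEmbedding
    (fun x : Plane => angular x ^ k * h ‖x‖)
  have h2 : ∀ x, angular (e x) ^ k * h ‖e x‖ = (c : ℂ) ^ k * (angular x ^ k * h ‖x‖) := fun x => by
    rw [angular, he, e.norm_map, mul_div_assoc, mul_zpow, ← angular, mul_assoc]
  simp only [h2] at h1
  rw [integral_const_mul] at h1
  have h3 : ((c : ℂ) ^ k - 1) * ∫ x : Plane, angular x ^ k * h ‖x‖ = 0 := by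
    rw [sub_mul, h1]; ring
  exact (mul_eq_zero.1 h3).resolve_left (sub_ne_zero.2 hc)

end

section

/-! ### The outgoing Green operator outside a disc -/

variable {n : ℕ} (s : Fin n → Plane) (α : Fin n → ℝ)

/-- The indicator function of a set. -/
def ind (A : Set Plane) : Plane → ℂ := A.indicator 1

theorem ind_mul_ind (A B : Set Plane) (x : Plane) : ind A x * ind B x = ind (A ∩ B) x := by
  classical
  by_cases h1 : x ∈ A <;> by_cases h2 : x ∈ B <;> simp [ind, h1, h2]

theorem ind_of_mem {A : Set Plane} {x : Plane} (h : x ∈ A) : ind A x = 1 := by simp [ind, h]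

theorem ind_of_notMem {A : Set Plane} {x : Plane} (h : x ∉ A) : ind A x = 0 := by simp [ind, h]

theorem norm_ind_le (A : Set Plane) (x : Plane) : ‖ind A x‖ ≤ 1 := by
  by_cases h : x ∈ A <;> simp [ind, h]

theorem measurable_ind {A : Set Plane} (hA : MeasurableSet A) : Measurable (ind A) :=
  measurable_one.indicator hA

theorem memLp_ind {A : Set Plane} (hA : MeasurableSet A) : MemLp (ind A) ⊤ volume :=
  memLp_top_of_bound (measurable_ind hA).aestronglyMeasurable 1 (Eventually.of_forall (norm_ind_le A))

/-- The open annulus. -/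
def annulus (a b : ℝ) : Set Plane := {x | a < ‖x‖ ∧ ‖x‖ < b}

theorem isOpen_annulus (a b : ℝ) : IsOpen (annulus a b) :=
  (isOpen_lt continuous_const continuous_norm).inter (isOpen_lt continuous_norm continuous_const)

theorem measurableSet_annulus (a b : ℝ) : MeasurableSet (annulus a b) :=
  (isOpen_annulus a b).measurableSet

theorem annulus_subset {a b a' b' : ℝ} (h1 : a' ≤ a) (h2 : b ≤ b') :
    annulus a b ⊆ annulus a' b' := fun _ hx => ⟨h1.trans_lt hx.1, hx.2.trans_le h2⟩

/-- The argument of the Bessel functions at the logarithmic radius `t`. -/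
def shift (ζ : ℂ) (t : ℝ) : ℂ := ζ + t - (Real.pi / 2 : ℝ) * Complex.I

/-- The order of the Bessel functions for an angular mode. -/
def order (m : ℤ) : ℝ := |m + flux α|

theorem order_nonneg (m : ℤ) : 0 ≤ order α m := abs_nonneg _

/-- The outgoing Green function of the radial equation. -/
def greenRadial (ν : ℝ) (ζ : ℂ) (t t' : ℝ) : ℂ :=
  besI ν (shift ζ (min t t')) * besK ν (shift ζ (max t t'))

/-- The contribution of an angular mode to the outgoing Green function. -/
def modeKernel (A B : Set Plane) (m : ℤ) (ζ : ℂ) (x y : Plane) : ℂ :=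
  ind A x * (mode s α m x * greenRadial (order α m) ζ (Real.log ‖x‖) (Real.log ‖y‖) *
    conj (mode s α m y) * ((2 * Real.pi)⁻¹ : ℝ)) * ind B y

/-- The integral operator of an angular mode. -/
def modeOp (A B : Set Plane) (m : ℤ) (ζ : ℂ) : L2 →L[ℂ] L2 := kernelOp (modeKernel s α A B m ζ)

theorem differentiable_besI {ν : ℝ} (hν : 0 ≤ ν) : Differentiable ℂ (besI ν) :=
  fun x => (hasDerivAt_besI hν x).differentiableAt

theorem continuous_shift : Continuous fun p : ℂ × ℝ => shift p.1 p.2 := by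
  unfold shift
  fun_prop

theorem differentiable_shift (t : ℝ) : Differentiable ℂ fun ζ => shift ζ t := by
  unfold shift
  fun_prop

theorem continuous_greenRadial {ν : ℝ} (hν : 0 ≤ ν) :
    Continuous fun p : ℂ × ℝ × ℝ => greenRadial ν p.1 p.2.1 p.2.2 := by
  have h1 := (differentiable_besI hν).continuous
  have h2 := (besK_spec hν).1.continuous
  have h3 : Continuous fun p : ℂ × ℝ × ℝ => shift p.1 (min p.2.1 p.2.2) :=
    continuous_shift.comp (by fun_prop : Continuous fun p : ℂ × ℝ × ℝ => (p.1, min p.2.1 p.2.2))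
  have h4 : Continuous fun p : ℂ × ℝ × ℝ => shift p.1 (max p.2.1 p.2.2) :=
    continuous_shift.comp (by fun_prop : Continuous fun p : ℂ × ℝ × ℝ => (p.1, max p.2.1 p.2.2))
  exact (h1.comp h3).mul (h2.comp h4)

theorem differentiable_greenRadial {ν : ℝ} (hν : 0 ≤ ν) (t t' : ℝ) :
    Differentiable ℂ fun ζ => greenRadial ν ζ t t' :=
  ((differentiable_besI hν).comp (differentiable_shift _)).mul
    ((besK_spec hν).1.comp (differentiable_shift _))

theorem exists_norm_greenRadial_le {ν : ℝ} (hν : 0 ≤ ν) (z₀ : ℂ) (r p q : ℝ) :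
    ∃ C, 0 ≤ C ∧ ∀ ζ ∈ Metric.closedBall z₀ r, ∀ t ∈ Icc p q, ∀ t' ∈ Icc p q,
      ‖greenRadial ν ζ t t'‖ ≤ C := by
  obtain ⟨C, hC⟩ := ((isCompact_closedBall z₀ r).prod ((isCompact_Icc (a := p) (b := q)).prod
    (isCompact_Icc (a := p) (b := q)))).exists_bound_of_continuousOn
      (continuous_greenRadial hν).continuousOn
  exact ⟨max C 0, le_max_right _ _, fun ζ hζ t ht t' ht' =>
    (hC (ζ, t, t') ⟨hζ, ht, ht'⟩).trans (le_max_left _ _)⟩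

theorem measurable_mode (m : ℤ) : Measurable (mode s α m) := by
  have hz : Measurable fun x => zc x := zc.continuous.measurable
  have hg : Measurable (gaugePhase s α) := by
    refine Finset.measurable_fun_sum _ fun i _ => measurable_const.mul ?_
    exact Complex.measurable_im.comp (Complex.measurable_log.comp
      (measurable_const.sub (measurable_const.div hz)))
  have ha : Measurable angular := hz.div (Complex.measurable_ofReal.comp measurable_norm)
  exact (Complex.measurable_exp.comp (measurable_const.mul
    (Complex.measurable_ofReal.comp hg))).mul (ha.pow_const m)

variable {A B : Set Plane} {ρ N : ℝ}

theorem log_mem_Icc (hρ0 : 0 < ρ) {x : Plane} (hx : x ∈ annulus ρ N) :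
    Real.log ‖x‖ ∈ Icc (Real.log ρ) (Real.log N) :=
  ⟨Real.log_le_log hρ0 hx.1.le, Real.log_le_log (hρ0.trans hx.1) hx.2.le⟩

theorem measurable_modeKernel (hA : MeasurableSet A) (hB : MeasurableSet B) (m : ℤ) (ζ : ℂ) :
    Measurable (Function.uncurry (modeKernel s α A B m ζ)) := by
  have hE := measurable_mode s α m
  have hl : Measurable fun x : Plane => Real.log ‖x‖ := Real.measurable_log.comp measurable_norm
  have hg : Measurable fun p : Plane × Plane =>
      greenRadial (order α m) ζ (Real.log ‖p.1‖) (Real.log ‖p.2‖) := by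
    have h0 : Measurable fun p : Plane × Plane => (ζ, Real.log ‖p.1‖, Real.log ‖p.2‖) :=
      measurable_const.prodMk ((hl.comp measurable_fst).prodMk (hl.comp measurable_snd))
    have h1 := (continuous_greenRadial (order_nonneg α m)).measurable
    have h2 := h1.comp h0
    simp only [Function.comp_def] at h2
    exact h2
  have h1 : Measurable fun p : Plane × Plane => ind A p.1 := (measurable_ind hA).comp measurable_fst
  have h2 : Measurable fun p : Plane × Plane => ind B p.2 := (measurable_ind hB).comp measurable_snd
  have h3 : Measurable fun p : Plane × Plane => mode s α m p.1 := hE.comp measurable_fst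
  have h4 : Measurable fun p : Plane × Plane => conj (mode s α m p.2) :=
    Complex.continuous_conj.measurable.comp (hE.comp measurable_snd)
  have h5 := (h1.mul (((h3.mul hg).mul h4).mul_const (((2 * Real.pi)⁻¹ : ℝ) : ℂ))).mul h2
  simp only [Function.uncurry_def, modeKernel]
  exact h5

theorem norm_modeKernel_le (hρ0 : 0 < ρ) (hA' : A ⊆ annulus ρ N) (hB' : B ⊆ annulus ρ N) (m : ℤ)
    (ζ : ℂ) {x y : Plane} {C : ℝ} (hC : 0 ≤ C) (h : x ∈ A → y ∈ B →
      ‖greenRadial (order α m) ζ (Real.log ‖x‖) (Real.log ‖y‖)‖ ≤ C) :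
    ‖modeKernel s α A B m ζ x y‖ ≤ C * (2 * Real.pi)⁻¹ := by
  have hp := Real.pi_pos
  by_cases hx : x ∈ A
  swap
  · rw [modeKernel, ind_of_notMem hx, zero_mul, zero_mul, norm_zero]; positivity
  by_cases hy : y ∈ B
  swap
  · rw [modeKernel, ind_of_notMem hy, mul_zero, norm_zero]; positivity
  rw [modeKernel, ind_of_mem hx, ind_of_mem hy, one_mul, mul_one, norm_mul, norm_mul, norm_mul,
    RCLike.norm_conj, norm_mode s α (ne_zero_of_lt hρ0 (hA' hx).1),
    norm_mode s α (ne_zero_of_lt hρ0 (hB' hy).1), one_mul, mul_one, Complex.norm_real,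
    Real.norm_of_nonneg (by positivity)]
  exact mul_le_mul_of_nonneg_right (h hx hy) (by positivity)

theorem two_pi_inv_le_one : (2 * Real.pi)⁻¹ ≤ 1 := by
  apply inv_le_one_of_one_le₀
  linarith [Real.pi_gt_three]

theorem isKernel_modeKernel (hρ0 : 0 < ρ) (hA : MeasurableSet A) (hB : MeasurableSet B)
    (hA' : A ⊆ annulus ρ N) (hB' : B ⊆ annulus ρ N) (m : ℤ) (ζ : ℂ) {C : ℝ} (hC : 0 ≤ C)
    (h : ∀ x ∈ A, ∀ y ∈ B, ‖greenRadial (order α m) ζ (Real.log ‖x‖) (Real.log ‖y‖)‖ ≤ C) :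
    IsKernel N C (modeKernel s α A B m ζ) where
  measurable := measurable_modeKernel s α hA hB m ζ
  norm_le x y := (norm_modeKernel_le s α hρ0 hA' hB' m ζ hC fun hx hy => h x hx y hy).trans
    (mul_le_of_le_one_right hC two_pi_inv_le_one)
  left x y hx := by
    rw [modeKernel, ind_of_notMem fun h => (hA' h).2.not_gt hx, zero_mul, zero_mul]
  right x y hy := by
    rw [modeKernel, ind_of_notMem fun h => (hB' h).2.not_gt hy, mul_zero]

theorem exists_isKernel_modeKernel (hρ0 : 0 < ρ) (hA : MeasurableSet A) (hB : MeasurableSet B)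
    (hA' : A ⊆ annulus ρ N) (hB' : B ⊆ annulus ρ N) (m : ℤ) (z₀ : ℂ) (r : ℝ) :
    ∃ C, ∀ ζ ∈ Metric.closedBall z₀ r, IsKernel N C (modeKernel s α A B m ζ) := by
  obtain ⟨C, h0, hC⟩ := exists_norm_greenRadial_le (order_nonneg α m) z₀ r (Real.log ρ) (Real.log N)
  exact ⟨C, fun ζ hζ => isKernel_modeKernel s α hρ0 hA hB hA' hB' m ζ h0 fun x hx y hy =>
    hC ζ hζ _ (log_mem_Icc hρ0 (hA' hx)) _ (log_mem_Icc hρ0 (hB' hy))⟩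

theorem differentiable_modeOp (hρ0 : 0 < ρ) (hA : MeasurableSet A) (hB : MeasurableSet B)
    (hA' : A ⊆ annulus ρ N) (hB' : B ⊆ annulus ρ N) (m : ℤ) :
    Differentiable ℂ (modeOp s α A B m) := by
  refine differentiable_kernelOp (fun z₀ =>
    exists_isKernel_modeKernel s α hρ0 hA hB hA' hB' m z₀ 3) fun x y => ?_
  unfold modeKernel
  exact ((((differentiable_greenRadial (order_nonneg α m) _ _).const_mul _).mul_const _).mul_const
    _ |>.const_mul _).mul_const _

/-- The square of a row is at most (C/ν)² e^{-2ν|t - t'|} up to constants, and the integral of the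
exponential over t' is 1/ν. The row norm is thus of order ν^{-3/2}, which is summable over the
modes, whereas ν⁻¹ would not be. -/
theorem norm_modeOp_le_of_exp (hρ0 : 0 < ρ) (hA : MeasurableSet A) (hB : MeasurableSet B)
    (hA' : A ⊆ annulus ρ N) (hB' : B ⊆ annulus ρ N) (m : ℤ) (ζ : ℂ) {C : ℝ} (hC : 0 ≤ C)
    (hν : 0 < order α m) (h : ∀ x ∈ A, ∀ y ∈ B,
      ‖greenRadial (order α m) ζ (Real.log ‖x‖) (Real.log ‖y‖)‖ ≤
        C / order α m * Real.exp (-order α m * |Real.log ‖x‖ - Real.log ‖y‖|)) :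
    ‖modeOp s α A B m ζ‖ ≤ C * |N| * √(discArea N) * (1 / order α m ^ (3 / 2 : ℝ)) := by
  set ν := order α m
  have hp := Real.pi_pos
  have hk : IsKernel N (C / ν) (modeKernel s α A B m ζ) :=
    isKernel_modeKernel s α hρ0 hA hB hA' hB' m ζ (by positivity) fun x hx y hy =>
      (h x hx y hy).trans (mul_le_of_le_one_right (by positivity) (Real.exp_le_one_iff.2 (by
        have := abs_nonneg (Real.log ‖x‖ - Real.log ‖y‖)
        nlinarith)))
  have hb : 0 ≤ C * |N| * (1 / ν ^ (3 / 2 : ℝ)) := by positivity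
  refine (norm_kernelOp_le hk hb fun x => ?_).trans (le_of_eq (by ring))
  obtain ⟨hi, hv⟩ := integral_exp_neg_mul_abs (c := 2 * ν) (by positivity) (Real.log ‖x‖)
  set e : ℝ → ℝ := fun t => Real.exp (-(2 * ν) * |Real.log ‖x‖ - t|) with he
  set D : ℝ := (C / ν * (2 * Real.pi)⁻¹) ^ 2 * N ^ 2 with hD
  have hi2 : Integrable fun y : Plane => (‖y‖ ^ 2)⁻¹ * e (Real.log ‖y‖) := by
    have := (integrable_log_norm hi.ofReal).re
    refine this.congr (Eventually.of_forall fun y => ?_)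
    simp only [RCLike.re_to_complex]
    rw [Complex.re_ofReal_mul]
    rfl
  have hv2 : ∫ y : Plane, (‖y‖ ^ 2)⁻¹ * e (Real.log ‖y‖) = 2 * Real.pi * (2 / (2 * ν)) := by
    have h1 := integral_log_norm fun t => (e t : ℂ)
    rw [integral_complex_ofReal, hv] at h1
    have h2 : ∫ x : Plane, (((‖x‖ ^ 2)⁻¹ : ℝ) : ℂ) * (e (Real.log ‖x‖) : ℂ) =
        ((∫ y : Plane, (‖y‖ ^ 2)⁻¹ * e (Real.log ‖y‖) : ℝ) : ℂ) := by
      rw [← integral_complex_ofReal]; simp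
    rw [h2] at h1
    exact_mod_cast h1
  calc ∫⁻ y, ‖modeKernel s α A B m ζ x y‖ₑ ^ 2
      ≤ ∫⁻ y : Plane, ENNReal.ofReal (D * ((‖y‖ ^ 2)⁻¹ * e (Real.log ‖y‖))) := by
        refine lintegral_mono fun y => ?_
        rw [← ofReal_norm, ← ENNReal.ofReal_pow (norm_nonneg _)]
        refine ENNReal.ofReal_le_ofReal ?_
        by_cases hy : y ∈ B
        swap
        · rw [modeKernel, ind_of_notMem hy, mul_zero, norm_zero, zero_pow two_ne_zero]
          have : 0 ≤ e (Real.log ‖y‖) := (Real.exp_pos _).le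
          positivity
        have h1 := norm_modeKernel_le s α hρ0 hA' hB' m ζ (x := x) (y := y)
          (by positivity) fun hx hy => h x hx y hy
        have hy0 : 0 < ‖y‖ := hρ0.trans (hB' hy).1
        have hyN : ‖y‖ < N := (hB' hy).2
        have h2 : 1 ≤ N ^ 2 * (‖y‖ ^ 2)⁻¹ := by
          rw [← div_eq_mul_inv, one_le_div (by positivity)]
          gcongr
        calc ‖modeKernel s α A B m ζ x y‖ ^ 2 ≤ _ := pow_le_pow_left₀ (norm_nonneg _) h1 2
          _ = (C / ν * (2 * Real.pi)⁻¹) ^ 2 * e (Real.log ‖y‖) * 1 := by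
            have : e (Real.log ‖y‖) = Real.exp (-ν * |Real.log ‖x‖ - Real.log ‖y‖|) ^ 2 := by
              rw [he, ← Real.exp_nat_mul]
              push_cast
              ring_nf
            rw [this]
            ring
          _ ≤ (C / ν * (2 * Real.pi)⁻¹) ^ 2 * e (Real.log ‖y‖) * (N ^ 2 * (‖y‖ ^ 2)⁻¹) := by
            have : 0 ≤ e (Real.log ‖y‖) := (Real.exp_pos _).le
            gcongr
          _ = _ := by rw [hD]; ring
    _ = ENNReal.ofReal (D * (2 * Real.pi * (2 / (2 * ν)))) := by
        rw [← ofReal_integral_eq_lintegral_ofReal (hi2.const_mul D) (Eventually.of_forall fun y => by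
          have : 0 ≤ e (Real.log ‖y‖) := (Real.exp_pos _).le
          positivity), integral_const_mul, hv2]
    _ ≤ _ := by
        refine ENNReal.ofReal_le_ofReal ?_
        have h3 : (ν ^ (3 / 2 : ℝ)) ^ 2 = ν ^ 3 := by
          rw [← Real.rpow_natCast, ← Real.rpow_mul hν.le]
          norm_num
        have h4 : (C * |N| * (1 / ν ^ (3 / 2 : ℝ))) ^ 2 = C ^ 2 * N ^ 2 / ν ^ 3 := by
          rw [mul_pow, mul_pow, div_pow, h3, sq_abs]; ring
        have h5 : D * (2 * Real.pi * (2 / (2 * ν))) = C ^ 2 * N ^ 2 / ν ^ 3 * (2 * Real.pi)⁻¹ := by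
          rw [hD]
          field_simp
        rw [h4, h5]
        exact mul_le_of_le_one_right (by positivity) two_pi_inv_le_one

theorem finite_order_lt (M : ℝ) : {m : ℤ | order α m < M}.Finite := by
  refine (finite_Icc (⌊-M - flux α⌋) (⌈M - flux α⌉)).subset fun m hm => ?_
  have hm' : |(m : ℝ) + flux α| < M := hm
  rw [abs_lt] at hm'
  constructor
  · exact_mod_cast (Int.floor_le (-M - flux α)).trans (by linarith : -M - flux α ≤ (m : ℝ))
  · exact_mod_cast (by linarith : (m : ℝ) ≤ M - flux α).trans (Int.le_ceil (M - flux α))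

/-- Finitely many modes have small order and are bounded by compactness; the others obey the uniform
large-order estimate. The majorant is the same for all ζ in the disc, so the sum inherits
holomorphy. -/
theorem exists_norm_modeOp_le (hρ0 : 0 < ρ) (hA : MeasurableSet A) (hB : MeasurableSet B)
    (hA' : A ⊆ annulus ρ N) (hB' : B ⊆ annulus ρ N) (r : ℝ) :
    ∃ u : ℤ → ℝ, Summable u ∧ ∀ m, ∀ ζ ∈ Metric.ball (0 : ℂ) r, ‖modeOp s α A B m ζ‖ ≤ u m := by
  choose C hC using fun m => exists_isKernel_modeKernel s α hρ0 hA hB hA' hB' m 0 r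
  -- This bounds from above the real parts ζ + log r, and in absolute value the imaginary parts
  -- after the translation by -π/2, for all arguments that occur.
  set R : ℝ := |r| + |Real.log N| + Real.pi with hR
  have hR0 : 0 ≤ R := by have := Real.pi_pos; positivity
  set M : ℝ := max 1 (Real.exp (2 * (R + 1))) with hM
  set D : ℝ := 8 * (6 + 4 * R) * |N| * √(discArea N) with hD
  have hf : Summable fun m : ℤ => if order α m < M then |C m| * discArea N else 0 := by
    refine summable_of_hasFiniteSupport ((finite_order_lt α M).subset fun m hm => ?_)
    by_contra h
    exact hm (if_neg h)
  have hs : Summable fun m : ℤ => D * (1 / order α m ^ (3 / 2 : ℝ)) :=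
    ((Real.summable_one_div_int_add_rpow (flux α) (3 / 2)).2 (by norm_num)).mul_left D
  refine ⟨_, hf.add hs, fun m ζ hζ => ?_⟩
  have hD0 : 0 ≤ D := by positivity
  by_cases hm : order α m < M
  · have h1 := norm_kernelOp_le' (hC m ζ (Metric.ball_subset_closedBall hζ))
    have h2 : 0 ≤ D * (1 / order α m ^ (3 / 2 : ℝ)) := by
      have := order_nonneg α m
      positivity
    simp only [if_pos hm]
    calc ‖modeOp s α A B m ζ‖ ≤ C m * discArea N := h1
      _ ≤ |C m| * discArea N := mul_le_mul_of_nonneg_right (le_abs_self _) (discArea_nonneg N)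
      _ ≤ _ := by linarith
  · rw [not_lt] at hm
    simp only [if_neg hm.not_gt, zero_add]
    have h1 : 1 ≤ order α m := (le_max_left _ _).trans hm
    have h2 : Real.exp (2 * (R + 1)) ≤ order α m := (le_max_right _ _).trans hm
    refine norm_modeOp_le_of_exp s α hρ0 hA hB hA' hB' m ζ (by positivity) (by linarith)
      fun x hx y hy => ?_
    have hζ' : ‖ζ‖ ≤ |r| := by
      rw [mem_ball_zero_iff] at hζ
      exact hζ.le.trans (le_abs_self r)
    have hre := (Complex.abs_re_le_norm ζ).trans hζ'
    have him := (Complex.abs_im_le_norm ζ).trans hζ'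
    rw [abs_le] at hre him
    have hp := Real.pi_pos
    have hl := le_abs_self (Real.log N)
    have e1 : ∀ t, (shift ζ t).re = ζ.re + t := fun t => by simp [shift]
    have e2 : ∀ t, (shift ζ t).im = ζ.im - Real.pi / 2 := fun t => by simp [shift]
    have hx2 := (log_mem_Icc hρ0 (hA' hx)).2
    have hy2 := (log_mem_Icc hρ0 (hB' hy)).2
    have hl0 := abs_nonneg (Real.log N)
    have := norm_besI_mul_besK_le_of_large hR0 h1 h2
      (x := shift ζ (min (Real.log ‖x‖) (Real.log ‖y‖)))
      (y := shift ζ (max (Real.log ‖x‖) (Real.log ‖y‖)))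
      (by rw [e1]; linarith [min_le_left (Real.log ‖x‖) (Real.log ‖y‖)])
      (by rw [e1]; linarith [max_le hx2 hy2])
      (by rw [e2, abs_le]; constructor <;> linarith)
    rw [greenRadial, norm_mul]
    refine this.trans (le_of_eq ?_)
    congr 2
    rw [e1, e1, add_sub_add_left_eq_sub, neg_mul, ← mul_neg, neg_eq_iff_eq_neg.2]
    rw [neg_sub, max_sub_min_eq_abs, abs_sub_comm]

/-- The outgoing Green operator outside a disc, cut off to the sets `A` and `B`. -/
def green (A B : Set Plane) (ζ : ℂ) : L2 →L[ℂ] L2 := ∑' m, modeOp s α A B m ζ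

theorem hasSum_green (hρ0 : 0 < ρ) (hA : MeasurableSet A) (hB : MeasurableSet B)
    (hA' : A ⊆ annulus ρ N) (hB' : B ⊆ annulus ρ N) (ζ : ℂ) :
    HasSum (fun m => modeOp s α A B m ζ) (green s α A B ζ) := by
  obtain ⟨u, hu, h⟩ := exists_norm_modeOp_le s α hρ0 hA hB hA' hB' (‖ζ‖ + 1)
  exact (Summable.of_norm_bounded hu fun m => h m ζ (by simp)).hasSum

theorem differentiable_green (hρ0 : 0 < ρ) (hA : MeasurableSet A) (hB : MeasurableSet B)
    (hA' : A ⊆ annulus ρ N) (hB' : B ⊆ annulus ρ N) : Differentiable ℂ (green s α A B) := by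
  intro ζ
  obtain ⟨u, hu, h⟩ := exists_norm_modeOp_le s α hρ0 hA hB hA' hB' (‖ζ‖ + 1)
  have := Complex.differentiableOn_tsum_of_summable_norm hu (fun m =>
    (differentiable_modeOp s α hρ0 hA hB hA' hB' m).differentiableOn) Metric.isOpen_ball
    fun m w hw => h m w hw
  exact this.differentiableAt (Metric.isOpen_ball.mem_nhds (by simp))

/-- Cutting off the Green operator. -/
theorem bmul_green_bmul (hρ0 : 0 < ρ) (hA : MeasurableSet A) (hB : MeasurableSet B)
    (hA' : A ⊆ annulus ρ N) (hB' : B ⊆ annulus ρ N) {A₁ B₁ : Set Plane} (hA₁ : MeasurableSet A₁)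
    (hB₁ : MeasurableSet B₁) (ζ : ℂ) :
    bmul (ind A₁) ∘L green s α A B ζ ∘L bmul (ind B₁) = green s α (A₁ ∩ A) (B ∩ B₁) ζ := by
  have h1 := (hasSum_green s α hρ0 hA hB hA' hB' ζ).mapL
    ((ContinuousLinearMap.compL ℂ L2 L2 L2 (bmul (ind A₁))) ∘L
      ((ContinuousLinearMap.compL ℂ L2 L2 L2).flip (bmul (ind B₁))))
  have h2 := hasSum_green s α hρ0 (hA₁.inter hA) (hB.inter hB₁) (inter_subset_right.trans hA')
    (inter_subset_left.trans hB') ζ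
  refine h1.unique ?_
  convert! h2 using 1
  funext m
  obtain ⟨C, hC⟩ := exists_isKernel_modeKernel s α hρ0 hA hB hA' hB' m ζ 0
  obtain ⟨C', hC'⟩ := exists_isKernel_modeKernel s α hρ0 (hA₁.inter hA) (hB.inter hB₁)
    (inter_subset_right.trans hA') (inter_subset_left.trans hB') m ζ 0
  have e : modeKernel s α (A₁ ∩ A) (B ∩ B₁) m ζ =
      fun x y => ind A₁ x * modeKernel s α A B m ζ x y * ind B₁ y := by
    funext x y
    rw [modeKernel, modeKernel, ← ind_mul_ind, ← ind_mul_ind]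
    ring
  have h0 := hC' ζ (by simp)
  rw [e] at h0
  ext1 f
  change bmul (ind A₁) (modeOp s α A B m ζ (bmul (ind B₁) f)) = _
  rw [modeOp, bmul_kernelOp_bmul (hC ζ (by simp)) (memLp_ind hA₁) (memLp_ind hB₁) h0, ← e, modeOp]

end

section

/-! ### The radial equation -/

variable {n : ℕ} (s : Fin n → Plane) (α : Fin n → ℝ)

/-- The outgoing solution of the radial equation. -/
def radSol (ν : ℝ) (ζ : ℂ) (F : ℝ → ℂ) (t : ℝ) : ℂ := ∫ t', greenRadial ν ζ t t' * F t'

/-- Bootstrapping: if V and V' are k times continuously differentiable, so is the right side of the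
equation for V''. -/
theorem contDiff_of_ode {V W Q F : ℝ → ℂ} (h1 : ∀ t, HasDerivAt V (W t) t)
    (h2 : ∀ t, HasDerivAt W (Q t * V t - F t) t) (hQ : ContDiff ℝ ∞ Q) (hF : ContDiff ℝ ∞ F) :
    ContDiff ℝ ∞ V := by
  have e1 : deriv V = W := funext fun t => (h1 t).deriv
  have e2 : deriv W = fun t => Q t * V t - F t := funext fun t => (h2 t).deriv
  have d1 : Differentiable ℝ V := fun t => (h1 t).differentiableAt
  have d2 : Differentiable ℝ W := fun t => (h2 t).differentiableAt
  have key : ∀ k : ℕ, ContDiff ℝ k V ∧ ContDiff ℝ k W := by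
    intro k
    induction k with
    | zero => exact ⟨contDiff_zero.2 d1.continuous, contDiff_zero.2 d2.continuous⟩
    | succ k ih =>
      have hk : ((k + 1 : ℕ) : WithTop ℕ∞) = (k : WithTop ℕ∞) + 1 := by norm_cast
      rw [hk]
      refine ⟨contDiff_succ_iff_deriv.2 ⟨d1, by simp, by rw [e1]; exact ih.2⟩,
        contDiff_succ_iff_deriv.2 ⟨d2, by simp, ?_⟩⟩
      rw [e2]
      exact ((hQ.of_le (by exact_mod_cast le_top)).mul ih.1).sub
        (hF.of_le (by exact_mod_cast le_top))
  exact contDiff_infty.2 fun k => (key k).1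

/-! ### Variation of parameters for the radial equation. -/

section Radial

variable {ν : ℝ} {F : ℝ → ℂ}

theorem continuous_besI_shift (hν : 0 ≤ ν) (ζ : ℂ) : Continuous fun t => besI ν (shift ζ t) :=
  (differentiable_besI hν).continuous.comp (continuous_shift.comp (by fun_prop : Continuous
    fun t : ℝ => (ζ, t)))

theorem continuous_besK_shift (hν : 0 ≤ ν) (ζ : ℂ) : Continuous fun t => besK ν (shift ζ t) :=
  (besK_spec hν).1.continuous.comp (continuous_shift.comp (by fun_prop : Continuous
    fun t : ℝ => (ζ, t)))

theorem integrable_mul_of_compactSupport {g : ℝ → ℂ} (hg : Continuous g) (hF : Continuous F)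
    (hFc : HasCompactSupport F) : Integrable fun t => g t * F t :=
  (hg.mul hF).integrable_of_hasCompactSupport hFc.mul_left

theorem continuous_greenRadial_right (hν : 0 ≤ ν) (ζ : ℂ) (t : ℝ) :
    Continuous fun u => greenRadial ν ζ t u := by
  have h0 : Continuous fun u : ℝ => (ζ, t, u) := by fun_prop
  have h1 := (continuous_greenRadial hν).comp h0
  simp only [Function.comp_def] at h1
  exact h1

theorem radSol_eq_Iic_add_Ioi (hν : 0 ≤ ν) (ζ : ℂ) (hF : Continuous F) (hFc : HasCompactSupport F)
    (t : ℝ) : radSol ν ζ F t = besK ν (shift ζ t) * (∫ u in Iic t, besI ν (shift ζ u) * F u) +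
      besI ν (shift ζ t) * ∫ u in Ioi t, besK ν (shift ζ u) * F u := by
  have hI : Integrable fun u => greenRadial ν ζ t u * F u :=
    integrable_mul_of_compactSupport (continuous_greenRadial_right hν ζ t) hF hFc
  rw [radSol, ← integral_add_compl measurableSet_Iic hI, compl_Iic, ← integral_const_mul,
    ← integral_const_mul]
  congr 1
  · refine setIntegral_congr_fun measurableSet_Iic fun u hu => ?_
    rw [mem_Iic] at hu
    simp only [greenRadial, min_eq_right hu, max_eq_left hu]
    ring
  · refine setIntegral_congr_fun measurableSet_Ioi fun u hu => ?_
    rw [mem_Ioi] at hu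
    simp only [greenRadial, min_eq_left hu.le, max_eq_right hu.le]
    ring

theorem hasDerivAt_integral_Iic {g : ℝ → ℂ} (hg : Continuous g) (hi : Integrable g) (t : ℝ) :
    HasDerivAt (fun t => ∫ u in Iic t, g u) (g t) t := by
  have h1 : (fun t => ∫ u in Iic t, g u) = fun t => (∫ u in Iic (0 : ℝ), g u) + ∫ u in (0 : ℝ)..t, g u := by
    funext t
    rw [← intervalIntegral.integral_Iic_sub_Iic hi.integrableOn hi.integrableOn]
    ring
  rw [h1]
  exact (intervalIntegral.integral_hasDerivAt_right (hg.intervalIntegrable _ _)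
    (hg.stronglyMeasurableAtFilter _ _) hg.continuousAt).const_add _

theorem hasDerivAt_integral_Ioi {g : ℝ → ℂ} (hg : Continuous g) (hi : Integrable g) (t : ℝ) :
    HasDerivAt (fun t => ∫ u in Ioi t, g u) (-g t) t := by
  have h1 : (fun t => ∫ u in Ioi t, g u) = fun t => (∫ u, g u) - ∫ u in Iic t, g u := by
    funext t
    rw [← integral_add_compl (measurableSet_Iic (a := t)) hi, compl_Iic]
    ring
  rw [h1]
  exact (hasDerivAt_integral_Iic hg hi t).const_sub _

theorem hasDerivAt_comp_shift {f : ℂ → ℂ} {ζ d : ℂ} {t : ℝ} (h : HasDerivAt f d (shift ζ t)) :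
    HasDerivAt (fun t : ℝ => f (shift ζ t)) d t := by
  have h1 : HasDerivAt (fun t : ℝ => shift ζ t) 1 t := by
    unfold shift
    exact ((Complex.ofRealCLM.hasDerivAt (x := t)).const_add ζ).sub_const _
  simpa [Function.comp_def] using h.comp t h1

theorem exp_two_mul_shift (ζ : ℂ) (t : ℝ) :
    Complex.exp (2 * shift ζ t) = -Complex.exp (2 * (ζ + t)) := by
  have : 2 * shift ζ t = 2 * (ζ + t) - Real.pi * Complex.I := by
    rw [shift]; push_cast; ring
  rw [this, Complex.exp_sub, Complex.exp_pi_mul_I, div_neg, div_one]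

/-- In variation of parameters the boundary terms cancel in the first derivative and give the
Wronskian times F, that is -F, in the second. The translation by -iπ/2 reverses the sign of e^{2x}
and so turns the modified Bessel equation into the one for λ² = e^{2ζ}. -/
theorem radSol_spec (hν : 0 ≤ ν) (ζ : ℂ) (hF : ContDiff ℝ ∞ F) (hFc : HasCompactSupport F) :
    ContDiff ℝ ∞ (radSol ν ζ F) ∧ ∀ t, deriv (deriv (radSol ν ζ F)) t =
      ((ν : ℂ) ^ 2 - Complex.exp (2 * (ζ + t))) * radSol ν ζ F t - F t := by
  obtain ⟨hK, hKo, hW, -⟩ := besK_spec hν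
  have cI := continuous_besI_shift hν ζ
  have cK := continuous_besK_shift hν ζ
  have hA : ∀ t, HasDerivAt (fun t => ∫ u in Iic t, besI ν (shift ζ u) * F u)
      (besI ν (shift ζ t) * F t) t := hasDerivAt_integral_Iic (cI.mul hF.continuous)
    (integrable_mul_of_compactSupport cI hF.continuous hFc)
  have hB : ∀ t, HasDerivAt (fun t => ∫ u in Ioi t, besK ν (shift ζ u) * F u)
      (-(besK ν (shift ζ t) * F t)) t := hasDerivAt_integral_Ioi (cK.mul hF.continuous)
    (integrable_mul_of_compactSupport cK hF.continuous hFc)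
  set A : ℝ → ℂ := fun t => ∫ u in Iic t, besI ν (shift ζ u) * F u with hAdef
  set B : ℝ → ℂ := fun t => ∫ u in Ioi t, besK ν (shift ζ u) * F u with hBdef
  have hV : radSol ν ζ F = fun t => besK ν (shift ζ t) * A t + besI ν (shift ζ t) * B t :=
    funext fun t => radSol_eq_Iic_add_Ioi hν ζ hF.continuous hFc t
  have dK : ∀ t, HasDerivAt (fun t => besK ν (shift ζ t)) (deriv (besK ν) (shift ζ t)) t :=
    fun t => hasDerivAt_comp_shift (hK _).hasDerivAt
  have dI : ∀ t, HasDerivAt (fun t => besI ν (shift ζ t)) (deriv (besI ν) (shift ζ t)) t :=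
    fun t => hasDerivAt_comp_shift (differentiable_besI hν _).hasDerivAt
  have dK' := fun t => hasDerivAt_comp_shift (hKo (shift ζ t))
  have dI' := fun t => hasDerivAt_comp_shift (besI_ode hν (shift ζ t))
  simp only [exp_two_mul_shift, ← sub_eq_add_neg] at dK' dI'
  set W : ℝ → ℂ := fun t => deriv (besK ν) (shift ζ t) * A t + deriv (besI ν) (shift ζ t) * B t
    with hWdef
  have h1 : ∀ t, HasDerivAt (radSol ν ζ F) (W t) t := fun t => by
    rw [hV]
    refine (((dK t).mul (hA t)).add ((dI t).mul (hB t))).congr_deriv ?_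
    simp only [hWdef, hAdef, hBdef]
    ring
  have h2 : ∀ t : ℝ, HasDerivAt W
      (((ν : ℂ) ^ 2 - Complex.exp (2 * (ζ + t))) * radSol ν ζ F t - F t) t := fun t => by
    refine (((dK' t).mul (hA t)).add ((dI' t).mul (hB t))).congr_deriv ?_
    rw [hV]
    linear_combination F t * hW (shift ζ t)
  have hQ : ContDiff ℝ ∞ fun t : ℝ => (ν : ℂ) ^ 2 - Complex.exp (2 * (ζ + t)) := by
    have : ContDiff ℝ ∞ fun t : ℝ => (t : ℂ) := Complex.ofRealCLM.contDiff
    exact contDiff_const.sub (contDiff_const.mul (contDiff_const.add this)).cexp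
  refine ⟨contDiff_of_ode h1 h2 hQ hF, fun t => ?_⟩
  have e1 : deriv (radSol ν ζ F) = W := funext fun t => (h1 t).deriv
  rw [e1, (h2 t).deriv]

/-- Beyond the support of the source only the outgoing solution appears, with a constant
coefficient; its decay is then that of `besK`. -/
theorem radSol_of_ge (hν : 0 ≤ ν) (ζ : ℂ) (hF : Continuous F) (hFc : HasCompactSupport F) {q : ℝ}
    (hq : ∀ t, q < t → F t = 0) {t : ℝ} (ht : q ≤ t) :
    radSol ν ζ F t = besK ν (shift ζ t) * ∫ u, besI ν (shift ζ u) * F u := by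
  have h0 : ∀ u ∈ Ioi t, F u = 0 := fun u hu => hq u (ht.trans_lt hu)
  have hi := integrable_mul_of_compactSupport (continuous_besI_shift hν ζ) hF hFc
  rw [radSol_eq_Iic_add_Ioi hν ζ hF hFc, ← integral_add_compl (measurableSet_Iic (a := t)) hi,
    compl_Iic, setIntegral_eq_zero_of_forall_eq_zero (t := Ioi t)
      (f := fun u => besK ν (shift ζ u) * F u) fun u hu => by rw [h0 u hu, mul_zero],
    setIntegral_eq_zero_of_forall_eq_zero (t := Ioi t)
      (f := fun u => besI ν (shift ζ u) * F u) fun u hu => by rw [h0 u hu, mul_zero]]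
  ring

end Radial

/-! ### Functions with a single angular mode -/

/-- A function with a single angular mode. -/
def modeFun (m : ℤ) (F : ℝ → ℂ) (y : Plane) : ℂ :=
  mode s α m y * (((‖y‖ ^ 2)⁻¹ : ℝ) * F (Real.log ‖y‖))

theorem measurable_modeFun (m : ℤ) {F : ℝ → ℂ} (hF : Continuous F) :
    Measurable (modeFun s α m F) := by
  have hl : Measurable fun x : Plane => Real.log ‖x‖ := Real.measurable_log.comp measurable_norm
  have h1 : Measurable fun y : Plane => F (Real.log ‖y‖) := hF.measurable.comp hl
  have h2 : Measurable fun y : Plane => (((‖y‖ ^ 2)⁻¹ : ℝ) : ℂ) :=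
    Complex.measurable_ofReal.comp (measurable_norm.pow_const 2).inv
  exact (measurable_mode s α m).mul (h2.mul h1)

theorem norm_modeFun {x : Plane} (hx : x ≠ 0) (m : ℤ) (F : ℝ → ℂ) :
    ‖modeFun s α m F x‖ = (‖x‖ ^ 2)⁻¹ * ‖F (Real.log ‖x‖)‖ := by
  rw [modeFun, norm_mul, norm_mul, norm_mode s α hx, one_mul, Complex.norm_real,
    Real.norm_of_nonneg (by positivity)]

theorem memLp_modeFun (m : ℤ) {F : ℝ → ℂ} (hF : Continuous F) (hFc : HasCompactSupport F) :
    MemLp (modeFun s α m F) 2 volume := by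
  have hm := (measurable_modeFun s α m hF).aestronglyMeasurable (μ := volume)
  rw [memLp_two_iff_integrable_sq_norm hm]
  have hi : Integrable fun t : ℝ => (((Real.exp t ^ 2)⁻¹ : ℝ) : ℂ) * ((‖F t‖ ^ 2 : ℝ) : ℂ) := by
    refine Continuous.integrable_of_hasCompactSupport ?_ ?_
    · have : Continuous fun t : ℝ => ((Real.exp t ^ 2)⁻¹ : ℝ) :=
        (Real.continuous_exp.pow 2).inv₀ fun t => (pow_pos (Real.exp_pos t) 2).ne'
      exact (Complex.continuous_ofReal.comp this).mul
        (Complex.continuous_ofReal.comp (hF.norm.pow 2))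
    · refine HasCompactSupport.mul_left ?_
      exact hFc.comp_left (g := fun z : ℂ => ((‖z‖ ^ 2 : ℝ) : ℂ)) (by simp)
  refine (integrable_log_norm hi).re.congr ?_
  have h0 : ∀ᵐ x : Plane, x ≠ 0 := by
    rw [ae_iff]; simp
  filter_upwards [h0] with x hx
  have hx0 : 0 < ‖x‖ := norm_pos_iff.2 hx
  rw [norm_modeFun s α hx, Real.exp_log hx0]
  simp only [RCLike.re_to_complex]
  rw [← Complex.ofReal_mul, ← Complex.ofReal_mul, Complex.ofReal_re]
  ring

/-- A function with a single angular mode as an element of `L²`. -/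
def modeVec (m : ℤ) (F : ℝ → ℂ) (h : Continuous F ∧ HasCompactSupport F) : L2 :=
  (memLp_modeFun s α m h.1 h.2).toLp

theorem modeVec_ae (m : ℤ) (F : ℝ → ℂ) (h : Continuous F ∧ HasCompactSupport F) :
    modeVec s α m F h =ᵐ[volume] modeFun s α m F := (memLp_modeFun s α m h.1 h.2).coeFn_toLp

theorem conj_mode_mul_mode {x : Plane} (hx : x ≠ 0) (m m' : ℤ) :
    conj (mode s α m x) * mode s α m' x = angular x ^ (m' - m) := by
  have ha := norm_angular hx
  have ha0 : angular x ≠ 0 := by rw [← norm_ne_zero_iff, ha]; exact one_ne_zero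
  have hc : conj (angular x) = (angular x)⁻¹ := by
    rw [Complex.inv_def, Complex.normSq_eq_norm_sq, ha]; simp
  rw [mode, mode, map_mul, map_zpow₀, hc, ← Complex.exp_conj, zpow_sub₀ ha0, inv_zpow]
  have e : conj (-Complex.I * (gaugePhase s α x : ℂ)) = -(-Complex.I * (gaugePhase s α x : ℂ)) := by
    rw [map_mul, map_neg, Complex.conj_I, Complex.conj_ofReal]; ring
  rw [e, Complex.exp_neg]
  have := Complex.exp_ne_zero (-Complex.I * (gaugePhase s α x : ℂ))
  field_simp

variable {A B : Set Plane} {ρ N : ℝ}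

/-- The gauge phases cancel between the conjugated mode and the mode of the source, leaving the
angular power m' - m. It integrates to zero unless the indices agree, and otherwise the integral
reduces to the one over the logarithmic radius. -/
theorem integral_modeKernel_modeFun (m m' : ℤ) (ζ : ℂ) {F : ℝ → ℂ}
    (hFB : ∀ y : Plane, y ≠ 0 → y ∉ B → F (Real.log ‖y‖) = 0) (x : Plane) :
    ∫ y, modeKernel s α A B m ζ x y * modeFun s α m' F y =
      if m = m' then ind A x * (mode s α m x * radial (radSol (order α m) ζ F) x) else 0 := by
  have h0 : ∀ᵐ x : Plane, x ≠ 0 := by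
    rw [ae_iff]; simp
  set h : ℝ → ℂ := fun t => greenRadial (order α m) ζ (Real.log ‖x‖) t * F t with hh
  have h1 : ∫ y, modeKernel s α A B m ζ x y * modeFun s α m' F y =
      ∫ y : Plane, (ind A x * mode s α m x * ((2 * Real.pi)⁻¹ : ℝ)) *
        (angular y ^ (m' - m) * (((‖y‖ ^ 2)⁻¹ : ℝ) * h (Real.log ‖y‖))) := by
    refine integral_congr_ae ?_
    filter_upwards [h0] with y hy
    rw [← conj_mode_mul_mode s α hy, modeKernel, modeFun]
    simp only [hh]
    by_cases hyB : y ∈ B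
    · rw [ind_of_mem hyB]; ring
    · rw [hFB y hy hyB]; ring
  rw [h1, integral_const_mul]
  split_ifs with hm
  · subst hm
    simp only [sub_self, zpow_zero, one_mul]
    rw [integral_log_norm, radial, radSol, ← hh]
    have hp : (Real.pi : ℂ) ≠ 0 := by exact_mod_cast Real.pi_ne_zero
    push_cast
    field_simp
  · rw [integral_angular_zpow (sub_ne_zero.2 (Ne.symm hm))
      fun r : ℝ => (((r ^ 2)⁻¹ : ℝ) : ℂ) * h (Real.log r), mul_zero]

/-- The Green operator acting on a function with a single angular mode. -/
theorem green_modeVec_ae (hρ0 : 0 < ρ) (hA : MeasurableSet A) (hB : MeasurableSet B)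
    (hA' : A ⊆ annulus ρ N) (hB' : B ⊆ annulus ρ N) (m : ℤ) (ζ : ℂ) {F : ℝ → ℂ}
    (h : Continuous F ∧ HasCompactSupport F) (hFB : ∀ y : Plane, y ≠ 0 → y ∉ B → F (Real.log ‖y‖) = 0) :
    green s α A B ζ (modeVec s α m F h) =ᵐ[volume]
      fun x => ind A x * (mode s α m x * radial (radSol (order α m) ζ F) x) := by
  have hop : ∀ m', modeOp s α A B m' ζ (modeVec s α m F h) =ᵐ[volume] fun x =>
      if m' = m then ind A x * (mode s α m' x * radial (radSol (order α m') ζ F) x) else 0 := by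
    intro m'
    obtain ⟨C, hC⟩ := exists_isKernel_modeKernel s α hρ0 hA hB hA' hB' m' ζ 0
    filter_upwards [kernelOp_ae (hC ζ (by simp)) (modeVec s α m F h)] with x hx
    rw [modeOp, hx, ← integral_modeKernel_modeFun s α m' m ζ hFB x]
    refine integral_congr_ae ?_
    filter_upwards [modeVec_ae s α m F h] with y hy
    rw [hy]
  have h1 := (hasSum_green s α hρ0 hA hB hA' hB' ζ).mapL
    (ContinuousLinearMap.apply ℂ L2 (modeVec s α m F h))
  have h2 : green s α A B ζ (modeVec s α m F h) = modeOp s α A B m ζ (modeVec s α m F h) := by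
    refine h1.unique (hasSum_single m fun m' hm' => ?_)
    refine Lp.ext ?_
    filter_upwards [hop m', Lp.coeFn_zero ℂ 2 (volume : Measure Plane)] with x hx hx0
    rw [hx0]
    change modeOp s α A B m' ζ (modeVec s α m F h) x = _
    rw [hx, if_neg hm']
    rfl
  rw [h2]
  filter_upwards [hop m] with x hx
  rw [hx, if_pos rfl]

end

section

/-! ### Density of the functions with a single angular mode -/

variable {n : ℕ} (s : Fin n → Plane) (α : Fin n → ℝ)

/-- Polynomials in a complex variable and its conjugate are dense in the continuous functions. -/
theorem exists_approx_polynomial (N : ℝ) (ψ : ℂ → ℂ) (hψ : Continuous ψ) {ε : ℝ} (hε : 0 < ε) :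
    ∃ P ∈ Submodule.span ℂ (range fun k : ℕ × ℕ => fun z : ℂ => z ^ k.1 * conj z ^ k.2),
      ∀ z : ℂ, ‖z‖ ≤ N → ‖ψ z - P z‖ ≤ ε := by
  set K : Set ℂ := Metric.closedBall 0 N with hK
  have : CompactSpace K := isCompact_iff_compactSpace.1 (isCompact_closedBall 0 N)
  let f : C(K, ℂ) := ⟨fun z => ψ z, hψ.comp continuous_subtype_val⟩
  have hf : f ∈ (polynomialFunctions K).starClosure.topologicalClosure := by
    rw [polynomialFunctions.starClosure_topologicalClosure]; trivial
  obtain ⟨p, hp, hpf⟩ := Metric.mem_closure_iff.1 hf ε hε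
  have key : ∀ p : C(K, ℂ), p ∈ (polynomialFunctions K).starClosure →
      ∃ P ∈ Submodule.span ℂ (range fun k : ℕ × ℕ => fun z : ℂ => z ^ k.1 * conj z ^ k.2),
        ∀ z : K, p z = P z := by
    intro p hp
    rw [polynomialFunctions.starClosure_eq_adjoin_X, ← StarSubalgebra.mem_toSubalgebra,
      StarAlgebra.adjoin_toSubalgebra, ← Subalgebra.mem_toSubmodule, Algebra.adjoin_eq_span] at hp
    induction hp using Submodule.span_induction with
    | mem q hq =>
      rw [Set.star_singleton, Set.singleton_union] at hq
      obtain ⟨i, j, rfl⟩ := (Submonoid.mem_closure_pair _ _ _).1 hq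
      exact ⟨_, Submodule.subset_span ⟨(i, j), rfl⟩, fun z => by simp⟩
    | zero => exact ⟨0, Submodule.zero_mem _, fun z => rfl⟩
    | add q q' _ _ h h' =>
      obtain ⟨P, hP, hq⟩ := h
      obtain ⟨P', hP', hq'⟩ := h'
      exact ⟨P + P', Submodule.add_mem _ hP hP', fun z => by simp [hq, hq']⟩
    | smul c q _ h =>
      obtain ⟨P, hP, hq⟩ := h
      exact ⟨c • P, Submodule.smul_mem _ c hP, fun z => by simp [hq]⟩
  obtain ⟨P, hP, hq⟩ := key p hp
  refine ⟨P, hP, fun z hz => ?_⟩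
  have hz' : z ∈ K := by rw [hK, mem_closedBall_zero_iff]; exact hz
  have := ContinuousMap.dist_apply_le_dist (f := f) (g := p) ⟨z, hz'⟩
  rw [dist_eq_norm, hq] at this
  exact this.trans hpf.le

/-- An integrable function of bounded support is zero if all its moments vanish. -/
theorem ae_eq_zero_of_moments {G : Plane → ℂ} (hG : Integrable G) {N : ℝ}
    (hN : ∀ x, N < ‖x‖ → G x = 0)
    (h : ∀ i j : ℕ, ∫ x, zc x ^ i * conj (zc x) ^ j * G x = 0) : ∀ᵐ x, G x = 0 := by
  have hN0 : ∀ x, G x ≠ 0 → ‖x‖ ≤ N := fun x hx => not_lt.1 fun h => hx (hN x h)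
  have hint : ∀ {g : Plane → ℂ}, Continuous g → Integrable fun x => g x * G x := by
    intro g hg
    obtain ⟨C, hC⟩ := (isCompact_closedBall (0 : Plane) N).exists_bound_of_continuousOn
      hg.continuousOn
    refine Integrable.mono' (hG.norm.const_mul C)
      (hg.aestronglyMeasurable.mul hG.aestronglyMeasurable) (Eventually.of_forall fun x => ?_)
    rw [norm_mul]
    by_cases hx : G x = 0
    · simp [hx]
    · exact mul_le_mul_of_nonneg_right (hC x (by simpa using hN0 x hx)) (norm_nonneg _)
  have hpoly : ∀ P ∈ Submodule.span ℂ (range fun k : ℕ × ℕ => fun z : ℂ => z ^ k.1 * conj z ^ k.2),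
      Continuous P ∧ ∫ x, P (zc x) * G x = 0 := by
    intro P hP
    induction hP using Submodule.span_induction with
    | mem q hq =>
      obtain ⟨k, rfl⟩ := hq
      exact ⟨(continuous_id.pow _).mul (Complex.continuous_conj.pow _), h k.1 k.2⟩
    | zero => exact ⟨continuous_zero, by simp⟩
    | add q q' _ _ h h' =>
      refine ⟨h.1.add h'.1, ?_⟩
      simp only [Pi.add_apply, add_mul]
      have := integral_add (hint (h.1.comp zc.continuous)) (hint (h'.1.comp zc.continuous))
      simp only [Function.comp_apply] at this
      rw [this, h.2, h'.2, add_zero]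
    | smul c q _ h =>
      refine ⟨h.1.const_smul c, ?_⟩
      simp only [Pi.smul_apply, smul_eq_mul, mul_assoc]
      rw [integral_const_mul, h.2, mul_zero]
  refine ae_eq_zero_of_integral_contDiff_smul_eq_zero hG.locallyIntegrable fun g hg _ => ?_
  set ψ : ℂ → ℂ := fun z => (g (zc.symm z) : ℂ) with hψ
  have hψc : Continuous ψ := Complex.continuous_ofReal.comp (hg.continuous.comp zc.symm.continuous)
  have h0 : ∀ ε > 0, ‖∫ x, g x • G x‖ ≤ ε * ∫ x, ‖G x‖ := by
    intro ε hε
    obtain ⟨P, hP, hPε⟩ := exists_approx_polynomial N ψ hψc hε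
    obtain ⟨hPc, hP0⟩ := hpoly P hP
    have e : ∫ x, g x • G x = ∫ x, (ψ (zc x) - P (zc x)) * G x := by
      simp only [sub_mul]
      have := integral_sub (hint (hψc.comp zc.continuous)) (hint (hPc.comp zc.continuous))
      simp only [Function.comp_apply] at this
      rw [this, hP0, sub_zero]
      simp [hψ]
    rw [e, ← integral_const_mul]
    refine norm_integral_le_of_norm_le (hG.norm.const_mul ε) (Eventually.of_forall fun x => ?_)
    rw [norm_mul]
    by_cases hx : G x = 0
    · simp [hx]
    · exact mul_le_mul_of_nonneg_right (hPε _ (by rw [norm_zc]; exact hN0 x hx)) (norm_nonneg _)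
  by_contra hne
  have hpos : 0 < ‖∫ x, g x • G x‖ := norm_pos_iff.2 hne
  have hI : 0 ≤ ∫ x, ‖G x‖ := integral_nonneg fun x => norm_nonneg _
  have := h0 (‖∫ x, g x • G x‖ / (2 * (1 + ∫ x, ‖G x‖))) (by positivity)
  rw [div_mul_eq_mul_div, le_div_iff₀ (by positivity)] at this
  nlinarith

/-- The profiles of functions with a single mode that are supported in an annulus. -/
def IsProfile (b N : ℝ) (F : ℝ → ℂ) : Prop :=
  ContDiff ℝ ∞ F ∧ HasCompactSupport F ∧ ∀ t, t ∉ Ioo (Real.log b) (Real.log N) → F t = 0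

theorem IsProfile.continuous_and {b N : ℝ} {F : ℝ → ℂ} (h : IsProfile b N F) :
    Continuous F ∧ HasCompactSupport F := ⟨h.1.continuous, h.2.1⟩

theorem IsProfile.eq_zero {b N : ℝ} (hb : 0 < b) (hbN : b < N) {F : ℝ → ℂ} (h : IsProfile b N F) {y : Plane}
    (hy : y ≠ 0) (hy' : y ∉ annulus b N) : F (Real.log ‖y‖) = 0 := by
  refine h.2.2 _ fun ht => hy' ?_
  have hy0 := norm_pos_iff.2 hy
  refine ⟨(Real.log_lt_log_iff hb hy0).1 ht.1, ?_⟩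
  exact (Real.log_lt_log_iff hy0 (hb.trans hbN)).1 ht.2

/-- A smooth bump on an interval. -/
def bump (p q t : ℝ) : ℝ := expNegInvGlue (t - p) * expNegInvGlue (q - t)

theorem contDiff_bump (p q : ℝ) : ContDiff ℝ ∞ (bump p q) :=
  (expNegInvGlue.contDiff.comp (contDiff_id.sub contDiff_const)).mul
    (expNegInvGlue.contDiff.comp (contDiff_const.sub contDiff_id))

theorem bump_pos {p q t : ℝ} (ht : t ∈ Ioo p q) : 0 < bump p q t :=
  mul_pos (expNegInvGlue.pos_of_pos (sub_pos.2 ht.1)) (expNegInvGlue.pos_of_pos (sub_pos.2 ht.2))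

theorem bump_eq_zero {p q t : ℝ} (ht : t ∉ Ioo p q) : bump p q t = 0 := by
  rw [bump]
  by_cases h : p < t
  · rw [expNegInvGlue.zero_of_nonpos (x := q - t)
      (by linarith [not_lt.1 fun h' => ht ⟨h, h'⟩]), mul_zero]
  · rw [expNegInvGlue.zero_of_nonpos (x := t - p) (by linarith), zero_mul]

theorem isProfile_bump (b N c : ℝ) : IsProfile b N fun t =>
    (Real.exp (c * t) * bump (Real.log b) (Real.log N) t : ℝ) := by
  refine ⟨Complex.ofRealCLM.contDiff.comp ((Real.contDiff_exp.comp
    (contDiff_const.mul contDiff_id)).mul (contDiff_bump _ _)), ?_, fun t ht => by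
      simp [bump_eq_zero ht]⟩
  refine HasCompactSupport.intro (isCompact_Icc (a := Real.log b) (b := Real.log N)) fun t ht => ?_
  rw [bump_eq_zero fun h => ht (Ioo_subset_Icc_self h)]
  simp

/-- A function that is orthogonal to all functions with a single angular mode supported in an
annulus vanishes on the annulus. -/
theorem ae_eq_zero_of_orthogonal {b N : ℝ} (hb : 0 < b) (hbN : b < N) {g : L2}
    (h : ∀ (m : ℤ) (F : ℝ → ℂ) (hF : IsProfile b N F),
      inner ℂ (modeVec s α m F hF.continuous_and) g = 0) :
    ∀ᵐ x, x ∈ annulus b N → g x = 0 := by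
  have hne : ∀ᵐ x : Plane, x ≠ 0 := by
    rw [ae_iff]; simp
  -- The factor e^{2t} cancels the weight |x|⁻² and e^{kt} is the k-th power of the radius. Pairing
  -- with the mode j - i and the profile k = i + j therefore produces the moment zⁱ z̄ʲ of one fixed
  -- function G.
  set F : ℕ → ℝ → ℂ := fun k t =>
    (Real.exp ((2 + k : ℝ) * t) * bump (Real.log b) (Real.log N) t : ℝ) with hFdef
  have hF : ∀ k, IsProfile b N (F k) := fun k => isProfile_bump b N (2 + k)
  set G : Plane → ℂ := fun x => conj (modeFun s α 0 (F 0) x) * g x with hG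
  have hGi : Integrable G :=
    (memLp_modeFun s α 0 (hF 0).1.continuous (hF 0).2.1).star.integrable_mul (Lp.memLp g)
  have hzero : ∀ x, x ≠ 0 → x ∉ annulus b N → G x = 0 := fun x hx0 hx => by
    rw [hG]
    simp only [modeFun]
    rw [(hF 0).eq_zero hb hbN hx0 hx]
    simp
  have hGz := ae_eq_zero_of_moments hGi (N := N) (fun x hx => hzero x (by
      rintro rfl
      rw [norm_zero] at hx
      linarith) fun h => h.2.not_gt hx) fun i j => by
    rw [← h (j - i) (F (i + j)) (hF _), L2.inner_def]
    refine integral_congr_ae ?_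
    filter_upwards [modeVec_ae s α (j - i) (F (i + j)) (hF _).continuous_and, hne] with x hx hx0
    rw [RCLike.inner_apply, hx, mul_comm (g x), hG]
    simp only
    rw [← mul_assoc]
    congr 1
    have hn0 : 0 < ‖x‖ := norm_pos_iff.2 hx0
    have hn : (‖x‖ : ℂ) ≠ 0 := by exact_mod_cast hn0.ne'
    have hz : zc x = angular x * ‖x‖ := by rw [angular]; field_simp
    have ha := norm_angular hx0
    have ha0 : angular x ≠ 0 := by rw [← norm_ne_zero_iff, ha]; exact one_ne_zero
    have hc : conj (angular x) = (angular x)⁻¹ := by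
      rw [Complex.inv_def, Complex.normSq_eq_norm_sq, ha]; simp
    have hE : mode s α (j - i) x = angular x ^ (j : ℤ) * (angular x ^ (i : ℤ))⁻¹ * mode s α 0 x := by
      rw [mode, mode, zpow_sub₀ ha0, zpow_zero]; ring
    have hFk : F (i + j) (Real.log ‖x‖) = (‖x‖ : ℂ) ^ (i + j) * F 0 (Real.log ‖x‖) := by
      simp only [hFdef]
      have : Real.exp ((2 + ((i + j : ℕ) : ℝ)) * Real.log ‖x‖) =
          ‖x‖ ^ (i + j) * Real.exp ((2 + ((0 : ℕ) : ℝ)) * Real.log ‖x‖) := by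
        rw [add_mul, Real.exp_add, mul_comm ((i + j : ℕ) : ℝ), ← Real.rpow_def_of_pos hn0,
          Real.rpow_natCast]
        push_cast
        ring_nf
      rw [this]
      push_cast
      ring
    simp only [modeFun]
    rw [hE, hFk]
    simp only [map_mul, map_pow, map_inv₀, hz, hc, Complex.conj_ofReal, zpow_natCast, inv_pow, inv_inv]
    ring
  filter_upwards [hGz, hne] with x hx hx0 hxa
  rw [hG] at hx
  refine (mul_eq_zero.1 hx).resolve_left ?_
  rw [map_eq_zero, ← ne_eq, ← norm_ne_zero_iff, norm_modeFun s α hx0]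
  have hn0 : 0 < ‖x‖ := norm_pos_iff.2 hx0
  have hl : Real.log ‖x‖ ∈ Ioo (Real.log b) (Real.log N) :=
    ⟨Real.log_lt_log hb hxa.1, Real.log_lt_log hn0 hxa.2⟩
  have hpos := mul_pos (Real.exp_pos ((2 + ((0 : ℕ) : ℝ)) * Real.log ‖x‖)) (bump_pos hl)
  have : ‖F 0 (Real.log ‖x‖)‖ ≠ 0 := by
    rw [norm_ne_zero_iff, hFdef]
    exact Complex.ofReal_ne_zero.2 hpos.ne'
  exact mul_ne_zero (by positivity) this

/-- Two operators that agree on the functions with a single angular mode supported in an annulus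
agree on all functions supported there. -/
theorem eq_of_eq_modeVec {b N : ℝ} (hb : 0 < b) (hbN : b < N) {E : Type*} [NormedAddCommGroup E]
    [NormedSpace ℂ E] {S T : L2 →L[ℂ] E} (h : ∀ (m : ℤ) (F : ℝ → ℂ) (hF : IsProfile b N F),
      S (modeVec s α m F hF.continuous_and) = T (modeVec s α m F hF.continuous_and)) :
    S ∘L bmul (ind (annulus b N)) = T ∘L bmul (ind (annulus b N)) := by
  set X : Set L2 := {f | ∃ (m : ℤ) (F : ℝ → ℂ) (hF : IsProfile b N F),
    f = modeVec s α m F hF.continuous_and} with hX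
  have hm := memLp_ind (measurableSet_annulus b N)
  have hcl : ∀ f, bmul (ind (annulus b N)) f ∈ (Submodule.span ℂ X).topologicalClosure := by
    intro f
    rw [← Submodule.orthogonal_orthogonal_eq_closure, Submodule.mem_orthogonal]
    intro g hg
    have h0 := ae_eq_zero_of_orthogonal s α hb hbN (g := g) fun m F hF =>
      (Submodule.mem_orthogonal _ _).1 hg _ (Submodule.subset_span ⟨m, F, hF, rfl⟩)
    rw [L2.inner_def]
    rw [← integral_zero Plane ℂ]
    refine integral_congr_ae ?_
    filter_upwards [h0, bmul_ae hm f] with x h1 h2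
    rw [h2]
    by_cases hx : x ∈ annulus b N
    · simp [h1 hx]
    · simp [ind_of_notMem hx]
  ext f
  have hle : (Submodule.span ℂ X).topologicalClosure ≤ LinearMap.eqLocus S T :=
    Submodule.topologicalClosure_minimal _ (Submodule.span_le.2 fun f hf => by
      obtain ⟨m, F, hF, rfl⟩ := hf
      exact h m F hF) (isClosed_eq S.continuous T.continuous)
  exact hle (hcl f)

end

section

/-! ### Local solutions outside a disc -/

variable {n : ℕ} (s : Fin n → Plane) (α : Fin n → ℝ)

/-- The part of `(P + 1) (χ v)` that depends on `(P + 1) v`. -/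
def sourceA (χ χ' : Plane → ℂ) : L2 →L[ℂ] L2 :=
  bmul χ - (2 * Complex.I) • ∑ j, bmul (pd j χ) ∘L comp (some j) ∘L formProj s α ∘L
    inc none ∘L bmul χ'

/-- The part of `(P + 1) (χ v)` that depends on `v`. -/
def sourceB (χ χ' : Plane → ℂ) : L2 →L[ℂ] L2 :=
  -bmul (lap χ) - (2 * Complex.I) • ∑ j, bmul (pd j χ) ∘L comp (some j) ∘L formProj s α ∘L
    (inc none ∘L bmul (lap χ') - (2 * Complex.I) • ∑ k, inc (some k) ∘L bmul (pd k χ'))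

theorem pd_eq_zero_of_notMem {χ : Plane → ℂ} {x : Plane} (hx : x ∉ tsupport χ) (j : Fin 2) :
    pd j χ x = 0 :=
  image_eq_zero_of_notMem_tsupport fun h => hx (tsupport_pd j χ h)

theorem lap_eq_zero_of_notMem {χ : Plane → ℂ} {x : Plane} (hx : x ∉ tsupport χ) : lap χ x = 0 :=
  Finset.sum_eq_zero fun j _ => pd_eq_zero_of_notMem (fun h => hx (tsupport_pd j χ h)) j

theorem bmul_congr {g : Plane → ℂ} (hg : MemLp g ⊤ (volume : Measure Plane)) {u v : L2}
    (h : ∀ᵐ x, g x = 0 ∨ u x = v x) : bmul g u = bmul g v := by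
  refine bmul_eq_of_ae hg ?_
  filter_upwards [h, bmul_ae hg v] with x hx h2
  rw [h2]
  rcases hx with hx | hx
  · rw [hx, zero_mul, zero_mul]
  · rw [hx]

/-- The right side is (P + 1) applied to χTg. Its first-order term is computed from a wider cutoff
and the divergence form of the Leibniz rule, so it depends only on g and Tg near the support of χ.
Hence u and v, which need only be locally a source and its solution, suffice, and no derivative of v
is taken. -/
theorem sourceA_add_sourceB {χ χ' : Plane → ℂ} (hχ : IsCutoff χ) (hχ' : IsCutoff χ')
    (h1 : ∀ᶠ x in 𝓝ˢ (tsupport χ), χ' x = 1) {g u v : L2}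
    (h : ∀ᵐ x, x ∈ tsupport χ' → u x = g x ∧ v x = invOne s α g x) :
    sourceA s α χ χ' u + sourceB s α χ χ' v = bmul χ g + comm s α χ g := by
  have hsub : ∀ x ∈ tsupport χ, x ∈ tsupport χ' := fun x hx => by
    refine subset_closure ?_
    rw [Function.mem_support, (h1.filter_mono (nhds_le_nhdsSet hx)).self_of_nhds]
    exact one_ne_zero
  have e1 : bmul χ u = bmul χ g := bmul_congr hχ.memLp (by
    filter_upwards [h] with x hx
    by_cases hxs : x ∈ tsupport χ
    · exact Or.inr (hx (hsub x hxs)).1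
    · exact Or.inl (image_eq_zero_of_notMem_tsupport hxs))
  have e2 : bmul (lap χ) v = bmul (lap χ) (invOne s α g) := bmul_congr hχ.lap.memLp (by
    filter_upwards [h] with x hx
    by_cases hxs : x ∈ tsupport χ
    · exact Or.inr (hx (hsub x hxs)).2
    · exact Or.inl (lap_eq_zero_of_notMem hxs))
  have e3 : bmul χ' u = bmul χ' g := bmul_congr hχ'.memLp (by
    filter_upwards [h] with x hx
    by_cases hxs : x ∈ tsupport χ'
    · exact Or.inr (hx hxs).1
    · exact Or.inl (image_eq_zero_of_notMem_tsupport hxs))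
  have e4 : bmul (lap χ') v = bmul (lap χ') (invOne s α g) := bmul_congr hχ'.lap.memLp (by
    filter_upwards [h] with x hx
    by_cases hxs : x ∈ tsupport χ'
    · exact Or.inr (hx hxs).2
    · exact Or.inl (lap_eq_zero_of_notMem hxs))
  have e5 : ∀ k, bmul (pd k χ') v = bmul (pd k χ') (invOne s α g) := fun k =>
    bmul_congr (hχ'.pd k).memLp (by
      filter_upwards [h] with x hx
      by_cases hxs : x ∈ tsupport χ'
      · exact Or.inr (hx hxs).2
      · exact Or.inl (pd_eq_zero_of_notMem hxs k))
  have e6 : ∀ j, bmul (pd j χ) (derivInv s α j g) =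
      bmul (pd j χ) (mulJet χ' (formProj s α (inc none g)) (some j)) := fun j =>
    bmul_pd_derivInv (hχ.pd j) hχ'
      (h1.filter_mono (nhdsSet_mono (tsupport_pd j χ))) j _
  have key : sourceA s α χ χ' u + sourceB s α χ χ' v = bmul χ u - bmul (lap χ) v -
      (2 * Complex.I) • ∑ j, bmul (pd j χ) (formProj s α (inc none (bmul χ' u + bmul (lap χ') v) -
      (2 * Complex.I) • ∑ k, inc (some k) (bmul (pd k χ') v)) (some j)) := by
    simp only [sourceA, sourceB, sub_apply, smul_apply, sum_apply, neg_apply,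
      ContinuousLinearMap.comp_apply, map_sub, map_add, map_smul, map_sum]
    have hc : ∀ (w : Jet) (j : Fin 2), comp (some j) w = w (some j) := fun w j => rfl
    simp only [Fin.sum_univ_two, ← hc, map_sub, map_add, map_smul]
    module
  rw [key, e1, e2, e3, e4]
  simp only [e5]
  rw [mulJet_formProj' s α hχ', comm_apply]
  simp only [e6]
  abel

variable {s} {ρ : ℝ}

/-- A mode with a smooth radial factor, cut off, as a test function. -/
def modeTest (hρ : ∀ i, ‖s i‖ < ρ) (hρ0 : 0 < ρ) {θ : Plane → ℂ} (hθ : IsCutoff θ)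
    (hθs : ∀ x ∈ tsupport θ, ρ < ‖x‖) (m : ℤ) {V : ℝ → ℂ} (hV : ContDiff ℝ ∞ V) : testFun s :=
  ⟨fun x => θ x * (mode s α m x * radial V x), by
    refine contDiff_iff_contDiffAt.2 fun x => ?_
    by_cases hx : x ∈ tsupport θ
    · exact hθ.1.contDiffAt.mul ((contDiffAt_mode α hρ hρ0 m (hθs x hx)).mul
        (contDiffAt_radial hV (ne_zero_of_lt hρ0 (hθs x hx))))
    · have h0 : (fun x => θ x * (mode s α m x * radial V x)) =ᶠ[𝓝 x] fun _ => 0 := by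
        filter_upwards [(isClosed_tsupport θ).isOpen_compl.mem_nhds hx] with y hy
        rw [image_eq_zero_of_notMem_tsupport hy, zero_mul]
      exact contDiffAt_const.congr_of_eventuallyEq h0,
    hθ.2.mul_right, by
      refine (tsupport_mul_subset_left (f := θ)).trans fun x hx => ?_
      rintro ⟨i, rfl⟩
      exact (hρ i).not_gt (hθs _ hx)⟩

theorem magneticDerivFun_congr {f g : Plane → ℂ} {x : Plane} (h : f =ᶠ[𝓝 x] g) (j : Fin 2) :
    magneticDerivFun s α j f =ᶠ[𝓝 x] magneticDerivFun s α j g := by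
  filter_upwards [h.eventuallyEq_nhds] with y hy
  rw [magneticDerivFun, magneticDerivFun, hy.fderiv_eq, hy.self_of_nhds]

/-- A mode times a solution of the radial equation is, on compact sets outside the disc, of the form
`(P + 1)⁻¹ g`. -/
theorem exists_source_of_mode (hρ : ∀ i, ‖s i‖ < ρ) (hρ0 : 0 < ρ) {K : Set Plane}
    (hK : IsCompact K) (hKρ : ∀ x ∈ K, ρ < ‖x‖) (m : ℤ) (ζ : ℂ) {V F : ℝ → ℂ}
    (hV : ContDiff ℝ ∞ V) (hode : ∀ t : ℝ, deriv (deriv V) t =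
      ((order α m : ℂ) ^ 2 - Complex.exp (2 * (ζ + t))) * V t - F t) :
    ∃ g : L2, ∀ᵐ x, x ∈ K → invOne s α g x = mode s α m x * radial V x ∧
      g x = modeFun s α m F x + (1 + Complex.exp (2 * ζ)) * (mode s α m x * radial V x) := by
  obtain ⟨θ, hθ, -, -, hθs, hθ1⟩ := exists_cutoff hK
    (isOpen_lt (continuous_const (y := ρ)) continuous_norm) hKρ
  set ψ := modeTest α hρ hρ0 hθ hθs m hV with hψ
  set D : testFun s := ∑ j, magneticDeriv s α j (magneticDeriv s α j ψ) with hD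
  have hT : invOne s α (testToL2 s (ψ + D)) = testToL2 s ψ := by
    have := (mem_graph_iff s α _ _).1 (test_mem_graph s α ψ)
    rwa [← map_sum, ← map_add] at this
  refine ⟨testToL2 s (ψ + D), ?_⟩
  rw [hT]
  filter_upwards [testToL2_ae s ψ, testToL2_ae s (ψ + D)] with x h1 h2 hx
  have hx1 : ∀ᶠ y in 𝓝 x, θ y = 1 := hθ1.filter_mono (nhds_le_nhdsSet hx)
  have hloc : ψ.1 =ᶠ[𝓝 x] fun y => mode s α m y * radial V y := by
    filter_upwards [hx1] with y hy
    change θ y * _ = _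
    rw [hy, one_mul]
  have hDx : D.1 x = ∑ j, magneticDerivFun s α j (magneticDerivFun s α j
      fun y => mode s α m y * radial V y) x := by
    have : D.1 x = ∑ j, magneticDerivFun s α j (magneticDerivFun s α j ψ.1) x := by
      rw [hD]
      simp only [Submodule.coe_sum, Finset.sum_apply]
      rfl
    rw [this]
    exact Finset.sum_congr rfl fun j _ =>
      (magneticDerivFun_congr α (magneticDerivFun_congr α hloc j) j).self_of_nhds
  have hx0 : x ≠ 0 := ne_zero_of_lt hρ0 (hKρ x hx)
  refine ⟨by rw [h1, hloc.self_of_nhds], ?_⟩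
  rw [h2]
  change ψ.1 x + D.1 x = _
  rw [hDx, sum_magneticDerivFun_mode α hρ hρ0 m hV (hKρ x hx), hloc.self_of_nhds, modeFun]
  have hν : (order α m : ℂ) ^ 2 = ((m : ℂ) + flux α) ^ 2 := by
    have : order α m ^ 2 = ((m : ℝ) + flux α) ^ 2 := sq_abs _
    exact_mod_cast this
  have hexp : Complex.exp (2 * (ζ + (Real.log ‖x‖ : ℝ))) = Complex.exp (2 * ζ) * (‖x‖ : ℂ) ^ 2 := by
    rw [mul_add, Complex.exp_add, two_mul ((Real.log ‖x‖ : ℝ) : ℂ), Complex.exp_add,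
      ← Complex.ofReal_exp, Real.exp_log (norm_pos_iff.2 hx0)]
    ring
  have hr : radial (deriv (deriv V)) x = (((m : ℂ) + flux α) ^ 2 -
      Complex.exp (2 * ζ) * (‖x‖ : ℂ) ^ 2) * radial V x - F (Real.log ‖x‖) := by
    rw [radial, hode, hν, hexp, radial]
  have hn : (‖x‖ : ℂ) ≠ 0 := by exact_mod_cast norm_ne_zero_iff.2 hx0
  rw [hr]
  push_cast
  field_simp
  ring

/-- The cut off Green operator takes values in the domain of the Hamiltonian. -/
theorem exists_greenSource (hρ : ∀ i, ‖s i‖ < ρ) (hρ0 : 0 < ρ) {a b N : ℝ} (ha : ρ ≤ a)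
    (hab : a ≤ b) (hbN : b < N) {χ : Plane → ℂ} (hχ : IsCutoff χ)
    (hχs : tsupport χ ⊆ annulus a N) :
    ∃ h : ℂ → L2 →L[ℂ] L2, Differentiable ℂ h ∧
      (∀ ζ, invOne s α ∘L h ζ = bmul χ ∘L green s α (annulus a N) (annulus b N) ζ) ∧
      ∀ (ζ : ℂ) (θ : Plane → ℂ), IsCutoff θ → (∀ᶠ x in 𝓝ˢ (tsupport θ), χ x = 1) →
        bmul θ ∘L h ζ = bmul θ ∘L (bmul (ind (annulus b N)) +
          (1 + Complex.exp (2 * ζ)) • green s α (annulus a N) (annulus b N) ζ) := by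
  obtain ⟨χ', hχ', -, -, hχ's, hχ'1⟩ := exists_cutoff hχ.2.isCompact (isOpen_annulus a N) hχs
  set G := green s α (annulus a N) (annulus b N) with hG
  set J := bmul (ind (annulus b N)) with hJ
  have hAm := measurableSet_annulus a N
  have hBm := measurableSet_annulus b N
  have hA' : annulus a N ⊆ annulus ρ N := annulus_subset ha le_rfl
  have hB' : annulus b N ⊆ annulus ρ N := annulus_subset (ha.trans hab) le_rfl
  have hb0 : 0 < b := hρ0.trans_le (ha.trans hab)
  have hGd : Differentiable ℂ G := differentiable_green s α hρ0 hAm hBm hA' hB'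
  have hGJ : ∀ ζ, G ζ ∘L J = G ζ := fun ζ => by
    have e1 := bmul_green_bmul s α hρ0 hAm hBm hA' hB' hAm hBm ζ
    rw [inter_self, inter_self] at e1
    change bmul (ind (annulus a N)) ∘L G ζ ∘L J = G ζ at e1
    have hJJ : J ∘L J = J := by
      ext1 f
      change bmul _ (bmul _ f) = bmul _ f
      have hm := memLp_ind hBm
      rw [bmul_bmul hm hm (by simpa only [ind_mul_ind, inter_self] using hm)]
      simp only [ind_mul_ind, inter_self]
    rw [← e1]
    simp only [ContinuousLinearMap.comp_assoc, hJJ]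
  -- Locally (P - λ²)G = J, that is (P + 1)G = J + (1 + λ²)G with λ² = e^{2ζ}. Inserting this source
  -- and G itself into the two bounded source maps gives the candidate for (P + 1)χG, visibly entire
  -- in ζ.
  set h : ℂ → L2 →L[ℂ] L2 := fun ζ => sourceA s α χ χ' ∘L
    (J + (1 + Complex.exp (2 * ζ)) • G ζ) + sourceB s α χ χ' ∘L G ζ with hh
  refine ⟨h, ?_, fun ζ => ?_, fun ζ θ hθ hθ1 => ?_⟩
  · have hc : ∀ S : L2 →L[ℂ] L2, ∀ T : ℂ → L2 →L[ℂ] L2, Differentiable ℂ T →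
        Differentiable ℂ fun ζ => S ∘L T ζ := fun S T hT =>
      (ContinuousLinearMap.compL ℂ L2 L2 L2 S).differentiable.comp hT
    refine (hc _ _ ?_).add (hc _ _ hGd)
    refine (differentiable_const _).add (Differentiable.fun_smul ?_ hGd)
    fun_prop
  · have hJh : h ζ ∘L J = h ζ := by
      have hJJ : J ∘L J = J := by
        ext1 f
        change bmul _ (bmul _ f) = bmul _ f
        have hm := memLp_ind hBm
        rw [bmul_bmul hm hm (by simpa only [ind_mul_ind, inter_self] using hm)]
        simp only [ind_mul_ind, inter_self]
      simp only [hh, ContinuousLinearMap.add_comp, ContinuousLinearMap.comp_assoc,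
        ContinuousLinearMap.smul_comp, hJJ, hGJ]
    -- Both sides are bounded operators, so it is enough to compare them on a single angular mode,
    -- where G is given by the smooth radial solution.
    have := eq_of_eq_modeVec s α hb0 hbN (S := invOne s α ∘L h ζ) (T := bmul χ ∘L G ζ) ?_
    · rw [ContinuousLinearMap.comp_assoc, ContinuousLinearMap.comp_assoc, ← hJ, hJh, hGJ] at this
      exact this
    intro m F hF
    set f := modeVec s α m F hF.continuous_and with hf
    obtain ⟨hV, hode⟩ := radSol_spec (order_nonneg α m) ζ hF.1 hF.2.1
    set V := radSol (order α m) ζ F with hVdef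
    obtain ⟨g, hg⟩ := exists_source_of_mode α hρ hρ0 hχ'.2.isCompact
      (fun x hx => (hA' (hχ's hx)).1) m ζ hV hode
    have hGf := green_modeVec_ae s α hρ0 hAm hBm hA' hB' m ζ hF.continuous_and
      fun y hy hy' => hF.eq_zero hb0 hbN hy hy'
    have hne : ∀ᵐ x : Plane, x ≠ 0 := by
      rw [ae_iff]; simp
    have hJf : J f =ᵐ[volume] modeFun s α m F := by
      filter_upwards [bmul_ae (memLp_ind hBm) f, modeVec_ae s α m F hF.continuous_and, hne]
        with x e1 e2 hx
      rw [e1, e2]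
      by_cases hxb : x ∈ annulus b N
      · rw [ind_of_mem hxb, one_mul]
      · rw [modeFun, hF.eq_zero hb0 hbN hx hxb]; simp
    have hpt : ∀ᵐ x, x ∈ tsupport χ' →
        (J f + (1 + Complex.exp (2 * ζ)) • G ζ f : L2) x = g x ∧ (G ζ f) x = invOne s α g x := by
      filter_upwards [hg, hGf, hJf, Lp.coeFn_add (J f) ((1 + Complex.exp (2 * ζ)) • G ζ f),
        Lp.coeFn_smul (1 + Complex.exp (2 * ζ)) (G ζ f)] with x e1 e2 e3 e4 e5 hx
      have hxa : x ∈ annulus a N := hχ's hx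
      rw [ind_of_mem hxa, one_mul] at e2
      rw [(e1 hx).1, (e1 hx).2, e4, Pi.add_apply, e5, Pi.smul_apply, e3, e2, smul_eq_mul]
      exact ⟨rfl, rfl⟩
    have e := sourceA_add_sourceB s α hχ hχ' hχ'1 hpt
    have eh : h ζ f = bmul χ g + comm s α χ g := by
      rw [← e]; rfl
    change invOne s α (h ζ f) = bmul χ (G ζ f)
    rw [eh, ← bmul_invOne s α hχ]
    refine bmul_congr hχ.memLp ?_
    filter_upwards [hpt] with x hx
    by_cases hxs : x ∈ tsupport χ
    · right
      refine (hx ?_).2.symm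
      refine subset_closure ?_
      rw [Function.mem_support, (hχ'1.filter_mono (nhds_le_nhdsSet hxs)).self_of_nhds]
      exact one_ne_zero
    · exact Or.inl (image_eq_zero_of_notMem_tsupport hxs)
  -- Where θ lives χ is locally 1, so all derivatives of χ disappear and only the zeroth-order term
  -- remains.
  · have z1 : ∀ (j : Fin 2) (u : L2), bmul θ (bmul (pd j χ) u) = 0 := fun j u => by
      refine bmul_eq_of_ae hθ.memLp ?_
      filter_upwards [bmul_ae (hχ.pd j).memLp u, Lp.coeFn_zero ℂ 2 (volume : Measure Plane)]
        with x e1 e2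
      rw [e1, e2]
      by_cases hx : x ∈ tsupport θ
      · rw [pd_eq_zero_of_eventually (hθ1.filter_mono (nhds_le_nhdsSet hx))]; simp
      · rw [image_eq_zero_of_notMem_tsupport hx]; simp
    have z2 : ∀ u : L2, bmul θ (bmul (lap χ) u) = 0 := fun u => by
      rw [bmul_lap hχ, map_sum]
      refine Finset.sum_eq_zero fun j _ => ?_
      refine bmul_eq_of_ae hθ.memLp ?_
      filter_upwards [bmul_ae ((hχ.pd j).pd j).memLp u, Lp.coeFn_zero ℂ 2 (volume : Measure Plane)]
        with x e1 e2
      rw [e1, e2]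
      by_cases hx : x ∈ tsupport θ
      · have h1 : ∀ᶠ y in 𝓝 x, χ y = 1 := hθ1.filter_mono (nhds_le_nhdsSet hx)
        have h2 : ∀ᶠ y in 𝓝 x, pd j χ y = 0 := by
          filter_upwards [h1.eventually_nhds] with y hy
          exact pd_eq_zero_of_eventually hy j
        rw [pd_eq_zero_of_eventually h2]; simp
      · rw [image_eq_zero_of_notMem_tsupport hx]; simp
    have z3 : ∀ u : L2, bmul θ (bmul χ u) = bmul θ u := fun u => by
      refine bmul_congr hθ.memLp ?_
      filter_upwards [bmul_ae hχ.memLp u] with x e1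
      by_cases hx : x ∈ tsupport θ
      · right
        rw [e1, (hθ1.filter_mono (nhds_le_nhdsSet hx)).self_of_nhds, one_mul]
      · exact Or.inl (image_eq_zero_of_notMem_tsupport hx)
    ext1 f
    simp only [hh, sourceA, sourceB, ContinuousLinearMap.comp_apply, add_apply, sub_apply,
      smul_apply, sum_apply, neg_apply, map_add, map_sub, map_smul, map_sum, map_neg, z1, z2, z3]
    simp

end

section

/-! ### Locality of the commutators and uniqueness of local solutions -/

variable {n : ℕ} (s : Fin n → Plane) (α : Fin n → ℝ)

theorem comm_ae {χ : Plane → ℂ} (hχ : IsCutoff χ) (f : L2) : ∀ᵐ x, comm s α χ f x =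
    -(lap χ x * invOne s α f x) - 2 * Complex.I * ∑ j, pd j χ x * derivInv s α j f x := by
  rw [comm_apply, Fin.sum_univ_two]
  filter_upwards [Lp.coeFn_sub (-bmul (lap χ) (invOne s α f)) ((2 * Complex.I) •
      (bmul (pd 0 χ) (derivInv s α 0 f) + bmul (pd 1 χ) (derivInv s α 1 f))),
    Lp.coeFn_neg (bmul (lap χ) (invOne s α f)),
    Lp.coeFn_smul (2 * Complex.I)
      (bmul (pd 0 χ) (derivInv s α 0 f) + bmul (pd 1 χ) (derivInv s α 1 f)),
    Lp.coeFn_add (bmul (pd 0 χ) (derivInv s α 0 f)) (bmul (pd 1 χ) (derivInv s α 1 f)),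
    bmul_ae hχ.lap.memLp (invOne s α f), bmul_ae (hχ.pd 0).memLp (derivInv s α 0 f),
    bmul_ae (hχ.pd 1).memLp (derivInv s α 1 f)] with x e1 e2 e3 e4 e5 e6 e7
  rw [e1, Pi.sub_apply, e2, Pi.neg_apply, e3, Pi.smul_apply, e4, Pi.add_apply, e5, e6, e7,
    Fin.sum_univ_two, smul_eq_mul]

/-- The commutator with χ only sees Tg and its derivatives on the support of the gradient of χ,
where τ = 1; and by the Leibniz rule the new source is that of τTg. -/
theorem comm_source {χ τ : Plane → ℂ} (hχ : IsCutoff χ) (hτ : IsCutoff τ)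
    (h : ∀ j, ∀ᶠ x in 𝓝ˢ (tsupport (pd j χ)), τ x = 1) (g : L2) :
    comm s α χ (bmul τ g + comm s α τ g) = comm s α χ g := by
  have e1 : bmul (lap χ) (invOne s α (bmul τ g + comm s α τ g)) = bmul (lap χ) (invOne s α g) := by
    rw [← bmul_invOne s α hτ]
    refine bmul_congr hχ.lap.memLp ?_
    filter_upwards [bmul_ae hτ.memLp (invOne s α g)] with x hx
    by_cases h0 : lap χ x = 0
    · exact Or.inl h0
    · right
      obtain ⟨j, -, hj⟩ := Finset.exists_ne_zero_of_sum_ne_zero h0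
      have hxj : x ∈ tsupport (pd j χ) := tsupport_pd j _ (subset_closure hj)
      rw [hx, ((h j).filter_mono (nhds_le_nhdsSet hxj)).self_of_nhds, one_mul]
  have e2 : ∀ j, bmul (pd j χ) (derivInv s α j (bmul τ g + comm s α τ g)) =
      bmul (pd j χ) (derivInv s α j g) := fun j => by
    have h1 := bmul_pd_derivInv (hχ.pd j) hτ (h j) j (formProj s α (inc none g))
    rw [← mulJet_formProj s α hτ] at h1
    exact h1.symm
  rw [comm_apply s α χ, comm_apply s α χ, e1]
  simp only [e2]

/-- A family of cutoff functions with small derivatives that exhausts the plane. -/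
theorem exists_slow_cutoff : ∃ C : ℝ, 0 ≤ C ∧ ∀ k : ℕ, 0 < k → ∃ θ : Plane → ℂ, IsCutoff θ ∧
    (∀ x, conj (θ x) = θ x) ∧ (∀ x, ‖x‖ ≤ k → θ x = 1) ∧ (∀ x, 2 * k < ‖x‖ → θ x = 0) ∧
    ∀ j x, ‖pd j θ x‖ ≤ C / k := by
  obtain ⟨η, hη, hηr, -, hηs, hη1⟩ := exists_cutoff (isCompact_closedBall (0 : Plane) 1)
    (Metric.isOpen_ball (x := 0) (ε := 2)) (Metric.closedBall_subset_ball (by norm_num))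
  choose C hC using fun j => (hη.pd j).exists_bound
  refine ⟨|C 0| + |C 1|, by positivity, fun k hk => ?_⟩
  have hk0 : (0 : ℝ) < k := by exact_mod_cast hk
  set L : Plane → Plane := fun x => (k : ℝ)⁻¹ • x with hL
  have hLn : ∀ x, ‖L x‖ = ‖x‖ / k := fun x => by
    rw [hL, norm_smul, norm_inv, Real.norm_of_nonneg hk0.le]; ring
  have hLs : ContDiff ℝ ∞ L := contDiff_const_smul _
  have hd : ∀ j x, pd j (fun x => η (L x)) x = (k : ℝ)⁻¹ * pd j η (L x) := fun j x => by
    have h1 : HasFDerivAt L ((k : ℝ)⁻¹ • ContinuousLinearMap.id ℝ Plane) x :=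
      ((k : ℝ)⁻¹ • ContinuousLinearMap.id ℝ Plane).hasFDerivAt
    have h2 := (hη.1.differentiable (by simp) (L x)).hasFDerivAt.comp x h1
    have h3 : fderiv ℝ (fun x => η (L x)) x = _ := h2.fderiv
    rw [pd, h3, pd]
    simp
  have hz : ∀ x, 2 * k < ‖x‖ → η (L x) = 0 := fun x hx => by
    refine image_eq_zero_of_notMem_tsupport fun h => ?_
    have := hηs h
    rw [mem_ball_zero_iff, hLn, div_lt_iff₀ hk0] at this
    linarith
  refine ⟨fun x => η (L x), ⟨hη.1.comp hLs, ?_⟩, fun x => hηr _, fun x hx => ?_, hz, fun j x => ?_⟩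
  · refine HasCompactSupport.intro (isCompact_closedBall (0 : Plane) (2 * k)) fun x hx => hz x ?_
    simpa using hx
  · exact (hη1.filter_mono (nhds_le_nhdsSet (by
      rw [mem_closedBall_zero_iff, hLn, div_le_one hk0]; exact hx))).self_of_nhds
  · rw [hd, norm_mul, Complex.norm_real, norm_inv, Real.norm_of_nonneg hk0.le, div_eq_inv_mul]
    refine mul_le_mul_of_nonneg_left (((hC j).2 _).trans ?_) (by positivity)
    fin_cases j
    · exact (le_abs_self _).trans (le_add_of_nonneg_right (abs_nonneg _))
    · exact (le_abs_self _).trans (le_add_of_nonneg_left (abs_nonneg _))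

/-- A square integrable function that is locally in the domain of the Hamiltonian and satisfies
`P d = -κ² d` vanishes. -/
theorem eq_zero_of_local_solution {κ : ℝ} (hκ : 0 < κ) {d : L2}
    (h : ∀ r : ℝ, ∃ g : L2, ∀ᵐ x, ‖x‖ < r → invOne s α g x = d x ∧
      g x - invOne s α g x = -(κ ^ 2 : ℝ) * d x) : d = 0 := by
  obtain ⟨C, hC0, hC⟩ := exists_slow_cutoff
  have key : ∀ k : ℕ, 0 < k → κ * ‖bmul (ind (Metric.closedBall 0 k)) d‖ ≤ 2 * (C / k) * ‖d‖ := by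
    intro k hk
    obtain ⟨θ, hθ, hθr, hθ1, hθ0, hθd⟩ := hC k hk
    obtain ⟨g, hg⟩ := h (2 * k + 1)
    have hz : ∀ x, ¬ ‖x‖ < 2 * k + 1 → θ x = 0 := fun x hx => hθ0 x (by linarith)
    have hzd : ∀ j x, ¬ ‖x‖ < 2 * k + 1 → pd j θ x = 0 := fun j x hx => by
      refine pd_eq_zero_of_eventually (c := 0) ?_ j
      filter_upwards [(isOpen_lt (continuous_const (y := (2 * k : ℝ))) continuous_norm).mem_nhds
        (by simp only [mem_ofPred_eq]; linarith : x ∈ {y : Plane | (2 * k : ℝ) < ‖y‖})] with y hy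
      exact hθ0 y hy
    have e1 : bmul θ (invOne s α g) = bmul θ d := bmul_congr hθ.memLp (by
      filter_upwards [hg] with x hx
      by_cases hxr : ‖x‖ < 2 * k + 1
      · exact Or.inr (hx hxr).1
      · exact Or.inl (hz x hxr))
    have e2 : bmul θ (g - invOne s α g) = bmul θ ((-(κ ^ 2 : ℝ) : ℂ) • d) :=
      bmul_congr hθ.memLp (by
        filter_upwards [hg, Lp.coeFn_sub g (invOne s α g), Lp.coeFn_smul (-(κ ^ 2 : ℝ) : ℂ) d]
          with x hx hx1 hx2
        by_cases hxr : ‖x‖ < 2 * k + 1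
        · right
          rw [hx1, Pi.sub_apply, (hx hxr).2, hx2, Pi.smul_apply, smul_eq_mul]
        · exact Or.inl (hz x hxr))
    have e3 : ∀ j, bmul (pd j θ) (invOne s α g) = bmul (pd j θ) d := fun j =>
      bmul_congr (hθ.pd j).memLp (by
        filter_upwards [hg] with x hx
        by_cases hxr : ‖x‖ < 2 * k + 1
        · exact Or.inr (hx hxr).1
        · exact Or.inl (hzd j x hxr))
    -- Since P d = -κ² d locally, the energy identity forces κ²‖θd‖² ≤ Σ‖(∂_jθ)d‖², which is
    -- O(k⁻²)‖d‖² as the cutoffs spread out.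
    have hc := sum_norm_mulJet_sq s α hθ hθr g
    simp only [e1, e2, e3] at hc
    rw [map_smul, inner_smul_right, inner_self_eq_norm_sq_to_K] at hc
    have hre : ((-(κ ^ 2 : ℝ) : ℂ) * ((‖bmul θ d‖ : ℝ) : ℂ) ^ 2).re = -(κ ^ 2 * ‖bmul θ d‖ ^ 2) := by
      rw [← Complex.ofReal_pow, ← Complex.ofReal_neg, ← Complex.ofReal_mul, Complex.ofReal_re]
      ring
    have h0 : 0 ≤ ∑ j, ‖mulJet θ (formProj s α (inc none g)) (some j)‖ ^ 2 :=
      Finset.sum_nonneg fun _ _ => sq_nonneg _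
    rw [hc] at h0
    have hb : ∀ j, ‖bmul (pd j θ) d‖ ≤ C / k * ‖d‖ := fun j =>
      norm_bmul_le_mul (hθ.pd j).memLp (hθd j) d
    rw [Fin.sum_univ_two] at h0
    have hb0 := pow_le_pow_left₀ (norm_nonneg _) (hb 0) 2
    have hb1 := pow_le_pow_left₀ (norm_nonneg _) (hb 1) 2
    have hk0 : (0 : ℝ) < k := by exact_mod_cast hk
    have hCd : 0 ≤ C / k * ‖d‖ := by positivity
    have hmain : (κ * ‖bmul θ d‖) ^ 2 ≤ (2 * (C / k * ‖d‖)) ^ 2 := by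
      have h0' : 0 ≤ -(κ ^ 2 * ‖bmul θ d‖ ^ 2) + (‖bmul (pd 0 θ) d‖ ^ 2 + ‖bmul (pd 1 θ) d‖ ^ 2) := by
        rw [← hre]; exact h0
      nlinarith
    have h2 : κ * ‖bmul θ d‖ ≤ 2 * (C / k * ‖d‖) :=
      (pow_le_pow_iff_left₀ (by positivity) (by positivity) two_ne_zero).1 hmain
    have h3 : ‖bmul (ind (Metric.closedBall 0 k)) d‖ ≤ 1 * ‖bmul θ d‖ :=
      norm_bmul_le (memLp_ind measurableSet_closedBall) hθ.memLp (Eventually.of_forall fun x => by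
        by_cases hx : x ∈ Metric.closedBall (0 : Plane) k
        · rw [ind_of_mem hx, hθ1 x (by simpa using hx)]; simp
        · rw [ind_of_notMem hx]; simp) d
    rw [one_mul] at h3
    calc _ ≤ κ * ‖bmul θ d‖ := by gcongr
      _ ≤ _ := by rw [mul_assoc]; exact h2
  have hzero : ∀ r : ℕ, bmul (ind (Metric.closedBall 0 r)) d = 0 := by
    intro r
    rw [← norm_le_zero_iff]
    have hlim : Tendsto (fun k : ℕ => 2 * (C / k) * ‖d‖) atTop (𝓝 0) := by
      have := ((tendsto_const_div_atTop_nhds_zero_nat C).const_mul 2).mul_const ‖d‖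
      simpa using this
    have hle : κ * ‖bmul (ind (Metric.closedBall 0 (r : ℝ))) d‖ ≤ 0 := by
      refine ge_of_tendsto hlim ?_
      filter_upwards [eventually_ge_atTop (r + 1)] with k hk
      refine le_trans ?_ (key k (by omega))
      refine mul_le_mul_of_nonneg_left ?_ hκ.le
      have hrk : (r : ℝ) ≤ k := by exact_mod_cast (by omega : r ≤ k)
      refine (norm_bmul_le (C := 1) (memLp_ind measurableSet_closedBall)
        (memLp_ind measurableSet_closedBall) (Eventually.of_forall fun x => ?_) d).trans
        (le_of_eq (one_mul _))
      by_cases hx : x ∈ Metric.closedBall (0 : Plane) r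
      · rw [ind_of_mem hx, ind_of_mem (Metric.closedBall_subset_closedBall hrk hx)]; simp
      · rw [ind_of_notMem hx]; simp
    by_contra hpos
    rw [not_le] at hpos
    exact (mul_pos hκ hpos).not_ge hle
  refine Lp.ext ?_
  have hall : ∀ᵐ x, ∀ r : ℕ, bmul (ind (Metric.closedBall 0 (r : ℝ))) d x =
      ind (Metric.closedBall 0 (r : ℝ)) x * d x :=
    ae_all_iff.2 fun r => bmul_ae (memLp_ind measurableSet_closedBall) d
  filter_upwards [hall, Lp.coeFn_zero ℂ 2 (volume : Measure Plane)] with x hx h0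
  obtain ⟨r, hr⟩ := exists_nat_ge ‖x‖
  have h1 := hx r
  rw [hzero r, ind_of_mem (by simpa using hr), one_mul] at h1
  rw [← h1]

end

section

/-! ### The parametrix and its error -/

variable {n : ℕ} (s : Fin n → Plane) (α : Fin n → ℝ)

theorem bmul_comp_bmul_ind {χ : Plane → ℂ} (hχ : MemLp χ ⊤ (volume : Measure Plane)) {A : Set Plane}
    (hA : MeasurableSet A) (h : ∀ x ∉ A, χ x = 0) : bmul χ ∘L bmul (ind A) = bmul χ := by
  ext1 f
  change bmul χ (bmul (ind A) f) = _
  refine bmul_congr hχ ?_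
  filter_upwards [bmul_ae (memLp_ind hA) f] with x hx
  by_cases hxA : x ∈ A
  · right; rw [hx, ind_of_mem hxA, one_mul]
  · exact Or.inl (h x hxA)

theorem bmul_ind_comp_bmul {χ : Plane → ℂ} (hχ : MemLp χ ⊤ (volume : Measure Plane)) {A : Set Plane}
    (hA : MeasurableSet A) (h : ∀ x ∉ A, χ x = 0) : bmul (ind A) ∘L bmul χ = bmul χ := by
  have h1 := bmul_comp_bmul_ind hχ hA h
  ext1 f
  exact (bmul_comm (memLp_ind hA) hχ f).trans (congrArg (fun T : L2 →L[ℂ] L2 => T f) h1)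

theorem bmul_ind_bmul_ind {A B : Set Plane} (hA : MeasurableSet A) (hB : MeasurableSet B) :
    bmul (ind A) ∘L bmul (ind B) = bmul (ind (A ∩ B)) := by
  ext1 f
  change bmul _ (bmul _ f) = _
  rw [bmul_bmul (memLp_ind hA) (memLp_ind hB)
    (by simpa only [ind_mul_ind] using memLp_ind (hA.inter hB))]
  simp only [ind_mul_ind]

/-- The Green operator with sources outside the disc of radius `ρ + 3`. -/
def outerGreen (ρ N : ℝ) (ζ : ℂ) : L2 →L[ℂ] L2 := green s α (annulus ρ N) (annulus (ρ + 3) N) ζ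

/-- The multiplication by the indicator function of a disc. -/
def disc (r : ℝ) : L2 →L[ℂ] L2 := bmul (ind (Metric.ball 0 r))

/-- The multiplication by the indicator function of a closed disc. -/
def cdisc (r : ℝ) : L2 →L[ℂ] L2 := bmul (ind (Metric.closedBall 0 r))

/-- The operator `h` satisfies `(P + 1)⁻¹ h = χ G` for the outer Green operator `G`. -/
structure IsOuterSource (ρ N : ℝ) (χ : Plane → ℂ) (h : ℂ → L2 →L[ℂ] L2) : Prop where
  differentiable : Differentiable ℂ h
  invOne_comp : ∀ ζ, invOne s α ∘L h ζ = bmul χ ∘L outerGreen s α ρ N ζ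
  local_eq : ∀ (ζ : ℂ) (θ : Plane → ℂ), IsCutoff θ → (∀ᶠ x in 𝓝ˢ (tsupport θ), χ x = 1) →
    bmul θ ∘L h ζ = bmul θ ∘L (bmul (ind (annulus (ρ + 3) N)) +
      (1 + Complex.exp (2 * ζ)) • outerGreen s α ρ N ζ)

open scoped Classical in
/-- The operator `h` with `(P + 1)⁻¹ h = χ G` for the outer Green operator `G`. -/
def outerSource (ρ N : ℝ) (χ : Plane → ℂ) : ℂ → L2 →L[ℂ] L2 :=
  if h : ∃ h, IsOuterSource s α ρ N χ h then h.choose else 0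

/-- The cutoff functions of the parametrix. -/
structure Cutoffs (ρ : ℝ) where
  /-- The cutoff function of the outer part. -/
  inn : Plane → ℂ
  /-- The cutoff function of the inner part. -/
  out : Plane → ℂ
  /-- A cutoff function near the support of the gradient of `inn`. -/
  mid : Plane → ℂ
  /-- A cutoff function near the support of `mid`. -/
  wide : Plane → ℂ
  pos : 0 < ρ
  norm_lt : ∀ i, ‖s i‖ < ρ
  cut_inn : IsCutoff inn
  cut_out : IsCutoff out
  cut_mid : IsCutoff mid
  cut_wide : IsCutoff wide
  inn_eq : ∀ᶠ x in 𝓝ˢ (Metric.closedBall 0 (ρ + 1)), inn x = 1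
  inn_supp : tsupport inn ⊆ Metric.ball 0 (ρ + 2)
  mid_real : ∀ x, conj (mid x) = mid x
  mid_eq : ∀ᶠ x in 𝓝ˢ {x : Plane | ρ + 1 ≤ ‖x‖ ∧ ‖x‖ ≤ ρ + 2}, mid x = 1
  wide_eq : ∀ᶠ x in 𝓝ˢ (tsupport mid), wide x = 1
  wide_supp : tsupport wide ⊆ annulus ρ (ρ + 5 / 2)
  out_eq : ∀ᶠ x in 𝓝ˢ (Metric.closedBall 0 (ρ + 3)), out x = 1
  out_supp : tsupport out ⊆ Metric.ball 0 (ρ + 4)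

theorem exists_cutoffs {ρ : ℝ} (hρ0 : 0 < ρ) (hρ : ∀ i, ‖s i‖ < ρ) : Nonempty (Cutoffs s ρ) := by
  obtain ⟨inn, h1, -, -, h2, h3⟩ := exists_cutoff (isCompact_closedBall (0 : Plane) (ρ + 1))
    (Metric.isOpen_ball (x := 0) (ε := ρ + 2)) (Metric.closedBall_subset_ball (by linarith))
  obtain ⟨out, h4, -, -, h5, h6⟩ := exists_cutoff (isCompact_closedBall (0 : Plane) (ρ + 3))
    (Metric.isOpen_ball (x := 0) (ε := ρ + 4)) (Metric.closedBall_subset_ball (by linarith))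
  have hK : IsCompact {x : Plane | ρ + 1 ≤ ‖x‖ ∧ ‖x‖ ≤ ρ + 2} := by
    refine (isCompact_closedBall (0 : Plane) (ρ + 2)).of_isClosed_subset ?_ fun x hx => ?_
    · exact (isClosed_le continuous_const continuous_norm).inter
        (isClosed_le continuous_norm continuous_const)
    · simpa using hx.2
  obtain ⟨mid, h7, h8, -, h9, h10⟩ := exists_cutoff hK (isOpen_annulus ρ (ρ + 5 / 2))
    fun x hx => ⟨by linarith [hx.1], by linarith [hx.2]⟩
  obtain ⟨wide, h11, -, -, h12, h13⟩ := exists_cutoff h7.2.isCompact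
    (isOpen_annulus ρ (ρ + 5 / 2)) h9
  exact ⟨⟨inn, out, mid, wide, hρ0, hρ, h1, h4, h7, h11, h3, h2, h8, h10, h13, h12, h6, h5⟩⟩

namespace Cutoffs

variable {s} {ρ : ℝ}

theorem outerSource_spec (D : Cutoffs s ρ) {N : ℝ} (hN : ρ + 3 < N) {χ : Plane → ℂ} (hχ : IsCutoff χ)
    (hχs : tsupport χ ⊆ annulus ρ N) : IsOuterSource s α ρ N χ (outerSource s α ρ N χ) := by
  have h : ∃ h, IsOuterSource s α ρ N χ h := by
    obtain ⟨h, h1, h2, h3⟩ := exists_greenSource α D.norm_lt D.pos le_rfl (by linarith : ρ ≤ ρ + 3)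
      hN hχ hχs
    exact ⟨h, h1, h2, h3⟩
  rw [outerSource, dif_pos h]
  exact h.choose_spec

theorem outerGreen_comp (D : Cutoffs s ρ) {N : ℝ} {A : Set Plane} (hA : MeasurableSet A) (ζ : ℂ) :
    outerGreen s α ρ N ζ ∘L bmul (ind A) =
      green s α (annulus ρ N) (annulus (ρ + 3) N ∩ A) ζ := by
  have h := bmul_green_bmul s α D.pos (measurableSet_annulus ρ N) (measurableSet_annulus (ρ + 3) N)
    le_rfl (annulus_subset (by linarith) le_rfl) MeasurableSet.univ hA ζ
  have h1 : bmul (ind univ) = ContinuousLinearMap.id ℂ L2 := by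
    ext1 f
    refine bmul_eq_of_ae (memLp_ind MeasurableSet.univ) (Eventually.of_forall fun x => ?_)
    simp [ind]
  rw [h1, univ_inter, ContinuousLinearMap.id_comp] at h
  exact h

theorem differentiable_outerGreen (D : Cutoffs s ρ) {N : ℝ} : Differentiable ℂ (outerGreen s α ρ N) :=
  differentiable_green s α D.pos (measurableSet_annulus ρ N) (measurableSet_annulus (ρ + 3) N)
    le_rfl (annulus_subset (by linarith) le_rfl)

theorem outerGreen_comp_annulus (D : Cutoffs s ρ) {N : ℝ} (ζ : ℂ) :
    outerGreen s α ρ N ζ ∘L bmul (ind (annulus (ρ + 3) N)) = outerGreen s α ρ N ζ := by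
  rw [outerGreen_comp α D (measurableSet_annulus _ _), inter_self, outerGreen]

/-- The radius N only truncates a fixed kernel, so cutting the larger operator on both sides gives
back the smaller one. -/
theorem disc_comp_outerGreen_comp (D : Cutoffs s ρ) {N N' : ℝ} (h : N ≤ N') (ζ : ℂ) :
    disc N ∘L outerGreen s α ρ N' ζ ∘L disc N = outerGreen s α ρ N ζ := by
  rw [disc, outerGreen, bmul_green_bmul s α D.pos (measurableSet_annulus ρ N')
    (measurableSet_annulus (ρ + 3) N') le_rfl (annulus_subset (by linarith) le_rfl)
    measurableSet_ball measurableSet_ball, outerGreen]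
  have e : ∀ a : ℝ, annulus a N' ∩ Metric.ball 0 N = annulus a N := fun a => by
    ext x
    simp only [annulus, mem_inter_iff, mem_ofPred_eq, mem_ball_zero_iff]
    exact ⟨fun hx => ⟨hx.1.1, hx.2⟩, fun hx => ⟨⟨hx.1, hx.2.trans_le h⟩, hx.2⟩⟩
  rw [inter_comm, e, e]

theorem eq_of_invOne_comp {S T : L2 →L[ℂ] L2} (h : invOne s α ∘L S = invOne s α ∘L T) : S = T := by
  ext1 f
  exact invOne_injective s α (congrArg (fun A : L2 →L[ℂ] L2 => A f) h)

/-- The sources are obtained by choice, but T is injective, so identities between them follow from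
the corresponding identities for the Green operators. -/
theorem outerSource_comp_disc (D : Cutoffs s ρ) {N N' : ℝ} (hN : ρ + 3 < N) (h : N ≤ N') {χ : Plane → ℂ}
    (hχ : IsCutoff χ) (hχs : tsupport χ ⊆ annulus ρ N) (ζ : ℂ) :
    outerSource s α ρ N' χ ζ ∘L disc N = outerSource s α ρ N χ ζ := by
  have h1 := (outerSource_spec α D hN hχ hχs).invOne_comp ζ
  have h2 := (outerSource_spec α D (hN.trans_le h) hχ
    (hχs.trans (annulus_subset le_rfl h))).invOne_comp ζ
  have h3 : bmul χ ∘L disc N = bmul χ := bmul_comp_bmul_ind hχ.memLp measurableSet_ball fun x hx =>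
    image_eq_zero_of_notMem_tsupport fun hx' => hx (by simpa using (hχs hx').2)
  refine eq_of_invOne_comp (s := s) α ?_
  rw [← ContinuousLinearMap.comp_assoc, h2, h1, ← disc_comp_outerGreen_comp α D h, ← h3]
  simp only [← ContinuousLinearMap.comp_assoc]
  rw [ContinuousLinearMap.comp_assoc (bmul χ) (disc N) (disc N)]
  have h4 : disc N ∘L disc N = disc N := by
    rw [disc, bmul_ind_bmul_ind measurableSet_ball measurableSet_ball, inter_self]
  rw [h4]

theorem outerSource_comp_annulus (D : Cutoffs s ρ) {N : ℝ} (hN : ρ + 3 < N) {χ : Plane → ℂ}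
    (hχ : IsCutoff χ) (hχs : tsupport χ ⊆ annulus ρ N) (ζ : ℂ) :
    outerSource s α ρ N χ ζ ∘L bmul (ind (annulus (ρ + 3) N)) = outerSource s α ρ N χ ζ := by
  refine eq_of_invOne_comp (s := s) α ?_
  rw [← ContinuousLinearMap.comp_assoc, (outerSource_spec α D hN hχ hχs).invOne_comp,
    ContinuousLinearMap.comp_assoc, outerGreen_comp_annulus α D]

variable (D : Cutoffs s ρ)

/-- The error of the parametrix that comes from the outer part. -/
def errOuter (N : ℝ) (ζ : ℂ) : L2 →L[ℂ] L2 := -(comm s α D.inn ∘L outerSource s α ρ N D.wide ζ)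

/-- The error of the parametrix that comes from the inner part. -/
def errInner (κ : ℝ) (ζ : ℂ) : L2 →L[ℂ] L2 :=
  ((-(κ ^ 2 : ℝ) - Complex.exp (2 * ζ) : ℂ) • (bmul D.out ∘L invOne s α) + comm s α D.out) ∘L
    resFactor s α (-(κ ^ 2 : ℝ)) ∘L cdisc (ρ + 3)

/-- The error of the parametrix on the disc of radius `ρ + 4`. -/
def err (κ : ℝ) (ζ : ℂ) : L2 →L[ℂ] L2 := errInner α D κ ζ + errOuter α D (ρ + 4) ζ

theorem wide_subset {N : ℝ} (hN : ρ + 3 < N) : tsupport D.wide ⊆ annulus ρ N :=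
  D.wide_supp.trans (annulus_subset le_rfl (by linarith))

theorem wideSource {N : ℝ} (hN : ρ + 3 < N) :
    IsOuterSource s α ρ N D.wide (outerSource s α ρ N D.wide) :=
  outerSource_spec α D hN D.cut_wide (wide_subset D hN)

theorem differentiable_comp {S : L2 →L[ℂ] L2} {T : ℂ → L2 →L[ℂ] L2} (hT : Differentiable ℂ T) :
    Differentiable ℂ fun ζ => S ∘L T ζ :=
  (ContinuousLinearMap.compL ℂ L2 L2 L2 S).differentiable.comp hT

theorem differentiable_comp_right {S : L2 →L[ℂ] L2} {T : ℂ → L2 →L[ℂ] L2}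
    (hT : Differentiable ℂ T) : Differentiable ℂ fun ζ => T ζ ∘L S :=
  ((ContinuousLinearMap.compL ℂ L2 L2 L2).flip S).differentiable.comp hT

theorem differentiable_errOuter {N : ℝ} (hN : ρ + 3 < N) : Differentiable ℂ (errOuter α D N) :=
  (differentiable_comp (wideSource α D hN).differentiable).neg

theorem differentiable_err (κ : ℝ) : Differentiable ℂ (err α D κ) := by
  refine Differentiable.add ?_ (differentiable_errOuter α D (by linarith))
  refine differentiable_comp_right ?_
  refine Differentiable.add_const _ (Differentiable.fun_smul ?_ (differentiable_const _))
  fun_prop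

theorem isCompactOperator_err (κ : ℝ) (ζ : ℂ) : IsCompactOperator (err α D κ ζ) := by
  have h1 : IsCompactOperator ((-(κ ^ 2 : ℝ) - Complex.exp (2 * ζ) : ℂ) •
      (bmul D.out ∘L invOne s α) + comm s α D.out) :=
    ((isCompactOperator_bmul_invOne s α D.cut_out).smul _).add
      (isCompactOperator_comm s α D.cut_out)
  have h2 : IsCompactOperator (errInner α D κ ζ) := h1.comp_clm _
  have h3 : IsCompactOperator (errOuter α D (ρ + 4) ζ) :=
    ((isCompactOperator_comm s α D.cut_inn).comp_clm _).neg
  exact h2.add h3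

/-- Commutators are local operators. Consequently the range of the error stays in a fixed disc
whatever the truncation radius, which allows a single Fredholm inverse to serve all radii. -/
theorem comm_disc {χ : Plane → ℂ} (hχ : IsCutoff χ) {r : ℝ} (hr : tsupport χ ⊆ Metric.ball 0 r) :
    disc r ∘L comm s α χ = comm s α χ := by
  ext1 f
  refine bmul_eq_of_ae (memLp_ind measurableSet_ball) ?_
  filter_upwards [comm_ae s α hχ f] with x hx
  by_cases hxr : x ∈ Metric.ball (0 : Plane) r
  · rw [ind_of_mem hxr, one_mul]; rfl
  · have h0 : x ∉ tsupport χ := fun h => hxr (hr h)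
    rw [ind_of_notMem hxr, zero_mul, hx, lap_eq_zero_of_notMem h0]
    simp [pd_eq_zero_of_notMem h0]

theorem disc_comp_errOuter {r : ℝ} (hr : ρ + 2 ≤ r) (N : ℝ) (ζ : ℂ) :
    disc r ∘L errOuter α D N ζ = errOuter α D N ζ := by
  rw [errOuter, ContinuousLinearMap.comp_neg, ← ContinuousLinearMap.comp_assoc,
    comm_disc (s := s) α D.cut_inn (D.inn_supp.trans (Metric.ball_subset_ball hr))]

theorem disc_comp_errInner {r : ℝ} (hr : ρ + 4 ≤ r) (κ : ℝ) (ζ : ℂ) :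
    disc r ∘L errInner α D κ ζ = errInner α D κ ζ := by
  have h1 := comm_disc (s := s) α D.cut_out (D.out_supp.trans (Metric.ball_subset_ball hr))
  have h2 : disc r ∘L bmul D.out = bmul D.out :=
    bmul_ind_comp_bmul D.cut_out.memLp measurableSet_ball fun x hx =>
      image_eq_zero_of_notMem_tsupport fun hx' =>
        hx ((D.out_supp.trans (Metric.ball_subset_ball hr)) hx')
  rw [errInner, ← ContinuousLinearMap.comp_assoc, ContinuousLinearMap.comp_add,
    ContinuousLinearMap.comp_smul, ← ContinuousLinearMap.comp_assoc (disc r) (bmul D.out), h1, h2,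
    ← ContinuousLinearMap.comp_assoc]

theorem errOuter_comp_disc {N N' : ℝ} (hN : ρ + 3 < N) (h : N ≤ N') (ζ : ℂ) :
    errOuter α D N' ζ ∘L disc N = errOuter α D N ζ := by
  rw [errOuter, ContinuousLinearMap.neg_comp, ContinuousLinearMap.comp_assoc,
    outerSource_comp_disc α D hN h D.cut_wide (wide_subset D hN), errOuter]

end Cutoffs

end

section

/-! ### Smallness of the error -/

variable {n : ℕ} (s : Fin n → Plane) (α : Fin n → ℝ)

theorem neg_sq_notMem {κ : ℝ} (hκ : 0 < κ) :
    ¬ ((-(κ ^ 2 : ℝ) : ℂ).im = 0 ∧ 0 ≤ (-(κ ^ 2 : ℝ) : ℂ).re) := by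
  rw [Complex.neg_re, Complex.ofReal_re, not_and, not_le]
  intro _
  have : 0 < κ ^ 2 := by positivity
  linarith

/-- Energy estimate for the resolvent at a negative point. -/
theorem norm_resFactor_le {κ : ℝ} (hκ : 0 < κ) (f : L2) :
    κ ^ 2 * ‖invOne s α (resFactor s α (-(κ ^ 2 : ℝ)) f)‖ ≤ ‖f‖ ∧
      ∀ j, κ * ‖derivInv s α j (resFactor s α (-(κ ^ 2 : ℝ)) f)‖ ≤ ‖f‖ := by
  set g := resFactor s α (-(κ ^ 2 : ℝ)) f with hg
  have h1 : f = g - (-(κ ^ 2 : ℝ) + 1 : ℂ) • invOne s α g :=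
    (mul_resFactor s α (neg_sq_notMem hκ) f).symm
  -- Pairing f = (P + κ²)u with u = Tg gives κ²‖u‖² + Σ‖D_j u‖²; Cauchy–Schwarz then yields both
  -- bounds.
  have h2 : (inner ℂ (invOne s α g) f : ℂ) =
      ((κ ^ 2 * ‖invOne s α g‖ ^ 2 + ∑ j, ‖derivInv s α j g‖ ^ 2 : ℝ) : ℂ) := by
    rw [h1, inner_sub_right, inner_invOne_self, inner_smul_right, inner_self_eq_norm_sq_to_K]
    push_cast
    simp only [Complex.coe_algebraMap]
    ring
  have h3 : κ ^ 2 * ‖invOne s α g‖ ^ 2 + ∑ j, ‖derivInv s α j g‖ ^ 2 ≤ ‖invOne s α g‖ * ‖f‖ := by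
    have := norm_inner_le_norm (𝕜 := ℂ) (invOne s α g) f
    rw [h2, Complex.norm_real] at this
    exact (le_abs_self _).trans this
  have h4 : 0 ≤ ∑ j, ‖derivInv s α j g‖ ^ 2 := Finset.sum_nonneg fun j _ => sq_nonneg _
  have h5 : κ ^ 2 * ‖invOne s α g‖ ≤ ‖f‖ := by
    by_contra! h
    have h0 : 0 < ‖invOne s α g‖ := by
      by_contra! h0
      have : ‖invOne s α g‖ = 0 := le_antisymm h0 (norm_nonneg _)
      rw [this, mul_zero] at h
      exact h.not_ge (norm_nonneg _)
    nlinarith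
  refine ⟨h5, fun j => ?_⟩
  have h6 : ‖derivInv s α j g‖ ^ 2 ≤ ∑ j, ‖derivInv s α j g‖ ^ 2 :=
    Finset.single_le_sum (f := fun j => ‖derivInv s α j g‖ ^ 2) (fun j _ => sq_nonneg _)
      (Finset.mem_univ j)
  refine abs_le_of_sq_le_sq' ?_ (norm_nonneg _) |>.2
  have h7 : 0 < κ ^ 2 := by positivity
  have h8 : 0 ≤ κ ^ 2 * ‖invOne s α g‖ ^ 2 := by positivity
  have h9 : κ ^ 2 * ‖derivInv s α j g‖ ^ 2 ≤ κ ^ 2 * (‖invOne s α g‖ * ‖f‖) := by gcongr; linarith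
  calc (κ * ‖derivInv s α j g‖) ^ 2 = κ ^ 2 * ‖derivInv s α j g‖ ^ 2 := by ring
    _ ≤ κ ^ 2 * (‖invOne s α g‖ * ‖f‖) := h9
    _ = (κ ^ 2 * ‖invOne s α g‖) * ‖f‖ := by ring
    _ ≤ ‖f‖ * ‖f‖ := by gcongr
    _ = ‖f‖ ^ 2 := by ring

/-- The point of the logarithmic cover above `i κ` on the physical sheet. -/
def imagPoint (κ : ℝ) : ℂ := Real.log κ + (Real.pi / 2 : ℝ) * Complex.I

theorem exp_two_mul_imagPoint {κ : ℝ} (hκ : 0 < κ) :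
    Complex.exp (2 * imagPoint κ) = -(κ ^ 2 : ℝ) := by
  have h : 2 * imagPoint κ = ((Real.log κ : ℝ) : ℂ) + (Real.log κ : ℝ) + Real.pi * Complex.I := by
    rw [imagPoint]; push_cast; ring
  rw [h, Complex.exp_add, Complex.exp_add, Complex.exp_pi_mul_I, ← Complex.ofReal_exp,
    Real.exp_log hκ]
  push_cast
  ring

/-- Above λ = iκ the arguments of the Bessel functions are real, so the sharp estimates on the real
axis apply for every order. -/
theorem shift_imagPoint (κ t : ℝ) : shift (imagPoint κ) t = (Real.log κ + t : ℝ) := by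
  rw [shift, imagPoint]; push_cast; ring

theorem summable_exp_neg_order {δ : ℝ} (hδ : 0 < δ) :
    Summable fun m : ℤ => Real.exp (-(δ * order α m)) := by
  have h1 : Summable fun k : ℕ => Real.exp (-(δ * |((k : ℤ) : ℝ)|)) := by
    have h := summable_geometric_of_lt_one (Real.exp_pos (-δ)).le (by simpa using hδ)
    refine h.congr fun k => ?_
    rw [← Real.exp_nat_mul, Int.cast_natCast, abs_of_nonneg (Nat.cast_nonneg k)]
    ring_nf
  have h2 : Summable fun m : ℤ => Real.exp (-(δ * |(m : ℝ)|)) :=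
    Summable.of_nat_of_neg h1 (by simpa using h1)
  refine Summable.of_nonneg_of_le (fun m => (Real.exp_pos _).le) (fun m => ?_)
    (h2.mul_left (Real.exp (δ * |flux α|)))
  rw [← Real.exp_add, Real.exp_le_exp, order]
  have : |(m : ℝ)| ≤ |(m : ℝ) + flux α| + |flux α| := by
    simpa using abs_sub ((m : ℝ) + flux α) (flux α)
  nlinarith

/-- The Green operator between separated annuli is small at high energies. -/
theorem exists_norm_green_le {ρ a b N : ℝ} (hρ : 0 < ρ) (hab : a < b) (hρa : ρ < a) (hb : 1 ≤ b)
    (haN : a ≤ N) : ∃ C, 0 ≤ C ∧ ∀ κ : ℝ, 1 ≤ κ →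
      ‖green s α (annulus ρ a) (annulus b N) (imagPoint κ)‖ ≤ C / κ := by
  -- The logarithmic gap between the annuli turns the exponential factor into at most e^{-δν},
  -- summable over the modes. The factor 1/κ comes from the square root in the bound of IK, where
  -- radii are at least b ≥ 1.
  set δ := Real.log b - Real.log a with hδ
  have ha : 0 < a := hρ.trans hρa
  have hδ0 : 0 < δ := sub_pos.2 (Real.log_lt_log ha hab)
  have hsum := (summable_exp_neg_order α hδ0).mul_right (discArea N)
  refine ⟨∑' m, Real.exp (-(δ * order α m)) * discArea N,
    tsum_nonneg fun m => mul_nonneg (Real.exp_pos _).le (discArea_nonneg N), fun κ hκ => ?_⟩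
  have hκ0 : 0 < κ := by linarith
  have hk : ∀ m, ‖modeOp s α (annulus ρ a) (annulus b N) m (imagPoint κ)‖ ≤
      Real.exp (-(δ * order α m)) * discArea N / κ := fun m => by
    have := norm_kernelOp_le' (isKernel_modeKernel s α hρ (measurableSet_annulus ρ a)
      (measurableSet_annulus b N) (annulus_subset le_rfl haN)
      (annulus_subset (by linarith) le_rfl) m (imagPoint κ)
      (C := Real.exp (-(δ * order α m)) / κ) (by positivity) fun x hx y hy => ?_)
    · refine this.trans (le_of_eq ?_); ring
    have hx0 : 0 < ‖x‖ := hρ.trans hx.1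
    have hy0 : 0 < ‖y‖ := by linarith [hy.1]
    have e1 : Real.log ‖x‖ ≤ Real.log a := Real.log_le_log hx0 hx.2.le
    have e2 : Real.log b ≤ Real.log ‖y‖ := Real.log_le_log (ha.trans hab) hy.1.le
    have e3 : Real.log ‖x‖ ≤ Real.log ‖y‖ := by linarith
    rw [greenRadial, min_eq_left e3, max_eq_right e3, shift_imagPoint, shift_imagPoint, norm_mul]
    refine (norm_besI_mul_besK_le (order_nonneg α m) (by linarith)).trans ?_
    refine div_le_div₀ (Real.exp_pos _).le ?_ hκ0 ?_
    · rw [Real.exp_le_exp]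
      nlinarith [order_nonneg α m]
    · refine Real.le_sqrt_of_sq_le ?_
      have e4 : Real.exp (2 * (Real.log κ + Real.log ‖y‖)) = (κ * ‖y‖) ^ 2 := by
        rw [← Real.log_mul hκ0.ne' hy0.ne', two_mul, Real.exp_add,
          Real.exp_log (mul_pos hκ0 hy0), sq]
      rw [e4]
      have e5 : κ ≤ κ * ‖y‖ := le_mul_of_one_le_right hκ0.le (by linarith [hy.1])
      nlinarith [sq_nonneg (order α m)]
  rw [green]
  refine (tsum_of_norm_bounded (hsum.div_const κ).hasSum hk).trans ?_
  rw [tsum_div_const]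

/-- For u = (P + κ²)⁻¹f the energy estimate gives ‖u‖ = O(κ⁻²) and ‖D_j u‖ = O(κ⁻¹), and a
commutator contains at most one derivative of u. -/
theorem exists_norm_comm_resFactor_le {χ : Plane → ℂ} (hχ : IsCutoff χ) : ∃ C, 0 ≤ C ∧
    ∀ κ : ℝ, 1 ≤ κ → ∀ f, ‖comm s α χ (resFactor s α (-(κ ^ 2 : ℝ)) f)‖ ≤ C / κ * ‖f‖ := by
  obtain ⟨C, hC, hCb⟩ := hχ.lap.exists_bound
  choose c hc hcb using fun j => (hχ.pd j).exists_bound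
  have hs : 0 ≤ ∑ j, c j := Finset.sum_nonneg fun j _ => hc j
  refine ⟨C + 2 * ∑ j, c j, by positivity, fun κ hκ f => ?_⟩
  have hκ0 : 0 < κ := by linarith
  obtain ⟨h1, h2⟩ := norm_resFactor_le s α hκ0 f
  set g := resFactor s α (-(κ ^ 2 : ℝ)) f with hg
  have h1' : ‖invOne s α g‖ ≤ ‖f‖ / κ := by
    rw [le_div_iff₀ hκ0]
    nlinarith [norm_nonneg (invOne s α g), mul_nonneg (norm_nonneg (invOne s α g)) hκ0.le]
  have h2' : ∀ j, ‖derivInv s α j g‖ ≤ ‖f‖ / κ := fun j => by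
    rw [le_div_iff₀ hκ0, mul_comm]; exact h2 j
  rw [comm_apply]
  calc _ ≤ ‖-bmul (lap χ) (invOne s α g)‖ +
        ‖(2 * Complex.I) • ∑ j, bmul (pd j χ) (derivInv s α j g)‖ := norm_sub_le _ _
    _ ≤ C * (‖f‖ / κ) + 2 * ∑ j, c j * (‖f‖ / κ) := by
      rw [norm_neg, norm_smul]
      have : ‖2 * Complex.I‖ = 2 := by simp
      rw [this]
      gcongr
      · exact (norm_bmul_le_mul hχ.lap.memLp hCb _).trans (by gcongr)
      · refine norm_sum_le_of_le _ fun j _ => ?_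
        exact (norm_bmul_le_mul (hχ.pd j).memLp (hcb j) _).trans
          (mul_le_mul_of_nonneg_left (h2' j) (hc j))
    _ = _ := by rw [← Finset.sum_mul]; ring

/-! ### Estimates for the two error terms on the imaginary axis. -/

namespace Cutoffs

variable {s} {ρ : ℝ} (D : Cutoffs s ρ)

theorem tsupport_pd_inn (j : Fin 2) :
    tsupport (pd j D.inn) ⊆ {x : Plane | ρ + 1 ≤ ‖x‖ ∧ ‖x‖ ≤ ρ + 2} := by
  intro x hx
  constructor
  · by_contra! h
    have h0 : ∀ᶠ y in 𝓝 x, D.inn y = 1 :=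
      eventually_nhdsSet_iff_forall.1 D.inn_eq x (by simpa using h.le)
    refine (mem_closure_iff_frequently.1 hx) ?_
    filter_upwards [h0.eventually_nhds] with y hy hy'
    exact hy' (pd_eq_zero_of_eventually hy j)
  · exact (mem_ball_zero_iff.1 (D.inn_supp (tsupport_pd j _ hx))).le

/-- The hypothesis says that u = Tf satisfies Pu = -κ²u where `mid` lives. In the energy identity
for `mid` the inner product is then nonpositive, so derivatives near the gradient of `inn` are
bounded by u alone, uniformly in κ. -/
theorem norm_comm_inn_le : ∃ C, 0 ≤ C ∧ ∀ (κ : ℝ) (f : L2),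
    bmul D.mid f = ((1 - (κ ^ 2 : ℝ) : ℂ)) • bmul D.mid (invOne s α f) →
    ‖comm s α D.inn f‖ ≤ C * ‖invOne s α f‖ := by
  obtain ⟨C, hC, hCb⟩ := D.cut_inn.lap.exists_bound
  choose c hc hcb using fun j => (D.cut_inn.pd j).exists_bound
  choose d hd hdb using fun j => (D.cut_mid.pd j).exists_bound
  have hs : 0 ≤ ∑ j, c j := Finset.sum_nonneg fun j _ => hc j
  have ht : 0 ≤ ∑ j, d j := Finset.sum_nonneg fun j _ => hd j
  refine ⟨C + 2 * ∑ j, c j * ∑ j, d j, by rw [← Finset.sum_mul]; positivity, fun κ f h => ?_⟩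
  set w := formProj s α (inc none f) with hw
  have h1 := sum_norm_mulJet_sq s α D.cut_mid D.mid_real f
  have h2 : bmul D.mid (f - invOne s α f) = (-(κ ^ 2 : ℝ) : ℂ) • bmul D.mid (invOne s α f) := by
    rw [map_sub, h, sub_smul, one_smul, neg_smul]; abel
  have h3 : (inner ℂ (bmul D.mid (invOne s α f)) (bmul D.mid (f - invOne s α f)) : ℂ).re ≤ 0 := by
    rw [h2, inner_smul_right, inner_self_eq_norm_sq_to_K]
    have : (-(κ ^ 2 : ℝ) : ℂ) * ((‖bmul D.mid (invOne s α f)‖ : ℝ) : ℂ) ^ 2 =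
        ((-(κ ^ 2 * ‖bmul D.mid (invOne s α f)‖ ^ 2) : ℝ) : ℂ) := by push_cast; ring
    refine (congrArg Complex.re this).trans_le ?_
    rw [Complex.ofReal_re]
    have : 0 ≤ κ ^ 2 * ‖bmul D.mid (invOne s α f)‖ ^ 2 := by positivity
    linarith
  have h4 : ∑ j, ‖bmul (pd j D.mid) (invOne s α f)‖ ^ 2 ≤
      ((∑ j, d j) * ‖invOne s α f‖) ^ 2 := by
    calc _ ≤ ∑ j, (d j * ‖invOne s α f‖) ^ 2 := by
          refine Finset.sum_le_sum fun j _ => ?_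
          gcongr
          exact norm_bmul_le_mul (D.cut_mid.pd j).memLp (hdb j) _
      _ ≤ (∑ j, d j * ‖invOne s α f‖) ^ 2 :=
          Finset.sum_sq_le_sq_sum_of_nonneg fun j _ => mul_nonneg (hd j) (norm_nonneg _)
      _ = _ := by rw [Finset.sum_mul]
  have h5 : ∀ j, ‖mulJet D.mid w (some j)‖ ≤ (∑ j, d j) * ‖invOne s α f‖ := fun j => by
    refine abs_le_of_sq_le_sq' ?_ (by positivity) |>.2
    refine le_trans ?_ (h1.trans_le (add_le_add h3 h4) |>.trans_eq (zero_add _))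
    exact Finset.single_le_sum (f := fun j => ‖mulJet D.mid w (some j)‖ ^ 2)
      (fun j _ => sq_nonneg _) (Finset.mem_univ j)
  rw [comm_apply]
  calc _ ≤ ‖-bmul (lap D.inn) (invOne s α f)‖ +
        ‖(2 * Complex.I) • ∑ j, bmul (pd j D.inn) (derivInv s α j f)‖ := norm_sub_le _ _
    _ ≤ C * ‖invOne s α f‖ + 2 * ∑ j, c j * ((∑ j, d j) * ‖invOne s α f‖) := by
      rw [norm_neg, norm_smul]
      have : ‖2 * Complex.I‖ = 2 := by simp
      rw [this]
      gcongr
      · exact norm_bmul_le_mul D.cut_inn.lap.memLp hCb _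
      · refine norm_sum_le_of_le _ fun j _ => ?_
        have e : bmul (pd j D.inn) (derivInv s α j f) =
            bmul (pd j D.inn) (mulJet D.mid w (some j)) :=
          bmul_pd_derivInv (D.cut_inn.pd j) D.cut_mid
            (D.mid_eq.filter_mono (nhdsSet_mono (tsupport_pd_inn D j))) j w
        rw [e]
        exact (norm_bmul_le_mul (D.cut_inn.pd j).memLp (hcb j) _).trans
          (mul_le_mul_of_nonneg_left (h5 j) (hc j))
    _ = _ := by
      rw [← Finset.sum_mul, ← Finset.sum_mul]; ring

theorem mid_zero_of_norm_ge {x : Plane} (hx : ρ + 5 / 2 ≤ ‖x‖) : D.mid x = 0 := by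
  refine image_eq_zero_of_notMem_tsupport fun h => ?_
  have h1 : D.wide x ≠ 0 := by
    rw [(eventually_nhdsSet_iff_forall.1 D.wide_eq x h).self_of_nhds]
    exact one_ne_zero
  exact hx.not_gt (D.wide_supp (subset_tsupport _ h1)).2

/-- Sources lie beyond radius ρ + 3, while the commutator uses G f within ρ + 5/2, where the
separated Green operator is O(1/κ). There G f solves the homogeneous equation, so its gradient is
controlled by its norm. -/
theorem exists_norm_errOuter_le : ∃ C, 0 ≤ C ∧ ∀ κ : ℝ, 1 ≤ κ →
    ‖errOuter α D (ρ + 4) (imagPoint κ)‖ ≤ C / κ := by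
  have hρ := D.pos
  obtain ⟨C₁, hC₁, h1⟩ := norm_comm_inn_le α D
  obtain ⟨C₂, hC₂, h2⟩ := D.cut_wide.exists_bound
  obtain ⟨C₃, hC₃, h3⟩ := exists_norm_green_le s α hρ (by linarith : ρ + 5 / 2 < ρ + 3)
    (by linarith) (by linarith) (by linarith : ρ + 5 / 2 ≤ ρ + 4)
  refine ⟨C₁ * (C₂ * C₃), by positivity, fun κ hκ => ?_⟩
  have hκ0 : 0 < κ := by linarith
  refine ContinuousLinearMap.opNorm_le_bound _ (by positivity) fun f => ?_
  have hS := wideSource α D (by linarith : ρ + 3 < ρ + 4)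
  set v := outerSource s α ρ (ρ + 4) D.wide (imagPoint κ) f with hv
  have e1 : invOne s α v = bmul D.wide (outerGreen s α ρ (ρ + 4) (imagPoint κ) f) :=
    congrArg (fun A : L2 →L[ℂ] L2 => A f) (hS.invOne_comp (imagPoint κ))
  have e2 := congrArg (fun A : L2 →L[ℂ] L2 => A f) (hS.local_eq (imagPoint κ) D.mid D.cut_mid
    D.wide_eq)
  simp only [ContinuousLinearMap.comp_apply, add_apply, smul_apply, map_add, map_smul] at e2
  -- The supports are disjoint: `mid` vanishes from radius ρ + 5/2 on, the source starts at ρ + 3.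
  have e3 : bmul D.mid (bmul (ind (annulus (ρ + 3) (ρ + 4))) f) = 0 := by
    refine bmul_eq_of_ae D.cut_mid.memLp ?_
    filter_upwards [bmul_ae (memLp_ind (measurableSet_annulus (ρ + 3) (ρ + 4))) f,
      Lp.coeFn_zero ℂ 2 (volume : Measure Plane)] with x hx h0
    rw [h0, hx]
    by_cases hxA : x ∈ annulus (ρ + 3) (ρ + 4)
    · rw [mid_zero_of_norm_ge D (by linarith [hxA.1])]; simp
    · rw [ind_of_notMem hxA]; simp
  have e4 : bmul D.mid (bmul D.wide (outerGreen s α ρ (ρ + 4) (imagPoint κ) f)) =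
      bmul D.mid (outerGreen s α ρ (ρ + 4) (imagPoint κ) f) := by
    refine bmul_congr D.cut_mid.memLp ?_
    filter_upwards [bmul_ae D.cut_wide.memLp (outerGreen s α ρ (ρ + 4) (imagPoint κ) f)] with x hx
    by_cases hxs : x ∈ tsupport D.mid
    · right
      rw [hx, (eventually_nhdsSet_iff_forall.1 D.wide_eq x hxs).self_of_nhds, one_mul]
    · exact Or.inl (image_eq_zero_of_notMem_tsupport hxs)
  have e5 := h1 κ v (by
    rw [e1, e4, e2, e3, zero_add, exp_two_mul_imagPoint hκ0, ← sub_eq_add_neg])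
  have e6 : bmul D.wide (outerGreen s α ρ (ρ + 4) (imagPoint κ) f) =
      bmul D.wide (green s α (annulus ρ (ρ + 5 / 2)) (annulus (ρ + 3) (ρ + 4))
        (imagPoint κ) f) := by
    have g1 := bmul_green_bmul s α hρ (measurableSet_annulus ρ (ρ + 4))
      (measurableSet_annulus (ρ + 3) (ρ + 4)) le_rfl (annulus_subset (by linarith) le_rfl)
      (measurableSet_annulus ρ (ρ + 5 / 2)) (measurableSet_annulus (ρ + 3) (ρ + 4)) (imagPoint κ)
    rw [inter_self, inter_eq_left.2 (annulus_subset le_rfl (by linarith))] at g1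
    rw [← g1, ← outerGreen, outerGreen_comp_annulus α D]
    exact (congrArg (fun A : L2 →L[ℂ] L2 => A (outerGreen s α ρ (ρ + 4) (imagPoint κ) f))
      (bmul_comp_bmul_ind D.cut_wide.memLp (measurableSet_annulus ρ (ρ + 5 / 2)) fun x hx =>
        image_eq_zero_of_notMem_tsupport fun hx' => hx (D.wide_supp hx'))).symm
  calc ‖errOuter α D (ρ + 4) (imagPoint κ) f‖ = ‖comm s α D.inn v‖ := norm_neg _
    _ ≤ C₁ * ‖invOne s α v‖ := e5
    _ ≤ C₁ * (C₂ * (C₃ / κ * ‖f‖)) := by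
      rw [e1, e6]
      gcongr
      refine (norm_bmul_le_mul D.cut_wide.memLp h2 _).trans ?_
      gcongr
      exact (ContinuousLinearMap.le_opNorm _ _).trans
        (mul_le_mul_of_nonneg_right (h3 κ hκ) (norm_nonneg _))
    _ = _ := by ring

theorem norm_cdisc_le (r : ℝ) (f : L2) : ‖cdisc r f‖ ≤ ‖f‖ := by
  exact (norm_bmul_le_mul (memLp_ind measurableSet_closedBall) (norm_ind_le _) f).trans_eq
    (one_mul _)

/-- The error is small at high energies on the imaginary axis. -/
theorem exists_isUnit_one_add_err :
    ∃ κ : ℝ, 0 < κ ∧ IsUnit (1 + err α D κ (imagPoint κ)) := by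
  obtain ⟨C₁, hC₁, h1⟩ := exists_norm_errOuter_le α D
  obtain ⟨C₂, hC₂, h2⟩ := exists_norm_comm_resFactor_le s α D.cut_out
  -- With this κ the two bounds add up to (C₁ + C₂)/κ < 1.
  set κ := C₁ + C₂ + 1 with hκ
  have hκ1 : 1 ≤ κ := by linarith
  have hκ0 : 0 < κ := by linarith
  refine ⟨κ, hκ0, ?_⟩
  have h3 : ‖errInner α D κ (imagPoint κ)‖ ≤ C₂ / κ := by
    refine ContinuousLinearMap.opNorm_le_bound _ (by positivity) fun f => ?_
    -- At this point λ² = -κ² is exactly the spectral parameter of the inner resolvent, so the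
    -- zeroth-order term of the error vanishes and only the commutator is left.
    rw [errInner, exp_two_mul_imagPoint hκ0, sub_self, zero_smul, zero_add]
    refine (h2 κ hκ1 _).trans ?_
    gcongr
    exact norm_cdisc_le _ _
  have h4 : ‖-err α D κ (imagPoint κ)‖ < 1 := by
    rw [norm_neg, err]
    calc _ ≤ C₂ / κ + C₁ / κ := (norm_add_le _ _).trans (add_le_add h3 (h1 κ hκ1))
      _ < 1 := by rw [← add_div, div_lt_one hκ0]; linarith
  simpa using isUnit_one_sub_of_norm_lt_one h4

end Cutoffs

end

section

/-! ### The outer part of the resolvent on the physical sheet -/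

variable {n : ℕ} (s : Fin n → Plane) (α : Fin n → ℝ)

theorem pd_congr_one_sub {f g : Plane → ℂ} {x : Plane} (h : f =ᶠ[𝓝 x] fun y => 1 - g y)
    (j : Fin 2) : pd j f =ᶠ[𝓝 x] fun y => -pd j g y := by
  filter_upwards [h.eventuallyEq_nhds] with y hy
  rw [pd, hy.fderiv_eq, fderiv_const_sub]
  rfl

theorem lap_congr_one_sub {f g : Plane → ℂ} {x : Plane} (h : f =ᶠ[𝓝 x] fun y => 1 - g y) :
    lap f x = -lap g x := by
  have h1 : ∀ j, pd j (pd j f) x = -pd j (pd j g) x := fun j => by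
    rw [pd, (pd_congr_one_sub h j).fderiv_eq, fderiv_fun_neg]
    rfl
  simp only [lap, h1, Finset.sum_neg_distrib]

/-- Past the support of F, and once log κ + t ≥ 0, the solution is a constant times the decaying
Bessel function at log κ + t. The remaining compact interval is covered by continuity. -/
theorem exists_norm_radSol_le {ν : ℝ} (hν : 0 ≤ ν) (κ a : ℝ) {F : ℝ → ℂ}
    (hF : ContDiff ℝ ∞ F) (hFc : HasCompactSupport F) {q : ℝ} (hq : ∀ t, q < t → F t = 0) :
    ∃ C, 0 ≤ C ∧ ∀ t, a ≤ t → ‖radSol ν (imagPoint κ) F t‖ ≤ C * Real.exp (-4 * t) := by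
  obtain ⟨C₁, hC₁, h1⟩ := exists_norm_besK_le hν
  set p := max q (-Real.log κ) with hp
  set V := radSol ν (imagPoint κ) F with hV
  have hVc : Continuous V := (radSol_spec hν _ hF hFc).1.continuous
  obtain ⟨C₂, h2⟩ := (isCompact_Icc (a := a) (b := p)).exists_bound_of_continuousOn
    (f := fun t => (Real.exp (4 * t) : ℂ) * V t) (by fun_prop)
  set J := ∫ u, besI ν (shift (imagPoint κ) u) * F u with hJ
  refine ⟨max 0 (max C₂ (C₁ * Real.exp (-4 * Real.log κ) * ‖J‖)), le_max_left _ _, fun t ht => ?_⟩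
  rcases le_total t p with htp | htp
  · have := h2 t ⟨ht, htp⟩
    rw [norm_mul, Complex.norm_real, Real.norm_of_nonneg (Real.exp_pos _).le] at this
    calc ‖V t‖ = (Real.exp (4 * t) * ‖V t‖) * Real.exp (-4 * t) := by
          rw [mul_right_comm, ← Real.exp_add]; simp
      _ ≤ _ := by
          gcongr
          exact this.trans ((le_max_left _ _).trans (le_max_right _ _))
  · have e := radSol_of_ge hν (imagPoint κ) hF.continuous hFc hq ((le_max_left _ _).trans htp)
    have h3 : 0 ≤ Real.log κ + t := by
      have := (le_max_right q (-Real.log κ)).trans htp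
      linarith
    rw [hV, e, shift_imagPoint, norm_mul]
    calc _ ≤ C₁ * Real.exp (-4 * (Real.log κ + t)) * ‖J‖ := by gcongr; exact h1 _ h3
      _ = C₁ * Real.exp (-4 * Real.log κ) * ‖J‖ * Real.exp (-4 * t) := by
          rw [mul_add, Real.exp_add]; ring
      _ ≤ _ := by
          gcongr
          exact (le_max_right _ _).trans (le_max_right _ _)

/-! ### The outer solution for a single mode at λ = iκ. -/

namespace Cutoffs

variable {s} {ρ : ℝ} (D : Cutoffs s ρ)

theorem inn_eq_one {x : Plane} (hx : ‖x‖ ≤ ρ + 1) : D.inn x = 1 :=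
  (eventually_nhdsSet_iff_forall.1 D.inn_eq x (by simpa using hx)).self_of_nhds

theorem inn_eq_zero {x : Plane} (hx : ρ + 2 ≤ ‖x‖) : D.inn x = 0 :=
  image_eq_zero_of_notMem_tsupport fun h => hx.not_gt (mem_ball_zero_iff.1 (D.inn_supp h))

/-- The radial solution decays like r⁻⁴, while 1 - inn removes the disc where the mode expansion has
no meaning. -/
theorem memLp_outer_mode (κ : ℝ) {N : ℝ} (m : ℤ) {F : ℝ → ℂ} (hF : IsProfile (ρ + 3) N F) :
    MemLp (fun x => (1 - D.inn x) * (mode s α m x * radial (radSol (order α m) (imagPoint κ) F) x))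
      2 (volume : Measure Plane) := by
  have hρ := D.pos
  set V := radSol (order α m) (imagPoint κ) F with hV
  have hVs := (radSol_spec (order_nonneg α m) (imagPoint κ) hF.1 hF.2.1).1
  obtain ⟨C, hC, hCV⟩ := exists_norm_radSol_le (order_nonneg α m) κ 0 hF.1 hF.2.1
    (q := Real.log N) fun t ht => hF.2.2 t fun h => ht.not_gt h.2
  obtain ⟨c, hc, hcb⟩ := D.cut_inn.exists_bound
  have hl : Measurable fun x : Plane => Real.log ‖x‖ := Real.measurable_log.comp measurable_norm
  have hm : AEStronglyMeasurable (fun x => (1 - D.inn x) *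
      (mode s α m x * radial V x)) (volume : Measure Plane) :=
    ((measurable_const.sub D.cut_inn.1.continuous.measurable).mul
      ((measurable_mode s α m).mul (hVs.continuous.measurable.comp hl))).aestronglyMeasurable
  rw [memLp_two_iff_integrable_sq_norm hm]
  have hi := (integrable_one_add_norm (μ := (volume : Measure Plane)) (r := 8)
    (by rw [finrank_euclideanSpace_fin]; norm_num)).const_mul (((1 + c) * (C * 16)) ^ 2)
  refine hi.mono' (hm.norm.pow 2) (Eventually.of_forall fun x => ?_)
  rw [Real.norm_of_nonneg (sq_nonneg _)]
  have hx1 : 0 < 1 + ‖x‖ := by positivity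
  have e8 : (1 + ‖x‖) ^ (-(8 : ℝ)) = (((1 + ‖x‖) ^ 4)⁻¹) ^ 2 := by
    rw [Real.rpow_neg hx1.le, inv_pow, ← pow_mul]
    norm_cast
  rw [e8, ← mul_pow]
  refine pow_le_pow_left₀ (norm_nonneg _) ?_ 2
  by_cases hx : ‖x‖ ≤ ρ + 1
  · rw [inn_eq_one D hx]
    simp only [sub_self, zero_mul, norm_zero]
    positivity
  rw [not_le] at hx
  have hx0 : 0 < ‖x‖ := by linarith
  rw [norm_mul, norm_mul, norm_mode s α (norm_pos_iff.1 hx0), one_mul, mul_assoc]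
  have h1 : ‖1 - D.inn x‖ ≤ 1 + c := (norm_sub_le _ _).trans (by rw [norm_one]; gcongr; exact hcb x)
  have h2 := hCV (Real.log ‖x‖) (Real.log_nonneg (by linarith))
  have h3 : Real.exp (-4 * Real.log ‖x‖) = (‖x‖ ^ 4)⁻¹ := by
    rw [neg_mul, Real.exp_neg, ← Real.exp_log (pow_pos hx0 4), Real.log_pow]
    norm_num
  rw [h3] at h2
  refine mul_le_mul h1 (h2.trans ?_) (norm_nonneg _) (by positivity)
  rw [mul_assoc]
  refine mul_le_mul_of_nonneg_left ?_ hC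
  rw [← div_eq_mul_inv, inv_eq_one_div, div_le_div_iff₀ (by positivity) (by positivity), one_mul]
  calc (1 + ‖x‖) ^ 4 ≤ (2 * ‖x‖) ^ 4 := by gcongr; linarith
    _ = 16 * ‖x‖ ^ 4 := by ring

/-- Sources supported in an annulus with a single angular mode: the resolvent on the imaginary axis
in terms of the solution of the radial equation. -/
theorem outer_mode_ae {κ N : ℝ} (hκ : 0 < κ) (hN : ρ + 3 < N) (m : ℤ) {F : ℝ → ℂ}
    (hF : IsProfile (ρ + 3) N F) : invOne s α (resFactor s α (-(κ ^ 2 : ℝ))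
      (modeVec s α m F hF.continuous_and +
        errOuter α D N (imagPoint κ) (modeVec s α m F hF.continuous_and))) =ᵐ[volume]
      fun x => (1 - D.inn x) * (mode s α m x * radial (radSol (order α m) (imagPoint κ) F) x) := by
  have hρ := D.pos
  set V := radSol (order α m) (imagPoint κ) F with hV
  set f := modeVec s α m F hF.continuous_and with hf
  set y := f + errOuter α D N (imagPoint κ) f with hy
  set y' := resFactor s α (-(κ ^ 2 : ℝ)) y with hy'
  -- The candidate for (P + κ²)⁻¹y. The function v - Ty' is square integrable and will be shown to
  -- solve P d = -κ² d on every disc, hence to vanish.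
  set v : L2 := (memLp_outer_mode α D κ m hF).toLp with hv
  have hvae : v =ᵐ[volume] fun x => (1 - D.inn x) * (mode s α m x * radial V x) :=
    (memLp_outer_mode α D κ m hF).coeFn_toLp
  have hy1 : y' - invOne s α y' = y - ((κ ^ 2 : ℝ) : ℂ) • invOne s α y' := by
    have := mul_resFactor s α (neg_sq_notMem hκ) y
    rw [← hy', add_smul, one_smul, neg_smul] at this
    conv_rhs => rw [← this]
    abel
  obtain ⟨hVs, hode⟩ := radSol_spec (order_nonneg α m) (imagPoint κ) hF.1 hF.2.1
  suffices hd : v - invOne s α y' = 0 by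
    rw [← sub_eq_zero.1 hd]; exact hvae
  refine eq_zero_of_local_solution s α hκ fun r => ?_
  set R := max r (ρ + 2) with hR
  obtain ⟨θ, hθ, -, -, hθs, hθ1⟩ := exists_cutoff (isCompact_closedBall (0 : Plane) R)
    (Metric.isOpen_ball (x := 0) (ε := R + 1)) (Metric.closedBall_subset_ball (by linarith))
  -- A compactly supported substitute for 1 - inn: the two agree on the ball of radius R, and the
  -- Leibniz rule requires compact support.
  have hχ : IsCutoff fun x => θ x + (-1) * D.inn x :=
    hθ.add ⟨contDiff_const.mul D.cut_inn.1, D.cut_inn.2.mul_left⟩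
  set χ := fun x => θ x + (-1) * D.inn x with hχd
  have hχ1 : ∀ x : Plane, ‖x‖ < R → χ =ᶠ[𝓝 x] fun y => 1 - D.inn y := fun x hx => by
    filter_upwards [eventually_nhdsSet_iff_forall.1 hθ1 x (by simpa using hx.le)] with y hy
    rw [hχd]
    simp only [hy]
    ring
  set K := tsupport D.wide ∪ {x : Plane | ρ + 1 ≤ ‖x‖ ∧ ‖x‖ ≤ R} with hK
  have hKc : IsCompact K := by
    refine D.cut_wide.2.isCompact.union
      ((isCompact_closedBall (0 : Plane) R).of_isClosed_subset ?_ fun x hx => ?_)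
    · exact (isClosed_le continuous_const continuous_norm).inter
        (isClosed_le continuous_norm continuous_const)
    · simpa using hx.2
  obtain ⟨g', hg'⟩ := exists_source_of_mode α D.norm_lt D.pos hKc (fun x hx => hx.elim
    (fun h => (D.wide_supp h).1) fun h => by linarith [h.1]) m (imagPoint κ) hVs hode
  rw [exp_two_mul_imagPoint hκ] at hg'
  have hN' := wide_subset D hN
  have hS := wideSource α D hN
  have e1 : bmul D.wide g' + comm s α D.wide g' = outerSource s α ρ N D.wide (imagPoint κ) f := by
    refine invOne_injective s α ?_
    rw [← bmul_invOne s α D.cut_wide]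
    refine Eq.trans ?_ (congrArg (fun A : L2 →L[ℂ] L2 => A f) (hS.invOne_comp (imagPoint κ))).symm
    refine bmul_congr D.cut_wide.memLp ?_
    filter_upwards [hg', green_modeVec_ae s α hρ (measurableSet_annulus ρ N)
      (measurableSet_annulus (ρ + 3) N) le_rfl (annulus_subset (by linarith) le_rfl) m (imagPoint κ)
      hF.continuous_and fun z hz hz' => hF.eq_zero (by linarith) hN hz hz'] with x hx1 hx2
    by_cases hxs : x ∈ tsupport D.wide
    · right
      rw [(hx1 (Or.inl hxs)).1, outerGreen]
      refine Eq.trans ?_ hx2.symm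
      rw [ind_of_mem (hN' hxs), one_mul]
    · exact Or.inl (image_eq_zero_of_notMem_tsupport hxs)
  -- The explicit local source g' and the abstract outer source have the same commutator with `inn`,
  -- because `wide` is 1 near the support of the gradient of `inn`.
  have e2 : errOuter α D N (imagPoint κ) f = -comm s α D.inn g' := by
    rw [← comm_source s α D.cut_inn D.cut_wide (fun j => D.wide_eq.filter_mono
      (nhdsSet_mono ((tsupport_pd_inn D j).trans fun x hx => ?_))) g', e1]
    · rfl
    · refine subset_tsupport _ ?_
      rw [Function.mem_support, (eventually_nhdsSet_iff_forall.1 D.mid_eq x hx).self_of_nhds]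
      exact one_ne_zero
  set G := bmul χ g' + comm s α χ g' - y' with hG
  refine ⟨G, ?_⟩
  have e3 : invOne s α G =
      bmul χ (invOne s α g') - invOne s α y' := by
    rw [hG, map_sub, ← bmul_invOne s α hχ]
  have e4 : G - invOne s α G =
      bmul χ (g' - invOne s α g') + comm s α χ g' - (y - ((κ ^ 2 : ℝ) : ℂ) • invOne s α y') := by
    rw [← hy1, e3, map_sub, hG]; abel
  filter_upwards [hg', hvae, bmul_ae hχ.memLp (invOne s α g'),
    bmul_ae hχ.memLp (g' - invOne s α g'), Lp.coeFn_sub g' (invOne s α g'), comm_ae s α hχ g',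
    comm_ae s α D.cut_inn g', modeVec_ae s α m F hF.continuous_and,
    Lp.coeFn_sub (bmul χ (invOne s α g')) (invOne s α y'), Lp.coeFn_sub v (invOne s α y'),
    Lp.coeFn_sub (bmul χ (g' - invOne s α g') + comm s α χ g')
      (y - ((κ ^ 2 : ℝ) : ℂ) • invOne s α y'),
    Lp.coeFn_add (bmul χ (g' - invOne s α g')) (comm s α χ g'),
    Lp.coeFn_sub y (((κ ^ 2 : ℝ) : ℂ) • invOne s α y'),
    Lp.coeFn_smul ((κ ^ 2 : ℝ) : ℂ) (invOne s α y'),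
    Lp.coeFn_add f (errOuter α D N (imagPoint κ) f), Lp.coeFn_neg (comm s α D.inn g'),
    Lp.coeFn_sub G (invOne s α G)]
    with x a1 a2 a3 a4 a5 a6 a7 a8 a9 a10 a11 a12 a13 a14 a15 a16 a17 hxr
  have hxR : ‖x‖ < R := hxr.trans_le (le_max_left _ _)
  have hχx := hχ1 x hxR
  have b1 : comm s α χ g' x = -comm s α D.inn g' x := by
    rw [a6, a7, lap_congr_one_sub hχx]
    simp only [(pd_congr_one_sub hχx _).self_of_nhds, neg_mul, Finset.sum_neg_distrib]
    ring
  have b2 : y x = f x - comm s α D.inn g' x := by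
    rw [hy, a15, Pi.add_apply, e2, a16, Pi.neg_apply, sub_eq_add_neg]
  have b3 : χ x = 1 - D.inn x := hχx.self_of_nhds
  rw [e4, Pi.sub_apply] at a17
  rw [← a17, e3, a9, Pi.sub_apply, a10, Pi.sub_apply, a11, Pi.sub_apply, a12, Pi.add_apply, a13, Pi.sub_apply,
    a14, Pi.smul_apply, smul_eq_mul, a3, a4, a5, Pi.sub_apply, b1, b2, a2, hf, a8,
    b3]
  by_cases hx1 : ‖x‖ ≤ ρ + 1
  · have hz : modeFun s α m F x = 0 := by
      by_cases hx0 : x = 0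
      · subst hx0
        simp [modeFun]
      · rw [modeFun, hF.eq_zero (by linarith) hN hx0 fun h => by linarith [h.1]]
        simp
    rw [inn_eq_one D hx1, hz]
    constructor
    · ring
    · push_cast; ring
  · rw [not_le] at hx1
    have hx0 : x ≠ 0 := norm_pos_iff.1 (by linarith)
    obtain ⟨c1, c2⟩ := a1 (Or.inr ⟨hx1.le, hxR.le⟩)
    have hz : D.inn x * modeFun s α m F x = 0 := by
      by_cases hx2 : ρ + 2 ≤ ‖x‖
      · rw [inn_eq_zero D hx2, zero_mul]
      · rw [modeFun, hF.eq_zero (by linarith) hN hx0 fun h => by linarith [h.1]]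
        simp
    rw [c2, c1]
    constructor
    · ring
    · linear_combination (-1 : ℂ) * hz

end Cutoffs

end

section

/-! ### The parametrix and the resolvent -/

variable {n : ℕ} (s : Fin n → Plane) (α : Fin n → ℝ)

/-- The resolvent in the coordinate of the logarithmic cover, on the physical sheet. -/
def physResolvent (ζ : ℂ) : L2 →L[ℂ] L2 := invOne s α ∘L resFactor s α (Complex.exp (2 * ζ))

theorem exp_two_mul_eq (ζ : ℂ) : Complex.exp (2 * ζ) = LogCover.proj ζ ^ 2 := by
  rw [LogCover.proj, ← Complex.exp_nat_mul]
  norm_num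

theorem proj_im_pos {ζ : ℂ} (hζ : ζ ∈ LogCover.physicalSheet) : 0 < (LogCover.proj ζ).im := by
  rw [LogCover.proj, Complex.exp_im]
  exact mul_pos (Real.exp_pos _) (Real.sin_pos_of_pos_of_lt_pi hζ.1 hζ.2)

theorem exp_two_mul_notMem {ζ : ℂ} (hζ : ζ ∈ LogCover.physicalSheet) :
    ¬ ((Complex.exp (2 * ζ)).im = 0 ∧ 0 ≤ (Complex.exp (2 * ζ)).re) := by
  rw [exp_two_mul_eq]
  exact sq_notMem_of_im_pos (proj_im_pos hζ)

theorem resolventAt_proj {ζ : ℂ} (hζ : ζ ∈ LogCover.physicalSheet) :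
    resolventAt (hamiltonian s α) (LogCover.proj ζ ^ 2) = physResolvent s α ζ := by
  rw [← exp_two_mul_eq, resolventAt_eq s α (exp_two_mul_notMem hζ), physResolvent]

theorem physResolvent_apply_sub {ζ : ℂ} (hζ : ζ ∈ LogCover.physicalSheet) (g : L2) :
    physResolvent s α ζ (g - (Complex.exp (2 * ζ) + 1) • invOne s α g) = invOne s α g :=
  congrArg (invOne s α) (resFactor_mul s α (exp_two_mul_notMem hζ) g)

theorem analyticAt_physResolvent {ζ : ℂ} (hζ : ζ ∈ LogCover.physicalSheet) :
    AnalyticAt ℂ (physResolvent s α) ζ :=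
  analyticAt_comp analyticAt_const ((analyticAt_resFactor s α (exp_two_mul_notMem hζ)).comp
    (f := fun ζ : ℂ => Complex.exp (2 * ζ)) (by fun_prop))

theorem isPreconnected_physicalSheet : IsPreconnected LogCover.physicalSheet := by
  have h : Convex ℝ LogCover.physicalSheet :=
    (convex_halfSpace_im_gt 0).inter (convex_halfSpace_im_lt Real.pi)
  exact h.isPreconnected

theorem imagPoint_mem (κ : ℝ) : imagPoint κ ∈ LogCover.physicalSheet := by
  have hp := Real.pi_pos
  have h : (imagPoint κ).im = Real.pi / 2 := by simp [imagPoint]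
  rw [LogCover.physicalSheet, mem_ofPred_eq, h]
  exact ⟨by linarith, by linarith⟩

/-- The points above the positive imaginary axis accumulate at the one above i, which is what the
identity theorem requires. -/
theorem frequently_imagPoint {p : ℂ → Prop} (h : ∀ κ : ℝ, 0 < κ → p (imagPoint κ)) :
    ∃ᶠ z in 𝓝[≠] (imagPoint 1), p z := by
  have h1 : Tendsto (fun t : ℝ => imagPoint (Real.exp t)) (𝓝[≠] 0) (𝓝[≠] (imagPoint 1)) := by
    have hc : Continuous fun t : ℝ => imagPoint (Real.exp t) := by
      simp only [imagPoint, Real.log_exp]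
      fun_prop
    refine tendsto_nhdsWithin_of_tendsto_nhds_of_eventually_within _ ?_ ?_
    · have := hc.tendsto 0
      rw [Real.exp_zero] at this
      exact this.mono_left nhdsWithin_le_nhds
    · filter_upwards [self_mem_nhdsWithin] with t ht h0
      refine ht ?_
      have : (Real.log (Real.exp t) : ℂ) = (Real.log 1 : ℝ) := by
        simpa [imagPoint] using h0
      rw [Real.log_exp, Real.log_one] at this
      exact_mod_cast this
  exact h1.frequently (Eventually.of_forall fun t => h _ (Real.exp_pos t)).frequently

/-- Inversion of `1 + K'` in terms of the inverse of `1 + K' J`. -/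
theorem inverse_one_add_formula {A : Type*} [Ring A] {K' J : A} (h : J * K' = K')
    (hu : IsUnit (1 + K' * J)) :
    (1 + K') * (Ring.inverse (1 + K' * J) * (1 - K' * (1 - J))) = 1 ∧
      (Ring.inverse (1 + K' * J) * (1 - K' * (1 - J))) * (1 + K') = 1 := by
  set u := Ring.inverse (1 + K' * J) with hud
  have h1 : (1 + K' * J) * u = 1 := Ring.mul_inverse_cancel _ hu
  have h2 : u * (1 + K' * J) = 1 := Ring.inverse_mul_cancel _ hu
  set E := K' * (1 - J) with hE
  -- With E = K'(1 - J) this gives EK' = 0 and E² = 0. Thus 1 + K' = (1 + E)(1 + K'J), and 1 + E has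
  -- inverse 1 - E.
  have hJ : (1 - J) * K' = 0 := by rw [sub_mul, one_mul, h, sub_self]
  have hEK : E * K' = 0 := by rw [hE, mul_assoc, hJ, mul_zero]
  have hE1 : E * (1 + K' * J) = E := by rw [mul_add, mul_one, ← mul_assoc, hEK, zero_mul, add_zero]
  have hEu : E * u = E := by
    conv_lhs => rw [← hE1]
    rw [mul_assoc, h1, mul_one]
  have hEE : E * E = 0 := by
    conv_lhs => rw [hE, ← mul_assoc, ← hE]
    rw [hEK, zero_mul]
  have hK : 1 + K' = 1 + K' * J + E := by rw [hE]; noncomm_ring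
  constructor
  · rw [hK, ← mul_assoc, add_mul, h1, hEu, mul_sub, mul_one, add_mul, one_mul, hEE]
    abel
  · rw [mul_assoc, sub_mul, one_mul, mul_add, hEK, mul_one, hK, add_zero]
    rw [add_sub_cancel_right, h2]

/-! ### The parametrix identity on the physical sheet and the inversion of its error. -/

namespace Cutoffs

variable {s} {ρ : ℝ} (D : Cutoffs s ρ)

theorem analyticAt_outerGreen (D : Cutoffs s ρ) {N : ℝ} (ζ : ℂ) :
    AnalyticAt ℂ (outerGreen s α ρ N) ζ :=
  (differentiable_outerGreen α D).analyticAt ζ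

/-- Both sides are bounded and agree on single-mode functions in the outer annulus by the explicit
solution at λ = iκ; density does the rest. The error term depends only on the part of the source in
that annulus. -/
theorem physResolvent_outer_imagPoint {κ N : ℝ} (hκ : 0 < κ) (hN : ρ + 3 < N) :
    disc N ∘L physResolvent s α (imagPoint κ) ∘L
      (bmul (ind (annulus (ρ + 3) N)) + errOuter α D N (imagPoint κ)) =
    (1 - bmul D.inn) ∘L outerGreen s α ρ N (imagPoint κ) := by
  have hρ := D.pos
  have h := eq_of_eq_modeVec s α (b := ρ + 3) (N := N) (by linarith) hN
    (S := disc N ∘L physResolvent s α (imagPoint κ) ∘L (1 + errOuter α D N (imagPoint κ)))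
    (T := (1 - bmul D.inn) ∘L outerGreen s α ρ N (imagPoint κ)) fun m F hF => by
      set f := modeVec s α m F hF.continuous_and with hf
      have h1 := outer_mode_ae α D hκ hN m hF
      rw [← exp_two_mul_imagPoint hκ, ← hf] at h1
      change bmul (ind (Metric.ball 0 N)) (invOne s α (resFactor s α
        (Complex.exp (2 * imagPoint κ)) (f + errOuter α D N (imagPoint κ) f))) =
        outerGreen s α ρ N (imagPoint κ) f - bmul D.inn (outerGreen s α ρ N (imagPoint κ) f)
      refine bmul_eq_of_ae (memLp_ind measurableSet_ball) ?_
      filter_upwards [h1, green_modeVec_ae s α hρ (measurableSet_annulus ρ N)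
        (measurableSet_annulus (ρ + 3) N) le_rfl (annulus_subset (by linarith) le_rfl) m
        (imagPoint κ) hF.continuous_and fun z hz hz' => hF.eq_zero (by linarith) hN hz hz',
        bmul_ae D.cut_inn.memLp (outerGreen s α ρ N (imagPoint κ) f),
        Lp.coeFn_sub (outerGreen s α ρ N (imagPoint κ) f)
          (bmul D.inn (outerGreen s α ρ N (imagPoint κ) f))] with x e1 e2 e3 e4
      rw [e4, Pi.sub_apply, e3, e1, outerGreen, e2]
      by_cases hx : x ∈ Metric.ball (0 : Plane) N
      · rw [ind_of_mem hx]
        by_cases hxa : ρ < ‖x‖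
        · rw [ind_of_mem (show x ∈ annulus ρ N from ⟨hxa, by simpa using hx⟩)]
          ring
        · rw [inn_eq_one D (by linarith)]
          ring
      · rw [ind_of_notMem hx, ind_of_notMem (show x ∉ annulus ρ N from fun h => hx (by
          simpa using h.2))]
        ring
  rw [ContinuousLinearMap.comp_assoc (1 - bmul D.inn), outerGreen_comp_annulus α D] at h
  rw [← h]
  simp only [ContinuousLinearMap.comp_assoc, ContinuousLinearMap.add_comp]
  have h2 : errOuter α D N (imagPoint κ) ∘L bmul (ind (annulus (ρ + 3) N)) =
      errOuter α D N (imagPoint κ) := by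
    rw [errOuter, ContinuousLinearMap.neg_comp, ContinuousLinearMap.comp_assoc,
      outerSource_comp_annulus α D hN D.cut_wide (wide_subset D hN)]
  rw [h2, ContinuousLinearMap.one_def, ContinuousLinearMap.id_comp]

/-- The outer part of the parametrix on the physical sheet. -/
theorem physResolvent_outer {N : ℝ} (hN : ρ + 3 < N) {ζ : ℂ} (hζ : ζ ∈ LogCover.physicalSheet) :
    disc N ∘L physResolvent s α ζ ∘L (bmul (ind (annulus (ρ + 3) N)) + errOuter α D N ζ) =
    (1 - bmul D.inn) ∘L outerGreen s α ρ N ζ := by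
  set F : ℂ → L2 →L[ℂ] L2 := fun ζ =>
    disc N ∘L physResolvent s α ζ ∘L (bmul (ind (annulus (ρ + 3) N)) + errOuter α D N ζ) -
      (1 - bmul D.inn) ∘L outerGreen s α ρ N ζ with hF
  have hFa : AnalyticOnNhd ℂ F LogCover.physicalSheet := fun ζ hζ => by
    refine AnalyticAt.sub (analyticAt_comp analyticAt_const (analyticAt_comp
      (analyticAt_physResolvent s α hζ) (analyticAt_const.add ?_)))
      (analyticAt_comp analyticAt_const (analyticAt_outerGreen α D ζ))
    exact (differentiable_errOuter α D hN).analyticAt ζ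
  -- The identity is known on the line above the imaginary axis, both sides are analytic on the
  -- strip, and the strip is connected.
  have h := hFa.eqOn_zero_of_preconnected_of_frequently_eq_zero isPreconnected_physicalSheet
    (imagPoint_mem 1) (frequently_imagPoint fun κ hκ => by
      rw [hF]
      exact sub_eq_zero.2 (physResolvent_outer_imagPoint α D hκ hN)) hζ
  exact sub_eq_zero.1 h

/-- The inner part of the parametrix. -/
def innerPart (κ : ℝ) : L2 →L[ℂ] L2 :=
  bmul D.out ∘L invOne s α ∘L resFactor s α (-(κ ^ 2 : ℝ)) ∘L cdisc (ρ + 3)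

theorem bmul_out_cdisc : bmul D.out ∘L cdisc (ρ + 3) = cdisc (ρ + 3) := by
  ext1 f
  refine bmul_eq_of_ae D.cut_out.memLp ?_
  filter_upwards [bmul_ae (memLp_ind measurableSet_closedBall) f] with x hx
  change bmul (ind (Metric.closedBall 0 (ρ + 3))) f x =
    D.out x * bmul (ind (Metric.closedBall 0 (ρ + 3))) f x
  rw [hx]
  by_cases hx1 : x ∈ Metric.closedBall (0 : Plane) (ρ + 3)
  · rw [(eventually_nhdsSet_iff_forall.1 D.out_eq x hx1).self_of_nhds, one_mul]
  · rw [ind_of_notMem hx1]; simp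

/-- The inner part of the parametrix on the physical sheet. -/
theorem physResolvent_inner {κ : ℝ} (hκ : 0 < κ) {ζ : ℂ} (hζ : ζ ∈ LogCover.physicalSheet) :
    physResolvent s α ζ ∘L (cdisc (ρ + 3) + errInner α D κ ζ) = innerPart α D κ := by
  ext1 f
  set g := resFactor s α (-(κ ^ 2 : ℝ)) (cdisc (ρ + 3) f) with hg
  have h1 : g - (-(κ ^ 2 : ℝ) + 1 : ℂ) • invOne s α g = cdisc (ρ + 3) f :=
    mul_resFactor s α (neg_sq_notMem hκ) _
  have h2 : bmul D.out (cdisc (ρ + 3) f) = cdisc (ρ + 3) f :=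
    congrArg (fun A : L2 →L[ℂ] L2 => A f) (bmul_out_cdisc D)
  have h3 := bmul_invOne s α D.cut_out g
  have h4 := physResolvent_apply_sub s α hζ (bmul D.out g + comm s α D.out g)
  rw [← h3] at h4
  change physResolvent s α ζ (cdisc (ρ + 3) f + errInner α D κ ζ f) = bmul D.out (invOne s α g)
  rw [← h4]
  congr 1
  rw [← h2, ← h1, map_sub, map_smul]
  change _ + ((-(κ ^ 2 : ℝ) - Complex.exp (2 * ζ) : ℂ) • bmul D.out (invOne s α g) +
    comm s α D.out g) = _
  module

/-- The error of the parametrix on the disc of radius `N`. -/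
def errAt (κ N : ℝ) (ζ : ℂ) : L2 →L[ℂ] L2 := errInner α D κ ζ + errOuter α D N ζ

/-- The parametrix on the disc of radius `N`. -/
def parametrix (κ N : ℝ) (ζ : ℂ) : L2 →L[ℂ] L2 :=
  innerPart α D κ + (1 - bmul D.inn) ∘L outerGreen s α ρ N ζ

theorem disc_comp_disc {r t : ℝ} (h : r ≤ t) : disc t ∘L disc r = disc r := by
  rw [disc, disc, bmul_ind_bmul_ind measurableSet_ball measurableSet_ball,
    inter_eq_right.2 (Metric.ball_subset_ball h)]

theorem cdisc_comp_disc {r t : ℝ} (h : r < t) : cdisc r ∘L disc t = cdisc r := by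
  rw [disc, cdisc, bmul_ind_bmul_ind measurableSet_closedBall measurableSet_ball,
    inter_eq_left.2 (Metric.closedBall_subset_ball h)]

theorem errAt_comp_disc {κ N N' : ℝ} (hN : ρ + 4 ≤ N) (h : N ≤ N') (ζ : ℂ) :
    errAt α D κ N' ζ ∘L disc N = errAt α D κ N ζ := by
  rw [errAt, ContinuousLinearMap.add_comp, errOuter_comp_disc α D (by linarith) h, errAt, errInner,
    ContinuousLinearMap.comp_assoc, ContinuousLinearMap.comp_assoc, cdisc_comp_disc (by linarith)]

theorem disc_comp_errAt {κ N r : ℝ} (hr : ρ + 4 ≤ r) (ζ : ℂ) :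
    disc r ∘L errAt α D κ N ζ = errAt α D κ N ζ := by
  rw [errAt, ContinuousLinearMap.comp_add, disc_comp_errInner α D hr,
    disc_comp_errOuter α D (by linarith)]

theorem disc_comp_bmul {χ : Plane → ℂ} (hχ : MemLp χ ⊤ (volume : Measure Plane)) (r : ℝ) :
    disc r ∘L bmul χ = bmul χ ∘L disc r := by
  ext1 f
  exact bmul_comm (memLp_ind measurableSet_ball) hχ f

theorem disc_comp_parametrix_comp {κ N N' : ℝ} (hN : ρ + 4 ≤ N) (h : N ≤ N') (ζ : ℂ) :
    disc N ∘L parametrix α D κ N' ζ ∘L disc N = parametrix α D κ N ζ := by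
  have h1 : disc N ∘L innerPart α D κ = innerPart α D κ := by
    rw [innerPart, ← ContinuousLinearMap.comp_assoc]
    congr 1
    exact bmul_ind_comp_bmul D.cut_out.memLp measurableSet_ball fun x hx =>
      image_eq_zero_of_notMem_tsupport fun hx' =>
        hx ((D.out_supp.trans (Metric.ball_subset_ball hN)) hx')
  have h2 : innerPart α D κ ∘L disc N = innerPart α D κ := by
    rw [innerPart]
    simp only [ContinuousLinearMap.comp_assoc]
    rw [cdisc_comp_disc (by linarith)]
  have h3 : disc N ∘L (1 - bmul D.inn) = (1 - bmul D.inn) ∘L disc N := by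
    rw [ContinuousLinearMap.comp_sub, ContinuousLinearMap.sub_comp,
      disc_comp_bmul D.cut_inn.memLp]
    rfl
  rw [parametrix, ContinuousLinearMap.add_comp, ContinuousLinearMap.comp_add, h2, h1,
    ← ContinuousLinearMap.comp_assoc, ← ContinuousLinearMap.comp_assoc, h3,
    ContinuousLinearMap.comp_assoc, ContinuousLinearMap.comp_assoc,
    disc_comp_outerGreen_comp α D h, parametrix]

/-- The parametrix on the physical sheet. -/
theorem physResolvent_comp_one_add {κ N : ℝ} (hκ : 0 < κ) (hN : ρ + 4 ≤ N) {ζ : ℂ}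
    (hζ : ζ ∈ LogCover.physicalSheet) :
    disc N ∘L physResolvent s α ζ ∘L (disc N + errAt α D κ N ζ) = parametrix α D κ N ζ := by
  have e : disc N = cdisc (ρ + 3) + bmul (ind (annulus (ρ + 3) N)) := by
    ext1 f
    refine bmul_eq_of_ae (memLp_ind measurableSet_ball) ?_
    filter_upwards [bmul_ae (memLp_ind measurableSet_closedBall) f,
      bmul_ae (memLp_ind (measurableSet_annulus (ρ + 3) N)) f,
      Lp.coeFn_add (bmul (ind (Metric.closedBall 0 (ρ + 3))) f)
        (bmul (ind (annulus (ρ + 3) N)) f)] with x e1 e2 e3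
    change (bmul (ind (Metric.closedBall 0 (ρ + 3))) f +
      bmul (ind (annulus (ρ + 3) N)) f : L2) x = _
    rw [e3, Pi.add_apply, e1, e2, ← add_mul]
    congr 1
    by_cases h1 : ‖x‖ ≤ ρ + 3
    · rw [ind_of_mem (show x ∈ Metric.closedBall (0 : Plane) (ρ + 3) by simpa using h1),
        ind_of_mem (show x ∈ Metric.ball (0 : Plane) N by
          rw [mem_ball_zero_iff]; linarith),
        ind_of_notMem (show x ∉ annulus (ρ + 3) N from fun h => h1.not_gt h.1), add_zero]
    · rw [ind_of_notMem (show x ∉ Metric.closedBall (0 : Plane) (ρ + 3) by simpa using h1),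
        zero_add]
      by_cases h2 : ‖x‖ < N
      · rw [ind_of_mem (show x ∈ Metric.ball (0 : Plane) N by simpa using h2),
          ind_of_mem (show x ∈ annulus (ρ + 3) N from ⟨not_le.1 h1, h2⟩)]
      · rw [ind_of_notMem (show x ∉ Metric.ball (0 : Plane) N by simpa using h2),
          ind_of_notMem (show x ∉ annulus (ρ + 3) N from fun h => h2 h.2)]
  have h1 : disc N ∘L innerPart α D κ = innerPart α D κ := by
    rw [innerPart, ← ContinuousLinearMap.comp_assoc]
    congr 1
    exact bmul_ind_comp_bmul D.cut_out.memLp measurableSet_ball fun x hx =>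
      image_eq_zero_of_notMem_tsupport fun hx' =>
        hx ((D.out_supp.trans (Metric.ball_subset_ball hN)) hx')
  have h2 : disc N + errAt α D κ N ζ = (cdisc (ρ + 3) + errInner α D κ ζ) +
      (bmul (ind (annulus (ρ + 3) N)) + errOuter α D N ζ) := by
    rw [e, errAt]; abel
  rw [h2, ContinuousLinearMap.comp_add, ContinuousLinearMap.comp_add,
    physResolvent_outer α D (by linarith) hζ, physResolvent_inner α D hκ hζ, h1, parametrix]

/-- The inverse of `1 + errAt`. -/
def corr (κ N : ℝ) (ζ : ℂ) : L2 →L[ℂ] L2 :=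
  Ring.inverse (1 + err α D κ ζ) ∘L (1 - errAt α D κ N ζ ∘L (1 - disc (ρ + 4)))

/-- The range of the error lies in the disc of radius ρ + 4, so inverting 1 plus its compression
there inverts the operator for every N. In particular the singular set does not depend on N. -/
theorem corr_spec {κ N : ℝ} (hN : ρ + 4 ≤ N) {ζ : ℂ} (hζ : ζ ∉ singularSet (err α D κ)) :
    (1 + errAt α D κ N ζ) * corr α D κ N ζ = 1 ∧ corr α D κ N ζ * (1 + errAt α D κ N ζ) = 1 := by
  have e : err α D κ ζ = errAt α D κ N ζ * disc (ρ + 4) := (errAt_comp_disc α D le_rfl hN ζ).symm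
  have hu : IsUnit (1 + err α D κ ζ) := not_not.1 hζ
  have h := inverse_one_add_formula (K' := errAt α D κ N ζ) (J := disc (ρ + 4))
    (disc_comp_errAt α D le_rfl ζ) (by rwa [← e])
  rw [← e] at h
  exact h

/-- From (1 + K)⁻¹ = 1 - K(1 + K)⁻¹ and the bounded range of K: corrections do not spread a source
beyond the disc it starts from. -/
theorem disc_comp_corr {κ N r : ℝ} (hN : ρ + 4 ≤ N) (hr : ρ + 4 ≤ r) {ζ : ℂ}
    (hζ : ζ ∉ singularSet (err α D κ)) :
    disc r * (corr α D κ N ζ * disc r) = corr α D κ N ζ * disc r := by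
  have h := (corr_spec α D hN hζ).1
  have h1 : corr α D κ N ζ * disc r = disc r - errAt α D κ N ζ * (corr α D κ N ζ * disc r) := by
    rw [add_mul, one_mul] at h
    rw [eq_sub_iff_add_eq, ← mul_assoc, ← add_mul, h, one_mul]
  have h2 : disc r * errAt α D κ N ζ = errAt α D κ N ζ := disc_comp_errAt α D hr ζ
  have h3 : disc r * disc r = disc r := disc_comp_disc le_rfl
  rw [h1, mul_sub, h3, ← mul_assoc, h2]

theorem corr_eq {κ N N' : ℝ} (hN : ρ + 4 ≤ N) (h : N ≤ N') {ζ : ℂ}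
    (hζ : ζ ∉ singularSet (err α D κ)) : corr α D κ N' ζ * disc N = corr α D κ N ζ * disc N := by
  have h1 : errAt α D κ N' ζ * (corr α D κ N ζ * disc N) =
      errAt α D κ N ζ * (corr α D κ N ζ * disc N) := by
    rw [← disc_comp_corr α D hN hN hζ, ← mul_assoc,
      show errAt α D κ N' ζ * disc N = errAt α D κ N ζ from errAt_comp_disc α D hN h ζ,
      disc_comp_corr α D hN hN hζ]
  have h2 : (1 + errAt α D κ N' ζ) * (corr α D κ N ζ * disc N) = disc N := by
    rw [add_mul, h1, ← add_mul, ← mul_assoc, (corr_spec α D hN hζ).1, one_mul]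
  conv_lhs => rw [← h2]
  rw [← mul_assoc, (corr_spec α D (hN.trans h) hζ).2, one_mul]

/-- The continued resolvent, restricted to the disc of radius `N`. -/
def contResolvent (κ N : ℝ) (ζ : ℂ) : L2 →L[ℂ] L2 :=
  parametrix α D κ N ζ * (corr α D κ N ζ * disc N)

/-- Enlarging the truncation radius changes nothing on the smaller disc. This consistency lets the
truncated operators be glued to one operator with values in functions on the whole plane. -/
theorem disc_comp_contResolvent_comp {κ N N' : ℝ} (hN : ρ + 4 ≤ N) (h : N ≤ N') {ζ : ℂ}
    (hζ : ζ ∉ singularSet (err α D κ)) :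
    disc N * contResolvent α D κ N' ζ * disc N = contResolvent α D κ N ζ := by
  have e1 : disc N' * disc N = disc N := disc_comp_disc h
  have e2 : disc N * (parametrix α D κ N' ζ * disc N) = parametrix α D κ N ζ :=
    disc_comp_parametrix_comp α D hN h ζ
  rw [contResolvent, mul_assoc, mul_assoc, mul_assoc, e1, corr_eq α D hN h hζ,
    ← disc_comp_corr α D hN hN hζ, ← mul_assoc (parametrix α D κ N' ζ), ← mul_assoc (disc N), e2,
    contResolvent]

/-- The parametrix identity R(1 + K) = Q, cut off to a disc, is composed on the right with (1 +
K)⁻¹. -/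
theorem disc_physResolvent_disc {κ N : ℝ} (hκ : 0 < κ) (hN : ρ + 4 ≤ N) {ζ : ℂ}
    (hζ : ζ ∉ singularSet (err α D κ)) (hp : ζ ∈ LogCover.physicalSheet) :
    disc N * (physResolvent s α ζ * disc N) = contResolvent α D κ N ζ := by
  have h1 : (disc N + errAt α D κ N ζ) * (corr α D κ N ζ * disc N) = disc N := by
    rw [add_mul, disc_comp_corr α D hN hN hζ]
    conv_lhs => enter [1]; rw [← one_mul (corr α D κ N ζ)]
    rw [mul_assoc, ← add_mul, ← mul_assoc, (corr_spec α D hN hζ).1, one_mul]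
  conv_lhs => enter [2, 2]; rw [← h1]
  rw [contResolvent, ← physResolvent_comp_one_add α D hκ hN hp]
  change _ = (disc N * (physResolvent s α ζ * (disc N + errAt α D κ N ζ))) *
    (corr α D κ N ζ * disc N)
  simp only [mul_assoc]

end Cutoffs

end

section

/-! ### The continuation of the resolvent -/

variable {n : ℕ} (s : Fin n → Plane) (α : Fin n → ℝ)

/-- The parametrization of the graph of the Hamiltonian by the resolvent at `-1`. -/
def graphMap : L2 →L[ℂ] (hamiltonian s α).graph :=
  ((invOne s α).prod (1 - invOne s α)).codRestrict _ fun f => by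
    exact mem_graph_invOne s α f

theorem cutoffMul_eq {χ : Plane → ℂ} (hχ : IsCutoff χ) (f : L2) :
    (cutoffMul hχ f : L2) = bmul χ f :=
  (bmul_eq_of_ae hχ.memLp (hχ.memLp_mul f).coeFn_toLp).symm

theorem disc_apply_ae (r : ℝ) (f : L2) : ∀ᵐ x, ‖x‖ < r → disc r f x = f x := by
  filter_upwards [bmul_ae (memLp_ind measurableSet_ball) f] with x hx hxr
  rw [disc, hx, ind_of_mem (show x ∈ Metric.ball (0 : Plane) r by simpa using hxr), one_mul]

theorem exists_disc_eq (f : Hcomp) : ∃ r : ℝ, ∀ N, r ≤ N → disc N (f : L2) = f := by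
  obtain ⟨r, hr⟩ := f.2
  refine ⟨r + 1, fun N hN => bmul_eq_of_ae (memLp_ind measurableSet_ball) ?_⟩
  filter_upwards [hr] with x hx
  by_cases h : x ∈ Metric.ball (0 : Plane) N
  · rw [ind_of_mem h, one_mul]
  · rw [ind_of_notMem h, zero_mul]
    exact hx (by rw [mem_ball_zero_iff] at h; linarith)

theorem exists_tsupport_subset_ball {χ : Plane → ℂ} (hχ : IsCutoff χ) :
    ∃ r : ℝ, ∀ N, r ≤ N → tsupport χ ⊆ Metric.ball 0 N := by
  obtain ⟨r, hr⟩ := hχ.2.isCompact.isBounded.subset_ball (0 : Plane)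
  exact ⟨r, fun N hN => hr.trans (Metric.ball_subset_ball hN)⟩

/-! ### Sources of the cut-off parametrix and gluing over the truncation radius. -/

namespace Cutoffs

variable {s} {ρ : ℝ} (D : Cutoffs s ρ)

/-- The operator `q` with `(P + 1)⁻¹ q = χ Q` for the parametrix `Q`. -/
def source (κ : ℝ) (χ : Plane → ℂ) (N : ℝ) (ζ : ℂ) : L2 →L[ℂ] L2 :=
  (bmul (fun x => χ x * D.out x) + comm s α fun x => χ x * D.out x) ∘L
    resFactor s α (-(κ ^ 2 : ℝ)) ∘L cdisc (ρ + 3) +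
      outerSource s α ρ N (fun x => χ x * (1 - D.inn x)) ζ

theorem cut_outer {χ : Plane → ℂ} (hχ : IsCutoff χ) : IsCutoff fun x => χ x * (1 - D.inn x) :=
  hχ.mul_contDiff (contDiff_const.sub D.cut_inn.1)

theorem tsupport_outer {χ : Plane → ℂ} {N : ℝ} (hN : tsupport χ ⊆ Metric.ball 0 N) :
    tsupport (fun x => χ x * (1 - D.inn x)) ⊆ annulus ρ N := by
  intro x hx
  refine ⟨?_, by simpa using hN (tsupport_mul_subset_left (f := χ) hx)⟩
  by_contra! h
  have h0 : ∀ᶠ y in 𝓝 x, D.inn y = 1 :=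
    eventually_nhdsSet_iff_forall.1 D.inn_eq x (by
      rw [mem_closedBall_zero_iff]; linarith)
  refine mem_closure_iff_frequently.1 hx ?_
  filter_upwards [h0] with y hy hy'
  exact hy' (by simp [hy])

theorem outerSource_isOuterSource {χ : Plane → ℂ} (hχ : IsCutoff χ) {N : ℝ} (hN : ρ + 4 ≤ N)
    (hχN : tsupport χ ⊆ Metric.ball 0 N) :
    IsOuterSource s α ρ N (fun x => χ x * (1 - D.inn x))
      (outerSource s α ρ N fun x => χ x * (1 - D.inn x)) :=
  outerSource_spec α D (by linarith) (cut_outer D hχ) (tsupport_outer D hχN)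

/-- This puts χQ(ζ) in the domain with a preimage under T that is bounded and entire in ζ.
Continuity and holomorphy in the graph norm come from here. -/
theorem invOne_source (κ : ℝ) {χ : Plane → ℂ} (hχ : IsCutoff χ) {N : ℝ} (hN : ρ + 4 ≤ N)
    (hχN : tsupport χ ⊆ Metric.ball 0 N) (ζ : ℂ) (f : L2) :
    invOne s α (source α D κ χ N ζ f) = bmul χ (parametrix α D κ N ζ f) := by
  set g := resFactor s α (-(κ ^ 2 : ℝ)) (cdisc (ρ + 3) f) with hg
  have h1 := (bmul_invOne s α (hχ.mul D.cut_out) g).symm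
  have h2 := congrArg (fun A : L2 →L[ℂ] L2 => A f)
    ((outerSource_isOuterSource α D hχ hN hχN).invOne_comp ζ)
  change invOne s α ((bmul (fun x => χ x * D.out x) g + comm s α (fun x => χ x * D.out x) g) +
    outerSource s α ρ N (fun x => χ x * (1 - D.inn x)) ζ f) = bmul χ (bmul D.out (invOne s α g) +
      (outerGreen s α ρ N ζ f - bmul D.inn (outerGreen s α ρ N ζ f)))
  rw [map_add, h1, map_add, map_sub, bmul_bmul hχ.memLp D.cut_out.memLp (hχ.mul D.cut_out).memLp,
    bmul_bmul hχ.memLp D.cut_inn.memLp (hχ.mul D.cut_inn).memLp]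
  congr 1
  refine h2.trans (bmul_eq_of_ae (cut_outer D hχ).memLp ?_)
  filter_upwards [bmul_ae hχ.memLp (outerGreen s α ρ N ζ f),
    bmul_ae (hχ.mul D.cut_inn).memLp (outerGreen s α ρ N ζ f),
    Lp.coeFn_sub (bmul χ (outerGreen s α ρ N ζ f))
      (bmul (fun x => χ x * D.inn x) (outerGreen s α ρ N ζ f))] with x e1 e2 e3
  rw [e3, Pi.sub_apply, e1, e2, ContinuousLinearMap.coe_coe]
  ring

theorem differentiable_source (κ : ℝ) {χ : Plane → ℂ} (hχ : IsCutoff χ) {N : ℝ} (hN : ρ + 4 ≤ N)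
    (hχN : tsupport χ ⊆ Metric.ball 0 N) : Differentiable ℂ (source α D κ χ N) :=
  (differentiable_const _).add (outerSource_isOuterSource α D hχ hN hχN).differentiable

theorem differentiable_errAt (κ : ℝ) {N : ℝ} (hN : ρ + 4 ≤ N) :
    Differentiable ℂ (errAt α D κ N) := by
  have h : errAt α D κ N = fun ζ =>
      err α D κ ζ - errOuter α D (ρ + 4) ζ + errOuter α D N ζ := by
    funext ζ
    rw [errAt, err]
    abel
  rw [h]
  exact ((differentiable_err α D κ).sub (differentiable_errOuter α D (by linarith))).add
    (differentiable_errOuter α D (by linarith))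

theorem bmul_contResolvent_mem (κ : ℝ) {χ : Plane → ℂ} (hχ : IsCutoff χ) {N : ℝ} (hN : ρ + 4 ≤ N)
    (hχN : tsupport χ ⊆ Metric.ball 0 N) (ζ : ℂ) (f : L2) :
    bmul χ (contResolvent α D κ N ζ f) ∈ (hamiltonian s α).domain :=
  (mem_domain_iff s α _).2 ⟨_, invOne_source α D κ hχ hN hχN ζ _⟩

theorem contResolvent_ae_eq {κ r N N' : ℝ} (hr : ρ + 4 ≤ r) {f : L2}
    (hf : ∀ N, r ≤ N → disc N f = f) (hN : r ≤ N) (hN' : r ≤ N') {ζ : ℂ}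
    (hζ : ζ ∉ singularSet (err α D κ)) : ∀ᵐ x, ‖x‖ < N → ‖x‖ < N' →
      contResolvent α D κ N ζ f x = contResolvent α D κ N' ζ f x := by
  wlog h : N ≤ N' generalizing N N'
  · filter_upwards [this hN' hN (not_le.1 h).le] with x hx h1 h2
    exact (hx h2 h1).symm
  have e := congrArg (fun A : L2 →L[ℂ] L2 => A f)
    (disc_comp_contResolvent_comp α D (hr.trans hN) h hζ)
  change disc N (contResolvent α D κ N' ζ (disc N f)) = contResolvent α D κ N ζ f at e
  rw [hf N hN] at e
  rw [← e]
  filter_upwards [disc_apply_ae N (contResolvent α D κ N' ζ f)] with x hx h1 _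
  exact hx h1

/-- The function `u` is the image of `f` under the continued resolvent. -/
def IsContinued (κ : ℝ) (ζ : ℂ) (f : L2) (u : Plane →ₘ[volume] ℂ) : Prop :=
  ∀ᶠ N : ℝ in atTop, ∀ᵐ x, ‖x‖ < N → u x = contResolvent α D κ N ζ f x

variable {α D}

theorem IsContinued.ae_eq {κ r N : ℝ} {ζ : ℂ} {f : L2} {u : Plane →ₘ[volume] ℂ}
    (h : IsContinued α D κ ζ f u) (hr : ρ + 4 ≤ r) (hf : ∀ N, r ≤ N → disc N f = f) (hN : r ≤ N)
    (hζ : ζ ∉ singularSet (err α D κ)) :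
    ∀ᵐ x, ‖x‖ < N → u x = contResolvent α D κ N ζ f x := by
  obtain ⟨N', h1, h2⟩ := (h.and (eventually_ge_atTop N)).exists
  filter_upwards [h1, contResolvent_ae_eq α D hr hf hN (hN.trans h2) hζ] with x e1 e2 hx
  rw [e1 (hx.trans_le h2), e2 hx (hx.trans_le h2)]

theorem IsContinued.unique {κ : ℝ} {ζ : ℂ} {f : L2} {u v : Plane →ₘ[volume] ℂ}
    (hu : IsContinued α D κ ζ f u) (hv : IsContinued α D κ ζ f v) : u = v := by
  refine AEEqFun.ext ?_
  have h : ∀ k : ℕ, ∀ᵐ x, ‖x‖ < k → u x = v x := fun k => by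
    obtain ⟨N, ⟨h1, h2⟩, h3⟩ := ((hu.and hv).and (eventually_ge_atTop (k : ℝ))).exists
    filter_upwards [h1, h2] with x e1 e2 hx
    rw [e1 (hx.trans_le h3), e2 (hx.trans_le h3)]
  filter_upwards [ae_all_iff.2 h] with x hx
  obtain ⟨k, hk⟩ := exists_nat_gt ‖x‖
  exact hx k hk

theorem IsContinued.add {κ : ℝ} {ζ : ℂ} {f g : L2} {u v : Plane →ₘ[volume] ℂ}
    (hu : IsContinued α D κ ζ f u) (hv : IsContinued α D κ ζ g v) :
    IsContinued α D κ ζ (f + g) (u + v) := by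
  filter_upwards [hu, hv] with N h1 h2
  rw [map_add]
  filter_upwards [h1, h2, AEEqFun.coeFn_add u v,
    Lp.coeFn_add (contResolvent α D κ N ζ f) (contResolvent α D κ N ζ g)] with x e1 e2 e3 e4 hx
  rw [e3, e4, Pi.add_apply, Pi.add_apply, e1 hx, e2 hx]

theorem IsContinued.smul {κ : ℝ} {ζ : ℂ} {f : L2} {u : Plane →ₘ[volume] ℂ} (c : ℂ)
    (hu : IsContinued α D κ ζ f u) : IsContinued α D κ ζ (c • f) (c • u) := by
  filter_upwards [hu] with N h1
  rw [map_smul]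
  filter_upwards [h1, AEEqFun.coeFn_smul c u,
    Lp.coeFn_smul c (contResolvent α D κ N ζ f)] with x e1 e3 e4 hx
  rw [e3, e4, Pi.smul_apply, Pi.smul_apply, e1 hx]

theorem exists_isContinued {κ : ℝ} {ζ : ℂ} (hζ : ζ ∉ singularSet (err α D κ)) (f : Hcomp) :
    ∃ u, IsContinued α D κ ζ (f : L2) u := by
  obtain ⟨r₀, hr₀⟩ := exists_disc_eq f
  set r := max r₀ (ρ + 4) with hr
  have hf : ∀ N, r ≤ N → disc N (f : L2) = f := fun N hN => hr₀ N ((le_max_left _ _).trans hN)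
  have hr4 : ρ + 4 ≤ r := le_max_right _ _
  have hr0 : 0 < r := by linarith [D.pos]
  set w : ℕ → L2 := fun k => contResolvent α D κ (r + k) ζ f with hw
  have hrk : ∀ k : ℕ, r ≤ r + k := fun k => by simp
  have hlt : ∀ x : Plane, ‖x‖ < r + ⌈‖x‖⌉₊ := fun x => by linarith [Nat.le_ceil ‖x‖]
  -- At x the value is taken from a truncation whose disc contains x. Only countably many radii
  -- occur, so the almost everywhere compatibility holds for all of them at once.
  set u₀ : Plane → ℂ := fun x => w ⌈‖x‖⌉₊ x with hu₀
  have key : ∀ N, r ≤ N → ∀ᵐ x, ‖x‖ < N → u₀ x = contResolvent α D κ N ζ f x := fun N hN => by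
    filter_upwards [ae_all_iff.2 fun k : ℕ =>
      contResolvent_ae_eq α D hr4 hf (hrk k) hN hζ] with x hx hxN
    exact hx _ (hlt x) hxN
  have hm : AEStronglyMeasurable u₀ (volume : Measure Plane) := by
    refine aestronglyMeasurable_of_tendsto_ae atTop (f := fun k => (w k : Plane → ℂ))
      (fun k => Lp.aestronglyMeasurable (w k)) ?_
    filter_upwards [ae_all_iff.2 fun k : ℕ => key (r + k) (hrk k)] with x hx
    refine tendsto_const_nhds.congr' ?_
    filter_upwards [eventually_ge_atTop ⌈‖x‖⌉₊] with k hk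
    refine hx k ((hlt x).trans_le ?_)
    have : (⌈‖x‖⌉₊ : ℝ) ≤ k := by exact_mod_cast hk
    linarith
  refine ⟨AEEqFun.mk u₀ hm, ?_⟩
  filter_upwards [eventually_ge_atTop r] with N hN
  filter_upwards [key N hN, AEEqFun.coeFn_mk u₀ hm] with x h1 h2 hx
  rw [h2, h1 hx]

theorem IsContinued.mem_Dloc {κ : ℝ} {ζ : ℂ} (hζ : ζ ∉ singularSet (err α D κ)) {f : Hcomp}
    {u : Plane →ₘ[volume] ℂ} (h : IsContinued α D κ ζ (f : L2) u) (R₀ : ℝ) :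
    u ∈ Dloc (hamiltonian s α) R₀ := by
  intro χ hχ _
  obtain ⟨r₁, h1⟩ := exists_disc_eq f
  obtain ⟨r₂, h2⟩ := exists_tsupport_subset_ball hχ
  set N := max (max r₁ r₂) (ρ + 4) with hN
  have hN1 : r₁ ≤ N := (le_max_left _ _).trans (le_max_left _ _)
  have hN2 : tsupport χ ⊆ Metric.ball 0 N := h2 N ((le_max_right _ _).trans (le_max_left _ _))
  have hN4 : ρ + 4 ≤ N := le_max_right _ _
  refine ⟨_, bmul_contResolvent_mem α D κ hχ hN4 hN2 ζ f, ?_⟩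
  filter_upwards [bmul_ae hχ.memLp (contResolvent α D κ N ζ f),
    h.ae_eq (r := N) hN4 (fun M hM => h1 M (hN1.trans hM)) le_rfl hζ] with x e1 e2
  rw [e1]
  by_cases hx : x ∈ tsupport χ
  · rw [e2 (by simpa using hN2 hx)]
  · rw [image_eq_zero_of_notMem_tsupport hx, zero_mul, zero_mul]

theorem isContinued_physResolvent {κ : ℝ} (hκ : 0 < κ) {ζ : ℂ}
    (hζ : ζ ∉ singularSet (err α D κ)) (hp : ζ ∈ LogCover.physicalSheet) (f : Hcomp) :
    IsContinued α D κ ζ (f : L2) (physResolvent s α ζ f : L2) := by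
  obtain ⟨r, hr⟩ := exists_disc_eq f
  filter_upwards [eventually_ge_atTop r, eventually_ge_atTop (ρ + 4)] with N hN hN4
  have e := congrArg (fun A : L2 →L[ℂ] L2 => A f) (disc_physResolvent_disc α D hκ hN4 hζ hp)
  change disc N (physResolvent s α ζ (disc N (f : L2))) = contResolvent α D κ N ζ f at e
  rw [hr N hN] at e
  rw [← e]
  filter_upwards [disc_apply_ae N (physResolvent s α ζ (f : L2))] with x hx h1
  exact (hx h1).symm

end Cutoffs

theorem physResolvent_mem_Dloc (ζ : ℂ) (R₀ : ℝ) (f : L2) :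
    ((physResolvent s α ζ f : L2) : Plane →ₘ[volume] ℂ) ∈ Dloc (hamiltonian s α) R₀ := by
  intro χ hχ _
  refine ⟨bmul χ (physResolvent s α ζ f), (mem_domain_iff s α _).2
    ⟨_, (bmul_invOne s α hχ (resFactor s α (Complex.exp (2 * ζ)) f)).symm⟩, ?_⟩
  exact bmul_ae hχ.memLp _

/-! ### The continuation as a meromorphic family. -/

namespace Cutoffs

variable {s} {ρ : ℝ} (D : Cutoffs s ρ)

/-- The continued resolvent at a point of the logarithmic cover. -/
theorem exists_linearMap {κ : ℝ} (hκ : 0 < κ) (R₀ : ℝ) (ζ : ℂ) :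
    ∃ R : Hcomp →ₗ[ℂ] Dloc (hamiltonian s α) R₀,
      (ζ ∉ singularSet (err α D κ) → ∀ f : Hcomp, IsContinued α D κ ζ (f : L2) (R f)) ∧
      (ζ ∈ LogCover.physicalSheet → ∀ f : Hcomp,
        (R f : Plane →ₘ[volume] ℂ) = (physResolvent s α ζ (f : L2) : L2)) := by
  -- The physical sheet is treated first: agreement with the resolvent is required at all its
  -- points, including those where 1 + `err` happens to be singular. Singular points off the
  -- physical sheet get the value zero.
  by_cases hp : ζ ∈ LogCover.physicalSheet
  · refine ⟨{ toFun := fun f => ⟨_, physResolvent_mem_Dloc s α ζ R₀ (f : L2)⟩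
              map_add' := fun f g => Subtype.ext ?_
              map_smul' := fun c f => Subtype.ext ?_ },
      fun hζ f => isContinued_physResolvent hκ hζ hp f, fun _ f => rfl⟩
    · exact congrArg (fun g : L2 => (g : Plane →ₘ[volume] ℂ)) (map_add
        (physResolvent s α ζ) (f : L2) (g : L2))
    · exact congrArg (fun g : L2 => (g : Plane →ₘ[volume] ℂ)) (map_smul
        (physResolvent s α ζ) c (f : L2))
  by_cases hζ : ζ ∈ singularSet (err α D κ)
  · exact ⟨0, fun h => absurd hζ h, fun h => absurd h hp⟩
  choose u hu using exists_isContinued hζ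
  refine ⟨{ toFun := fun f => ⟨u f, (hu f).mem_Dloc hζ R₀⟩
            map_add' := fun f g => Subtype.ext ((hu _).unique ((hu f).add (hu g)))
            map_smul' := fun c f => Subtype.ext ((hu _).unique ((hu f).smul c)) },
    fun _ f => hu f, fun h => absurd h hp⟩

/-- The cut-off operator factors as an analytic family into the graph, the Fredholm inverse of 1 +
`err`, and another analytic family. Only the middle factor has poles, and its polar coefficients of
finite rank stay so after composition. -/
theorem exists_cutoff_family {κ : ℝ} {ζ₀ : ℂ} (h0 : IsUnit (1 + err α D κ ζ₀)) {R₀ : ℝ}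
    {R : ℂ → Hcomp →ₗ[ℂ] Dloc (hamiltonian s α) R₀}
    (hR : ∀ ζ ∉ singularSet (err α D κ), ∀ f : Hcomp, IsContinued α D κ ζ (f : L2) (R ζ f))
    {χ₁ χ₂ : Plane → ℂ} (h₁ : IsCutoff χ₁) (h₂ : IsCutoff χ₂) :
    ∃ M : ℂ → L2 →L[ℂ] (hamiltonian s α).graph,
      (∀ ζ ∉ singularSet (err α D κ), ∀ f : L2, ∀ᵐ x,
        (M ζ f : L2 × L2).1 x = χ₂ x * (R ζ (cutoffMul h₁ f) : Plane →ₘ[volume] ℂ) x) ∧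
      AnalyticOnNhd ℂ M (singularSet (err α D κ))ᶜ ∧ ∀ ζ, MeromorphicFamilyAt M ζ := by
  obtain ⟨r₁, hr₁⟩ := exists_tsupport_subset_ball h₁
  obtain ⟨r₂, hr₂⟩ := exists_tsupport_subset_ball h₂
  set N := max (max r₁ r₂) (ρ + 4) with hN
  have hN1 : ∀ M, N ≤ M → tsupport χ₁ ⊆ Metric.ball 0 M := fun M hM =>
    hr₁ M (((le_max_left _ _).trans (le_max_left _ _)).trans hM)
  have hN2 : tsupport χ₂ ⊆ Metric.ball 0 N := hr₂ N ((le_max_right _ _).trans (le_max_left _ _))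
  have hN4 : ρ + 4 ≤ N := le_max_right _ _
  have hdisc : ∀ M, N ≤ M → ∀ f, disc M (bmul χ₁ f) = bmul χ₁ f := fun M hM f =>
    congrArg (fun A : L2 →L[ℂ] L2 => A f) (bmul_ind_comp_bmul h₁.memLp measurableSet_ball fun x hx =>
      image_eq_zero_of_notMem_tsupport fun hx' => hx (hN1 M hM hx'))
  have hK : ∀ ζ, AnalyticAt ℂ (err α D κ) ζ := (differentiable_err α D κ).analyticAt
  have hA : ∀ ζ, AnalyticAt ℂ (fun ζ => graphMap s α ∘L source α D κ χ₂ N ζ) ζ := fun ζ =>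
    analyticAt_comp analyticAt_const ((differentiable_source α D κ h₂ hN4 hN2).analyticAt ζ)
  have hB : ∀ ζ, AnalyticAt ℂ (fun ζ => (1 - errAt α D κ N ζ ∘L (1 - disc (ρ + 4))) ∘L
      (disc N ∘L bmul χ₁)) ζ := fun ζ =>
    analyticAt_comp (analyticAt_const.sub (analyticAt_comp
      ((differentiable_errAt α D κ hN4).analyticAt ζ) analyticAt_const)) analyticAt_const
  refine ⟨fun ζ => (graphMap s α ∘L source α D κ χ₂ N ζ) ∘L Ring.inverse (1 + err α D κ ζ) ∘L
    ((1 - errAt α D κ N ζ ∘L (1 - disc (ρ + 4))) ∘L (disc N ∘L bmul χ₁)), fun ζ hζ f => ?_,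
    fun ζ hζ => ?_, fun ζ => ?_⟩
  · have e : bmul χ₂ (contResolvent α D κ N ζ (bmul χ₁ f)) = invOne s α (source α D κ χ₂ N ζ
        (corr α D κ N ζ (disc N (bmul χ₁ f)))) := (invOne_source α D κ h₂ hN4 hN2 ζ _).symm
    change ∀ᵐ x, invOne s α (source α D κ χ₂ N ζ (corr α D κ N ζ (disc N (bmul χ₁ f)))) x = _
    rw [← e]
    have h := (hR ζ hζ (cutoffMul h₁ f)).ae_eq (r := N) hN4 (fun M hM => by
      rw [cutoffMul_eq]; exact hdisc M hM f) le_rfl hζ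
    rw [cutoffMul_eq] at h
    filter_upwards [h, bmul_ae h₂.memLp (contResolvent α D κ N ζ (bmul χ₁ f))] with x e1 e2
    rw [e2]
    by_cases hx : x ∈ tsupport χ₂
    · rw [e1 (by simpa using hN2 hx)]
    · rw [image_eq_zero_of_notMem_tsupport hx, zero_mul, zero_mul]
  · exact analyticAt_comp (hA ζ) (analyticAt_comp (analyticAt_inverse_one_add hK hζ) (hB ζ))
  · exact MeromorphicFamilyAt.comp_analyticAt (hA ζ)
      (meromorphicFamilyAt_inverse_one_add hK (isCompactOperator_err α D κ) h0 ζ) (hB ζ)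

end Cutoffs

/-- The resolvent continues meromorphically to the logarithmic cover. -/
theorem exists_continuation (R₀ : ℝ) (hR₀ : ∀ i, s i ∈ Metric.ball (0 : Plane) R₀) :
    ∃ (Z : Set LogCover) (R : LogCover → Hcomp →ₗ[ℂ] Dloc (hamiltonian s α) R₀),
      IsMeromorphicLocFamily (hamiltonian s α) R₀ Z R ∧
      ∀ ζ ∈ LogCover.physicalSheet, ∀ f : Hcomp, ∀ᵐ x,
        (R ζ f : Plane →ₘ[volume] ℂ) x =
          resolventAt (hamiltonian s α) (LogCover.proj ζ ^ 2) (f : L2) x := by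
  -- The absolute value and the added 1 make ρ positive and larger than every |s_i|, also when there
  -- are no points and R₀ is arbitrary.
  obtain ⟨D⟩ := exists_cutoffs s (ρ := |R₀| + 1) (by positivity) fun i => by
    have := mem_ball_zero_iff.1 (hR₀ i)
    linarith [le_abs_self R₀]
  obtain ⟨κ, hκ, h0⟩ := D.exists_isUnit_one_add_err α
  have hK : ∀ ζ, AnalyticAt ℂ (Cutoffs.err α D κ) ζ := (Cutoffs.differentiable_err α D κ).analyticAt
  have hc := Cutoffs.isCompactOperator_err α D κ
  choose R hR1 hR2 using Cutoffs.exists_linearMap α D hκ R₀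
  refine ⟨singularSet (Cutoffs.err α D κ), R, ⟨isClosed_singularSet hK,
    isDiscrete_singularSet hK hc h0, fun χ₁ χ₂ h₁ h₂ _ =>
      Cutoffs.exists_cutoff_family α D h0 hR1 h₁ h₂⟩, fun ζ hζ f => ?_⟩
  rw [hR2 ζ hζ f, resolventAt_proj s α hζ]
  exact Eventually.of_forall fun x => rfl

end

end AharonovBohm

end

open AharonovBohm in
theorem theorem3p3 {n : ℕ} (s : Fin n → Plane) (hs : Function.Injective s)
    (α : Fin n → ℝ) (hα : ∀ (i : Fin n) (k : ℤ), α i ≠ (k : ℝ))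
    (R₀ : ℝ) (hR₀ : ∀ i, s i ∈ Metric.ball (0 : Plane) R₀) :
    -- the resolvent is a meromorphic family on `L²` in the upper half plane
    ((∀ z : ℂ, 0 < z.im →
        IsResolventAt (hamiltonian s α) (z ^ 2) (resolventAt (hamiltonian s α) (z ^ 2))) ∧
      ∀ z : ℂ, 0 < z.im →
        MeromorphicFamilyAt (fun w : ℂ => resolventAt (hamiltonian s α) (w ^ 2)) z) ∧
    -- and it extends meromorphically to the logarithmic cover
    ∃ (Z : Set LogCover) (R : LogCover → Hcomp →ₗ[ℂ] Dloc (hamiltonian s α) R₀),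
      IsMeromorphicLocFamily (hamiltonian s α) R₀ Z R ∧
      ∀ ζ ∈ LogCover.physicalSheet, ∀ f : Hcomp, ∀ᵐ x,
        (R ζ f : Plane →ₘ[MeasureTheory.volume] ℂ) x =
          resolventAt (hamiltonian s α) (LogCover.proj ζ ^ 2) (f : L2) x := by
  exact ⟨⟨fun z hz => isResolventAt_resolventAt s α hz,
    fun z hz => meromorphicFamilyAt_resolventAt s α hz⟩, exists_continuation s α R₀ hR₀⟩
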